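/- **Setting.** Let $d\ge 1$, $1<p<\infty$, and let $(\nu_\varepsilon)_{\varepsilon>0}$ be radial measurable kernels $\nu_\varepsilon:\mathbb R^d\setminus\{0\}\to[0,\infty)$ with $$\int_{\mathbb R^d}(1\wedge|h|^p)\,\nu_\varepsilon(h)\,dh=1\ \text{ for all }\varepsilon>0,\qquad \lim_{\varepsilon\to0}\int_{|h|>\delta}\nu_\varepsilon(h)\,dh=0\ \text{ for all }\delta>0 .$$ If $d=1$, assume in addition that there are $c_0,\theta_0\in(0,1)$ with $\nu_\varepsilon(\theta x)\ge c_0\,\nu_\varepsilon(x)$ for all $0<\varepsilon<1$, $\theta_0\le\theta\le1$ and $x\neq 0$. Put $\mu^{-1}=K_{d,p}=\frac1{|\mathbb S^{d-1}|}\int_{\mathbb S^{d-1}}|w_d|^p\,d\sigma(w)$. Let $\Omega\subset\mathbb R^d$ be open. For $S\subset\mathbb R^d\times\mathbb R^d$ and measurable $u$ let $\mathcal E^\varepsilon(u,u)$, $\mathcal E^\varepsilon_\Omega(u,u)$, $\mathcal E^\varepsilon_{cr}(u,u)$ denote $\iint_S|u(x)-u(y)|^p\nu_\varepsilon(x-y)\,dy\,dx$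 for $S=(\Omega^c\times\Omega^c)^c$, $\Omega\times\Omega$, $\Omega\times\Omega^c$ respectively, and $$\mathcal E^\varepsilon(u,v)=\iint_{(\Omega^c\times\Omega^c)^c}|u(x)-u(y)|^{p-2}(u(x)-u(y))(v(x)-v(y))\,\nu_\varepsilon(x-y)\,dy\,dx .$$ Let $W^p_{\nu_\varepsilon}(\Omega|\mathbb R^d)$ be the space of measurable $u:\mathbb R^d\to\mathbb R$ with $u|_\Omega\in L^p(\Omega)$ and $\mathcal E^\varepsilon(u,u)<\infty$, with $\|u\|_{W^p_{\nu_\varepsilon}(\Omega|\mathbb R^d)}=(\|u\|^p_{L^p(\Omega)}+\mathcal E^\varepsilon(u,u))^{1/p}$; let $W^p_{\nu_\varepsilon,0}(\Omega|\mathbb R^d)$ be its subspace of functions vanishing a.e. on $\Omega^c$; let $\|u\|_{W^p_{\nu_\varepsilon}(\Omega)}=(\|u\|^p_{L^p(\Omega)}+\mathcal E^\varepsilon_\Omega(u,u))^{1/p}$. The trace space $T^p_{\nu_\varepsilon}(\Omega^c)$ consists of the restrictions to $\Omega^c$ of functions in $W^p_{\nu_\varepsilon}(\Omega|\mathbb R^d)$,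 with $\|g\|_{T^p_{\nu_\varepsilon}(\Omega^c)}=\inf\{\|w\|_{W^p_{\nu_\varepsilon}(\Omega|\mathbb R^d)}: w=g\text{ a.e. on }\Omega^c\}$. **Theorem (Dirichlet problem I).** Let $\Omega\subset\mathbb R^d$ be open and bounded with Lipschitz boundary. * Let $f_\varepsilon\in (W^p_{\nu_\varepsilon,0}(\Omega|\mathbb R^d))'$, $\varepsilon>0$, converge asymptotically weakly to $f\in(W^{1,p}_0(\Omega))'$, i.e. $\sup_{\varepsilon>0}\|f_\varepsilon\|_{(W^p_{\nu_\varepsilon,0}(\Omega|\mathbb R^d))'}<\infty$, and $\langle f_\varepsilon,v_\varepsilon\rangle\to\langle f,v\rangle$ as $\varepsilon\to0$ whenever $v_\varepsilon\in W^p_{\nu_\varepsilon,0}(\Omega|\mathbb R^d)$, $v\in W^{1,p}_0(\Omega)$ and $v_\varepsilon\to v$ in $L^p(\Omega)$. * Let $g_\varepsilon\in T^p_{\nu_\varepsilon}(\Omega^c)$ and $g\in W^{1,p}(\mathbb R^d\setminus\overline\Omega)$ with $\|g_\varepsilon-g\|_{T^p_{\nu_\varepsilon}(\Omega^c)}\to0$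 as $\varepsilon\to0$. * For each $\varepsilon>0$ let $u_\varepsilon\in W^p_{\nu_\varepsilon}(\Omega|\mathbb R^d)$ be the weak solution of $\mu L_\varepsilon u=f_\varepsilon$ in $\Omega$, $u=g_\varepsilon$ on $\Omega^c$, where $L_\varepsilon u(x)=2\,\mathrm{p.v.}\!\int_{\mathbb R^d}|u(x)-u(y)|^{p-2}(u(x)-u(y))\nu_\varepsilon(x-y)\,dy$; that is, $u_\varepsilon=g_\varepsilon$ a.e. on $\Omega^c$ and $\mu\,\mathcal E^\varepsilon(u_\varepsilon,v)=\langle f_\varepsilon,v\rangle$ for all $v\in W^p_{\nu_\varepsilon,0}(\Omega|\mathbb R^d)$. * Let $u\in W^{1,p}(\Omega)$ be the weak solution of $-\Delta_pu=f$ in $\Omega$, $u=g$ on $\partial\Omega$; that is, $u-\overline g\in W^{1,p}_0(\Omega)$ for an extension $\overline g\in W^{1,p}(\mathbb R^d)$ of $g$, and $\int_\Omega|\nabla u|^{p-2}\nabla u\cdot\nabla v\,dx=\langle f,v\rangle$ for all $v\in W^{1,p}_0(\Omega)$. Let $u_g$ be equal to $u$ on $\Omega$ and to $g$ on $\Omega^c$.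 Then $u_g\in W^{1,p}(\mathbb R^d)$, and for every $\overline u\in W^{1,p}(\mathbb R^d)$ with $\overline u=u$ a.e. on $\Omega$, $$\lim_{\varepsilon\to0}\|u_\varepsilon-u\|_{W^p_{\nu_\varepsilon}(\Omega)}=\lim_{\varepsilon\to0}\|u_\varepsilon-u_g\|_{W^p_{\nu_\varepsilon}(\Omega|\mathbb R^d)}=\lim_{\varepsilon\to0}\|u_\varepsilon-\overline u\|_{W^p_{\nu_\varepsilon}(\Omega|\mathbb R^d)}=0 .$$ In particular $\mathcal E^\varepsilon_{cr}(u_\varepsilon-\overline u,u_\varepsilon-\overline u)\to0$, and also $\mathcal E^\varepsilon_{cr}(u_\varepsilon,u_\varepsilon)\to0$, as $\varepsilon\to0$. -/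

import Mathlib

open MeasureTheory Set Filter Topology Metric
open scoped ENNReal NNReal ContDiff

/-- The space `ℝ^d` with its Euclidean norm and Lebesgue measure. -/
abbrev Rn (d : ℕ) : Type := EuclideanSpace ℝ (Fin d)

section Kernels

/-- A radial `p`-Lévy kernel on `ℝ^d`: a nonnegative, measurable, radial function `ν` with
`∫ (1 ∧ |h|^p) ν(h) dh < ∞`.  The value at the origin plays no role. -/
structure RadialLevyKernel (d : ℕ) (p : ℝ) where
  toFun : Rn d → ℝ≥0
  aemeasurable : AEMeasurable toFun volume
  radial : ∀ h k : Rn d, ‖h‖ = ‖k‖ → toFun h = toFun k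
  integrable : ∫⁻ h, ENNReal.ofReal (min 1 (‖h‖ ^ p)) * (toFun h : ℝ≥0∞) < ⊤

/-- The family `(ν_ε)_{ε>0}` is a `p`-Lévy approximation of the unity: the integrals
`∫ (1 ∧ |h|^p) ν_ε(h) dh` are equal to `1`, and for all `δ > 0` the mass of `ν_ε` on `{|h| > δ}`
vanishes as `ε → 0+`. -/
structure IsLevyApproxUnity {d : ℕ} {p : ℝ} (ν : ℝ → RadialLevyKernel d p) : Prop where
  normalized : ∀ ε : ℝ, 0 < ε →
    ∫⁻ h, ENNReal.ofReal (min 1 (‖h‖ ^ p)) * ((ν ε).toFun h : ℝ≥0∞) = 1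
  concentrates : ∀ δ : ℝ, 0 < δ →
    Tendsto (fun ε : ℝ => ∫⁻ h in {h : Rn d | δ < ‖h‖}, ((ν ε).toFun h : ℝ≥0∞)) (𝓝[>] 0) (𝓝 0)

/-- The additional lower bound that is imposed on the kernels in dimension one: there are
`c₀, θ₀ ∈ (0,1)` with `inf_{θ₀ ≤ θ ≤ 1} ν_ε(θ x) ≥ c₀ ν_ε(x)` for all `0 < ε < 1` and all `x`. -/
def OneDimLowerBound {d : ℕ} {p : ℝ} (ν : ℝ → RadialLevyKernel d p) : Prop :=
  ∃ c₀ θ₀ : ℝ, c₀ ∈ Ioo (0 : ℝ) 1 ∧ θ₀ ∈ Ioo (0 : ℝ) 1 ∧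
    ∀ ε ∈ Ioo (0 : ℝ) 1, ∀ θ ∈ Icc θ₀ 1, ∀ x : Rn d,
      c₀ * ((ν ε).toFun x : ℝ) ≤ ((ν ε).toFun (θ • x) : ℝ)

/-- The constant `K_{d,p}`: the average of `|w_d|^p` over the unit sphere of `ℝ^d`, with respect to
the surface measure (`Fin.rev 0` is the index of the last coordinate). -/
noncomputable def Kdp (d : ℕ) [NeZero d] (p : ℝ) : ℝ :=
  ⨍ w : sphere (0 : Rn d) 1, |(w : Rn d) (Fin.rev 0)| ^ p ∂((volume : Measure (Rn d)).toSphere)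

end Kernels

section Domains

/-- `Ω` has Lipschitz boundary: near each boundary point and after a rotation, `Ω` is the strict
epigraph of a Lipschitz function of the variables orthogonal to a unit vector `e`. -/
def HasLipschitzBoundary {d : ℕ} (Ω : Set (Rn d)) : Prop :=
  ∀ x₀ ∈ frontier Ω, ∃ r : ℝ, 0 < r ∧ ∃ e : Rn d, ‖e‖ = 1 ∧
    ∃ (L : ℝ≥0) (γ : Rn d → ℝ), LipschitzWith L γ ∧
      ∀ x ∈ ball x₀ r, (x ∈ Ω ↔ γ (x - inner ℝ e x • e) < inner ℝ e x)

/-- The function on `ℝ^d` equal to `u` on `Ω` and to `g` on `Ωᶜ`. -/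
noncomputable def glue {d : ℕ} (Ω : Set (Rn d)) (u g : Rn d → ℝ) : Rn d → ℝ :=
  Ω.indicator u + Ωᶜ.indicator g

end Domains

section NonlocalForms

variable {d : ℕ} {p : ℝ}

/-- `∬_S |u(x) - u(y)|^p ν(x - y) dy dx`, with values in `[0,∞]`. -/
noncomputable def pairEnergy (ν : RadialLevyKernel d p) (S : Set (Rn d × Rn d))
    (u : Rn d → ℝ) : ℝ≥0∞ :=
  ∫⁻ z in S, ENNReal.ofReal (|u z.1 - u z.2| ^ p) * (ν.toFun (z.1 - z.2) : ℝ≥0∞)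

/-- `𝓔(u,u)`: the energy over `(Ωᶜ × Ωᶜ)ᶜ`. -/
noncomputable def energy (ν : RadialLevyKernel d p) (Ω : Set (Rn d)) (u : Rn d → ℝ) : ℝ≥0∞ :=
  pairEnergy ν (Ωᶜ ×ˢ Ωᶜ)ᶜ u

/-- `𝓔_Ω(u,u)`: the energy over `Ω × Ω`. -/
noncomputable def energyIn (ν : RadialLevyKernel d p) (Ω : Set (Rn d)) (u : Rn d → ℝ) : ℝ≥0∞ :=
  pairEnergy ν (Ω ×ˢ Ω) u

/-- `𝓔_cr(u,u)`: the energy over `Ω × Ωᶜ`. -/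
noncomputable def energyCr (ν : RadialLevyKernel d p) (Ω : Set (Rn d)) (u : Rn d → ℝ) : ℝ≥0∞ :=
  pairEnergy ν (Ω ×ˢ Ωᶜ) u

/-- The form `𝓔(u,v) = ∬_{(Ωᶜ×Ωᶜ)ᶜ} |u(x)-u(y)|^{p-2} (u(x)-u(y)) (v(x)-v(y)) ν(x-y) dy dx`. -/
noncomputable def nonlocalForm (ν : RadialLevyKernel d p) (Ω : Set (Rn d))
    (u v : Rn d → ℝ) : ℝ :=
  ∫ z in (Ωᶜ ×ˢ Ωᶜ)ᶜ, |u z.1 - u z.2| ^ (p - 2) * (u z.1 - u z.2) * (v z.1 - v z.2) *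
    (ν.toFun (z.1 - z.2) : ℝ)

/-- The norm of `W^p_ν(Ω)`: `(‖u‖_{L^p(Ω)}^p + 𝓔_Ω(u,u))^{1/p}`. -/
noncomputable def normIn (ν : RadialLevyKernel d p) (Ω : Set (Rn d)) (u : Rn d → ℝ) : ℝ≥0∞ :=
  (eLpNorm u (ENNReal.ofReal p) (volume.restrict Ω) ^ p + energyIn ν Ω u) ^ (1 / p)

/-- The seminorm of `W^p_ν(Ω|ℝ^d)`: `(‖u‖_{L^p(Ω)}^p + 𝓔(u,u))^{1/p}`. -/
noncomputable def normAcross (ν : RadialLevyKernel d p) (Ω : Set (Rn d)) (u : Rn d → ℝ) : ℝ≥0∞ :=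
  (eLpNorm u (ENNReal.ofReal p) (volume.restrict Ω) ^ p + energy ν Ω u) ^ (1 / p)

theorem pairEnergy_add_lt_top (hp : 1 < p) (ν : RadialLevyKernel d p) (S : Set (Rn d × Rn d))
    {u v : Rn d → ℝ} (hum : AEStronglyMeasurable u volume)
    (hu : pairEnergy ν S u < ⊤) (hv : pairEnergy ν S v < ⊤) :
    pairEnergy ν S (u + v) < ⊤ := by
  have hp0 : 0 ≤ p := by linarith
  have hmeas : AEMeasurable (fun z : Rn d × Rn d =>
      ENNReal.ofReal (|u z.1 - u z.2| ^ p) * (ν.toFun (z.1 - z.2) : ℝ≥0∞))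
      (volume.restrict S) := by
    refine AEMeasurable.restrict ?_
    have h1 : AEMeasurable (fun z : Rn d × Rn d => u z.1) volume :=
      (hum.aemeasurable).comp_quasiMeasurePreserving Measure.quasiMeasurePreserving_fst
    have h2 : AEMeasurable (fun z : Rn d × Rn d => u z.2) volume :=
      (hum.aemeasurable).comp_quasiMeasurePreserving Measure.quasiMeasurePreserving_snd
    have h3 : AEMeasurable (fun z : Rn d × Rn d => ν.toFun (z.1 - z.2)) volume :=
      ν.aemeasurable.comp_quasiMeasurePreserving
        (quasiMeasurePreserving_sub volume volume)
    have h4 : AEMeasurable (fun z : Rn d × Rn d => |u z.1 - u z.2| ^ p) volume := by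
      have h5 : AEMeasurable (fun z : Rn d × Rn d => ‖u z.1 - u z.2‖) volume := (h1.sub h2).norm
      exact h5.pow_const p
    exact h4.ennreal_ofReal.mul h3.coe_nnreal_ennreal
  have hle : pairEnergy ν S (u + v) ≤
      ENNReal.ofReal (2 ^ p) * (pairEnergy ν S u + pairEnergy ν S v) := by
    unfold pairEnergy
    rw [← lintegral_add_left' hmeas, ← lintegral_const_mul' _ _ ENNReal.ofReal_ne_top]
    refine lintegral_mono fun z => ?_
    rw [← add_mul, ← mul_assoc, ← ENNReal.ofReal_add (by positivity) (by positivity),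
      ← ENNReal.ofReal_mul (by positivity)]
    gcongr
    set a := u z.1 - u z.2
    set b := v z.1 - v z.2
    have hab : (u + v) z.1 - (u + v) z.2 = a + b := by simp only [Pi.add_apply, a, b]; ring
    rw [hab]
    have h1 : |a + b| ≤ 2 * max |a| |b| :=
      (abs_add_le a b).trans (by linarith [le_max_left |a| |b|, le_max_right |a| |b|])
    calc |a + b| ^ p ≤ (2 * max |a| |b|) ^ p := Real.rpow_le_rpow (abs_nonneg _) h1 hp0
      _ = 2 ^ p * (max |a| |b|) ^ p := Real.mul_rpow (by norm_num) (by positivity)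
      _ ≤ 2 ^ p * (|a| ^ p + |b| ^ p) := by
        gcongr
        rcases max_cases |a| |b| with ⟨h, _⟩ | ⟨h, _⟩ <;> rw [h]
        · linarith [Real.rpow_nonneg (abs_nonneg b) p]
        · linarith [Real.rpow_nonneg (abs_nonneg a) p]
  exact hle.trans_lt (ENNReal.mul_lt_top ENNReal.ofReal_lt_top (ENNReal.add_lt_top.2 ⟨hu, hv⟩))

theorem pairEnergy_smul (ν : RadialLevyKernel d p) (S : Set (Rn d × Rn d))
    (c : ℝ) (u : Rn d → ℝ) :
    pairEnergy ν S (c • u) = ENNReal.ofReal (|c| ^ p) * pairEnergy ν S u := by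
  unfold pairEnergy
  rw [← lintegral_const_mul' _ _ ENNReal.ofReal_ne_top]
  refine lintegral_congr fun z => ?_
  rw [← mul_assoc, ← ENNReal.ofReal_mul (by positivity)]
  congr 2
  simp only [Pi.smul_apply, smul_eq_mul]
  rw [← mul_sub, abs_mul, Real.mul_rpow (abs_nonneg _) (abs_nonneg _)]

/-- The space `W^p_ν(Ω|ℝ^d)` of the measurable functions `u : ℝ^d → ℝ` with `u|_Ω ∈ L^p(Ω)` and
`𝓔(u,u) < ∞` (functions, not classes of functions). -/
def WAcross (hp : 1 < p) (ν : RadialLevyKernel d p) (Ω : Set (Rn d)) :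
    Submodule ℝ (Rn d → ℝ) where
  carrier := {u | AEStronglyMeasurable u volume ∧
    MemLp u (ENNReal.ofReal p) (volume.restrict Ω) ∧ energy ν Ω u < ⊤}
  zero_mem' := by
    refine ⟨aestronglyMeasurable_const, MemLp.zero, ?_⟩
    have hp0 : p ≠ 0 := by linarith
    simp [energy, pairEnergy, Real.zero_rpow hp0]
  add_mem' := fun hu hv =>
    ⟨hu.1.add hv.1, hu.2.1.add hv.2.1, pairEnergy_add_lt_top hp ν _ hu.1 hu.2.2 hv.2.2⟩
  smul_mem' := fun c u hu => by
    refine ⟨hu.1.const_smul c, hu.2.1.const_smul c, ?_⟩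
    have h := pairEnergy_smul ν (Ωᶜ ×ˢ Ωᶜ)ᶜ c u
    unfold energy
    rw [h]
    exact ENNReal.mul_lt_top ENNReal.ofReal_lt_top hu.2.2

/-- The space `W^p_{ν,0}(Ω|ℝ^d)` of the elements of `W^p_ν(Ω|ℝ^d)` that vanish a.e. on `Ωᶜ`. -/
def WAcrossZero (hp : 1 < p) (ν : RadialLevyKernel d p) (Ω : Set (Rn d)) :
    Submodule ℝ (Rn d → ℝ) where
  carrier := {u | u ∈ WAcross hp ν Ω ∧ u =ᵐ[volume.restrict Ωᶜ] 0}
  zero_mem' := ⟨Submodule.zero_mem _, EventuallyEq.rfl⟩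
  add_mem' := fun hu hv => by
    refine ⟨Submodule.add_mem _ hu.1 hv.1, ?_⟩
    simpa using hu.2.add hv.2
  smul_mem' := fun c u hu => by
    refine ⟨Submodule.smul_mem _ c hu.1, ?_⟩
    simpa using hu.2.const_smul c

/-- `g` belongs to the trace space `T^p_ν(Ωᶜ)`: on `Ωᶜ` it is the restriction of an element of
`W^p_ν(Ω|ℝ^d)`.  The values of `g` in `Ω` play no role. -/
def MemTrace (hp : 1 < p) (ν : RadialLevyKernel d p) (Ω : Set (Rn d)) (g : Rn d → ℝ) : Prop :=
  ∃ w ∈ WAcross hp ν Ω, w =ᵐ[volume.restrict Ωᶜ] g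

/-- The quotient seminorm of `T^p_ν(Ωᶜ)`; it is `∞` outside of `T^p_ν(Ωᶜ)`. -/
noncomputable def traceNorm (hp : 1 < p) (ν : RadialLevyKernel d p) (Ω : Set (Rn d))
    (g : Rn d → ℝ) : ℝ≥0∞ :=
  ⨅ w ∈ {w : Rn d → ℝ | w ∈ WAcross hp ν Ω ∧ w =ᵐ[volume.restrict Ωᶜ] g}, normAcross ν Ω w

end NonlocalForms

section LocalSobolev

variable {d : ℕ} {p : ℝ}

/-- Test functions `φ ∈ C_c^∞(U)`. -/
def IsTestFun (U : Set (Rn d)) (φ : Rn d → ℝ) : Prop :=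
  ContDiff ℝ ∞ φ ∧ HasCompactSupport φ ∧ tsupport φ ⊆ U

/-- `u ∈ L^p(U)` has the weak gradient `G ∈ L^p(U; ℝ^d)` in `U`. -/
structure HasSobolevGrad (p : ℝ) (U : Set (Rn d)) (u : Rn d → ℝ) (G : Rn d → Rn d) : Prop where
  memLp : MemLp u (ENNReal.ofReal p) (volume.restrict U)
  memLp_grad : MemLp G (ENNReal.ofReal p) (volume.restrict U)
  integral_eq : ∀ φ : Rn d → ℝ, IsTestFun U φ →
    ∫ x in U, u x • gradient φ x = - ∫ x in U, φ x • G x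

/-- `u ∈ W^{1,p}(U)`.  The values of `u` outside of `U` play no role. -/
def MemW1p (p : ℝ) (U : Set (Rn d)) (u : Rn d → ℝ) : Prop :=
  ∃ G : Rn d → Rn d, HasSobolevGrad p U u G

open Classical in
/-- The weak gradient of `u ∈ W^{1,p}(U)`; it is determined a.e. in the open set `U`. -/
noncomputable def weakGrad (p : ℝ) (U : Set (Rn d)) (u : Rn d → ℝ) : Rn d → Rn d :=
  if h : MemW1p p U u then h.choose else 0

/-- The norm `(‖u‖_{L^p(U)}^p + ‖∇u‖_{L^p(U)}^p)^{1/p}` of `W^{1,p}(U)`. -/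
noncomputable def normW1p (p : ℝ) (U : Set (Rn d)) (u : Rn d → ℝ) : ℝ≥0∞ :=
  (eLpNorm u (ENNReal.ofReal p) (volume.restrict U) ^ p +
    eLpNorm (weakGrad p U u) (ENNReal.ofReal p) (volume.restrict U) ^ p) ^ (1 / p)

/-- The local form `𝓔⁰(u,v) = ∫_Ω |∇u|^{p-2} ∇u · ∇v dx`. -/
noncomputable def localForm (p : ℝ) (Ω : Set (Rn d)) (u v : Rn d → ℝ) : ℝ :=
  ∫ x in Ω, ‖weakGrad p Ω u x‖ ^ (p - 2) * inner ℝ (weakGrad p Ω u x) (weakGrad p Ω v x)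

theorem IsTestFun.continuous_gradient {U : Set (Rn d)} {φ : Rn d → ℝ} (hφ : IsTestFun U φ) :
    Continuous (gradient φ) := by
  have h : Continuous (fderiv ℝ φ) := hφ.1.continuous_fderiv (by simp)
  exact (InnerProductSpace.toDual ℝ (Rn d)).symm.continuous.comp h

theorem IsTestFun.hasCompactSupport_gradient {U : Set (Rn d)} {φ : Rn d → ℝ}
    (hφ : IsTestFun U φ) : HasCompactSupport (gradient φ) := by
  have h : HasCompactSupport (fderiv ℝ φ) := hφ.2.1.fderiv ℝ
  exact h.comp_left (g := (InnerProductSpace.toDual ℝ (Rn d)).symm) (map_zero _)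

theorem HasSobolevGrad.integrable_left (hp : 1 < p) {U : Set (Rn d)} {u : Rn d → ℝ}
    {G : Rn d → Rn d} (h : HasSobolevGrad p U u G) {φ : Rn d → ℝ} (hφ : IsTestFun U φ) :
    Integrable (fun x => u x • gradient φ x) (volume.restrict U) := by
  have hl : LocallyIntegrable u (volume.restrict U) :=
    h.memLp.locallyIntegrable (by simpa using hp.le)
  exact hl.integrable_smul_right_of_hasCompactSupport hφ.continuous_gradient
    hφ.hasCompactSupport_gradient

theorem HasSobolevGrad.integrable_right (hp : 1 < p) {U : Set (Rn d)} {u : Rn d → ℝ}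
    {G : Rn d → Rn d} (h : HasSobolevGrad p U u G) {φ : Rn d → ℝ} (hφ : IsTestFun U φ) :
    Integrable (fun x => φ x • G x) (volume.restrict U) := by
  have hl : LocallyIntegrable G (volume.restrict U) :=
    h.memLp_grad.locallyIntegrable (by simpa using hp.le)
  exact hl.integrable_smul_left_of_hasCompactSupport hφ.1.continuous hφ.2.1

theorem HasSobolevGrad.add (hp : 1 < p) {U : Set (Rn d)} {u v : Rn d → ℝ} {G H : Rn d → Rn d}
    (hu : HasSobolevGrad p U u G) (hv : HasSobolevGrad p U v H) :
    HasSobolevGrad p U (u + v) (G + H) where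
  memLp := hu.memLp.add hv.memLp
  memLp_grad := hu.memLp_grad.add hv.memLp_grad
  integral_eq := fun φ hφ => by
    simp only [Pi.add_apply, add_smul, smul_add]
    rw [integral_add (hu.integrable_left hp hφ) (hv.integrable_left hp hφ),
      integral_add (hu.integrable_right hp hφ) (hv.integrable_right hp hφ),
      hu.integral_eq φ hφ, hv.integral_eq φ hφ]
    abel

theorem HasSobolevGrad.smul {U : Set (Rn d)} {u : Rn d → ℝ} {G : Rn d → Rn d} (c : ℝ)
    (hu : HasSobolevGrad p U u G) : HasSobolevGrad p U (c • u) (c • G) where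
  memLp := hu.memLp.const_smul c
  memLp_grad := hu.memLp_grad.const_smul c
  integral_eq := fun φ hφ => by
    have h1 : (fun x => (c • u) x • gradient φ x) = fun x => c • (u x • gradient φ x) := by
      funext x; simp [mul_smul]
    have h2 : (fun x => φ x • (c • G) x) = fun x => c • (φ x • G x) := by
      funext x; simp only [Pi.smul_apply]; exact smul_comm _ _ _
    rw [h1, h2, integral_smul, integral_smul, hu.integral_eq φ hφ, smul_neg]

theorem hasSobolevGrad_zero (p : ℝ) (U : Set (Rn d)) :
    HasSobolevGrad p U (0 : Rn d → ℝ) (0 : Rn d → Rn d) where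
  memLp := MemLp.zero
  memLp_grad := MemLp.zero
  integral_eq := fun φ _ => by simp

theorem IsTestFun.add {U : Set (Rn d)} {φ ψ : Rn d → ℝ} (hφ : IsTestFun U φ)
    (hψ : IsTestFun U ψ) : IsTestFun U (φ + ψ) :=
  ⟨hφ.1.add hψ.1, hφ.2.1.add hψ.2.1,
    (tsupport_add φ ψ).trans (union_subset hφ.2.2 hψ.2.2)⟩

theorem IsTestFun.smul {U : Set (Rn d)} {φ : Rn d → ℝ} (c : ℝ) (hφ : IsTestFun U φ) :
    IsTestFun U (c • φ) :=
  ⟨hφ.1.const_smul c, hφ.2.1.smul_left (f := fun _ => c),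
    (tsupport_smul_subset_right (fun _ : Rn d => c) φ).trans hφ.2.2⟩

theorem IsTestFun.gradient_add {U : Set (Rn d)} {φ ψ : Rn d → ℝ} (hφ : IsTestFun U φ)
    (hψ : IsTestFun U ψ) : gradient (φ + ψ) = gradient φ + gradient ψ := by
  funext x
  have h1 : DifferentiableAt ℝ φ x := hφ.1.differentiable (by simp) x
  have h2 : DifferentiableAt ℝ ψ x := hψ.1.differentiable (by simp) x
  simp [gradient, fderiv_add h1 h2]

theorem IsTestFun.gradient_smul {U : Set (Rn d)} {φ : Rn d → ℝ} (c : ℝ) (hφ : IsTestFun U φ) :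
    gradient (c • φ) = c • gradient φ := by
  funext x
  have h1 : DifferentiableAt ℝ φ x := hφ.1.differentiable (by simp) x
  simp [gradient, fderiv_const_smul h1 c]

/-- The space `W^{1,p}_0(Ω)`: the closure of `C_c^∞(Ω)` in `W^{1,p}(Ω)`. -/
def W1pZero (hp : 1 < p) (Ω : Set (Rn d)) : Submodule ℝ (Rn d → ℝ) where
  carrier := {u | ∃ G : Rn d → Rn d, HasSobolevGrad p Ω u G ∧
    ∃ φ : ℕ → Rn d → ℝ, (∀ n, IsTestFun Ω (φ n)) ∧
      Tendsto (fun n => eLpNorm (φ n - u) (ENNReal.ofReal p) (volume.restrict Ω)) atTop (𝓝 0) ∧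
      Tendsto (fun n => eLpNorm (gradient (φ n) - G) (ENNReal.ofReal p) (volume.restrict Ω))
        atTop (𝓝 0)}
  zero_mem' := by
    refine ⟨0, hasSobolevGrad_zero p Ω, fun _ => 0, fun _ => ⟨contDiff_const, ?_, ?_⟩, ?_, ?_⟩
    · exact HasCompactSupport.zero
    · rw [show tsupport (0 : Rn d → ℝ) = ∅ from tsupport_eq_empty_iff.2 rfl]
      exact empty_subset _
    · simp
    · have h : gradient (0 : Rn d → ℝ) = 0 := by
        funext x
        simp [gradient]
      simp [h]
  add_mem' := by
    rintro u v ⟨G, hG, φ, hφ, hφ1, hφ2⟩ ⟨H, hH, ψ, hψ, hψ1, hψ2⟩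
    have hp1 : (1 : ℝ≥0∞) ≤ ENNReal.ofReal p := by simpa using hp.le
    refine ⟨G + H, hG.add hp hH, fun n => φ n + ψ n, fun n => (hφ n).add (hψ n), ?_, ?_⟩
    · refine tendsto_of_tendsto_of_tendsto_of_le_of_le tendsto_const_nhds
        (by simpa using hφ1.add hψ1) (fun _ => bot_le) fun n => ?_
      simp only
      rw [add_sub_add_comm]
      exact eLpNorm_add_le ((hφ n).1.continuous.aestronglyMeasurable.sub hG.memLp.1)
        ((hψ n).1.continuous.aestronglyMeasurable.sub hH.memLp.1) hp1
    · refine tendsto_of_tendsto_of_tendsto_of_le_of_le tendsto_const_nhds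
        (by simpa using hφ2.add hψ2) (fun _ => bot_le) fun n => ?_
      simp only
      rw [(hφ n).gradient_add (hψ n), add_sub_add_comm]
      exact eLpNorm_add_le ((hφ n).continuous_gradient.aestronglyMeasurable.sub hG.memLp_grad.1)
        ((hψ n).continuous_gradient.aestronglyMeasurable.sub hH.memLp_grad.1) hp1
  smul_mem' := by
    rintro c u ⟨G, hG, φ, hφ, hφ1, hφ2⟩
    refine ⟨c • G, hG.smul c, fun n => c • φ n, fun n => (hφ n).smul c, ?_, ?_⟩
    · have h := ENNReal.Tendsto.const_mul (a := ‖c‖ₑ) hφ1 (Or.inr (by simp))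
      rw [mul_zero] at h
      refine h.congr fun n => ?_
      rw [← smul_sub, eLpNorm_const_smul]
    · have h := ENNReal.Tendsto.const_mul (a := ‖c‖ₑ) hφ2 (Or.inr (by simp))
      rw [mul_zero] at h
      refine h.congr fun n => ?_
      rw [(hφ n).gradient_smul c, ← smul_sub, eLpNorm_const_smul]

end LocalSobolev

section Problems

variable {d : ℕ} {p : ℝ}

/-- `f` is a bounded linear functional on `W^{1,p}_0(Ω)`, that is, `f ∈ (W^{1,p}_0(Ω))'`. -/
def IsBoundedFunctional (hp : 1 < p) (Ω : Set (Rn d)) (f : W1pZero hp Ω →ₗ[ℝ] ℝ) : Prop :=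
  ∃ C : ℝ≥0, ∀ v : W1pZero hp Ω, ENNReal.ofReal |f v| ≤ C * normW1p p Ω v

/-- Asymptotic weak convergence of functionals `f_ε ∈ (W^p_{ν_ε,0}(Ω|ℝ^d))'`, `ε > 0`, to
`f ∈ (W^{1,p}_0(Ω))'` as `ε → 0+`. -/
structure AsympWeakConv (hp : 1 < p) (ν : ℝ → RadialLevyKernel d p) (Ω : Set (Rn d))
    (fε : ∀ ε : ℝ, WAcrossZero hp (ν ε) Ω →ₗ[ℝ] ℝ) (f : W1pZero hp Ω →ₗ[ℝ] ℝ) : Prop where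
  /-- the dual norms of the `f_ε` are bounded uniformly in `ε > 0` -/
  bounded : ∃ M : ℝ≥0, ∀ ε : ℝ, 0 < ε → ∀ v : WAcrossZero hp (ν ε) Ω,
    ENNReal.ofReal |fε ε v| ≤ M * normAcross (ν ε) Ω v
  /-- `⟨f_ε, v_ε⟩ → ⟨f, v⟩` whenever `v_ε → v` in `L^p(Ω)` -/
  weak_strong : ∀ (vε : ∀ ε : ℝ, WAcrossZero hp (ν ε) Ω) (v : W1pZero hp Ω),
    Tendsto (fun ε : ℝ => eLpNorm ((vε ε : Rn d → ℝ) - (v : Rn d → ℝ)) (ENNReal.ofReal p)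
      (volume.restrict Ω)) (𝓝[>] 0) (𝓝 0) →
    Tendsto (fun ε : ℝ => fε ε (vε ε)) (𝓝[>] 0) (𝓝 (f v))

/-- `u` is a weak solution of the nonlocal Dirichlet problem `μ L u = f` in `Ω`, `u = g` on `Ωᶜ`,
where `L u (x) = 2 p.v. ∫ |u(x)-u(y)|^{p-2} (u(x)-u(y)) ν(x-y) dy`. -/
structure IsNonlocalDirichletSol (hp : 1 < p) (μ : ℝ) (ν : RadialLevyKernel d p)
    (Ω : Set (Rn d)) (f : WAcrossZero hp ν Ω →ₗ[ℝ] ℝ) (g u : Rn d → ℝ) : Prop where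
  mem : u ∈ WAcross hp ν Ω
  complement : u =ᵐ[volume.restrict Ωᶜ] g
  weak : ∀ v : WAcrossZero hp ν Ω, μ * nonlocalForm ν Ω u v = f v

/-- `u` is a weak solution of the local Dirichlet problem `-Δ_p u = f` in `Ω`, `u = g` on `∂Ω`, for
a datum `g ∈ W^{1,p}(ℝ^d ∖ closure Ω)`.  The boundary condition is `u - ḡ ∈ W^{1,p}_0(Ω)` with an
extension `ḡ ∈ W^{1,p}(ℝ^d)` of `g`. -/
structure IsLocalDirichletSol (hp : 1 < p) (Ω : Set (Rn d)) (f : W1pZero hp Ω →ₗ[ℝ] ℝ)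
    (g u : Rn d → ℝ) : Prop where
  mem : MemW1p p Ω u
  boundary : ∃ gbar : Rn d → ℝ, MemW1p p univ gbar ∧
    gbar =ᵐ[volume.restrict (closure Ω)ᶜ] g ∧ u - gbar ∈ W1pZero hp Ω
  weak : ∀ v : W1pZero hp Ω, localForm p Ω u v = f v

end Problems

/-!
In the variables `(h, x)`, the energy and the form of the nonlocal problem are integrals of
`|D u|^p` and `φ(D u) D v` with respect to the measure `ν_ε(h) dh dx`, where
`D w(h, x) = w(x + h) - w(x)` is the finite difference (`difference`) and `φ(a) = |a|^(p-2) a`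
(`signedPow`). The function `u_g` belongs to `W^{1,p}(ℝ^d)`, because it differs from the extension
of the boundary datum by a function in `W^{1,p}_0(Ω)`, up to the boundary of `Ω`, which is a null
set. The core of the proof is `tendsto_energy_sub`: the energy of `u_ε - u_g` tends to zero. It is
an instance of Minty's argument, and has the following ingredients.

*Limits of the forms.* For fixed Sobolev functions, the nonlocal forms converge to `K_{d,p}` times
the local form (`tendsto_integral_signedPow_difference`): by the Taylor expansion in `L^p`, the
differences may be replaced by `∇u(x) · h`, and the average over the directions of `h` produces the
constant, since the kernels are radial. If the second argument is a sequence with bounded energies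
that vanishes in `L^p` in the limit, then the forms tend to zero
(`tendsto_integral_signedPow_of_tendsto_zero`).

*Bounds and compactness.* Testing the equation with `u_ε - u_g`, corrected by a lift of the
difference of the exterior data, gives a bound on the energies (`exists_energy_bound`), where the
right-hand side is absorbed through a Poincaré inequality that is uniform in `ε`
(`exists_poincare`).
By `exists_annulus_bound`, the energies control averages of the `L^p` norms of finite differences
over annuli of any fixed size, eventually. In dimension `d ≥ 2` large differences are composed of
small ones through isometries that the spherical averages do not see; for `d = 1` the lower bound on
`ν_ε(θ x)` takes their place. With a mollifier that is supported in an annulus, such bounds are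
enough for compactness in `L^p` (`exists_subseq_tendsto_eLpNorm`), and the limits belong to
`W^{1,p}_0(Ω)` (`mem_W1pZero_of_annulus_bound`): in a Lipschitz domain, a localized function can be
translated inwards and mollified, which yields test functions with bounded gradients, and by uniform
convexity suitable convex combinations of these converge in `W^{1,p}`.

*Monotonicity.* Along a subsequence, the corrected differences thus converge in `L^p` to some
`v` in `W^{1,p}_0(Ω)`. Tested with them, the nonlocal equation for `u_ε` and the form of `u_g` have
the same limit, by the equation for `u`. As `φ` is strictly monotone, the difference of the two can
only vanish if the energy of `u_ε - u_g` does (`tendsto_lintegral_sub_rpow_of_monotone`).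

The `L^p` norms follow by the Poincaré inequality. The energy of a Sobolev function across the
boundary tends to zero, as it concentrates on a null set (`tendsto_pairEnergy_crossSet`). This gives
the statement on the energies `𝓔_cr`, and it allows the replacement of `u_g` by any other Sobolev
function that equals `u` in `Ω`.
-/

open scoped Convolution Manifold

/-! ### Inequalities for the power `|a|^(p-2) a` -/

/-- The odd power `|a|^(p-2) a`, the derivative of `|a|^p / p`. -/
noncomputable def signedPow (p a : ℝ) : ℝ := |a| ^ (p - 2) * a

theorem abs_signedPow {p : ℝ} (hp : 1 < p) (a : ℝ) : |signedPow p a| = |a| ^ (p - 1) := by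
  unfold signedPow
  rcases eq_or_ne a 0 with rfl | ha
  · rw [mul_zero, abs_zero, Real.zero_rpow (by linarith)]
  · rw [abs_mul, abs_of_nonneg (Real.rpow_nonneg (abs_nonneg a) _),
      ← Real.rpow_add_one (abs_ne_zero.2 ha)]
    ring_nf

theorem signedPow_mul_self {p : ℝ} (hp : 1 < p) (a : ℝ) : signedPow p a * a = |a| ^ p := by
  unfold signedPow
  rcases eq_or_ne a 0 with rfl | ha
  · rw [mul_zero, abs_zero, Real.zero_rpow (by linarith)]
  · rw [mul_assoc, ← abs_mul_abs_self, ← mul_assoc, ← Real.rpow_add_one (abs_ne_zero.2 ha),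
      ← Real.rpow_add_one (abs_ne_zero.2 ha)]
    ring_nf

theorem signedPow_zero (p : ℝ) : signedPow p 0 = 0 := by simp [signedPow]

theorem signedPow_neg (p a : ℝ) : signedPow p (-a) = -signedPow p a := by simp [signedPow]

theorem signedPow_of_nonneg {p : ℝ} (hp : 1 < p) {a : ℝ} (ha : 0 ≤ a) :
    signedPow p a = a ^ (p - 1) := by
  have h := abs_signedPow hp a
  rwa [abs_of_nonneg (by unfold signedPow; positivity), abs_of_nonneg ha] at h

theorem signedPow_mul {p : ℝ} (hp : 1 < p) {t : ℝ} (ht : 0 ≤ t) (a : ℝ) :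
    signedPow p (t * a) = t ^ (p - 1) * signedPow p a := by
  unfold signedPow
  rcases ht.eq_or_lt with rfl | h0
  · simp [Real.zero_rpow (show p - 1 ≠ 0 by linarith)]
  · rw [abs_mul, abs_of_pos h0, Real.mul_rpow ht (abs_nonneg a),
      show p - 1 = (p - 2) + 1 by ring, Real.rpow_add_one h0.ne']
    ring

theorem continuous_signedPow {p : ℝ} (hp : 1 < p) : Continuous (signedPow p) := by
  rw [continuous_iff_continuousAt]
  intro a
  rcases eq_or_ne a 0 with rfl | ha
  · rw [ContinuousAt, signedPow_zero, tendsto_zero_iff_abs_tendsto_zero]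
    have h : Tendsto (fun a : ℝ => |a| ^ (p - 1)) (𝓝 0) (𝓝 (|0| ^ (p - 1))) :=
      (continuous_abs.rpow_const fun _ => Or.inr (by linarith)).tendsto 0
    rw [abs_zero, Real.zero_rpow (by linarith)] at h
    exact h.congr fun a => (abs_signedPow hp a).symm
  · exact ((continuous_abs.continuousAt).rpow_const (Or.inl (abs_ne_zero.2 ha))).mul continuousAt_id

theorem strictMono_signedPow {p : ℝ} (hp : 1 < p) : StrictMono (signedPow p) := by
  have key : ∀ a b : ℝ, 0 ≤ a → a < b → signedPow p a < signedPow p b := fun a b ha hab => by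
    rw [signedPow_of_nonneg hp ha, signedPow_of_nonneg hp (ha.trans hab.le)]
    exact Real.rpow_lt_rpow ha hab (by linarith)
  intro a b hab
  rcases le_or_gt 0 a with ha | ha
  · exact key a b ha hab
  rcases le_or_gt b 0 with hb | hb
  · have := key (-b) (-a) (by linarith) (by linarith)
    rw [signedPow_neg, signedPow_neg] at this
    linarith
  · have h1 := key 0 (-a) le_rfl (by linarith)
    have h2 := key 0 b le_rfl hb
    rw [signedPow_neg, signedPow_zero] at h1
    rw [signedPow_zero] at h2
    linarith

/-- Homogeneous functions of the same degree can be compared by compactness of the unit sphere: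
if `f ≤ 0` wherever `g = 0`, then `f ≤ η ‖·‖^p + C g` for each `η > 0` and a suitable `C`. -/
theorem exists_le_of_homogeneous {X : Type*} [NormedAddCommGroup X] [NormedSpace ℝ X]
    [ProperSpace X] {p : ℝ} (hp : 1 < p) {f g : X → ℝ} (hf : Continuous f) (hg : Continuous g)
    (hfh : ∀ (t : ℝ) (x : X), 0 ≤ t → f (t • x) = t ^ p * f x)
    (hgh : ∀ (t : ℝ) (x : X), 0 ≤ t → g (t • x) = t ^ p * g x)
    (hg0 : ∀ x, 0 ≤ g x) (hfg : ∀ x, g x = 0 → f x ≤ 0) {η : ℝ} (hη : 0 < η) :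
    ∃ C : ℝ, 0 ≤ C ∧ ∀ x, f x ≤ η * ‖x‖ ^ p + C * g x := by
  have hS : IsCompact (sphere (0 : X) 1) := isCompact_sphere 0 1
  obtain ⟨C, hC0, hC⟩ : ∃ C : ℝ, 0 ≤ C ∧ ∀ x ∈ sphere (0 : X) 1, f x ≤ η + C * g x := by
    have hK : IsCompact (sphere (0 : X) 1 ∩ {x | η ≤ f x}) :=
      hS.inter_right (isClosed_le continuous_const hf)
    rcases (sphere (0 : X) 1 ∩ {x | η ≤ f x}).eq_empty_or_nonempty with he | hne
    · refine ⟨0, le_rfl, fun x hx => ?_⟩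
      by_contra! h
      have : x ∈ (sphere (0 : X) 1 ∩ {x | η ≤ f x}) := ⟨hx, by simp at h ⊢; linarith⟩
      rw [he] at this
      exact this
    · obtain ⟨x0, hx0, hmin⟩ := hK.exists_isMinOn hne hg.continuousOn
      obtain ⟨x1, hx1, hmax⟩ := hK.exists_isMaxOn hne hf.continuousOn
      have hm : 0 < g x0 := by
        refine lt_of_le_of_ne (hg0 x0) fun h => ?_
        have h1 := hfg x0 h.symm
        have h2 : η ≤ f x0 := hx0.2
        linarith
      have h1 : η ≤ f x1 := hx1.2
      have hC0 : 0 ≤ f x1 / g x0 := div_nonneg (by linarith) hm.le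
      refine ⟨f x1 / g x0, hC0, fun x hx => ?_⟩
      rcases le_or_gt η (f x) with h | h
      · have h3 : f x ≤ f x1 := hmax ⟨hx, h⟩
        have h4 : g x0 ≤ g x := hmin ⟨hx, h⟩
        have h5 : f x1 ≤ f x1 / g x0 * g x := by
          rw [div_mul_eq_mul_div, le_div_iff₀ hm]
          exact mul_le_mul_of_nonneg_left h4 (by linarith)
        linarith
      · have := mul_nonneg hC0 (hg0 x)
        linarith
  refine ⟨C, hC0, fun x => ?_⟩
  rcases eq_or_ne x 0 with rfl | hx
  · have h1 := hfh 0 0 le_rfl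
    rw [zero_smul, Real.zero_rpow (by linarith), zero_mul] at h1
    rw [h1, norm_zero, Real.zero_rpow (by linarith)]
    have := mul_nonneg hC0 (hg0 0)
    linarith
  · have hx' : ‖x‖ ≠ 0 := norm_ne_zero_iff.2 hx
    have h1 := hC (‖x‖⁻¹ • x) (by simp [norm_smul, hx'])
    have h2 : x = ‖x‖ • (‖x‖⁻¹ • x) := by rw [smul_smul, mul_inv_cancel₀ hx', one_smul]
    have h3 := hfh ‖x‖ (‖x‖⁻¹ • x) (norm_nonneg x)
    have h4 := hgh ‖x‖ (‖x‖⁻¹ • x) (norm_nonneg x)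
    rw [← h2] at h3 h4
    rw [h3, h4]
    have h5 := mul_le_mul_of_nonneg_left h1 (Real.rpow_nonneg (norm_nonneg x) p)
    linarith

theorem continuous_abs_rpow {p : ℝ} (hp : 1 < p) : Continuous fun a : ℝ => |a| ^ p :=
  continuous_abs.rpow_const fun _ => Or.inr (by linarith)

theorem continuous_norm_rpow {X : Type*} [NormedAddCommGroup X] {p : ℝ} (hp : 1 < p) :
    Continuous fun a : X => ‖a‖ ^ p :=
  continuous_norm.rpow_const fun _ => Or.inr (by linarith)

theorem norm_prod_rpow_le {X Y : Type*} [NormedAddCommGroup X] [NormedAddCommGroup Y] {p : ℝ}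
    (z : X × Y) : ‖z‖ ^ p ≤ ‖z.1‖ ^ p + ‖z.2‖ ^ p := by
  have h1 := Real.rpow_nonneg (norm_nonneg z.1) p
  have h2 := Real.rpow_nonneg (norm_nonneg z.2) p
  rw [Prod.norm_def]
  rcases max_cases ‖z.1‖ ‖z.2‖ with ⟨h, _⟩ | ⟨h, _⟩ <;> rw [h] <;> linarith

theorem abs_mul_rpow {p t : ℝ} (ht : 0 ≤ t) (a : ℝ) : |t * a| ^ p = t ^ p * |a| ^ p := by
  rw [abs_mul, abs_of_nonneg ht, Real.mul_rpow ht (abs_nonneg a)]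

theorem eq_zero_of_rpow_abs_le {p a : ℝ} (h : |a| ^ p ≤ 0) : a = 0 := by
  by_contra ha
  exact absurd h (not_le.2 (Real.rpow_pos_of_pos (abs_pos.2 ha) p))

theorem rpow_sub_one_mul {p t : ℝ} (hp : 1 < p) (ht : 0 ≤ t) : t ^ (p - 1) * t = t ^ p := by
  rcases ht.eq_or_lt with rfl | h
  · rw [mul_zero, Real.zero_rpow (by linarith)]
  · rw [← Real.rpow_add_one h.ne']; ring_nf

/-- Continuity of the form `|a|^(p-2) a c`, in a homogeneous version: up to a small multiple of the
`p`-th powers, its increments are controlled by those of `a` and `c`. This splitting serves all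
`p > 1` alike. -/
theorem exists_abs_signedPow_mul_sub_le {p : ℝ} (hp : 1 < p) {η : ℝ} (hη : 0 < η) :
    ∃ C : ℝ, 0 ≤ C ∧ ∀ a b c d : ℝ, |signedPow p a * c - signedPow p b * d| ≤
      η * (|a| ^ p + |b| ^ p + |c| ^ p + |d| ^ p) + C * (|a - b| ^ p + |c - d| ^ p) := by
  have hφ := continuous_signedPow hp
  have hP := continuous_abs_rpow hp
  obtain ⟨C, hC0, hC⟩ := exists_le_of_homogeneous (X := (ℝ × ℝ) × (ℝ × ℝ)) hp
    (f := fun z => |signedPow p z.1.1 * z.2.1 - signedPow p z.1.2 * z.2.2|)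
    (g := fun z => |z.1.1 - z.1.2| ^ p + |z.2.1 - z.2.2| ^ p)
    (by fun_prop)
    ((hP.comp (f := fun z : (ℝ × ℝ) × (ℝ × ℝ) => z.1.1 - z.1.2) (by fun_prop)).add
      (hP.comp (f := fun z : (ℝ × ℝ) × (ℝ × ℝ) => z.2.1 - z.2.2) (by fun_prop)))
    (fun t z ht => by
      simp only [Prod.smul_fst, Prod.smul_snd, smul_eq_mul]
      rw [signedPow_mul hp ht, signedPow_mul hp ht, ← rpow_sub_one_mul hp ht]
      rw [← abs_of_nonneg (show 0 ≤ t ^ (p - 1) * t by positivity)]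
      rw [← abs_mul]
      congr 1
      ring)
    (fun t z ht => by
      simp only [Prod.smul_fst, Prod.smul_snd, smul_eq_mul]
      rw [← mul_sub, ← mul_sub, abs_mul_rpow ht, abs_mul_rpow ht, mul_add])
    (fun z => by positivity)
    (fun z hz => by
      have h1 : 0 ≤ |z.1.1 - z.1.2| ^ p := by positivity
      have h2 : 0 ≤ |z.2.1 - z.2.2| ^ p := by positivity
      have h3 := eq_zero_of_rpow_abs_le (show |z.1.1 - z.1.2| ^ p ≤ 0 by linarith)
      have h4 := eq_zero_of_rpow_abs_le (show |z.2.1 - z.2.2| ^ p ≤ 0 by linarith)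
      rw [sub_eq_zero.1 h3, sub_eq_zero.1 h4]
      simp) hη
  refine ⟨C, hC0, fun a b c d => (hC ((a, b), (c, d))).trans ?_⟩
  have h1 := norm_prod_rpow_le (p := p) (((a, b), (c, d)) : (ℝ × ℝ) × (ℝ × ℝ))
  have h2 := norm_prod_rpow_le (p := p) ((a, b) : ℝ × ℝ)
  have h3 := norm_prod_rpow_le (p := p) ((c, d) : ℝ × ℝ)
  simp only [Real.norm_eq_abs] at h1 h2 h3 ⊢
  gcongr
  linarith

theorem exists_abs_signedPow_mul_le {p : ℝ} (hp : 1 < p) {η : ℝ} (hη : 0 < η) :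
    ∃ C : ℝ, 0 ≤ C ∧ ∀ a c : ℝ, |signedPow p a * c| ≤ η * |a| ^ p + C * |c| ^ p := by
  obtain ⟨C, hC0, hC⟩ := exists_abs_signedPow_mul_sub_le hp (half_pos hη)
  refine ⟨C + η, by linarith, fun a c => ?_⟩
  have h := hC a a c 0
  simp only [mul_zero, sub_zero, sub_self, abs_zero, Real.zero_rpow (show p ≠ 0 by linarith),
    add_zero, zero_add] at h
  have : 0 ≤ |c| ^ p := by positivity
  nlinarith

/-- A quantitative form of the strict monotonicity of `a ↦ |a|^(p-2) a` that serves all `p > 1`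
alike. -/
theorem exists_abs_sub_rpow_le {p : ℝ} (hp : 1 < p) {η : ℝ} (hη : 0 < η) :
    ∃ C : ℝ, 0 ≤ C ∧ ∀ a b : ℝ, |a - b| ^ p ≤
      η * (|a| ^ p + |b| ^ p) + C * ((signedPow p a - signedPow p b) * (a - b)) := by
  have hφ := continuous_signedPow hp
  have hP := continuous_abs_rpow hp
  have hm := strictMono_signedPow hp
  obtain ⟨C, hC0, hC⟩ := exists_le_of_homogeneous (X := ℝ × ℝ) hp
    (f := fun z => |z.1 - z.2| ^ p)
    (g := fun z => (signedPow p z.1 - signedPow p z.2) * (z.1 - z.2))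
    (hP.comp (f := fun z : ℝ × ℝ => z.1 - z.2) (by fun_prop))
    (by fun_prop)
    (fun t z ht => by
      simp only [Prod.smul_fst, Prod.smul_snd, smul_eq_mul]
      rw [← mul_sub, abs_mul_rpow ht])
    (fun t z ht => by
      simp only [Prod.smul_fst, Prod.smul_snd, smul_eq_mul]
      rw [signedPow_mul hp ht, signedPow_mul hp ht, ← rpow_sub_one_mul hp ht]
      ring)
    (fun z => by
      rcases le_total z.1 z.2 with h | h
      · exact mul_nonneg_of_nonpos_of_nonpos (by linarith [hm.monotone h]) (by linarith)
      · exact mul_nonneg (by linarith [hm.monotone h]) (by linarith))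
    (fun z hz => by
      have : z.1 - z.2 = 0 := by
        rcases mul_eq_zero.1 hz with h | h
        · rw [hm.injective (sub_eq_zero.1 h), sub_self]
        · exact h
      rw [this, abs_zero, Real.zero_rpow (by linarith)]) hη
  refine ⟨C, hC0, fun a b => (hC (a, b)).trans ?_⟩
  have h2 := norm_prod_rpow_le (p := p) ((a, b) : ℝ × ℝ)
  simp only [Real.norm_eq_abs] at h2 ⊢
  gcongr

/-- A quantitative form of the strict convexity of `‖·‖^p`. -/
theorem exists_norm_sub_rpow_le {d : ℕ} {p : ℝ} (hp : 1 < p) {η : ℝ} (hη : 0 < η) :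
    ∃ C : ℝ, 0 ≤ C ∧ ∀ a b : Rn d, ‖a - b‖ ^ p ≤ η * (‖a‖ ^ p + ‖b‖ ^ p) +
      C * (‖a‖ ^ p / 2 + ‖b‖ ^ p / 2 - ‖(1 / 2 : ℝ) • (a + b)‖ ^ p) := by
  have hP := continuous_norm_rpow (X := Rn d) hp
  have hsc := strictConvexOn_rpow hp
  have hhalf : ∀ a b : Rn d, ‖(1 / 2 : ℝ) • (a + b)‖ ≤ (1 / 2) * ‖a‖ + (1 / 2) * ‖b‖ :=
    fun a b => by
      rw [norm_smul]
      have := norm_add_le a b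
      norm_num
      linarith
  have hle : ∀ a b : Rn d, ‖(1 / 2 : ℝ) • (a + b)‖ ^ p ≤ ‖a‖ ^ p / 2 + ‖b‖ ^ p / 2 :=
    fun a b => by
      have h1 := Real.rpow_le_rpow (norm_nonneg _) (hhalf a b) (show 0 ≤ p by linarith)
      have h2 := hsc.convexOn.2 (norm_nonneg a) (norm_nonneg b) (show (0 : ℝ) ≤ 1 / 2 by norm_num)
        (show (0 : ℝ) ≤ 1 / 2 by norm_num) (by norm_num)
      simp only [smul_eq_mul] at h2
      linarith
  obtain ⟨C, hC0, hC⟩ := exists_le_of_homogeneous (X := Rn d × Rn d) hp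
    (f := fun z => ‖z.1 - z.2‖ ^ p)
    (g := fun z => ‖z.1‖ ^ p / 2 + ‖z.2‖ ^ p / 2 - ‖(1 / 2 : ℝ) • (z.1 + z.2)‖ ^ p)
    (hP.comp (f := fun z : Rn d × Rn d => z.1 - z.2) (by fun_prop))
    ((((hP.comp continuous_fst).div_const 2).add ((hP.comp continuous_snd).div_const 2)).sub
      (hP.comp (f := fun z : Rn d × Rn d => (1 / 2 : ℝ) • (z.1 + z.2)) (by fun_prop)))
    (fun t z ht => by
      simp only [Prod.smul_fst, Prod.smul_snd]
      rw [← smul_sub, norm_smul, Real.norm_of_nonneg ht, Real.mul_rpow ht (norm_nonneg _)])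
    (fun t z ht => by
      simp only [Prod.smul_fst, Prod.smul_snd]
      rw [← smul_add, smul_comm, norm_smul, norm_smul, norm_smul t, Real.norm_of_nonneg ht,
        Real.mul_rpow ht (norm_nonneg _), Real.mul_rpow ht (norm_nonneg _),
        Real.mul_rpow ht (norm_nonneg _)]
      ring)
    (fun z => by linarith [hle z.1 z.2])
    (fun z hz => by
      have h1 := Real.rpow_le_rpow (norm_nonneg _) (hhalf z.1 z.2) (show 0 ≤ p by linarith)
      have hn : ‖z.1‖ = ‖z.2‖ := by
        by_contra hne
        have h2 := hsc.2 (norm_nonneg z.1) (norm_nonneg z.2) hne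
          (show (0 : ℝ) < 1 / 2 by norm_num) (show (0 : ℝ) < 1 / 2 by norm_num) (by norm_num)
        simp only [smul_eq_mul] at h2
        linarith
      have heq : z.1 = z.2 := by
        refine eq_of_norm_eq_of_norm_add_eq hn ?_
        refine le_antisymm (norm_add_le _ _) ?_
        have h3 : ‖z.1‖ ^ p = ‖(1 / 2 : ℝ) • (z.1 + z.2)‖ ^ p := by
          rw [← hn] at hz; linarith
        have h4 := (Real.rpow_left_inj (norm_nonneg _) (norm_nonneg _) (by linarith)).1 h3
        rw [norm_smul] at h4
        norm_num at h4
        linarith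
      rw [heq, sub_self, norm_zero, Real.zero_rpow (by linarith)]) hη
  refine ⟨C, hC0, fun a b => (hC (a, b)).trans ?_⟩
  have h2 := norm_prod_rpow_le (p := p) ((a, b) : Rn d × Rn d)
  dsimp only at h2 ⊢
  gcongr

/-! ### Polar coordinates and isometry invariance -/

/-- The surface measure of the unit sphere of `ℝ^d`. -/
noncomputable abbrev sphereMeasure (d : ℕ) : Measure (sphere (0 : Rn d) 1) :=
  (volume : Measure (Rn d)).toSphere

theorem measurePreserving_sphereMap {d : ℕ} (A : Rn d ≃ₗᵢ[ℝ] Rn d) :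
    MeasurePreserving (fun w : sphere (0 : Rn d) 1 =>
      (⟨A w, by simp⟩ : sphere (0 : Rn d) 1)) (sphereMeasure d) (sphereMeasure d) := by
  have hm : Measurable (fun w : sphere (0 : Rn d) 1 => (⟨A w, by simp⟩ : sphere (0 : Rn d) 1)) := by
    refine Measurable.subtype_mk ?_
    exact A.continuous.measurable.comp measurable_subtype_coe
  refine ⟨hm, ?_⟩
  ext s hs
  rw [Measure.map_apply hm hs, Measure.toSphere_apply' _ hs, Measure.toSphere_apply' _ (hm hs)]
  congr 1
  rw [← A.symm.measurePreserving.measure_preimage_emb A.symm.toHomeomorph.measurableEmbedding]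
  congr 1
  ext x
  simp only [mem_preimage, Set.mem_smul, mem_image]
  constructor
  · rintro ⟨r, hr, _, ⟨w, hw, rfl⟩, h⟩
    exact ⟨r, hr, _, ⟨_, hw, rfl⟩, by simpa using congrArg A h⟩
  · rintro ⟨r, hr, _, ⟨w, hw, rfl⟩, rfl⟩
    exact ⟨r, hr, A.symm w, ⟨⟨A.symm w, by simp⟩, by simpa using hw, rfl⟩, by simp⟩

theorem lintegral_sphere_comp {d : ℕ} (A : Rn d ≃ₗᵢ[ℝ] Rn d) {f : Rn d → ℝ≥0∞}
    (hf : Measurable f) :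
    ∫⁻ w : sphere (0 : Rn d) 1, f (A w) ∂(sphereMeasure d) =
      ∫⁻ w : sphere (0 : Rn d) 1, f w ∂(sphereMeasure d) :=
  (measurePreserving_sphereMap A).lintegral_comp (f := fun w => f w)
    (hf.comp measurable_subtype_coe)

theorem lintegral_eq_polar {d : ℕ} [NeZero d] (f : Rn d → ℝ≥0∞) :
    ∫⁻ x, f x = ∫⁻ z : sphere (0 : Rn d) 1 × Ioi (0 : ℝ), f ((z.2 : ℝ) • (z.1 : Rn d))
      ∂((sphereMeasure d).prod (Measure.volumeIoiPow (d - 1))) := by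
  have h := (Measure.measurePreserving_homeomorphUnitSphereProd
    (volume : Measure (Rn d))).lintegral_comp_emb (Homeomorph.measurableEmbedding _)
    (fun z : sphere (0 : Rn d) 1 × Ioi (0 : ℝ) => f ((z.2 : ℝ) • (z.1 : Rn d)))
  rw [finrank_euclideanSpace_fin] at h
  rw [← h, ← setLIntegral_univ, ← lintegral_inter_add_sdiff f univ (measurableSet_singleton 0)]
  simp only [univ_inter]
  rw [Measure.restrict_singleton, measure_singleton, zero_smul, lintegral_zero_measure, zero_add,
    ← compl_eq_univ_sdiff, ← lintegral_subtype_comap (measurableSet_singleton 0).compl]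
  refine lintegral_congr fun x => ?_
  congr 1
  have hx : ‖(x : Rn d)‖ ≠ 0 := norm_ne_zero_iff.2 x.2
  simp [homeomorphUnitSphereProd, smul_smul, hx]

theorem aemeasurable_polar {d : ℕ} [NeZero d] {f : Rn d → ℝ≥0∞} (hf : AEMeasurable f) :
    AEMeasurable (fun z : sphere (0 : Rn d) 1 × Ioi (0 : ℝ) => f ((z.2 : ℝ) • (z.1 : Rn d)))
      ((sphereMeasure d).prod (Measure.volumeIoiPow (d - 1))) := by
  have hm : Measurable
      (fun z : sphere (0 : Rn d) 1 × Ioi (0 : ℝ) => (z.2 : ℝ) • (z.1 : Rn d)) := by fun_prop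
  refine hf.comp_quasiMeasurePreserving ⟨hm, Measure.AbsolutelyContinuous.mk fun s hs h0 => ?_⟩
  rw [Measure.map_apply hm hs, ← lintegral_indicator_one (hm hs)]
  have h := lintegral_eq_polar (s.indicator (1 : Rn d → ℝ≥0∞))
  rw [lintegral_indicator_one hs, h0] at h
  exact h.symm

/-- Integration against a radial density sees only spherical averages. -/
theorem lintegral_mul_radial {d : ℕ} [NeZero d] {ν : Rn d → ℝ≥0} (hν : AEMeasurable ν)
    (hr : ∀ h k : Rn d, ‖h‖ = ‖k‖ → ν h = ν k) {Ψ : Rn d → ℝ≥0∞} (hΨ : Measurable Ψ) :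
    sphereMeasure d univ * ∫⁻ h, Ψ h * (ν h : ℝ≥0∞) =
      ∫⁻ h, (∫⁻ w : sphere (0 : Rn d) 1, Ψ (‖h‖ • (w : Rn d)) ∂(sphereMeasure d)) *
        (ν h : ℝ≥0∞) := by
  set e : Rn d := EuclideanSpace.single 0 1 with he
  have hen : ‖e‖ = 1 := by simp [he]
  have hνr : ∀ (w : sphere (0 : Rn d) 1) (r : Ioi (0 : ℝ)),
      ν ((r : ℝ) • (w : Rn d)) = ν ((r : ℝ) • e) := fun w r => hr _ _ (by
    rw [norm_smul, norm_smul, hen]; simp)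
  have hνm : AEMeasurable (fun h => (ν h : ℝ≥0∞)) := hν.coe_nnreal_ennreal
  have havg : Measurable fun h : Rn d =>
      ∫⁻ w : sphere (0 : Rn d) 1, Ψ (‖h‖ • (w : Rn d)) ∂(sphereMeasure d) := by
    refine Measurable.lintegral_prod_right
      (f := fun h : Rn d => fun w : sphere (0 : Rn d) 1 => Ψ (‖h‖ • (w : Rn d))) ?_
    exact hΨ.comp (by fun_prop)
  rw [lintegral_eq_polar, lintegral_eq_polar (fun h => (∫⁻ w : sphere (0 : Rn d) 1,
      Ψ (‖h‖ • (w : Rn d)) ∂(sphereMeasure d)) * (ν h : ℝ≥0∞)),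
    lintegral_prod_symm _ (aemeasurable_polar (f := fun h => Ψ h * (ν h : ℝ≥0∞))
      (hΨ.aemeasurable.mul hνm)),
    lintegral_prod_symm _ (aemeasurable_polar (f := fun h => (∫⁻ w : sphere (0 : Rn d) 1,
      Ψ (‖h‖ • (w : Rn d)) ∂(sphereMeasure d)) * (ν h : ℝ≥0∞)) (havg.aemeasurable.mul hνm)),
    ← lintegral_const_mul' _ _ (measure_ne_top _ _)]
  refine lintegral_congr fun r => ?_
  have hr0 : (0 : ℝ) < r := r.2
  have hn : ∀ w : sphere (0 : Rn d) 1, ‖(r : ℝ) • (w : Rn d)‖ = r := fun w => by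
    rw [norm_smul]; simp [abs_of_pos hr0]
  simp only [hνr, hn]
  rw [lintegral_const, lintegral_mul_const' _ _ ENNReal.coe_ne_top]
  ring

/-! ### The constant `K_{d,p}` -/

theorem exists_isometry_eq {d : ℕ} {v w : Rn d} (h : ‖v‖ = ‖w‖) :
    ∃ A : Rn d ≃ₗᵢ[ℝ] Rn d, A v = w :=
  ⟨(ℝ ∙ (v - w))ᗮ.reflection, Submodule.reflection_sub h⟩

theorem sphereMeasure_univ_ne_zero {d : ℕ} [NeZero d] : sphereMeasure d univ ≠ 0 := by
  have : Nonempty (Fin d) := ⟨0⟩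
  exact fun h => (volume : Measure (Rn d)).toSphere_ne_zero (Measure.measure_univ_eq_zero.1 h)

theorem inner_isometry {d : ℕ} (A : Rn d ≃ₗᵢ[ℝ] Rn d) (a h : Rn d) :
    inner ℝ a (A h) = inner ℝ (A.symm a) h := by
  rw [← A.inner_map_map (A.symm a) h, A.apply_symm_apply]

theorem lintegral_sphere_inner {d : ℕ} [NeZero d] {p : ℝ} (e : Rn d) (he : ‖e‖ = 1) :
    ∫⁻ w : sphere (0 : Rn d) 1, ENNReal.ofReal (|inner ℝ e (w : Rn d)| ^ p) ∂(sphereMeasure d) =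
    ∫⁻ w : sphere (0 : Rn d) 1, ENNReal.ofReal (|(w : Rn d) (Fin.rev 0)| ^ p)
      ∂(sphereMeasure d) := by
  obtain ⟨A, hA⟩ := exists_isometry_eq (v := e) (w := EuclideanSpace.single (Fin.rev 0) 1)
    (by simp [he])
  have h := lintegral_sphere_comp A (f := fun w => ENNReal.ofReal (|w (Fin.rev 0)| ^ p))
    (by fun_prop)
  rw [← h]
  refine lintegral_congr fun w => ?_
  have h1 : (A (w : Rn d)) (Fin.rev 0) = inner ℝ e (w : Rn d) := by
    rw [← A.inner_map_map e w, hA, EuclideanSpace.inner_single_left]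
    simp
  rw [h1]

theorem integrable_sphere_coord {d : ℕ} {p : ℝ} (hp : 1 < p) (i : Fin d) :
    Integrable (fun w : sphere (0 : Rn d) 1 => |(w : Rn d) i| ^ p) (sphereMeasure d) := by
  have hc : Continuous fun w : sphere (0 : Rn d) 1 => |(w : Rn d) i| ^ p :=
    (continuous_abs_rpow hp).comp (f := fun w : sphere (0 : Rn d) 1 => (w : Rn d) i) (by fun_prop)
  refine (integrable_const (1 : ℝ)).mono' hc.aestronglyMeasurable (Eventually.of_forall fun w => ?_)
  rw [Real.norm_of_nonneg (by positivity)]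
  refine Real.rpow_le_one (abs_nonneg _) ?_ (by linarith)
  have := PiLp.norm_apply_le (w : Rn d) i
  simpa using this

theorem Kdp_nonneg {d : ℕ} [NeZero d] {p : ℝ} : 0 ≤ Kdp d p := by
  unfold Kdp
  rw [average_eq]
  have : 0 ≤ ∫ w : sphere (0 : Rn d) 1, |(w : Rn d) (Fin.rev 0)| ^ p ∂(sphereMeasure d) :=
    integral_nonneg fun w => by positivity
  exact smul_nonneg (by positivity) this

theorem ofReal_Kdp {d : ℕ} [NeZero d] {p : ℝ} (hp : 1 < p) (e : Rn d) (he : ‖e‖ = 1) :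
    ∫⁻ w : sphere (0 : Rn d) 1, ENNReal.ofReal (|inner ℝ e (w : Rn d)| ^ p) ∂(sphereMeasure d) =
      sphereMeasure d univ * ENNReal.ofReal (Kdp d p) := by
  rw [lintegral_sphere_inner e he, ← ofReal_integral_eq_lintegral_ofReal
    (integrable_sphere_coord hp _) (Eventually.of_forall fun w => by positivity)]
  unfold Kdp
  rw [average_eq, smul_eq_mul, ENNReal.ofReal_mul (by positivity), ← mul_assoc, measureReal_def,
    ENNReal.ofReal_inv_of_pos, ENNReal.ofReal_toReal (measure_ne_top _ _),
    ENNReal.mul_inv_cancel sphereMeasure_univ_ne_zero (measure_ne_top _ _), one_mul]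
  exact ENNReal.toReal_pos sphereMeasure_univ_ne_zero (measure_ne_top _ _)

theorem Kdp_pos {d : ℕ} [NeZero d] {p : ℝ} (hp : 1 < p) : 0 < Kdp d p := by
  refine lt_of_le_of_ne Kdp_nonneg fun h0 => ?_
  -- if `K = 0`, then almost every point of the sphere is orthogonal to all coordinate vectors
  have h1 : ∀ i : Fin d, ∀ᵐ w : sphere (0 : Rn d) 1 ∂(sphereMeasure d), (w : Rn d) i = 0 := by
    intro i
    have h := ofReal_Kdp hp (EuclideanSpace.single i (1 : ℝ)) (by simp)
    rw [← h0, ENNReal.ofReal_zero, mul_zero, lintegral_eq_zero_iff' (by fun_prop)] at h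
    filter_upwards [h] with w hw
    rw [Pi.zero_apply, ENNReal.ofReal_eq_zero, EuclideanSpace.inner_single_left] at hw
    simpa using eq_zero_of_rpow_abs_le hw
  have h2 : ∀ᵐ w : sphere (0 : Rn d) 1 ∂(sphereMeasure d), False := by
    filter_upwards [ae_all_iff.2 h1] with w hw
    have : (w : Rn d) = 0 := by ext i; simpa using hw i
    have hn : ‖(w : Rn d)‖ = 1 := by simp
    rw [this, norm_zero] at hn
    exact zero_ne_one hn
  exact sphereMeasure_univ_ne_zero (d := d) (by simpa [ae_iff] using h2)

/-- For a radial density `ν`, `∫ |a · h|^p ν(h) dh = K_{d,p} |a|^p ∫ |h|^p ν(h) dh`. -/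
theorem lintegral_inner_radial {d : ℕ} [NeZero d] {p : ℝ} (hp : 1 < p) {ν : Rn d → ℝ≥0}
    (hν : AEMeasurable ν) (hr : ∀ h k : Rn d, ‖h‖ = ‖k‖ → ν h = ν k) (a : Rn d) :
    ∫⁻ h, ENNReal.ofReal (|inner ℝ a h| ^ p) * (ν h : ℝ≥0∞) =
      ENNReal.ofReal (Kdp d p * ‖a‖ ^ p) * ∫⁻ h, ENNReal.ofReal (‖h‖ ^ p) * (ν h : ℝ≥0∞) := by
  have hS0 := sphereMeasure_univ_ne_zero (d := d)
  have hSt : sphereMeasure d univ ≠ ⊤ := measure_ne_top _ _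
  rw [← ENNReal.mul_right_inj hS0 hSt, lintegral_mul_radial hν hr (by fun_prop),
    ← lintegral_const_mul' _ _ ENNReal.ofReal_ne_top, ← lintegral_const_mul' _ _ hSt]
  refine lintegral_congr fun h => ?_
  rw [← mul_assoc, ← mul_assoc]
  congr 1
  rcases eq_or_ne a 0 with rfl | ha
  · simp [Real.zero_rpow (show p ≠ 0 by linarith)]
  have ha' : ‖a‖ ≠ 0 := norm_ne_zero_iff.2 ha
  have h1 : ∀ w : sphere (0 : Rn d) 1, ENNReal.ofReal (|inner ℝ a (‖h‖ • (w : Rn d))| ^ p) =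
      ENNReal.ofReal (‖a‖ ^ p * ‖h‖ ^ p) *
        ENNReal.ofReal (|inner ℝ (‖a‖⁻¹ • a) (w : Rn d)| ^ p) := fun w => by
    rw [← ENNReal.ofReal_mul (by positivity), inner_smul_right, inner_smul_left]
    congr 1
    rw [abs_mul_rpow (norm_nonneg h), RCLike.conj_to_real, abs_mul_rpow (by positivity),
      Real.inv_rpow (norm_nonneg a)]
    have : ‖a‖ ^ p ≠ 0 := (Real.rpow_pos_of_pos (norm_pos_iff.2 ha) p).ne'
    field_simp
  simp_rw [h1]
  rw [lintegral_const_mul' _ _ ENNReal.ofReal_ne_top, ofReal_Kdp hp _ (by simp [norm_smul, ha']),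
    ENNReal.ofReal_mul (by positivity), ENNReal.ofReal_mul Kdp_nonneg]
  ring

/-- For a measure that is invariant under linear isometries, the vector
`∫ |a · h|^(p-2) (a · h) h dλ(h)` is parallel to `a`. -/
theorem integral_signedPow_inner {d : ℕ} {p : ℝ} (hp : 1 < p) {m : Measure (Rn d)}
    (hm : ∀ A : Rn d ≃ₗᵢ[ℝ] Rn d, MeasurePreserving A m m) {c : ℝ}
    (hint : Integrable (fun h : Rn d => ‖h‖ ^ p) m)
    (hc : ∀ a : Rn d, ∫ h, |inner ℝ a h| ^ p ∂m = c * ‖a‖ ^ p) (a b : Rn d) :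
    ∫ h, signedPow p (inner ℝ a h) * inner ℝ b h ∂m = c * (‖a‖ ^ (p - 2) * inner ℝ a b) := by
  rcases eq_or_ne a 0 with rfl | ha
  · simp [signedPow_zero]
  have ha' : ‖a‖ ≠ 0 := norm_ne_zero_iff.2 ha
  have hI : ∀ b : Rn d, Integrable (fun h => signedPow p (inner ℝ a h) * inner ℝ b h) m := by
    intro b
    have hcont : Continuous fun h : Rn d => signedPow p (inner ℝ a h) * inner ℝ b h :=
      ((continuous_signedPow hp).comp (by fun_prop)).mul (by fun_prop)
    refine (hint.const_mul (‖a‖ ^ (p - 1) * ‖b‖)).mono' hcont.aestronglyMeasurable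
      (Eventually.of_forall fun h => ?_)
    rw [Real.norm_eq_abs, abs_mul, abs_signedPow hp]
    calc |inner ℝ a h| ^ (p - 1) * |inner ℝ b h|
        ≤ (‖a‖ * ‖h‖) ^ (p - 1) * (‖b‖ * ‖h‖) := by
          refine mul_le_mul (Real.rpow_le_rpow (abs_nonneg _) (abs_real_inner_le_norm a h)
            (by linarith)) (abs_real_inner_le_norm b h) (abs_nonneg _) (by positivity)
      _ = ‖a‖ ^ (p - 1) * ‖b‖ * ‖h‖ ^ p := by
          rw [Real.mul_rpow (norm_nonneg _) (norm_nonneg _), ← rpow_sub_one_mul hp (norm_nonneg h)]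
          ring
  set t : ℝ := inner ℝ a b / ‖a‖ ^ 2 with ht
  set b' : Rn d := b - t • a with hb'
  have horth : inner ℝ b' a = 0 := by
    rw [hb', inner_sub_left, real_inner_smul_left, real_inner_self_eq_norm_sq, ht,
      real_inner_comm]
    field_simp
    ring
  -- the reflection in the hyperplane orthogonal to `b'` fixes `a · h` and changes the sign of
  -- `b' · h`
  have hzero : ∫ h, signedPow p (inner ℝ a h) * inner ℝ b' h ∂m = 0 := by
    set A : Rn d ≃ₗᵢ[ℝ] Rn d := (ℝ ∙ b')ᗮ.reflection with hA
    have hsymm : A.symm = A := by rw [hA, Submodule.reflection_symm]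
    have hAa : A a = a := by
      rw [hA]
      exact Submodule.reflection_mem_subspace_eq_self
        (Submodule.mem_orthogonal_singleton_iff_inner_right.2 horth)
    have hAb : A b' = -b' := by
      rw [hA]
      exact Submodule.reflection_orthogonalComplement_singleton_eq_neg b'
    have h := (hm A).integral_comp A.toHomeomorph.measurableEmbedding
      (fun h => signedPow p (inner ℝ a h) * inner ℝ b' h)
    simp only [inner_isometry, hsymm, hAa, hAb, inner_neg_left, mul_neg, integral_neg] at h
    linarith
  have hbt : b = t • a + b' := by rw [hb']; abel
  have hself : ∀ h : Rn d, signedPow p (inner ℝ a h) * inner ℝ b h =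
      t * |inner ℝ a h| ^ p + signedPow p (inner ℝ a h) * inner ℝ b' h := fun h => by
    rw [← signedPow_mul_self hp]
    have h3 : inner ℝ b h = t * inner ℝ a h + inner ℝ b' h := by
      conv_lhs => rw [hbt]
      rw [inner_add_left, real_inner_smul_left]
    rw [h3]
    ring
  have hIa : Integrable (fun h => t * |inner ℝ a h| ^ p) m := by
    simpa only [signedPow_mul_self hp] using (hI a).const_mul t
  simp_rw [hself]
  rw [integral_add hIa (hI b'), hzero, integral_const_mul, hc, ht]
  have h2 : ‖a‖ ^ p = ‖a‖ ^ (p - 2) * ‖a‖ ^ 2 := by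
    rw [← Real.rpow_add_natCast ha']
    norm_num
  rw [h2]
  field_simp
  ring

/-! ### Norms of finite differences -/

theorem ofReal_abs_rpow {p : ℝ} (hp : 1 < p) (a : ℝ) : ENNReal.ofReal (|a| ^ p) = ‖a‖ₑ ^ p := by
  rw [← ENNReal.ofReal_rpow_of_nonneg (abs_nonneg a) (by linarith), Real.enorm_eq_ofReal_abs]

theorem ofReal_norm_rpow {F : Type*} [NormedAddCommGroup F] {p : ℝ} (hp : 1 < p) (a : F) :
    ENNReal.ofReal (‖a‖ ^ p) = ‖a‖ₑ ^ p := by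
  rw [← ENNReal.ofReal_rpow_of_nonneg (norm_nonneg a) (by linarith), ofReal_norm]

theorem eLpNorm_rpow_eq {α F : Type*} [MeasurableSpace α] [NormedAddCommGroup F] {p : ℝ}
    (hp : 1 < p) (f : α → F) (m : Measure α) :
    eLpNorm f (ENNReal.ofReal p) m ^ p = ∫⁻ x, ‖f x‖ₑ ^ p ∂m := by
  have hp0 : (0 : ℝ) < p := by linarith
  rw [eLpNorm_eq_lintegral_rpow_enorm_toReal (by simpa using hp0) ENNReal.ofReal_ne_top,
    ENNReal.toReal_ofReal hp0.le, ← ENNReal.rpow_mul, one_div, inv_mul_cancel₀ hp0.ne',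
    ENNReal.rpow_one]

theorem one_le_ofReal {p : ℝ} (hp : 1 < p) : (1 : ℝ≥0∞) ≤ ENNReal.ofReal p := by
  simpa using hp.le

theorem ennreal_rpow_le_rpow_iff {p : ℝ} (hp : 1 < p) {a b : ℝ≥0∞} : a ^ p ≤ b ^ p ↔ a ≤ b :=
  ENNReal.rpow_le_rpow_iff (by linarith)

theorem add_rpow_le_two {p : ℝ} (hp : 1 < p) (a b : ℝ≥0∞) :
    (a + b) ^ p ≤ 2 ^ p * (a ^ p + b ^ p) := by
  have hp0 : 0 ≤ p := by linarith
  calc (a + b) ^ p ≤ (2 * max a b) ^ p := by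
        refine ENNReal.rpow_le_rpow ?_ hp0
        rw [two_mul]
        exact add_le_add (le_max_left _ _) (le_max_right _ _)
    _ = 2 ^ p * (max a b) ^ p := ENNReal.mul_rpow_of_nonneg _ _ hp0
    _ ≤ 2 ^ p * (a ^ p + b ^ p) := by
        gcongr
        rcases max_cases a b with ⟨h, _⟩ | ⟨h, _⟩ <;> rw [h]
        · exact le_self_add
        · exact le_add_self

section Shift

variable {d : ℕ} {F : Type*} [NormedAddCommGroup F] {p : ℝ}

/-- The `L^p(ℝ^d)` norm of the finite difference `w(· + h) - w`. -/
noncomputable def shiftNorm (p : ℝ) (w : Rn d → F) (h : Rn d) : ℝ≥0∞ :=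
  eLpNorm (fun x => w (x + h) - w x) (ENNReal.ofReal p) volume

theorem shiftNorm_rpow (hp : 1 < p) (w : Rn d → F) (h : Rn d) :
    shiftNorm p w h ^ p = ∫⁻ x, ‖w (x + h) - w x‖ₑ ^ p := eLpNorm_rpow_eq hp _ _

theorem aestronglyMeasurable_shift {w : Rn d → F} (hw : AEStronglyMeasurable w volume)
    (h : Rn d) : AEStronglyMeasurable (fun x => w (x + h)) volume :=
  hw.comp_measurePreserving (measurePreserving_add_right volume h)

theorem eLpNorm_shift {w : Rn d → F} (hw : AEStronglyMeasurable w volume) (q : ℝ≥0∞)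
    (h : Rn d) : eLpNorm (fun x => w (x + h)) q volume = eLpNorm w q volume :=
  eLpNorm_comp_measurePreserving hw (measurePreserving_add_right volume h)

theorem ae_shift {P : Rn d → Prop} (hP : ∀ᵐ x, P x) (h : Rn d) : ∀ᵐ x : Rn d, P (x + h) :=
  (measurePreserving_add_right volume h).quasiMeasurePreserving.ae hP

theorem shiftNorm_congr {w w' : Rn d → F} (hw : w =ᵐ[volume] w') (h : Rn d) :
    shiftNorm p w h = shiftNorm p w' h := by
  refine eLpNorm_congr_ae ?_
  filter_upwards [hw, ae_shift hw h] with x h1 h2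
  rw [h1, h2]

theorem shiftNorm_zero_right (w : Rn d → F) : shiftNorm p w 0 = 0 := by
  simp [shiftNorm]

theorem shiftNorm_add_right (hp : 1 < p) {w : Rn d → F} (hw : AEStronglyMeasurable w volume)
    (h k : Rn d) : shiftNorm p w (h + k) ≤ shiftNorm p w h + shiftNorm p w k := by
  have h1 : (fun x => w (x + (h + k)) - w x) =
      (fun x => w ((x + k) + h) - w (x + k)) + fun x => w (x + k) - w x := by
    funext x
    simp only [Pi.add_apply]
    rw [add_comm h k, ← add_assoc]
    abel
  have hm : AEStronglyMeasurable (fun x => w (x + h) - w x) volume :=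
    (aestronglyMeasurable_shift hw h).sub hw
  unfold shiftNorm
  rw [h1]
  refine (eLpNorm_add_le (aestronglyMeasurable_shift hm k)
    ((aestronglyMeasurable_shift hw k).sub hw) (one_le_ofReal hp)).trans ?_
  exact add_le_add (eLpNorm_shift hm _ k).le le_rfl

theorem shiftNorm_sum_le (hp : 1 < p) {w : Rn d → F} (hw : AEStronglyMeasurable w volume)
    {ι : Type*} (s : Finset ι) (h : ι → Rn d) :
    shiftNorm p w (∑ i ∈ s, h i) ≤ ∑ i ∈ s, shiftNorm p w (h i) := by
  classical
  induction s using Finset.induction_on with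
  | empty => simp [shiftNorm_zero_right]
  | insert i s hi ih =>
    rw [Finset.sum_insert hi, Finset.sum_insert hi]
    exact (shiftNorm_add_right hp hw _ _).trans (add_le_add le_rfl ih)

theorem shiftNorm_nsmul_le (hp : 1 < p) {w : Rn d → F} (hw : AEStronglyMeasurable w volume)
    (N : ℕ) (h : Rn d) : shiftNorm p w ((N : ℝ) • h) ≤ N * shiftNorm p w h := by
  have := shiftNorm_sum_le hp hw (Finset.range N) (fun _ => h)
  simpa [Nat.cast_smul_eq_nsmul] using this

theorem shiftNorm_neg {w : Rn d → F} (hw : AEStronglyMeasurable w volume) (h : Rn d) :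
    shiftNorm p w (-h) = shiftNorm p w h := by
  have hm : AEStronglyMeasurable (fun x => w (x + -h) - w x) volume :=
    (aestronglyMeasurable_shift hw (-h)).sub hw
  have h1 := eLpNorm_shift hm (ENNReal.ofReal p) h
  unfold shiftNorm
  rw [← h1, ← eLpNorm_neg]
  congr 1
  funext x
  simp

theorem shiftNorm_le_two_mul (hp : 1 < p) {w : Rn d → F} (hw : AEStronglyMeasurable w volume)
    (h : Rn d) : shiftNorm p w h ≤ 2 * eLpNorm w (ENNReal.ofReal p) volume := by
  refine (eLpNorm_sub_le (aestronglyMeasurable_shift hw h) hw (one_le_ofReal hp)).trans ?_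
  rw [eLpNorm_shift hw, two_mul]

theorem shiftNorm_add_left (hp : 1 < p) {u v : Rn d → F} (hu : AEStronglyMeasurable u volume)
    (hv : AEStronglyMeasurable v volume) (h : Rn d) :
    shiftNorm p (u + v) h ≤ shiftNorm p u h + shiftNorm p v h := by
  refine le_trans (le_of_eq ?_) (eLpNorm_add_le ((aestronglyMeasurable_shift hu h).sub hu)
    ((aestronglyMeasurable_shift hv h).sub hv) (one_le_ofReal hp))
  unfold shiftNorm
  congr 1
  funext x
  simp only [Pi.add_apply]
  abel

theorem measurable_shiftNorm_rpow (hp : 1 < p) {w : Rn d → F}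
    (hw : AEStronglyMeasurable w volume) : Measurable fun h => shiftNorm p w h ^ p := by
  have h1 : (fun h => shiftNorm p w h ^ p) = fun h => ∫⁻ x, ‖hw.mk w (x + h) - hw.mk w x‖ₑ ^ p := by
    funext h
    rw [shiftNorm_congr hw.ae_eq_mk, shiftNorm_rpow hp]
  rw [h1]
  refine Measurable.lintegral_prod_right (f := fun h x => ‖hw.mk w (x + h) - hw.mk w x‖ₑ ^ p) ?_
  refine Measurable.pow_const ?_ p
  have h2 : StronglyMeasurable fun z : Rn d × Rn d => hw.mk w (z.2 + z.1) - hw.mk w z.2 :=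
    (hw.stronglyMeasurable_mk.comp_measurable (by fun_prop)).sub
      (hw.stronglyMeasurable_mk.comp_measurable (by fun_prop))
  exact h2.enorm

end Shift

/-! ### The energy over the whole space -/

section Energy

variable {d : ℕ} {p : ℝ}

theorem aemeasurable_energy_integrand (hp : 1 < p) (ν : RadialLevyKernel d p) {w : Rn d → ℝ}
    (hw : AEStronglyMeasurable w volume) :
    AEMeasurable (fun z : Rn d × Rn d =>
      ENNReal.ofReal (|w z.1 - w z.2| ^ p) * (ν.toFun (z.1 - z.2) : ℝ≥0∞)) volume := by
  have h1 : AEMeasurable (fun z : Rn d × Rn d => w z.1) volume :=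
    (hw.aemeasurable).comp_quasiMeasurePreserving Measure.quasiMeasurePreserving_fst
  have h2 : AEMeasurable (fun z : Rn d × Rn d => w z.2) volume :=
    (hw.aemeasurable).comp_quasiMeasurePreserving Measure.quasiMeasurePreserving_snd
  have h3 : AEMeasurable (fun z : Rn d × Rn d => ν.toFun (z.1 - z.2)) volume :=
    ν.aemeasurable.comp_quasiMeasurePreserving
      (quasiMeasurePreserving_sub volume volume)
  simp_rw [ofReal_abs_rpow hp]
  exact ((h1.sub h2).enorm.pow_const p).mul h3.coe_nnreal_ennreal

/-- The energy over the whole space is the integral of the norms of the finite differences against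
the kernel. -/
theorem pairEnergy_univ_eq (hp : 1 < p) (ν : RadialLevyKernel d p) {w : Rn d → ℝ}
    (hw : AEStronglyMeasurable w volume) :
    pairEnergy ν univ w = ∫⁻ h, shiftNorm p w h ^ p * (ν.toFun h : ℝ≥0∞) := by
  have hm := aemeasurable_energy_integrand hp ν hw
  have hmp : MeasurePreserving (fun z : Rn d × Rn d => (z.2 + z.1, z.2))
      (volume.prod volume) (volume.prod volume) := by
    simpa only [add_comm] using measurePreserving_add_prod (volume : Measure (Rn d)) volume
  set f : Rn d × Rn d → ℝ≥0∞ := fun z =>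
    ENNReal.ofReal (|w z.1 - w z.2| ^ p) * (ν.toFun (z.1 - z.2) : ℝ≥0∞) with hf
  have hme : AEMeasurable (fun z : Rn d × Rn d => f (z.2 + z.1, z.2))
      (volume.prod volume) := hm.comp_quasiMeasurePreserving hmp.quasiMeasurePreserving
  have h1 : ∫⁻ z, f z ∂(volume.prod volume) =
      ∫⁻ z : Rn d × Rn d, f (z.2 + z.1, z.2) ∂(volume.prod volume) := by
    have h2 := lintegral_map' (μ := volume.prod volume) (f := f)
      (g := fun z : Rn d × Rn d => (z.2 + z.1, z.2)) (by rw [hmp.map_eq]; exact hm)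
      hmp.measurable.aemeasurable
    rwa [hmp.map_eq] at h2
  have h3 : pairEnergy ν univ w = ∫⁻ z, f z ∂(volume.prod volume) := by
    unfold pairEnergy
    rw [setLIntegral_univ, Measure.volume_eq_prod]
  rw [h3, h1, lintegral_prod _ hme]
  refine lintegral_congr fun h => ?_
  rw [shiftNorm_rpow hp, ← lintegral_mul_const' _ _ ENNReal.coe_ne_top]
  refine lintegral_congr fun x => ?_
  simp only [hf]
  rw [ofReal_abs_rpow hp, add_sub_cancel_left]

theorem pairEnergy_mono (ν : RadialLevyKernel d p) {S T : Set (Rn d × Rn d)} (h : S ⊆ T)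
    (w : Rn d → ℝ) : pairEnergy ν S w ≤ pairEnergy ν T w := lintegral_mono_set h

theorem pairEnergy_add_le (hp : 1 < p) (ν : RadialLevyKernel d p) (S : Set (Rn d × Rn d))
    {u v : Rn d → ℝ} (hu : AEStronglyMeasurable u volume) :
    pairEnergy ν S (u + v) ≤ 2 ^ p * (pairEnergy ν S u + pairEnergy ν S v) := by
  unfold pairEnergy
  rw [← lintegral_add_left' (aemeasurable_energy_integrand hp ν hu).restrict,
    ← lintegral_const_mul' _ _ (by finiteness)]
  refine lintegral_mono fun z => ?_
  simp_rw [ofReal_abs_rpow hp]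
  rw [← add_mul, ← mul_assoc]
  gcongr
  refine le_trans ?_ (add_rpow_le_two hp _ _)
  refine ENNReal.rpow_le_rpow ?_ (by linarith)
  refine le_trans (le_of_eq ?_) (enorm_add_le _ _)
  congr 1
  simp only [Pi.add_apply]
  ring

theorem pairEnergy_congr (ν : RadialLevyKernel d p) (S : Set (Rn d × Rn d)) {u v : Rn d → ℝ}
    (h : u =ᵐ[volume] v) : pairEnergy ν S u = pairEnergy ν S v := by
  refine lintegral_congr_ae (ae_restrict_of_ae ?_)
  have h1 : ∀ᵐ z : Rn d × Rn d, u z.1 = v z.1 := Measure.quasiMeasurePreserving_fst.ae h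
  have h2 : ∀ᵐ z : Rn d × Rn d, u z.2 = v z.2 := Measure.quasiMeasurePreserving_snd.ae h
  filter_upwards [h1, h2] with z h1 h2
  rw [h1, h2]

theorem energy_eq_univ (hp : 1 < p) (ν : RadialLevyKernel d p) {Ω : Set (Rn d)}
    (hΩ : MeasurableSet Ω) {w : Rn d → ℝ} (h0 : ∀ᵐ x, x ∉ Ω → w x = 0) :
    energy ν Ω w = pairEnergy ν univ w := by
  unfold energy pairEnergy
  rw [setLIntegral_univ, ← lintegral_indicator (hΩ.compl.prod hΩ.compl).compl]
  refine lintegral_congr_ae ?_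
  have h1 : ∀ᵐ z : Rn d × Rn d, z.1 ∉ Ω → w z.1 = 0 := Measure.quasiMeasurePreserving_fst.ae h0
  have h2 : ∀ᵐ z : Rn d × Rn d, z.2 ∉ Ω → w z.2 = 0 := Measure.quasiMeasurePreserving_snd.ae h0
  filter_upwards [h1, h2] with z h1 h2
  by_cases hz : z ∈ (Ωᶜ ×ˢ Ωᶜ)ᶜ
  · rw [indicator_of_mem hz]
  · rw [indicator_of_notMem hz]
    rw [mem_compl_iff, not_not] at hz
    rw [h1 hz.1, h2 hz.2, sub_zero, abs_zero, Real.zero_rpow (by linarith)]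
    simp

end Energy

/-! ### Concentration of the kernels and the Poincaré inequality -/

section Poincare

variable {d : ℕ} {p : ℝ}

/-- The measures `|h|^p ν_ε(h) dh` on a ball around the origin have total mass close to `1`. -/
theorem tendsto_mass_near_zero (hp : 1 < p) {ν : ℝ → RadialLevyKernel d p}
    (hν : IsLevyApproxUnity ν) {δ : ℝ} (hδ : 0 < δ) (hδ1 : δ ≤ 1) :
    Tendsto (fun ε => ∫⁻ h in {h : Rn d | ‖h‖ ≤ δ}, ENNReal.ofReal (‖h‖ ^ p) *
      ((ν ε).toFun h : ℝ≥0∞)) (𝓝[>] 0) (𝓝 1) := by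
  have hms : MeasurableSet {h : Rn d | ‖h‖ ≤ δ} := measurableSet_le measurable_norm measurable_const
  have hcompl : {h : Rn d | ‖h‖ ≤ δ}ᶜ = {h : Rn d | δ < ‖h‖} := by ext; simp
  have hlow : Tendsto (fun ε => 1 - ∫⁻ h in {h : Rn d | δ < ‖h‖}, ((ν ε).toFun h : ℝ≥0∞))
      (𝓝[>] 0) (𝓝 1) := by
    have := ENNReal.Tendsto.sub (tendsto_const_nhds (x := (1 : ℝ≥0∞)) (f := 𝓝[>] (0 : ℝ)))
      (hν.concentrates δ hδ) (Or.inl ENNReal.one_ne_top)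
    simpa using this
  refine tendsto_of_tendsto_of_tendsto_of_le_of_le' hlow tendsto_const_nhds ?_ ?_
  · filter_upwards [self_mem_nhdsWithin] with ε hε
    rw [tsub_le_iff_right, ← hν.normalized ε hε,
      ← lintegral_add_compl _ hms, hcompl]
    refine add_le_add ?_ ?_
    · refine setLIntegral_mono_ae' hms (Eventually.of_forall fun h _ => ?_)
      gcongr
      exact min_le_right _ _
    · refine lintegral_mono fun h => ?_
      calc _ ≤ ENNReal.ofReal 1 * ((ν ε).toFun h : ℝ≥0∞) := by gcongr; exact min_le_left _ _
        _ = _ := by simp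
  · filter_upwards [self_mem_nhdsWithin] with ε hε
    rw [← hν.normalized ε hε]
    refine le_trans ?_ (setLIntegral_le_lintegral {h : Rn d | ‖h‖ ≤ δ} _)
    refine setLIntegral_mono_ae' hms (Eventually.of_forall fun h hh => ?_)
    gcongr
    refine le_min ?_ le_rfl
    exact Real.rpow_le_one (norm_nonneg h) (le_trans hh hδ1) (by linarith)

theorem eventually_half_le_mass (hp : 1 < p) {ν : ℝ → RadialLevyKernel d p}
    (hν : IsLevyApproxUnity ν) {δ : ℝ} (hδ : 0 < δ) :
    ∀ᶠ ε in 𝓝[>] (0 : ℝ), 2⁻¹ ≤ ∫⁻ h in {h : Rn d | ‖h‖ ≤ δ}, ENNReal.ofReal (‖h‖ ^ p) *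
      ((ν ε).toFun h : ℝ≥0∞) := by
  have h1 := tendsto_mass_near_zero hp hν (lt_min hδ one_pos) (min_le_right δ 1)
  have h2 : (2⁻¹ : ℝ≥0∞) < 1 := by norm_num
  filter_upwards [h1.eventually_const_le h2] with ε hε
  refine hε.trans (lintegral_mono_set fun h hh => ?_)
  exact le_trans (show ‖h‖ ≤ min δ 1 from hh) (min_le_left _ _)

/-- The `L^p` norm of a function with bounded support is controlled by a single finite difference:
after finitely many steps of size `h` the support has left itself. -/
theorem norm_rpow_mul_eLpNorm_le (hp : 1 < p) {Ω : Set (Rn d)} {R : ℝ} (hR : 0 < R)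
    (hΩR : Ω ⊆ ball 0 R) {w : Rn d → ℝ} (hw : AEStronglyMeasurable w volume)
    (h0 : ∀ᵐ x, x ∉ Ω → w x = 0) {h : Rn d} (hh : ‖h‖ ≤ 1) :
    ENNReal.ofReal (‖h‖ ^ p) * eLpNorm w (ENNReal.ofReal p) volume ^ p ≤
      ENNReal.ofReal ((2 * R + 1) ^ p) * shiftNorm p w h ^ p := by
  rcases eq_or_ne h 0 with rfl | hne
  · simp [Real.zero_rpow (show p ≠ 0 by linarith)]
  have hpos : 0 < ‖h‖ := norm_pos_iff.2 hne
  set N : ℕ := ⌈2 * R / ‖h‖⌉₊ with hN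
  have hN1 : 2 * R ≤ N * ‖h‖ := by
    have := Nat.le_ceil (2 * R / ‖h‖)
    rwa [div_le_iff₀ hpos] at this
  have hN2 : (N : ℝ) * ‖h‖ ≤ 2 * R + 1 := by
    have h2 : (N : ℝ) < 2 * R / ‖h‖ + 1 := Nat.ceil_lt_add_one (by positivity)
    have h3 := mul_le_mul_of_nonneg_right h2.le hpos.le
    rw [add_mul, div_mul_cancel₀ _ hpos.ne'] at h3
    linarith
  -- after a translation by `N h` the support of `w` is disjoint from the original one
  have h1 : eLpNorm w (ENNReal.ofReal p) volume ≤ shiftNorm p w ((N : ℝ) • h) := by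
    rw [← ennreal_rpow_le_rpow_iff hp, eLpNorm_rpow_eq hp, shiftNorm_rpow hp]
    refine lintegral_mono_ae ?_
    filter_upwards [h0, ae_shift h0 ((N : ℝ) • h)] with x hx1 hx2
    by_cases hx : x ∈ Ω
    · rw [hx2, zero_sub, enorm_neg]
      intro hx3
      have h4 := hΩR hx
      have h5 := hΩR hx3
      rw [mem_ball_zero_iff] at h4 h5
      have h6 : ‖(N : ℝ) • h‖ ≤ ‖x + (N : ℝ) • h‖ + ‖x‖ := by
        have := norm_sub_le (x + (N : ℝ) • h) x
        rwa [add_sub_cancel_left] at this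
      rw [norm_smul, Real.norm_natCast] at h6
      linarith
    · rw [hx1 hx]
      simp [show (0 : ℝ) < p by linarith]
  have h2 := h1.trans (shiftNorm_nsmul_le hp hw N h)
  rw [← ENNReal.ofReal_rpow_of_nonneg hpos.le (by linarith),
    ← ENNReal.ofReal_rpow_of_nonneg (by linarith) (by linarith),
    ← ENNReal.mul_rpow_of_nonneg _ _ (by linarith), ← ENNReal.mul_rpow_of_nonneg _ _ (by linarith),
    ennreal_rpow_le_rpow_iff hp]
  calc ENNReal.ofReal ‖h‖ * eLpNorm w (ENNReal.ofReal p) volume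
      ≤ ENNReal.ofReal ‖h‖ * (N * shiftNorm p w h) := by gcongr
    _ = ENNReal.ofReal (N * ‖h‖) * shiftNorm p w h := by
        rw [ENNReal.ofReal_mul (by positivity), ENNReal.ofReal_natCast]; ring
    _ ≤ _ := by gcongr

/-- The Poincaré inequality for functions that vanish outside of a bounded set, uniformly in the
kernels that carry half of their mass in the unit ball. -/
theorem exists_poincare (hp : 1 < p) {Ω : Set (Rn d)} (hΩ : Bornology.IsBounded Ω)
    {ν : ℝ → RadialLevyKernel d p} (hν : IsLevyApproxUnity ν) :
    ∃ C : ℝ≥0, ∀ᶠ ε in 𝓝[>] (0 : ℝ), ∀ w : Rn d → ℝ, AEStronglyMeasurable w volume →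
      (∀ᵐ x, x ∉ Ω → w x = 0) →
      eLpNorm w (ENNReal.ofReal p) volume ^ p ≤ C * pairEnergy (ν ε) univ w := by
  obtain ⟨R, hR, hΩR⟩ := hΩ.subset_ball_lt 0 0
  refine ⟨2 * Real.toNNReal ((2 * R + 1) ^ p), ?_⟩
  filter_upwards [eventually_half_le_mass hp hν one_pos] with ε hε w hw h0
  have h1 : (∫⁻ h in {h : Rn d | ‖h‖ ≤ 1}, ENNReal.ofReal (‖h‖ ^ p) *
      ((ν ε).toFun h : ℝ≥0∞)) * eLpNorm w (ENNReal.ofReal p) volume ^ p ≤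
      ENNReal.ofReal ((2 * R + 1) ^ p) * pairEnergy (ν ε) univ w := by
    have hms : MeasurableSet {h : Rn d | ‖h‖ ≤ 1} :=
      measurableSet_le measurable_norm measurable_const
    rw [← lintegral_mul_const'' _ (by
      have := (ν ε).aemeasurable.restrict (s := {h : Rn d | ‖h‖ ≤ 1})
      fun_prop), pairEnergy_univ_eq hp _ hw,
      ← lintegral_const_mul' _ _ ENNReal.ofReal_ne_top]
    refine le_trans ?_ (setLIntegral_le_lintegral {h : Rn d | ‖h‖ ≤ 1} _)
    refine setLIntegral_mono_ae' hms (Eventually.of_forall fun h hh => ?_)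
    rw [← mul_assoc, mul_right_comm]
    exact mul_le_mul_left (norm_rpow_mul_eLpNorm_le hp hR hΩR hw h0 hh) _
  have h2 : 2⁻¹ * eLpNorm w (ENNReal.ofReal p) volume ^ p ≤
      ENNReal.ofReal ((2 * R + 1) ^ p) * pairEnergy (ν ε) univ w := by
    refine le_trans ?_ h1
    gcongr
  calc eLpNorm w (ENNReal.ofReal p) volume ^ p
      = 2 * (2⁻¹ * eLpNorm w (ENNReal.ofReal p) volume ^ p) := by
        rw [← mul_assoc, ENNReal.mul_inv_cancel (by norm_num) (by norm_num), one_mul]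
    _ ≤ 2 * (ENNReal.ofReal ((2 * R + 1) ^ p) * pairEnergy (ν ε) univ w) := by gcongr
    _ = _ := by
        rw [ENNReal.coe_mul, ← mul_assoc]
        rfl

end Poincare

/-! ### Spherical averages of finite differences -/

section SphereAverage

variable {d : ℕ} {p : ℝ}

theorem lintegral_comp_const_smul {c : ℝ} (hc : 0 < c) (f : Rn d → ℝ≥0∞) :
    ∫⁻ x, f (c • x) = ENNReal.ofReal ((c ^ d)⁻¹) * ∫⁻ x, f x := by
  have h := (Homeomorph.smulOfNeZero c hc.ne' (α := Rn d)).measurableEmbedding.lintegral_map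
    (μ := volume) f
  have h2 : Measure.map (fun x : Rn d => c • x) volume = ENNReal.ofReal ((c ^ d)⁻¹) • volume := by
    rw [Measure.map_addHaar_smul _ hc.ne', finrank_euclideanSpace_fin, abs_of_pos (by positivity)]
  calc ∫⁻ x, f (c • x) = ∫⁻ x, f x ∂(Measure.map (fun x : Rn d => c • x) volume) := h.symm
    _ = _ := by rw [h2, lintegral_smul_measure, smul_eq_mul]

theorem reflection_orthogonal_unit {u : Rn d} (hu : ‖u‖ = 1) (x : Rn d) :
    (ℝ ∙ u)ᗮ.reflection x = x - (2 * inner ℝ u x) • u := by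
  rw [Submodule.reflection_orthogonal_apply, Submodule.reflection_singleton_apply, hu]
  simp only [RCLike.ofReal_one, one_pow, div_one, two_nsmul]
  rw [mul_smul, two_smul]
  abel

/-- The two products of the reflections in the directions `u` and `α u + β v`, for orthonormal
`u, v` and `α ^ 2 + β ^ 2 = 1`, are inverse rotations of the plane spanned by `u` and `v`. -/
theorem reflection_add_reflection {u v : Rn d} (hu : ‖u‖ = 1) (hv : ‖v‖ = 1)
    (huv : inner ℝ u v = 0) {α β : ℝ} (hαβ : α ^ 2 + β ^ 2 = 1) (x : Rn d) :
    (ℝ ∙ u)ᗮ.reflection ((ℝ ∙ (α • u + β • v))ᗮ.reflection x) +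
      (ℝ ∙ (α • u + β • v))ᗮ.reflection ((ℝ ∙ u)ᗮ.reflection x) =
      (2 : ℝ) • x - (4 * β ^ 2) • (inner ℝ u x • u + inner ℝ v x • v) := by
  have huu : inner ℝ u u = 1 := by rw [real_inner_self_eq_norm_sq, hu, one_pow]
  have hvv : inner ℝ v v = 1 := by rw [real_inner_self_eq_norm_sq, hv, one_pow]
  have hvu : inner ℝ v u = 0 := by rw [real_inner_comm, huv]
  have hn : ‖α • u + β • v‖ = 1 := by
    have h : ‖α • u + β • v‖ ^ 2 = 1 := by
      rw [← real_inner_self_eq_norm_sq]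
      simp only [inner_add_left, inner_add_right, real_inner_smul_left, real_inner_smul_right,
        huu, hvv, huv, hvu]
      linarith
    exact (sq_eq_sq₀ (norm_nonneg _) zero_le_one).1 (by rw [h, one_pow])
  rw [reflection_orthogonal_unit hu, reflection_orthogonal_unit hn, reflection_orthogonal_unit hu,
    reflection_orthogonal_unit hn]
  simp only [inner_sub_right, inner_add_left, inner_add_right, real_inner_smul_left,
    real_inner_smul_right, huu, huv, hvu]
  set a : ℝ := inner ℝ u x
  set b : ℝ := inner ℝ v x
  have hα : α ^ 2 = 1 - β ^ 2 := by linarith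
  match_scalars
  · ring
  · ring_nf
    linear_combination (norm := ring_nf) (4 * a) * hα
  · ring

/-- In dimension at least two, all multiples `c x` of a vector with `2 d - 2 ≤ c ≤ 2 d` are sums
of `2 d` fixed isometric images of `x`. -/
theorem exists_isometries_sum (hd : 2 ≤ d) {c : ℝ} (hc1 : 2 * d - 2 ≤ c) (hc2 : c ≤ 2 * d) :
    ∃ A : Fin d × Fin 2 → Rn d ≃ₗᵢ[ℝ] Rn d, ∀ x, ∑ i, A i x = c • x := by
  have : NeZero d := ⟨by omega⟩
  set β : ℝ := √((2 * d - c) / 8) with hβ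
  have hβ2 : β ^ 2 = (2 * d - c) / 8 := Real.sq_sqrt (by linarith)
  set α : ℝ := √(1 - β ^ 2) with hα
  have hα2 : α ^ 2 = 1 - β ^ 2 := Real.sq_sqrt (by rw [hβ2]; linarith)
  set e : Fin d → Rn d := fun i => EuclideanSpace.single i 1 with he
  have hen : ∀ i, ‖e i‖ = 1 := fun i => by simp [he]
  have hei : ∀ i x, inner ℝ (e i) x = x i := fun i x => by
    simp [he, EuclideanSpace.inner_single_left]
  have hsum : ∀ x : Rn d, ∑ i, x i • e i = x := fun x => by
    ext j
    simp [he, Pi.single_apply]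
  have hne : ∀ i : Fin d, i ≠ i + 1 := fun i h => by
    have h1 : (1 : Fin d) = 0 := by simpa using h.symm
    have h2 := congrArg Fin.val h1
    rw [Fin.val_zero, Fin.val_one', Nat.mod_eq_of_lt (by omega)] at h2
    omega
  have horth : ∀ i, inner ℝ (e i) (e (i + 1)) = 0 := fun i => by
    rw [hei]
    simp [he, hne i]
  refine ⟨fun i => if i.2 = 0
    then ((ℝ ∙ (α • e i.1 + β • e (i.1 + 1)))ᗮ.reflection).trans ((ℝ ∙ e i.1)ᗮ.reflection)
    else ((ℝ ∙ e i.1)ᗮ.reflection).trans ((ℝ ∙ (α • e i.1 + β • e (i.1 + 1)))ᗮ.reflection),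
    fun x => ?_⟩
  rw [Fintype.sum_prod_type]
  simp only [Fin.sum_univ_two, if_true, Fin.isValue, one_ne_zero, if_false,
    LinearIsometryEquiv.trans_apply]
  have h1 : ∀ i, _ := fun i => reflection_add_reflection (hen i) (hen (i + 1)) (horth i)
    (α := α) (β := β) (by linarith) x
  rw [Finset.sum_congr rfl fun i _ => h1 i]
  simp only [hei]
  have hsum' : ∑ i, x (i + 1) • e (i + 1) = x :=
    (Equiv.sum_comp (Equiv.addRight (1 : Fin d)) (fun i => x i • e i)).trans (hsum x)
  rw [Finset.sum_sub_distrib, ← Finset.smul_sum, ← Finset.smul_sum, Finset.sum_add_distrib, hsum,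
    hsum', Finset.sum_const,
    Finset.card_univ, Fintype.card_fin, ← Nat.cast_smul_eq_nsmul ℝ]
  match_scalars
  rw [hβ2]
  ring

/-- The integral of `‖w(· + t ξ) - w‖_p^p` over the unit directions `ξ`. -/
noncomputable def sphereEnergy (p : ℝ) (w : Rn d → ℝ) (t : ℝ) : ℝ≥0∞ :=
  ∫⁻ ξ : sphere (0 : Rn d) 1, shiftNorm p w (t • (ξ : Rn d)) ^ p ∂(sphereMeasure d)

theorem lintegral_sphereEnergy [NeZero d] (hp : 1 < p) {ν : Rn d → ℝ≥0} (hν : AEMeasurable ν)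
    (hr : ∀ h k : Rn d, ‖h‖ = ‖k‖ → ν h = ν k) {w : Rn d → ℝ}
    (hw : AEStronglyMeasurable w volume) :
    ∫⁻ h : Rn d, sphereEnergy p w ‖h‖ * (ν h : ℝ≥0∞) =
      sphereMeasure d univ * ∫⁻ h : Rn d, shiftNorm p w h ^ p * (ν h : ℝ≥0∞) :=
  (lintegral_mul_radial hν hr (measurable_shiftNorm_rpow hp hw)).symm

/-- In dimension `d ≥ 2`, averaged finite differences at a large scale `t` are controlled by those
at a small scale `r`. The vector `t ξ` is an integer multiple of a sum of vectors `r A ξ` with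
finitely many fixed isometries `A`, and averages over the sphere do not see the isometries; so no
relation between `ν(h)` and `ν(θ h)` is needed. -/
theorem sphereEnergy_le_of_two_le (hp : 1 < p) (hd : 2 ≤ d) {w : Rn d → ℝ}
    (hw : AEStronglyMeasurable w volume) {r t : ℝ} (hr : 0 < r) (hrt : 2 * d ^ 2 * r ≤ t) :
    ENNReal.ofReal (r ^ p) * sphereEnergy p w t ≤
      ENNReal.ofReal ((2 * t) ^ p) * sphereEnergy p w r := by
  have hp0 : 0 ≤ p := by linarith
  have hd' : (2 : ℝ) ≤ d := by exact_mod_cast hd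
  have ht : 0 < t := lt_of_lt_of_le (by positivity) hrt
  -- this choice of `m` gives `2 d - 2 ≤ t / (m r) ≤ 2 d`, as `exists_isometries_sum` requires
  set m : ℕ := ⌈t / (2 * d * r)⌉₊ with hm
  have hx : (d : ℝ) ≤ t / (2 * d * r) := by
    rw [le_div_iff₀ (by positivity)]
    nlinarith
  have hm1 : t / (2 * d * r) ≤ m := Nat.le_ceil _
  have hm2 : (m : ℝ) < t / (2 * d * r) + 1 := Nat.ceil_lt_add_one (by positivity)
  have hm0 : (0 : ℝ) < m := by linarith
  have hm3 : t ≤ m * (2 * d * r) := (div_le_iff₀ (by positivity)).1 hm1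
  have hm4 : m * (2 * d * r) ≤ t + 2 * d * r := by
    have := mul_le_mul_of_nonneg_right hm2.le (show 0 ≤ 2 * d * r by positivity)
    rwa [add_mul, div_mul_cancel₀ _ (by positivity), one_mul] at this
  have hc2 : t / (m * r) ≤ 2 * d := by
    rw [div_le_iff₀ (by positivity)]; linarith
  have hc1 : 2 * d - 2 ≤ t / (m * r) := by
    rw [le_div_iff₀ (by positivity)]
    have : d * r ≤ m * r := by
      refine mul_le_mul_of_nonneg_right (hx.trans hm1) hr.le
    nlinarith
  obtain ⟨A, hA⟩ := exists_isometries_sum hd hc1 hc2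
  have hpt : ∀ ξ : Rn d, shiftNorm p w (t • ξ) ^ p ≤
      (m : ℝ≥0∞) ^ p * (((2 * d : ℕ) : ℝ≥0∞) ^ (p - 1) *
        ∑ i, shiftNorm p w (r • A i ξ) ^ p) := fun ξ => by
    have h1 : t • ξ = (m : ℝ) • ∑ i, r • A i ξ := by
      rw [← Finset.smul_sum, hA, smul_smul, smul_smul]
      congr 1
      field_simp
    rw [h1]
    refine (ENNReal.rpow_le_rpow (shiftNorm_nsmul_le hp hw m _) hp0).trans ?_
    rw [ENNReal.mul_rpow_of_nonneg _ _ hp0]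
    gcongr
    refine (ENNReal.rpow_le_rpow (shiftNorm_sum_le hp hw _ _) hp0).trans ?_
    have := ENNReal.rpow_sum_le_const_mul_sum_rpow Finset.univ
      (fun i => shiftNorm p w (r • A i ξ)) hp.le
    simpa [mul_comm] using this
  have hint : sphereEnergy p w t ≤ ((m * (2 * d : ℕ) : ℝ≥0∞)) ^ p * sphereEnergy p w r := by
    calc sphereEnergy p w t ≤ ∫⁻ ξ : sphere (0 : Rn d) 1, (m : ℝ≥0∞) ^ p *
          (((2 * d : ℕ) : ℝ≥0∞) ^ (p - 1) *
            ∑ i, shiftNorm p w (r • A i (ξ : Rn d)) ^ p) ∂(sphereMeasure d) :=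
          lintegral_mono fun ξ => hpt ξ
      _ = (m : ℝ≥0∞) ^ p * (((2 * d : ℕ) : ℝ≥0∞) ^ (p - 1) *
            ∑ i : Fin d × Fin 2, sphereEnergy p w r) := by
          rw [lintegral_const_mul' _ _ (by finiteness), lintegral_const_mul' _ _
            (ENNReal.rpow_ne_top_of_nonneg (by linarith) (by finiteness)), lintegral_finsetSum]
          · congr 2
            refine Finset.sum_congr rfl fun i _ => ?_
            exact lintegral_sphere_comp (A i) (f := fun y => shiftNorm p w (r • y) ^ p)
              ((measurable_shiftNorm_rpow hp hw).comp (by fun_prop))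
          · intro i _
            exact (measurable_shiftNorm_rpow hp hw).comp
              (((A i).continuous.comp continuous_subtype_val).const_smul r).measurable
      _ = _ := by
          have hdne : ((2 * d : ℕ) : ℝ≥0∞) ≠ 0 := by
            exact_mod_cast (by omega : 2 * d ≠ 0)
          have hq : ((2 * d : ℕ) : ℝ≥0∞) ^ p =
              ((2 * d : ℕ) : ℝ≥0∞) ^ (p - 1) * ((2 * d : ℕ) : ℝ≥0∞) := by
            nth_rewrite 3 [← ENNReal.rpow_one ((2 * d : ℕ) : ℝ≥0∞)]
            rw [← ENNReal.rpow_add _ _ hdne (by finiteness), sub_add_cancel]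
          rw [ENNReal.mul_rpow_of_nonneg _ _ hp0, hq]
          simp only [Finset.sum_const, Finset.card_univ, Fintype.card_prod, Fintype.card_fin,
            nsmul_eq_mul]
          push_cast
          ring
  calc ENNReal.ofReal (r ^ p) * sphereEnergy p w t
      ≤ ENNReal.ofReal (r ^ p) * (((m * (2 * d : ℕ) : ℝ≥0∞)) ^ p * sphereEnergy p w r) := by
        gcongr
    _ = ENNReal.ofReal ((r * (m * (2 * d))) ^ p) * sphereEnergy p w r := by
        rw [← mul_assoc, ← ENNReal.ofReal_rpow_of_nonneg hr.le hp0,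
          ← ENNReal.ofReal_rpow_of_nonneg (by positivity) hp0,
          ← ENNReal.mul_rpow_of_nonneg _ _ hp0, ENNReal.ofReal_mul hr.le,
          ENNReal.ofReal_mul hm0.le, ENNReal.ofReal_natCast]
        congr 4
        rw [ENNReal.ofReal_mul (by norm_num), ENNReal.ofReal_natCast]
        push_cast
        norm_num
    _ ≤ _ := by
        have h1 : 2 * d * r ≤ t := by nlinarith
        exact mul_le_mul_left (ENNReal.ofReal_le_ofReal
          (Real.rpow_le_rpow (by positivity) (by linarith) hp0)) _

/-- Scaling of a finite difference by a factor that ranges over an interval: small multiples of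
`h` are differences of multiples `θ h` with `θ₀ ≤ θ ≤ 1`. -/
theorem shiftNorm_smul_le_setLIntegral (hp : 1 < p) {w : Rn d → ℝ}
    (hw : AEStronglyMeasurable w volume) {θ₀ s : ℝ} (hθ1 : θ₀ < 1) (hs0 : 0 ≤ s)
    (hs : s ≤ (1 - θ₀) / 2) (h : Rn d) :
    ENNReal.ofReal ((1 - θ₀) / 2) * shiftNorm p w (s • h) ^ p ≤
      2 ^ p * (2 * ∫⁻ θ in Icc θ₀ 1, shiftNorm p w (θ • h) ^ p) := by
  have hp0 : 0 ≤ p := by linarith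
  set J : Set ℝ := Icc θ₀ ((1 + θ₀) / 2) with hJ
  have hvol : volume J = ENNReal.ofReal ((1 - θ₀) / 2) := by
    rw [hJ, Real.volume_Icc]; ring_nf
  have hmeas : Measurable fun θ : ℝ => shiftNorm p w (θ • h) ^ p :=
    (measurable_shiftNorm_rpow hp hw).comp (by fun_prop)
  have hpt : ∀ θ : ℝ, shiftNorm p w (s • h) ^ p ≤
      2 ^ p * (shiftNorm p w ((θ + s) • h) ^ p + shiftNorm p w (θ • h) ^ p) := fun θ => by
    have h1 : s • h = (θ + s) • h + -(θ • h) := by rw [add_smul]; abel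
    rw [h1]
    refine (ENNReal.rpow_le_rpow (shiftNorm_add_right hp hw _ _) hp0).trans ?_
    rw [shiftNorm_neg hw]
    exact add_rpow_le_two hp _ _
  have hshift : ∫⁻ θ in J, shiftNorm p w ((θ + s) • h) ^ p ≤
      ∫⁻ θ in Icc θ₀ 1, shiftNorm p w (θ • h) ^ p := by
    rw [← lintegral_indicator measurableSet_Icc, ← lintegral_indicator measurableSet_Icc,
      ← lintegral_add_right_eq_self (fun θ => (Icc θ₀ 1).indicator
        (fun θ => shiftNorm p w (θ • h) ^ p) θ) s]
    refine lintegral_mono fun θ => ?_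
    by_cases hθ : θ ∈ J
    · rw [indicator_of_mem hθ, indicator_of_mem]
      exact ⟨by linarith [hθ.1], by linarith [hθ.2]⟩
    · rw [indicator_of_notMem hθ]; exact zero_le
  calc ENNReal.ofReal ((1 - θ₀) / 2) * shiftNorm p w (s • h) ^ p
      = ∫⁻ _ in J, shiftNorm p w (s • h) ^ p := by rw [setLIntegral_const, hvol, mul_comm]
    _ ≤ ∫⁻ θ in J, 2 ^ p * (shiftNorm p w ((θ + s) • h) ^ p + shiftNorm p w (θ • h) ^ p) :=
        lintegral_mono fun θ => hpt θ
    _ = 2 ^ p * ((∫⁻ θ in J, shiftNorm p w ((θ + s) • h) ^ p) +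
          ∫⁻ θ in J, shiftNorm p w (θ • h) ^ p) := by
        rw [lintegral_const_mul' _ _ (by finiteness), lintegral_add_right _ hmeas]
    _ ≤ _ := by
        gcongr
        rw [two_mul]
        refine add_le_add hshift (lintegral_mono_set fun θ hθ => ⟨hθ.1, ?_⟩)
        linarith [hθ.2]

/-- The substitute for `sphereEnergy_le_of_two_le` that needs no isometries: averaged finite
differences at the scale `t` are controlled by those at all the scales `θ r` with `θ₀ ≤ θ ≤ 1`. -/
theorem sphereEnergy_le_setLIntegral (hp : 1 < p) {w : Rn d → ℝ}
    (hw : AEStronglyMeasurable w volume) {θ₀ r t : ℝ} (hθ0 : 0 < θ₀) (hθ1 : θ₀ < 1) (hr : 0 < r)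
    (hrt : r ≤ t) :
    ENNReal.ofReal (r ^ p) * sphereEnergy p w t ≤
      ENNReal.ofReal ((2 * t / ((1 - θ₀) / 2)) ^ p) * (ENNReal.ofReal ((1 - θ₀) / 2))⁻¹ * 2 ^ p * 2
        * ∫⁻ θ in Icc θ₀ 1, sphereEnergy p w (θ * r) := by
  have hp0 : 0 ≤ p := by linarith
  set κ : ℝ := (1 - θ₀) / 2 with hκ
  have hκ0 : 0 < κ := by rw [hκ]; linarith
  have hκ1 : κ ≤ 1 := by rw [hκ]; linarith
  have ht : 0 < t := hr.trans_le hrt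
  -- `t = N s r` with `s` so small that `shiftNorm_smul_le_setLIntegral` applies
  set N : ℕ := ⌈t / (κ * r)⌉₊ with hN
  have hN1 : t / (κ * r) ≤ N := Nat.le_ceil _
  have hN2 : (N : ℝ) < t / (κ * r) + 1 := Nat.ceil_lt_add_one (by positivity)
  have hN0 : (0 : ℝ) < N := lt_of_lt_of_le (by positivity) hN1
  have hN3 : t ≤ N * (κ * r) := (div_le_iff₀ (by positivity)).1 hN1
  have hN4 : N * (κ * r) ≤ t + κ * r := by
    have := mul_le_mul_of_nonneg_right hN2.le (show 0 ≤ κ * r by positivity)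
    rwa [add_mul, div_mul_cancel₀ _ (by positivity), one_mul] at this
  have hκr : κ * r ≤ t := by nlinarith
  set s : ℝ := t / (N * r) with hs
  have hsκ : s ≤ κ := by
    rw [hs, div_le_iff₀ (by positivity)]; linarith
  have hpt : ∀ ξ : Rn d, ENNReal.ofReal (r ^ p) * shiftNorm p w (t • ξ) ^ p ≤
      ENNReal.ofReal ((2 * t / κ) ^ p) * (ENNReal.ofReal κ)⁻¹ * 2 ^ p * 2 *
        ∫⁻ θ in Icc θ₀ 1, shiftNorm p w ((θ * r) • ξ) ^ p := fun ξ => by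
    have h1 : t • ξ = (N : ℝ) • s • r • ξ := by
      rw [smul_smul, smul_smul]
      congr 1
      rw [hs]
      field_simp
    have h2 := shiftNorm_smul_le_setLIntegral hp hw hθ1 (show 0 ≤ s by positivity) hsκ (r • ξ)
    rw [← hκ] at h2
    have h3 : shiftNorm p w (s • r • ξ) ^ p ≤ (ENNReal.ofReal κ)⁻¹ *
        (2 ^ p * (2 * ∫⁻ θ in Icc θ₀ 1, shiftNorm p w ((θ * r) • ξ) ^ p)) := by
      rw [mul_comm, ← div_eq_mul_inv, ENNReal.le_div_iff_mul_le
        (Or.inl (by simpa using hκ0)) (Or.inl ENNReal.ofReal_ne_top), mul_comm]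
      simpa only [smul_smul] using h2
    rw [h1]
    calc ENNReal.ofReal (r ^ p) * shiftNorm p w ((N : ℝ) • s • r • ξ) ^ p
        ≤ ENNReal.ofReal (r ^ p) * (N * shiftNorm p w (s • r • ξ)) ^ p := by
          gcongr
          exact shiftNorm_nsmul_le hp hw N _
      _ = ENNReal.ofReal ((N * r) ^ p) * shiftNorm p w (s • r • ξ) ^ p := by
          rw [ENNReal.mul_rpow_of_nonneg _ _ hp0, ← mul_assoc,
            Real.mul_rpow hN0.le hr.le, ENNReal.ofReal_mul (by positivity),
            ← ENNReal.ofReal_rpow_of_nonneg hN0.le hp0, ENNReal.ofReal_natCast]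
          ring
      _ ≤ ENNReal.ofReal ((2 * t / κ) ^ p) * ((ENNReal.ofReal κ)⁻¹ *
        (2 ^ p * (2 * ∫⁻ θ in Icc θ₀ 1, shiftNorm p w ((θ * r) • ξ) ^ p))) := by
          gcongr
          rw [le_div_iff₀ hκ0]
          linarith
      _ = _ := by ring
  calc ENNReal.ofReal (r ^ p) * sphereEnergy p w t
      = ∫⁻ ξ : sphere (0 : Rn d) 1, ENNReal.ofReal (r ^ p) * shiftNorm p w (t • (ξ : Rn d)) ^ p
          ∂(sphereMeasure d) := by
        rw [lintegral_const_mul' _ _ ENNReal.ofReal_ne_top]; rfl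
    _ ≤ ∫⁻ ξ : sphere (0 : Rn d) 1, ENNReal.ofReal ((2 * t / κ) ^ p) * (ENNReal.ofReal κ)⁻¹ *
          2 ^ p * 2 * (∫⁻ θ in Icc θ₀ 1, shiftNorm p w ((θ * r) • (ξ : Rn d)) ^ p)
          ∂(sphereMeasure d) := lintegral_mono fun ξ => hpt ξ
    _ = _ := by
        have hfin : (ENNReal.ofReal κ)⁻¹ ≠ ⊤ := by simpa using hκ0
        rw [lintegral_const_mul' _ _ (by finiteness)]
        congr 1
        refine lintegral_lintegral_swap ?_
        refine Measurable.aemeasurable ?_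
        exact (measurable_shiftNorm_rpow hp hw).comp
          (f := fun z : sphere (0 : Rn d) 1 × ℝ => (z.2 * r) • (z.1 : Rn d)) (by fun_prop)

/-- The dilation by `θ` is moved from the finite differences to the kernel, where the lower bound on
`ν(θ x)` undoes it. -/
theorem lintegral_sphereEnergy_smul_le [NeZero d] (hp : 1 < p) (ν : RadialLevyKernel d p) {c₀ θ : ℝ}
    (hc : 0 < c₀) (hθ : 0 < θ) (hν : ∀ x, c₀ * (ν.toFun x : ℝ) ≤ ν.toFun (θ • x)) {w : Rn d → ℝ}
    (hw : AEStronglyMeasurable w volume) :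
    ∫⁻ h : Rn d, sphereEnergy p w (θ * ‖h‖) * (ν.toFun h : ℝ≥0∞) ≤
      sphereMeasure d univ * (ENNReal.ofReal c₀⁻¹ * (ENNReal.ofReal ((θ ^ d)⁻¹) *
        pairEnergy ν univ w)) := by
  have h1 := lintegral_mul_radial ν.aemeasurable ν.radial
    (Ψ := fun h => shiftNorm p w (θ • h) ^ p) ((measurable_shiftNorm_rpow hp hw).comp (by fun_prop))
  have h2 : ∀ h : Rn d, sphereEnergy p w (θ * ‖h‖) = ∫⁻ ξ : sphere (0 : Rn d) 1,
      shiftNorm p w (θ • ‖h‖ • (ξ : Rn d)) ^ p ∂(sphereMeasure d) := fun h => by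
    simp only [sphereEnergy, smul_smul]
  simp_rw [h2]
  rw [← h1]
  gcongr
  rw [pairEnergy_univ_eq hp ν hw,
    ← lintegral_comp_const_smul hθ (fun h => shiftNorm p w h ^ p * (ν.toFun h : ℝ≥0∞)),
    ← lintegral_const_mul' _ _ ENNReal.ofReal_ne_top]
  refine lintegral_mono fun h => ?_
  rw [mul_left_comm]
  gcongr
  rw [← ENNReal.ofReal_coe_nnreal, ← ENNReal.ofReal_coe_nnreal,
    ← ENNReal.ofReal_mul (by positivity)]
  refine ENNReal.ofReal_le_ofReal ?_
  rw [inv_mul_eq_div, le_div_iff₀ hc, mul_comm]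
  exact hν h

/-- The spherical averages of the finite differences of size `t` are controlled by the nonlocal
energy, once the kernel is concentrated at scales that are small compared to `t`. -/
theorem exists_sphereEnergy_mul_mass_le [NeZero d] (hp : 1 < p) {ν : ℝ → RadialLevyKernel d p}
    (hν1 : d = 1 → OneDimLowerBound ν) :
    ∃ C : ℝ≥0, ∃ κ : ℝ, 0 < κ ∧ ∀ ε ∈ Ioo (0 : ℝ) 1, ∀ w : Rn d → ℝ,
      AEStronglyMeasurable w volume → ∀ t : ℝ, 0 < t →
      (∫⁻ h in {h : Rn d | ‖h‖ ≤ κ * t}, ENNReal.ofReal (‖h‖ ^ p) * ((ν ε).toFun h : ℝ≥0∞)) *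
        sphereEnergy p w t ≤ C * ENNReal.ofReal (t ^ p) * pairEnergy (ν ε) univ w := by
  have hp0 : 0 ≤ p := by linarith
  have hσ : sphereMeasure d univ ≠ ⊤ := measure_ne_top _ _
  have hms : ∀ r : ℝ, MeasurableSet {h : Rn d | ‖h‖ ≤ r} :=
    fun r => measurableSet_le measurable_norm measurable_const
  have hae : ∀ (ε r : ℝ), AEMeasurable (fun h : Rn d => ENNReal.ofReal (‖h‖ ^ p) *
      ((ν ε).toFun h : ℝ≥0∞)) (volume.restrict {h : Rn d | ‖h‖ ≤ r}) := fun ε r => by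
    have := (ν ε).aemeasurable.restrict (s := {h : Rn d | ‖h‖ ≤ r})
    fun_prop
  -- for `d ≥ 2` the isometries of the sphere are used, for `d = 1` the lower bound on `ν(θ x)`
  rcases lt_or_ge 1 d with hd | hd
  · have hd' : (0 : ℝ) < d := by exact_mod_cast (by omega : 0 < d)
    refine ⟨((2 : ℝ≥0) ^ p) * (sphereMeasure d univ).toNNReal, (2 * (d : ℝ) ^ 2)⁻¹,
      by positivity, fun ε _ w hw t ht => ?_⟩
    rw [← lintegral_mul_const'' _ (hae _ _)]
    calc ∫⁻ h in {h : Rn d | ‖h‖ ≤ (2 * (d : ℝ) ^ 2)⁻¹ * t}, ENNReal.ofReal (‖h‖ ^ p) *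
          ((ν ε).toFun h : ℝ≥0∞) * sphereEnergy p w t
        ≤ ∫⁻ h in {h : Rn d | ‖h‖ ≤ (2 * (d : ℝ) ^ 2)⁻¹ * t}, ENNReal.ofReal ((2 * t) ^ p) *
          (sphereEnergy p w ‖h‖ * ((ν ε).toFun h : ℝ≥0∞)) := by
          refine setLIntegral_mono_ae' (hms _) (Eventually.of_forall fun h hh => ?_)
          rw [mul_right_comm, ← mul_assoc]
          refine mul_le_mul_left ?_ _
          rcases (norm_nonneg h).eq_or_lt with h0 | h0
          · simp [← h0, Real.zero_rpow (show p ≠ 0 by linarith)]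
          · refine sphereEnergy_le_of_two_le hp hd hw h0 ?_
            have hh' : ‖h‖ ≤ (2 * (d : ℝ) ^ 2)⁻¹ * t := hh
            rwa [inv_mul_eq_div, le_div_iff₀ (by positivity), mul_comm] at hh'
      _ ≤ ∫⁻ h : Rn d, ENNReal.ofReal ((2 * t) ^ p) *
          (sphereEnergy p w ‖h‖ * ((ν ε).toFun h : ℝ≥0∞)) := setLIntegral_le_lintegral _ _
      _ = ENNReal.ofReal ((2 * t) ^ p) * (sphereMeasure d univ * pairEnergy (ν ε) univ w) := by
          rw [lintegral_const_mul' _ _ ENNReal.ofReal_ne_top,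
            lintegral_sphereEnergy hp (ν ε).aemeasurable (ν ε).radial hw,
            pairEnergy_univ_eq hp _ hw]
      _ = _ := by
          rw [ENNReal.coe_mul, ENNReal.coe_toNNReal hσ, Real.mul_rpow (by norm_num) ht.le,
            ENNReal.ofReal_mul (by positivity), ← ENNReal.ofReal_rpow_of_nonneg (by norm_num) hp0,
            ENNReal.coe_rpow_of_nonneg _ hp0]
          norm_num
          ring
  · have hd1 : d = 1 := le_antisymm hd (NeZero.one_le)
    obtain ⟨c₀, θ₀, hc₀, hθ₀, hlow⟩ := hν1 hd1
    set κ : ℝ := (1 - θ₀) / 2 with hκ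
    have hκ0 : 0 < κ := by rw [hκ]; linarith [hθ₀.2]
    have hκtop : (ENNReal.ofReal κ)⁻¹ ≠ ⊤ := by simpa using hκ0
    set C1 : ℝ≥0∞ := ENNReal.ofReal ((2 / κ) ^ p) * (ENNReal.ofReal κ)⁻¹ * 2 ^ p * 2 with hC1
    have hC1t : C1 ≠ ⊤ := by rw [hC1]; finiteness
    set C2 : ℝ≥0∞ := sphereMeasure d univ * (ENNReal.ofReal c₀⁻¹ * ENNReal.ofReal ((θ₀ ^ d)⁻¹))
      with hC2
    have hC2t : C2 ≠ ⊤ := by rw [hC2]; finiteness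
    refine ⟨(C1 * C2).toNNReal, 1, one_pos, fun ε hε w hw t ht => ?_⟩
    rw [ENNReal.coe_toNNReal (by finiteness), one_mul, ← lintegral_mul_const'' _ (hae _ _)]
    have hjm : AEMeasurable (Function.uncurry fun (h : Rn d) (θ : ℝ) =>
        sphereEnergy p w (θ * ‖h‖) * ((ν ε).toFun h : ℝ≥0∞))
        (volume.prod (volume.restrict (Icc θ₀ 1))) := by
      have h1 : Measurable fun z : Rn d × ℝ => sphereEnergy p w (z.2 * ‖z.1‖) := by
        refine Measurable.lintegral_prod_right (f := fun (z : Rn d × ℝ)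
          (ξ : sphere (0 : Rn d) 1) => shiftNorm p w ((z.2 * ‖z.1‖) • (ξ : Rn d)) ^ p) ?_
        exact (measurable_shiftNorm_rpow hp hw).comp (by fun_prop)
      have h2 : AEMeasurable (fun z : Rn d × ℝ => (ν ε).toFun z.1)
          (volume.prod (volume.restrict (Icc θ₀ 1))) :=
        (ν ε).aemeasurable.comp_quasiMeasurePreserving Measure.quasiMeasurePreserving_fst
      exact h1.aemeasurable.mul h2.coe_nnreal_ennreal
    calc ∫⁻ h in {h : Rn d | ‖h‖ ≤ t}, ENNReal.ofReal (‖h‖ ^ p) *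
          ((ν ε).toFun h : ℝ≥0∞) * sphereEnergy p w t
        ≤ ∫⁻ h in {h : Rn d | ‖h‖ ≤ t}, C1 * ENNReal.ofReal (t ^ p) *
          ((∫⁻ θ in Icc θ₀ 1, sphereEnergy p w (θ * ‖h‖)) * ((ν ε).toFun h : ℝ≥0∞)) := by
          refine setLIntegral_mono_ae' (hms _) (Eventually.of_forall fun h hh => ?_)
          rw [mul_right_comm, ← mul_assoc]
          refine mul_le_mul_left ?_ _
          rcases (norm_nonneg h).eq_or_lt with h0 | h0
          · simp [← h0, Real.zero_rpow (show p ≠ 0 by linarith)]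
          · refine (sphereEnergy_le_setLIntegral hp hw hθ₀.1 hθ₀.2 h0 hh).trans (le_of_eq ?_)
            rw [hC1, ← hκ, show 2 * t / κ = 2 / κ * t by ring,
              Real.mul_rpow (by positivity) ht.le, ENNReal.ofReal_mul (by positivity)]
            ring
      _ ≤ ∫⁻ h : Rn d, C1 * ENNReal.ofReal (t ^ p) *
          ((∫⁻ θ in Icc θ₀ 1, sphereEnergy p w (θ * ‖h‖)) * ((ν ε).toFun h : ℝ≥0∞)) :=
          setLIntegral_le_lintegral _ _
      _ = C1 * ENNReal.ofReal (t ^ p) * ∫⁻ θ in Icc θ₀ 1,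
            (∫⁻ h : Rn d, sphereEnergy p w (θ * ‖h‖) * ((ν ε).toFun h : ℝ≥0∞)) := by
          rw [lintegral_const_mul' _ _ (by finiteness), ← lintegral_lintegral_swap hjm]
          congr 1
          refine lintegral_congr fun h => ?_
          rw [lintegral_mul_const' _ _ ENNReal.coe_ne_top]
      _ ≤ C1 * ENNReal.ofReal (t ^ p) * ∫⁻ _ in Icc θ₀ 1, C2 * pairEnergy (ν ε) univ w := by
          refine mul_le_mul_right ?_ _
          refine setLIntegral_mono_ae' measurableSet_Icc (Eventually.of_forall fun θ hθ => ?_)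
          have hθ0 : 0 < θ := hθ₀.1.trans_le hθ.1
          refine (lintegral_sphereEnergy_smul_le hp (ν ε) hc₀.1 hθ0
            (fun x => hlow ε hε θ hθ x) hw).trans ?_
          rw [hC2]
          simp only [mul_assoc]
          gcongr
          · exact pow_pos hθ₀.1 d
          · exact hθ₀.1.le
          · exact hθ.1
      _ ≤ C1 * ENNReal.ofReal (t ^ p) * (C2 * pairEnergy (ν ε) univ w) := by
          gcongr
          rw [setLIntegral_const, Real.volume_Icc]
          refine mul_le_of_le_one_right zero_le ?_
          rw [← ENNReal.ofReal_one]
          exact ENNReal.ofReal_le_ofReal (by linarith [hθ₀.1])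
      _ = _ := by ring

/-- The annulus `{δ < |h| < 2δ}`. -/
def annulus (d : ℕ) (δ : ℝ) : Set (Rn d) := {h | δ < ‖h‖ ∧ ‖h‖ < 2 * δ}

theorem measurableSet_annulus (δ : ℝ) : MeasurableSet (annulus d δ) :=
  (measurableSet_lt measurable_const measurable_norm).inter
    (measurableSet_lt measurable_norm measurable_const)

/-- At every fixed scale `δ`, the nonlocal energies eventually control the finite differences in
the way in which the `L^p` norm of a gradient does. -/
theorem exists_annulus_bound [NeZero d] (hp : 1 < p) {ν : ℝ → RadialLevyKernel d p}
    (hν : IsLevyApproxUnity ν) (hν1 : d = 1 → OneDimLowerBound ν) :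
    ∃ C : ℝ≥0, ∀ δ : ℝ, 0 < δ → ∀ᶠ ε in 𝓝[>] (0 : ℝ), ∀ w : Rn d → ℝ,
      AEStronglyMeasurable w volume →
      ∫⁻ h in annulus d δ, shiftNorm p w h ^ p ≤
        C * ENNReal.ofReal (δ ^ p) * ENNReal.ofReal (δ ^ d) * pairEnergy (ν ε) univ w := by
  have hp0 : 0 ≤ p := by linarith
  obtain ⟨C, κ, hκ, hC⟩ := exists_sphereEnergy_mul_mass_le hp hν1
  have hσ0 := sphereMeasure_univ_ne_zero (d := d)
  have hσt : sphereMeasure d univ ≠ ⊤ := measure_ne_top _ _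
  set V : ℝ≥0∞ := volume (ball (0 : Rn d) 1) with hV
  have hVt : V ≠ ⊤ := measure_ball_lt_top.ne
  set C' : ℝ≥0∞ := (sphereMeasure d univ)⁻¹ * (2 * C * 2 ^ p * (2 ^ d * V)) with hC'
  have hC't : C' ≠ ⊤ := by
    have : (sphereMeasure d univ)⁻¹ ≠ ⊤ := by simpa using hσ0
    rw [hC']; finiteness
  refine ⟨C'.toNNReal, fun δ hδ => ?_⟩
  rw [ENNReal.coe_toNNReal hC't]
  filter_upwards [eventually_half_le_mass hp hν (mul_pos hκ hδ),
    Ioo_mem_nhdsGT (zero_lt_one (α := ℝ))] with ε hmass hε w hw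
  -- a bound for the spherical averages, uniformly on the annulus
  have hsph : ∀ t, δ < t → t < 2 * δ → sphereEnergy p w t ≤
      2 * C * 2 ^ p * ENNReal.ofReal (δ ^ p) * pairEnergy (ν ε) univ w := fun t h1 h2 => by
    have ht : 0 < t := hδ.trans h1
    have h3 := hC ε hε w hw t ht
    have h4 : 2⁻¹ ≤ ∫⁻ h in {h : Rn d | ‖h‖ ≤ κ * t}, ENNReal.ofReal (‖h‖ ^ p) *
        ((ν ε).toFun h : ℝ≥0∞) := by
      refine hmass.trans (lintegral_mono_set fun h hh => ?_)
      exact le_trans (show ‖h‖ ≤ κ * δ from hh) (by gcongr)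
    have h5 : ENNReal.ofReal (t ^ p) ≤ 2 ^ p * ENNReal.ofReal (δ ^ p) := by
      rw [show (2 : ℝ≥0∞) = ENNReal.ofReal 2 by simp,
        ENNReal.ofReal_rpow_of_nonneg (by norm_num) hp0,
        ← ENNReal.ofReal_mul (by positivity), ← Real.mul_rpow (by norm_num) hδ.le]
      exact ENNReal.ofReal_le_ofReal (Real.rpow_le_rpow ht.le h2.le hp0)
    calc sphereEnergy p w t = 2 * (2⁻¹ * sphereEnergy p w t) := by
          rw [← mul_assoc, ENNReal.mul_inv_cancel (by norm_num) (by norm_num), one_mul]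
      _ ≤ 2 * (C * (2 ^ p * ENNReal.ofReal (δ ^ p)) * pairEnergy (ν ε) univ w) := by
          refine mul_le_mul_right ((mul_le_mul_left h4 _).trans (h3.trans ?_)) 2
          gcongr
      _ = _ := by ring
  have hvol : volume (annulus d δ) ≤ 2 ^ d * ENNReal.ofReal (δ ^ d) * V := by
    refine (measure_mono (show annulus d δ ⊆ ball 0 (2 * δ) from fun h hh => by
      rw [mem_ball_zero_iff]; exact hh.2)).trans (le_of_eq ?_)
    rw [Measure.addHaar_ball _ _ (by positivity), finrank_euclideanSpace_fin, mul_pow,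
      ENNReal.ofReal_mul (by positivity), ENNReal.ofReal_pow (by norm_num)]
    simp [hV]
  -- the polar coordinate formula is applied to the indicator of the annulus, a radial density
  have hind : ∀ Ψ : Rn d → ℝ≥0∞, ∫⁻ h in annulus d δ, Ψ h =
      ∫⁻ h, Ψ h * (((annulus d δ).indicator (1 : Rn d → ℝ≥0) h : ℝ≥0) : ℝ≥0∞) := fun Ψ => by
    rw [← lintegral_indicator (measurableSet_annulus δ)]
    refine lintegral_congr fun h => ?_
    by_cases hh : h ∈ annulus d δ
    · simp [hh]
    · simp [hh]
  have hpolar := lintegral_sphereEnergy hp (ν := (annulus d δ).indicator (1 : Rn d → ℝ≥0))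
    ((measurable_const.indicator (measurableSet_annulus δ)).aemeasurable)
    (fun h k hk => by
      by_cases hh : h ∈ annulus d δ
      · have hk' : k ∈ annulus d δ := by simpa only [annulus, mem_ofPred_eq, hk] using hh
        rw [indicator_of_mem hh, indicator_of_mem hk']; rfl
      · have hk' : k ∉ annulus d δ := by simpa only [annulus, mem_ofPred_eq, hk] using hh
        rw [indicator_of_notMem hh, indicator_of_notMem hk']) hw
  rw [← hind, ← hind] at hpolar
  have h6 : ∫⁻ h in annulus d δ, shiftNorm p w h ^ p =
      (sphereMeasure d univ)⁻¹ * ∫⁻ h in annulus d δ, sphereEnergy p w ‖h‖ := by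
    rw [hpolar, ← mul_assoc, ENNReal.inv_mul_cancel hσ0 hσt, one_mul]
  rw [h6]
  calc (sphereMeasure d univ)⁻¹ * ∫⁻ h in annulus d δ, sphereEnergy p w ‖h‖
      ≤ (sphereMeasure d univ)⁻¹ * ∫⁻ _ in annulus d δ,
        2 * C * 2 ^ p * ENNReal.ofReal (δ ^ p) * pairEnergy (ν ε) univ w := by
        refine mul_le_mul_right ?_ _
        exact setLIntegral_mono_ae' (measurableSet_annulus δ)
          (Eventually.of_forall fun h hh => hsph _ hh.1 hh.2)
    _ = (sphereMeasure d univ)⁻¹ * (2 * C * 2 ^ p * ENNReal.ofReal (δ ^ p) *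
          pairEnergy (ν ε) univ w * volume (annulus d δ)) := by rw [setLIntegral_const]
    _ ≤ (sphereMeasure d univ)⁻¹ * (2 * C * 2 ^ p * ENNReal.ofReal (δ ^ p) *
          pairEnergy (ν ε) univ w * (2 ^ d * ENNReal.ofReal (δ ^ d) * V)) := by gcongr
    _ = _ := by rw [hC']; ring

end SphereAverage

/-! ### Finite differences of Sobolev functions -/

theorem lintegral_rpow_le {S : Type*} [MeasurableSpace S] {μ : Measure S} {p : ℝ} (hp : 1 < p)
    {f : S → ℝ≥0∞} (hf : AEMeasurable f μ) :
    (∫⁻ s, f s ∂μ) ^ p ≤ μ univ ^ (p - 1) * ∫⁻ s, f s ^ p ∂μ := by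
  have hp0 : 0 < p := by linarith
  have hpq : p.HolderConjugate (p / (p - 1)) := Real.HolderConjugate.conjExponent hp
  have h := ENNReal.lintegral_mul_le_Lp_mul_Lq μ hpq hf (aemeasurable_const (b := (1 : ℝ≥0∞)))
  simp only [Pi.mul_apply, mul_one, ENNReal.one_rpow, lintegral_const, one_mul] at h
  have h2 := ENNReal.rpow_le_rpow h hp0.le
  rw [ENNReal.mul_rpow_of_nonneg _ _ hp0.le, ← ENNReal.rpow_mul, ← ENNReal.rpow_mul,
    one_div_mul_cancel hp0.ne', ENNReal.rpow_one] at h2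
  rw [mul_comm]
  convert h2 using 3
  field_simp

/-- Jensen's inequality for the integral of a family of functions, in `L^p`. -/
theorem lintegral_enorm_integral_rpow_le {S X : Type*} [MeasurableSpace S] [MeasurableSpace X]
    {μ : Measure S} {m : Measure X} [IsFiniteMeasure μ] [SFinite m] {p : ℝ} (hp : 1 < p)
    {F : Type*} [NormedAddCommGroup F] [NormedSpace ℝ F]
    {k : S × X → F} (hk : AEStronglyMeasurable k (μ.prod m)) :
    ∫⁻ x, ‖∫ s, k (s, x) ∂μ‖ₑ ^ p ∂m ≤
      μ univ ^ (p - 1) * ∫⁻ s, ∫⁻ x, ‖k (s, x)‖ₑ ^ p ∂m ∂μ := by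
  have hp0 : 0 ≤ p := by linarith
  have hke : AEMeasurable (fun z : S × X => ‖k z‖ₑ ^ p) (μ.prod m) := hk.enorm.pow_const p
  have hμ : μ univ ^ (p - 1) ≠ ⊤ :=
    ENNReal.rpow_ne_top_of_nonneg (by linarith) (measure_ne_top _ _)
  rw [lintegral_lintegral_swap hke, ← lintegral_const_mul' _ _ hμ]
  refine lintegral_mono_ae ?_
  have h2 : ∀ᵐ x ∂m, AEStronglyMeasurable (fun s => k (s, x)) μ := hk.prod_swap.prodMk_left
  filter_upwards [h2] with x hx
  refine (ENNReal.rpow_le_rpow (enorm_integral_le_lintegral_enorm _) hp0).trans ?_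
  exact lintegral_rpow_le hp hx.enorm

theorem enorm_real_inner_le {d : ℕ} (a b : Rn d) : ‖inner ℝ a b‖ₑ ≤ ‖a‖ₑ * ‖b‖ₑ := by
  rw [← ofReal_norm, ← ofReal_norm, ← ofReal_norm, ← ENNReal.ofReal_mul (norm_nonneg a)]
  exact ENNReal.ofReal_le_ofReal (norm_inner_le_norm a b)

section Translation

variable {d : ℕ} {p : ℝ}

/-- Translations are continuous in `L^p`. -/
theorem tendsto_shiftNorm {F : Type*} [NormedAddCommGroup F] (hp : 1 < p) {G : Rn d → F}
    (hG : MemLp G (ENNReal.ofReal p) volume) :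
    Tendsto (shiftNorm p G) (𝓝 0) (𝓝 0) := by
  have : Fact ((1 : ℝ≥0∞) ≤ ENNReal.ofReal p) := ⟨one_le_ofReal hp⟩
  let g : C(Rn d, C(Rn d, Rn d)) := (ContinuousMap.mk (fun a : Rn d × Rn d => a.2 + a.1)
    (by fun_prop)).curry
  have hmp : ∀ z, MeasurePreserving (g z) (volume : Measure (Rn d)) volume :=
    fun z => measurePreserving_add_right volume z
  have h1 := Filter.Tendsto.compMeasurePreservingLp (l := 𝓝 (0 : Rn d)) (p := ENNReal.ofReal p)
    (f := fun _ : Rn d => hG.toLp G) tendsto_const_nhds (g.continuous.tendsto 0) hmp (hmp 0)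
    ENNReal.ofReal_ne_top
  rw [tendsto_iff_edist_tendsto_0] at h1
  refine h1.congr fun z => ?_
  rw [Lp.toLp_compMeasurePreserving, Lp.toLp_compMeasurePreserving, Lp.edist_toLp_toLp]
  unfold shiftNorm
  congr 1
  funext x
  change G (x + z) - G (x + 0) = _
  rw [add_zero]

variable {U : Rn d → ℝ} {G : Rn d → Rn d}

theorem measurePreserving_shear (h : Rn d) :
    MeasurePreserving (fun z : ℝ × Rn d => (z.1, z.2 + z.1 • h))
      ((volume.restrict (Ioc (0 : ℝ) 1)).prod volume)
      ((volume.restrict (Ioc (0 : ℝ) 1)).prod volume) := by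
  refine (MeasurePreserving.id _).skew_product (g := fun s x => x + s • h) (by fun_prop) ?_
  exact Eventually.of_forall fun s => (measurePreserving_add_right volume (s • h)).map_eq

theorem memLp_segment {F : Type*} [NormedAddCommGroup F] {G : Rn d → F}
    (hG : MemLp G (ENNReal.ofReal p) volume) (h : Rn d) :
    MemLp (fun z : ℝ × Rn d => G (z.2 + z.1 • h)) (ENNReal.ofReal p)
      ((volume.restrict (Ioc (0 : ℝ) 1)).prod volume) :=
  (hG.comp_snd (volume.restrict (Ioc (0 : ℝ) 1))).comp_measurePreserving (measurePreserving_shear h)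

theorem HasSobolevGrad.memLp_univ (hU : HasSobolevGrad p univ U G) :
    MemLp U (ENNReal.ofReal p) volume := by simpa using hU.memLp

theorem HasSobolevGrad.memLp_grad_univ (hU : HasSobolevGrad p univ U G) :
    MemLp G (ENNReal.ofReal p) volume := by simpa using hU.memLp_grad

theorem HasSobolevGrad.integral_mul_inner (hp : 1 < p) (hU : HasSobolevGrad p univ U G)
    {φ : Rn d → ℝ} (hφ : IsTestFun univ φ) (h : Rn d) :
    ∫ x, U x * inner ℝ (gradient φ x) h = - ∫ x, φ x * inner ℝ (G x) h := by
  have h1 := hU.integral_eq φ hφ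
  have i1 := hU.integrable_left hp hφ
  have i2 := hU.integrable_right hp hφ
  rw [Measure.restrict_univ] at h1 i1 i2
  have h2 := congrArg (fun y => inner ℝ y h) h1
  simp only [inner_neg_left] at h2
  simp only [real_inner_comm h] at h2 ⊢
  rw [← integral_inner i1, ← integral_inner i2] at h2
  simpa only [real_inner_smul_right] using h2

theorem integral_fderiv_segment {φ : Rn d → ℝ} (hφ : ContDiff ℝ ∞ φ) (x h : Rn d) :
    ∫ s in Ioc (0 : ℝ) 1, inner ℝ (gradient φ (x - s • h)) h = φ x - φ (x - h) := by
  have hd : ∀ s : ℝ, HasDerivAt (fun s : ℝ => -φ (x - s • h))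
      (inner ℝ (gradient φ (x - s • h)) h) s := fun s => by
    have h1 : HasDerivAt (fun s : ℝ => x - s • h) (-h) s := by
      simpa using ((hasDerivAt_id s).smul_const h).const_sub x
    have h2 : DifferentiableAt ℝ φ (x - s • h) := hφ.differentiable (by simp) _
    have h3 := (h2.hasFDerivAt.comp_hasDerivAt s h1).neg
    have h4 : inner ℝ (gradient φ (x - s • h)) h = -(fderiv ℝ φ (x - s • h)) (-h) := by
      simp [gradient]
    rw [h4]
    exact h3
  have hc : Continuous fun s : ℝ => inner ℝ (gradient φ (x - s • h)) h := by
    have h4 : Continuous (gradient φ) := (InnerProductSpace.toDual ℝ (Rn d)).symm.continuous.comp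
      (hφ.continuous_fderiv (by simp))
    fun_prop
  rw [← intervalIntegral.integral_of_le zero_le_one,
    intervalIntegral.integral_eq_sub_of_hasDerivAt (fun s _ => hd s) (hc.intervalIntegrable _ _)]
  simp
  ring

theorem integrable_mul_test (hp : 1 < p) {S : Type*} [MeasurableSpace S] {μ : Measure S}
    [IsFiniteMeasure μ] {k : S × Rn d → ℝ} (hk : MemLp k (ENNReal.ofReal p) (μ.prod volume))
    {g : Rn d → ℝ} (hg : Continuous g) (hgs : HasCompactSupport g) :
    Integrable (fun z : S × Rn d => g z.2 * k z) (μ.prod volume) := by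
  have hpq : p.HolderConjugate (p / (p - 1)) := Real.HolderConjugate.conjExponent hp
  have : ENNReal.HolderConjugate (ENNReal.ofReal (p / (p - 1))) (ENNReal.ofReal p) :=
    hpq.symm.ennrealOfReal
  have h1 : MemLp g (ENNReal.ofReal (p / (p - 1))) volume := hg.memLp_of_hasCompactSupport hgs
  exact (h1.comp_snd μ).integrable_mul hk

/-- The fundamental theorem of calculus along the segments `[x, x + h]`, for almost every `x`. It
follows from Fubini's theorem and the classical statement for test functions. -/
theorem HasSobolevGrad.shift_sub_eq (hp : 1 < p) (hU : HasSobolevGrad p univ U G) (h : Rn d) :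
    ∀ᵐ x, U (x + h) - U x = ∫ s in Ioc (0 : ℝ) 1, inner ℝ (G (x + s • h)) h := by
  set μ : Measure ℝ := volume.restrict (Ioc (0 : ℝ) 1) with hμ
  have : IsFiniteMeasure μ := by rw [hμ]; infer_instance
  have hUm := hU.memLp_univ
  have hGm := hU.memLp_grad_univ
  set k : ℝ × Rn d → ℝ := fun z => inner ℝ (G (z.2 + z.1 • h)) h with hk
  have hkm : MemLp k (ENNReal.ofReal p) (μ.prod volume) :=
    (memLp_segment hGm h).inner_const h
  have hkloc : LocallyIntegrable (fun x => ∫ s, k (s, x) ∂μ) volume := by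
    rw [locallyIntegrable_iff]
    intro K hK
    have : IsFiniteMeasure (volume.restrict K) := ⟨by simpa using hK.measure_lt_top⟩
    have h1 : MemLp k (ENNReal.ofReal p) (μ.prod (volume.restrict K)) := by
      refine hkm.mono_measure ?_
      exact Measure.prod_mono le_rfl Measure.restrict_le_self
    exact (h1.integrable (one_le_ofReal hp)).integral_prod_right
  have hUh : MemLp (fun x => U (x + h)) (ENNReal.ofReal p) volume :=
    hUm.comp_measurePreserving (measurePreserving_add_right volume h)
  have hUloc : LocallyIntegrable (fun x => U (x + h) - U x) volume :=
    (hUh.sub hUm).locallyIntegrable (one_le_ofReal hp)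
  have key := ae_eq_zero_of_integral_contDiff_smul_eq_zero (μ := volume) (hUloc.sub hkloc) ?_
  · filter_upwards [key] with x hx
    exact sub_eq_zero.1 hx
  intro g hg hgs
  have hgt : ∀ y : Rn d, IsTestFun univ (fun x => g (x - y)) := fun y =>
    ⟨hg.comp (contDiff_id.sub contDiff_const),
      hgs.comp_homeomorph (Homeomorph.subRight y), subset_univ _⟩
  have hgrad : ∀ y x : Rn d, gradient (fun x => g (x - y)) x = gradient g (x - y) := fun y x => by
    simp only [gradient]
    simp only [sub_eq_add_neg, fderiv_comp_add_right]
  have hg0 : IsTestFun univ g := by simpa using hgt 0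
  have igU : Integrable (fun x => g x * U x) volume := by
    simpa [mul_comm] using (hUm.locallyIntegrable
      (one_le_ofReal hp)).integrable_smul_right_of_hasCompactSupport hg.continuous hgs
  have igUh : Integrable (fun x => g x * U (x + h)) volume := by
    simpa [mul_comm] using (hUh.locallyIntegrable
      (one_le_ofReal hp)).integrable_smul_right_of_hasCompactSupport hg.continuous hgs
  have igUh' : Integrable (fun x => g (x - h) * U x) volume := by
    simpa [mul_comm] using (hUm.locallyIntegrable
      (one_le_ofReal hp)).integrable_smul_right_of_hasCompactSupport
        (hgt h).1.continuous (hgt h).2.1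
  have igF : Integrable (fun x => g x * ∫ s, k (s, x) ∂μ) volume := by
    simpa [mul_comm] using hkloc.integrable_smul_right_of_hasCompactSupport hg.continuous hgs
  have e1 : ∫ x, g x * ∫ s, k (s, x) ∂μ = ∫ s, (∫ x, g x * k (s, x)) ∂μ := by
    have := integral_integral_swap (μ := μ) (ν := (volume : Measure (Rn d)))
      (f := fun s x => g x * k (s, x)) (integrable_mul_test hp hkm hg.continuous hgs)
    rw [this]
    refine integral_congr_ae (Eventually.of_forall fun x => ?_)
    exact (integral_const_mul _ _).symm
  have e2 : ∀ s : ℝ, ∫ x, g x * k (s, x) = - ∫ x, U x * inner ℝ (gradient g (x - s • h)) h :=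
    fun s => by
      have h1 := hU.integral_mul_inner hp (hgt (s • h)) h
      simp only [hgrad] at h1
      rw [h1, neg_neg, ← integral_add_right_eq_self (fun x => g (x - s • h) * inner ℝ (G x) h)
        (s • h)]
      simp only [add_sub_cancel_right, hk]
  have hUseg : MemLp (fun z : ℝ × Rn d => U (z.2 + z.1 • h)) (ENNReal.ofReal p) (μ.prod volume) :=
    memLp_segment hUm h
  have hgc : Continuous fun x => inner ℝ (gradient g x) h := by
    have := hg0.continuous_gradient
    fun_prop
  have hgcs : HasCompactSupport fun x => inner ℝ (gradient g x) h :=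
    hg0.hasCompactSupport_gradient.comp_left (g := fun y => inner ℝ y h) (by simp)
  have iUg : Integrable (fun z : ℝ × Rn d => U z.2 * inner ℝ (gradient g (z.2 - z.1 • h)) h)
      (μ.prod volume) := by
    have h1 := integrable_mul_test hp hUseg hgc hgcs
    have h2 := (measurePreserving_shear (-h)).integrable_comp_of_integrable h1
    refine h2.congr (Eventually.of_forall fun z => ?_)
    simp only [Function.comp, smul_neg, add_assoc, neg_add_cancel, add_zero, sub_eq_add_neg]
    ring
  have e3 : ∫ s, (∫ x, U x * inner ℝ (gradient g (x - s • h)) h) ∂μ =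
      ∫ x, U x * (g x - g (x - h)) := by
    rw [integral_integral_swap iUg]
    refine integral_congr_ae (Eventually.of_forall fun x => ?_)
    simp only
    rw [integral_const_mul, hμ, integral_fderiv_segment hg]
  have e4 : ∫ x, g x * U (x + h) = ∫ x, g (x - h) * U x := by
    rw [← integral_add_right_eq_self (fun x => g (x - h) * U x) h]
    simp only [add_sub_cancel_right]
  simp only [Pi.sub_apply, smul_eq_mul, mul_sub]
  rw [integral_sub (f := fun x => g x * U (x + h) - g x * U x) (igUh.sub igU) igF,
    integral_sub igUh igU, e1]
  simp_rw [e2]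
  rw [integral_neg, e3, e4]
  simp only [mul_sub]
  rw [integral_sub (by simpa [mul_comm] using igU) (by simpa [mul_comm] using igUh')]
  simp only [mul_comm (U _)]
  ring

theorem measure_Ioc_zero_one : (volume.restrict (Ioc (0 : ℝ) 1)) univ = 1 := by simp

/-- The difference quotients of a Sobolev function are bounded in `L^p` by its gradient. -/
theorem HasSobolevGrad.shiftNorm_le (hp : 1 < p) (hU : HasSobolevGrad p univ U G) (h : Rn d) :
    shiftNorm p U h ^ p ≤
      ENNReal.ofReal (‖h‖ ^ p) * eLpNorm G (ENNReal.ofReal p) volume ^ p := by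
  have hp0 : 0 ≤ p := by linarith
  have hGm := hU.memLp_grad_univ
  rw [shiftNorm_rpow hp]
  have h1 : ∫⁻ x, ‖U (x + h) - U x‖ₑ ^ p =
      ∫⁻ x, ‖∫ s in Ioc (0 : ℝ) 1, inner ℝ (G (x + s • h)) h‖ₑ ^ p := by
    refine lintegral_congr_ae ?_
    filter_upwards [hU.shift_sub_eq hp h] with x hx
    rw [hx]
  rw [h1]
  refine (lintegral_enorm_integral_rpow_le (μ := volume.restrict (Ioc (0 : ℝ) 1)) hp
    (k := fun z : ℝ × Rn d => inner ℝ (G (z.2 + z.1 • h)) h)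
    ((memLp_segment hGm h).inner_const h).1).trans ?_
  rw [measure_Ioc_zero_one, ENNReal.one_rpow, one_mul]
  calc ∫⁻ s in Ioc (0 : ℝ) 1, ∫⁻ x, ‖inner ℝ (G (x + s • h)) h‖ₑ ^ p
      ≤ ∫⁻ s in Ioc (0 : ℝ) 1, ENNReal.ofReal (‖h‖ ^ p) *
          eLpNorm G (ENNReal.ofReal p) volume ^ p := by
        refine lintegral_mono fun s => ?_
        rw [← eLpNorm_shift hGm.1 _ (s • h), eLpNorm_rpow_eq hp,
          ← lintegral_const_mul' _ _ ENNReal.ofReal_ne_top]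
        refine lintegral_mono fun x => ?_
        rw [ofReal_norm_rpow hp, ← ENNReal.mul_rpow_of_nonneg _ _ hp0, mul_comm]
        exact ENNReal.rpow_le_rpow (enorm_real_inner_le _ _) hp0
    _ = _ := by rw [lintegral_const, measure_Ioc_zero_one, mul_one]

/-- The first order Taylor expansion of a Sobolev function holds in `L^p`. -/
theorem HasSobolevGrad.lintegral_taylor_le (hp : 1 < p) (hU : HasSobolevGrad p univ U G)
    {h : Rn d} {M : ℝ≥0∞} (hM : ∀ z : Rn d, ‖z‖ ≤ ‖h‖ → shiftNorm p G z ^ p ≤ M) :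
    ∫⁻ x, ‖U (x + h) - U x - inner ℝ (G x) h‖ₑ ^ p ≤ ENNReal.ofReal (‖h‖ ^ p) * M := by
  have hp0 : 0 ≤ p := by linarith
  have hGm := hU.memLp_grad_univ
  have hkm : MemLp (fun z : ℝ × Rn d => inner ℝ (G (z.2 + z.1 • h)) h)
    (ENNReal.ofReal p) ((volume.restrict (Ioc (0 : ℝ) 1)).prod volume) :=
    (memLp_segment hGm h).inner_const h
  have hint : ∀ᵐ x, Integrable (fun s : ℝ => inner ℝ (G (x + s • h)) h)
      (volume.restrict (Ioc (0 : ℝ) 1)) := by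
    have h1 := hkm.1.prod_swap.prodMk_left
    have h2 : ∀ᵐ x, ∫⁻ s in Ioc (0 : ℝ) 1, ‖inner ℝ (G (x + s • h)) h‖ₑ ^ p < ⊤ := by
      have h3 : AEMeasurable (fun z : ℝ × Rn d => ‖inner ℝ (G (z.2 + z.1 • h)) h‖ₑ ^ p)
        ((volume.restrict (Ioc (0 : ℝ) 1)).prod volume) := hkm.1.enorm.pow_const p
      refine ae_lt_top' (h3.lintegral_prod_left') ?_
      rw [← lintegral_lintegral_swap h3, ← lintegral_prod _ h3,
        ← eLpNorm_rpow_eq hp (fun z : ℝ × Rn d => inner ℝ (G (z.2 + z.1 • h)) h)]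
      exact ENNReal.rpow_ne_top_of_nonneg hp0 hkm.2.ne
    filter_upwards [h1, h2] with x hx1 hx2
    have h4 : MemLp (fun s : ℝ => inner ℝ (G (x + s • h)) h) (ENNReal.ofReal p)
        (volume.restrict (Ioc (0 : ℝ) 1)) := by
      refine ⟨hx1, ?_⟩
      rw [← eLpNorm_rpow_eq hp (fun s : ℝ => inner ℝ (G (x + s • h)) h)] at hx2
      by_contra htop
      rw [not_lt, top_le_iff] at htop
      rw [htop, ENNReal.top_rpow_of_pos (by linarith)] at hx2
      exact lt_irrefl _ hx2
    exact h4.integrable (one_le_ofReal hp)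
  have h1 : ∫⁻ x, ‖U (x + h) - U x - inner ℝ (G x) h‖ₑ ^ p =
      ∫⁻ x, ‖∫ s in Ioc (0 : ℝ) 1, inner ℝ (G (x + s • h) - G x) h‖ₑ ^ p := by
    refine lintegral_congr_ae ?_
    filter_upwards [hU.shift_sub_eq hp h, hint] with x hx hxi
    rw [hx]
    simp only [inner_sub_left]
    rw [integral_sub hxi (integrable_const _)]
    simp
  have hcm : AEStronglyMeasurable (fun z : ℝ × Rn d => G z.2)
      ((volume.restrict (Ioc (0 : ℝ) 1)).prod volume) := hGm.1.comp_snd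
  rw [h1]
  refine (lintegral_enorm_integral_rpow_le (μ := volume.restrict (Ioc (0 : ℝ) 1)) hp
    (k := fun z : ℝ × Rn d => inner ℝ (G (z.2 + z.1 • h) - G z.2) h)
    (((memLp_segment hGm h).1.sub hcm).inner aestronglyMeasurable_const)).trans ?_
  rw [measure_Ioc_zero_one, ENNReal.one_rpow, one_mul]
  calc ∫⁻ s in Ioc (0 : ℝ) 1, ∫⁻ x, ‖inner ℝ (G (x + s • h) - G x) h‖ₑ ^ p
      ≤ ∫⁻ s in Ioc (0 : ℝ) 1, ENNReal.ofReal (‖h‖ ^ p) * M := by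
        refine setLIntegral_mono_ae' measurableSet_Ioc (Eventually.of_forall fun s hs => ?_)
        have hz : ‖s • h‖ ≤ ‖h‖ := by
          rw [norm_smul, Real.norm_of_nonneg hs.1.le]
          exact mul_le_of_le_one_left (norm_nonneg h) hs.2
        refine le_trans ?_ (mul_le_mul_right (hM _ hz) _)
        rw [shiftNorm_rpow hp, ← lintegral_const_mul' _ _ ENNReal.ofReal_ne_top]
        refine lintegral_mono fun x => ?_
        rw [ofReal_norm_rpow hp, ← ENNReal.mul_rpow_of_nonneg _ _ hp0, mul_comm]
        exact ENNReal.rpow_le_rpow (enorm_real_inner_le _ _) hp0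
    _ = _ := by rw [lintegral_const, measure_Ioc_zero_one, mul_one]

theorem HasSobolevGrad.comp_add_sub (hp : 1 < p) (hU : HasSobolevGrad p univ U G) (z : Rn d) :
    HasSobolevGrad p univ (fun x => U (x + z) - U x) (fun x => G (x + z) - G x) := by
  have hmp := measurePreserving_add_right (volume : Measure (Rn d)) z
  have hs : HasSobolevGrad p univ (fun x => U (x + z)) (fun x => G (x + z)) := by
    refine ⟨?_, ?_, fun φ hφ => ?_⟩
    · rw [Measure.restrict_univ]
      exact hU.memLp_univ.comp_measurePreserving hmp
    · rw [Measure.restrict_univ]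
      exact hU.memLp_grad_univ.comp_measurePreserving hmp
    · have ht : IsTestFun univ (fun x => φ (x - z)) :=
        ⟨hφ.1.comp (contDiff_id.sub contDiff_const),
          hφ.2.1.comp_homeomorph (Homeomorph.subRight z), subset_univ _⟩
      have h1 := hU.integral_eq _ ht
      have hgrad : ∀ x : Rn d, gradient (fun x => φ (x - z)) x = gradient φ (x - z) := fun x => by
        simp only [gradient]
        simp only [sub_eq_add_neg, fderiv_comp_add_right]
      simp only [hgrad, Measure.restrict_univ] at h1 ⊢
      rw [← integral_add_right_eq_self _ z,
        ← integral_add_right_eq_self (fun x => φ (x - z) • G x) z] at h1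
      simpa only [add_sub_cancel_right] using h1
  have := hs.add hp (hU.smul (-1))
  convert this using 1
  · funext x; simp [sub_eq_add_neg]
  · funext x; simp [sub_eq_add_neg]

end Translation

/-! ### Mollification -/

section Mollifier

variable {d : ℕ} {p : ℝ}

theorem volume_annulus_le [NeZero d] {δ : ℝ} (hδ : 0 < δ) :
    volume (annulus d δ) ≤ 2 ^ d * ENNReal.ofReal (δ ^ d) * volume (ball (0 : Rn d) 1) := by
  refine (measure_mono (show annulus d δ ⊆ ball 0 (2 * δ) from fun h hh => by
    rw [mem_ball_zero_iff]; exact hh.2)).trans (le_of_eq ?_)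
  rw [Measure.addHaar_ball _ _ (by positivity), finrank_euclideanSpace_fin, mul_pow,
    ENNReal.ofReal_mul (by positivity), ENNReal.ofReal_pow (by norm_num)]
  simp

/-- A smooth bump function that is supported in the annulus `{1 < |x| < 2}`. -/
noncomputable def annularBump (d : ℕ) [NeZero d] :
    ContDiffBump (EuclideanSpace.single 0 (3 / 2) : Rn d) where
  rIn := 1 / 8
  rOut := 1 / 4
  rIn_pos := by norm_num
  rIn_lt_rOut := by norm_num

/-- A mollifier at scale `δ`. Its support avoids a neighbourhood of the origin: the energies
control finite differences `w(· + h) - w` only for `|h|` comparable to a given scale. -/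
noncomputable def mollifier (d : ℕ) [NeZero d] (δ : ℝ) (x : Rn d) : ℝ :=
  (δ ^ d)⁻¹ * (annularBump d).normed volume (δ⁻¹ • x)

theorem smul_inv_mem_annulus {δ : ℝ} (hδ : 0 < δ) {x : Rn d} (hx : δ⁻¹ • x ∈ annulus d 1) :
    x ∈ annulus d δ := by
  have h1 := hx.1
  have h2 := hx.2
  rw [norm_smul, Real.norm_of_nonneg (by positivity), inv_mul_eq_div] at h1 h2
  rw [lt_div_iff₀ hδ] at h1
  rw [div_lt_iff₀ hδ] at h2
  exact ⟨by linarith, by linarith⟩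

/-- An averaged finite difference with a bounded kernel that is supported in an annulus. -/
theorem lintegral_kernel_rpow_le (hp : 1 < p) {δ : ℝ} {w : Rn d → ℝ}
    (hw : AEStronglyMeasurable w volume) {k : Rn d → ℝ≥0∞} {A : ℝ≥0∞} (hA : A ≠ ⊤)
    (hk : ∀ z, k z ≤ A) (hk0 : ∀ z, z ∉ annulus d δ → k z = 0) :
    ∫⁻ x, (∫⁻ z, k z * ‖w (x - z) - w x‖ₑ) ^ p ≤
      A ^ p * volume (annulus d δ) ^ (p - 1) * ∫⁻ z in annulus d δ, shiftNorm p w z ^ p := by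
  have hp0 : 0 ≤ p := by linarith
  have hsec : ∀ x, AEStronglyMeasurable (fun z => w (x - z) - w x) volume := fun x =>
    (hw.comp_quasiMeasurePreserving (quasiMeasurePreserving_sub_left volume x)).sub
      aestronglyMeasurable_const
  have hvol : volume (annulus d δ) ≠ ⊤ := by
    refine ne_top_of_le_ne_top (measure_ball_lt_top (x := (0 : Rn d)) (r := 2 * δ)).ne
      (measure_mono fun h hh => ?_)
    rw [mem_ball_zero_iff]; exact hh.2
  have hpt : ∀ x, (∫⁻ z, k z * ‖w (x - z) - w x‖ₑ) ^ p ≤ A ^ p * (volume (annulus d δ) ^ (p - 1) *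
      ∫⁻ z in annulus d δ, ‖w (x - z) - w x‖ₑ ^ p) := fun x => by
    have h1 : ∫⁻ z, k z * ‖w (x - z) - w x‖ₑ ≤ A * ∫⁻ z in annulus d δ, ‖w (x - z) - w x‖ₑ := by
      rw [← lintegral_const_mul' _ _ hA, ← lintegral_indicator (measurableSet_annulus δ)]
      refine lintegral_mono fun z => ?_
      by_cases hz : z ∈ annulus d δ
      · rw [indicator_of_mem hz]
        exact mul_le_mul_left (hk z) _
      · rw [indicator_of_notMem hz, hk0 z hz, zero_mul]
    refine (ENNReal.rpow_le_rpow h1 hp0).trans ?_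
    rw [ENNReal.mul_rpow_of_nonneg _ _ hp0]
    refine mul_le_mul_right ?_ _
    have h2 := lintegral_rpow_le (μ := volume.restrict (annulus d δ)) hp
      ((hsec x).restrict (s := annulus d δ)).enorm
    rwa [Measure.restrict_apply_univ] at h2
  refine (lintegral_mono hpt).trans ?_
  rw [lintegral_const_mul' _ _ (ENNReal.rpow_ne_top_of_nonneg hp0 hA),
    lintegral_const_mul' _ _ (ENNReal.rpow_ne_top_of_nonneg (by linarith) hvol), ← mul_assoc]
  refine mul_le_mul_right ?_ _
  have hjm : AEMeasurable (Function.uncurry fun x z : Rn d => ‖w (x - z) - w x‖ₑ ^ p)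
      (volume.prod (volume.restrict (annulus d δ))) := by
    have h1 : AEMeasurable (fun z : Rn d × Rn d => ‖w (z.1 - z.2) - w z.1‖ₑ ^ p)
        (volume.prod volume) := by
      refine AEMeasurable.pow_const (AEStronglyMeasurable.enorm (AEStronglyMeasurable.sub ?_ ?_)) p
      · exact hw.comp_quasiMeasurePreserving (quasiMeasurePreserving_sub volume volume)
      · exact hw.comp_quasiMeasurePreserving Measure.quasiMeasurePreserving_fst
    exact h1.mono_measure (Measure.prod_mono le_rfl Measure.restrict_le_self)
  rw [lintegral_lintegral_swap hjm]
  refine lintegral_mono fun z => ?_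
  rw [← shiftNorm_neg hw, shiftNorm_rpow hp]
  simp only [sub_eq_add_neg]
  exact le_rfl

variable [NeZero d]

theorem annularBump_support {x : Rn d}
    (hx : x ∈ closedBall (EuclideanSpace.single 0 (3 / 2)) (1 / 4)) :
    x ∈ annulus d 1 := by
  have hn : ‖(EuclideanSpace.single 0 (3 / 2) : Rn d)‖ = 3 / 2 := by simp
  rw [mem_closedBall, dist_eq_norm] at hx
  have h1 := norm_sub_norm_le (EuclideanSpace.single 0 (3 / 2) : Rn d) x
  have h2 := norm_sub_norm_le x (EuclideanSpace.single 0 (3 / 2) : Rn d)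
  rw [norm_sub_rev] at h1
  constructor <;> linarith

theorem contDiff_mollifier (δ : ℝ) : ContDiff ℝ ∞ (mollifier d δ) :=
  contDiff_const.mul ((annularBump d).contDiff_normed.comp (contDiff_const_smul δ⁻¹))

theorem mollifier_nonneg {δ : ℝ} (hδ : 0 < δ) (x : Rn d) : 0 ≤ mollifier d δ x :=
  mul_nonneg (by positivity) ((annularBump d).nonneg_normed _)

theorem hasCompactSupport_mollifier {δ : ℝ} (hδ : 0 < δ) : HasCompactSupport (mollifier d δ) := by
  refine HasCompactSupport.mul_left (f := fun _ => (δ ^ d)⁻¹) ?_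
  exact ((annularBump d).hasCompactSupport_normed).comp_homeomorph
    (Homeomorph.smulOfNeZero δ⁻¹ (inv_ne_zero hδ.ne'))

theorem mollifier_eq_zero {δ : ℝ} (hδ : 0 < δ) {x : Rn d} (hx : x ∉ annulus d δ) :
    mollifier d δ x = 0 := by
  have : (annularBump d).normed volume (δ⁻¹ • x) = 0 := by
    by_contra h
    have h1 : δ⁻¹ • x ∈ Function.support ((annularBump d).normed volume) := h
    rw [ContDiffBump.support_normed_eq] at h1
    exact hx (smul_inv_mem_annulus hδ (annularBump_support (ball_subset_closedBall h1)))
  rw [mollifier, this, mul_zero]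

theorem integral_mollifier {δ : ℝ} (hδ : 0 < δ) : ∫ x, mollifier d δ x = 1 := by
  unfold mollifier
  rw [integral_const_mul, Measure.integral_comp_inv_smul, (annularBump d).integral_normed,
    finrank_euclideanSpace_fin, abs_of_pos (by positivity), smul_eq_mul, mul_one,
    inv_mul_cancel₀ (by positivity)]

theorem hasFDerivAt_mollifier (δ : ℝ) (x : Rn d) : HasFDerivAt (mollifier d δ)
    (((δ ^ d)⁻¹ * δ⁻¹) • fderiv ℝ ((annularBump d).normed volume) (δ⁻¹ • x)) x := by
  have h1 : DifferentiableAt ℝ ((annularBump d).normed volume) (δ⁻¹ • x) :=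
    ((annularBump d).contDiff_normed (n := 1)).differentiable one_ne_zero _
  have h2 : HasFDerivAt (fun x : Rn d => δ⁻¹ • x) (δ⁻¹ • ContinuousLinearMap.id ℝ (Rn d)) x :=
    (hasFDerivAt_id x).const_smul δ⁻¹
  have h3 := (h1.hasFDerivAt.comp x h2).const_mul ((δ ^ d)⁻¹)
  refine HasFDerivAt.congr_fderiv h3 ?_
  ext v
  simp [mul_assoc]

theorem fderiv_mollifier_eq_zero {δ : ℝ} (hδ : 0 < δ) {x : Rn d} (hx : x ∉ annulus d δ) :
    fderiv ℝ (mollifier d δ) x = 0 := by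
  rw [(hasFDerivAt_mollifier δ x).fderiv]
  have : fderiv ℝ ((annularBump d).normed volume) (δ⁻¹ • x) = 0 := by
    by_contra h
    have h1 := support_fderiv_subset ℝ (f := (annularBump d).normed volume) h
    rw [ContDiffBump.tsupport_normed_eq] at h1
    exact hx (smul_inv_mem_annulus hδ (annularBump_support h1))
  rw [this, smul_zero]

theorem exists_mollifier_bound (d : ℕ) [NeZero d] : ∃ C : ℝ, 0 ≤ C ∧ ∀ δ : ℝ, 0 < δ →
    (∀ x : Rn d, ‖mollifier d δ x‖ ≤ C * (δ ^ d)⁻¹) ∧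
    ∀ x : Rn d, ‖fderiv ℝ (mollifier d δ) x‖ ≤ C * ((δ ^ d)⁻¹ * δ⁻¹) := by
  set b : Rn d → ℝ := (annularBump d).normed volume with hb
  obtain ⟨C1, hC1⟩ := ((annularBump d).continuous_normed
    (μ := volume)).bounded_above_of_compact_support (annularBump d).hasCompactSupport_normed
  have hc : Continuous (fderiv ℝ b) :=
    ((annularBump d).contDiff_normed (n := 1)).continuous_fderiv one_ne_zero
  obtain ⟨C2, hC2⟩ := hc.bounded_above_of_compact_support
    ((annularBump d).hasCompactSupport_normed.fderiv ℝ)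
  refine ⟨max C1 C2, (norm_nonneg _).trans ((hC1 0).trans (le_max_left _ _)),
    fun δ hδ => ⟨fun x => ?_, fun x => ?_⟩⟩
  · rw [mollifier, norm_mul, Real.norm_of_nonneg (by positivity : 0 ≤ (δ ^ d)⁻¹), mul_comm]
    gcongr
    exact (hC1 _).trans (le_max_left _ _)
  · rw [(hasFDerivAt_mollifier δ x).fderiv, norm_smul, Real.norm_of_nonneg (by positivity),
      mul_comm]
    gcongr
    exact (hC2 _).trans (le_max_right _ _)

/-- The mollification of `w` at scale `δ`. -/
noncomputable def mollify (δ : ℝ) (w : Rn d → ℝ) : Rn d → ℝ :=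
  mollifier d δ ⋆[ContinuousLinearMap.lsmul ℝ ℝ, volume] w

theorem mollify_apply (δ : ℝ) (w : Rn d → ℝ) (x : Rn d) :
    mollify δ w x = ∫ z, mollifier d δ z * w (x - z) := by
  simp [mollify, convolution_def]

theorem contDiff_mollify {δ : ℝ} (hδ : 0 < δ) {w : Rn d → ℝ} (hw : LocallyIntegrable w volume) :
    ContDiff ℝ ∞ (mollify δ w) :=
  (hasCompactSupport_mollifier hδ).contDiff_convolution_left _ (contDiff_mollifier δ) hw

theorem integrable_mollifier_mul {δ : ℝ} (hδ : 0 < δ) {w : Rn d → ℝ}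
    (hw : LocallyIntegrable w volume) (x : Rn d) :
    Integrable (fun z => mollifier d δ z * w (x - z)) volume := by
  have := (hasCompactSupport_mollifier hδ).convolutionExists_left
    (ContinuousLinearMap.lsmul ℝ ℝ) (contDiff_mollifier δ).continuous hw x
  simpa [ConvolutionExistsAt] using this

theorem integrable_mollifier {δ : ℝ} (hδ : 0 < δ) : Integrable (mollifier d δ) volume :=
  (contDiff_mollifier δ).continuous.integrable_of_hasCompactSupport (hasCompactSupport_mollifier hδ)

theorem mollify_sub_eq {δ : ℝ} (hδ : 0 < δ) {w : Rn d → ℝ} (hw : LocallyIntegrable w volume)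
    (x : Rn d) : mollify δ w x - w x = ∫ z, mollifier d δ z * (w (x - z) - w x) := by
  simp only [mul_sub]
  rw [integral_sub (integrable_mollifier_mul hδ hw x) ((integrable_mollifier hδ).mul_const _),
    integral_mul_const, integral_mollifier hδ, one_mul, mollify_apply]

/-- Since the derivative of the mollifier has integral zero, the derivative of a mollified function
is an average of finite differences. -/
theorem hasFDerivAt_mollify {δ : ℝ} (hδ : 0 < δ) {w : Rn d → ℝ} (hw : LocallyIntegrable w volume)
    (x : Rn d) : HasFDerivAt (mollify δ w)
      (∫ z, (w (x - z) - w x) • fderiv ℝ (mollifier d δ) z) x := by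
  have hwc : LocallyIntegrable (fun y => w y - w x) volume := hw.sub (locallyIntegrable_const _)
  have h1 := (hasCompactSupport_mollifier hδ).hasFDerivAt_convolution_left
    (ContinuousLinearMap.lsmul ℝ ℝ) ((contDiff_mollifier (d := d) δ).of_le (by simp)) hwc x
  have h2 : mollify δ w = fun y => (mollifier d δ ⋆[ContinuousLinearMap.lsmul ℝ ℝ, volume]
      (fun y => w y - w x)) y + w x := by
    funext y
    rw [convolution_def, mollify_apply]
    simp only [ContinuousLinearMap.lsmul_apply, smul_eq_mul, mul_sub]
    rw [integral_sub (integrable_mollifier_mul hδ hw y) ((integrable_mollifier hδ).mul_const _),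
      integral_mul_const, integral_mollifier hδ]
    ring
  rw [h2]
  refine (h1.add_const _).congr_fderiv ?_
  rw [convolution_def]
  refine integral_congr_ae (Eventually.of_forall fun z => ?_)
  ext v
  simp [ContinuousLinearMap.precompL_apply, mul_comm]
  ring

/-- The finite differences over a single annulus control both the error and the gradient of the
mollification at the corresponding scale. -/
theorem exists_mollify_bound (d : ℕ) [NeZero d] (hp : 1 < p) : ∃ C : ℝ≥0, ∀ δ : ℝ, 0 < δ →
    ∀ w : Rn d → ℝ, MemLp w (ENNReal.ofReal p) volume →
    eLpNorm (mollify δ w - w) (ENNReal.ofReal p) volume ^ p ≤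
      C * ENNReal.ofReal ((δ ^ d)⁻¹) * ∫⁻ h in annulus d δ, shiftNorm p w h ^ p ∧
    eLpNorm (gradient (mollify δ w)) (ENNReal.ofReal p) volume ^ p ≤
      C * ENNReal.ofReal ((δ ^ p)⁻¹) * ENNReal.ofReal ((δ ^ d)⁻¹) *
        ∫⁻ h in annulus d δ, shiftNorm p w h ^ p := by
  have hp0 : 0 ≤ p := by linarith
  obtain ⟨C, hC0, hC⟩ := exists_mollifier_bound d
  set V : ℝ := (2 ^ d * volume (ball (0 : Rn d) 1)).toReal with hV
  have hVt : 2 ^ d * volume (ball (0 : Rn d) 1) ≠ ⊤ :=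
    ENNReal.mul_ne_top (by finiteness) measure_ball_lt_top.ne
  have hV0 : 0 ≤ V := ENNReal.toReal_nonneg
  refine ⟨Real.toNNReal (C ^ p * V ^ (p - 1)), fun δ hδ w hw => ?_⟩
  have hwl : LocallyIntegrable w volume := hw.locallyIntegrable (one_le_ofReal hp)
  have hann : volume (annulus d δ) ≤ ENNReal.ofReal (δ ^ d * V) := by
    refine (volume_annulus_le hδ).trans (le_of_eq ?_)
    rw [ENNReal.ofReal_mul (by positivity), hV, ENNReal.ofReal_toReal hVt]
    ring
  have hpow : ∀ a : ℝ, 0 ≤ a → ENNReal.ofReal (C * ((δ ^ d)⁻¹ * a)) ^ p *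
      volume (annulus d δ) ^ (p - 1) ≤
      ENNReal.ofReal (C ^ p * V ^ (p - 1)) * ENNReal.ofReal (a ^ p) * ENNReal.ofReal ((δ ^ d)⁻¹) :=
    fun a ha => by
    have hδd : 0 < δ ^ d := by positivity
    calc _ ≤ ENNReal.ofReal (C * ((δ ^ d)⁻¹ * a)) ^ p * ENNReal.ofReal (δ ^ d * V) ^ (p - 1) := by
          gcongr
      _ = _ := by
          rw [ENNReal.ofReal_rpow_of_nonneg (by positivity) hp0,
            ENNReal.ofReal_rpow_of_nonneg (by positivity) (by linarith),
            ← ENNReal.ofReal_mul (by positivity), ← ENNReal.ofReal_mul (by positivity),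
            ← ENNReal.ofReal_mul (by positivity)]
          congr 1
          rw [Real.mul_rpow hC0 (by positivity), Real.mul_rpow (by positivity) ha,
            Real.mul_rpow hδd.le hV0, Real.inv_rpow hδd.le, ← rpow_sub_one_mul hp hδd.le]
          have : (δ ^ d) ^ (p - 1) ≠ 0 := (Real.rpow_pos_of_pos hδd _).ne'
          field_simp
  constructor
  · have hb : ∀ z, ‖mollifier d δ z‖ₑ ≤ ENNReal.ofReal (C * ((δ ^ d)⁻¹ * 1)) := fun z => by
      rw [← ofReal_norm, mul_one]
      exact ENNReal.ofReal_le_ofReal ((hC δ hδ).1 z)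
    have h1 := lintegral_kernel_rpow_le hp hw.1 ENNReal.ofReal_ne_top hb
      (fun z hz => by rw [mollifier_eq_zero hδ hz, enorm_zero])
    rw [eLpNorm_rpow_eq hp]
    refine le_trans (lintegral_mono fun x => ENNReal.rpow_le_rpow ?_ hp0) (h1.trans ?_)
    · rw [Pi.sub_apply, mollify_sub_eq hδ hwl]
      refine (enorm_integral_le_lintegral_enorm _).trans (le_of_eq ?_)
      simp only [enorm_mul]
    · refine mul_le_mul_left ((hpow 1 zero_le_one).trans (le_of_eq ?_)) _
      rw [Real.one_rpow, ENNReal.ofReal_one, mul_one]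
      rfl
  · have hb : ∀ z, ‖fderiv ℝ (mollifier d δ) z‖ₑ ≤ ENNReal.ofReal (C * ((δ ^ d)⁻¹ * δ⁻¹)) :=
      fun z => by
      rw [← ofReal_norm]
      exact ENNReal.ofReal_le_ofReal ((hC δ hδ).2 z)
    have h1 := lintegral_kernel_rpow_le hp hw.1 ENNReal.ofReal_ne_top hb
      (fun z hz => by
        rw [← ofReal_norm, fderiv_mollifier_eq_zero hδ hz, norm_zero, ENNReal.ofReal_zero])
    rw [eLpNorm_rpow_eq hp]
    refine le_trans (lintegral_mono fun x => ENNReal.rpow_le_rpow ?_ hp0) (h1.trans ?_)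
    · have h2 : ‖gradient (mollify δ w) x‖ₑ = ‖fderiv ℝ (mollify δ w) x‖ₑ := by
        rw [← ofReal_norm, ← ofReal_norm, gradient, LinearIsometryEquiv.norm_map]
      rw [h2, (hasFDerivAt_mollify hδ hwl x).fderiv]
      refine (enorm_integral_le_lintegral_enorm _).trans (le_of_eq ?_)
      simp only [enorm_smul, mul_comm]
    · refine mul_le_mul_left ((hpow δ⁻¹ (by positivity)).trans (le_of_eq ?_)) _
      rw [Real.inv_rpow hδ.le]
      rfl

theorem setLIntegral_annulus_le {δ : ℝ} (hδ : 0 < δ) {w : Rn d → ℝ} {M : ℝ≥0∞}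
    (hM : ∀ z : Rn d, ‖z‖ < 2 * δ → shiftNorm p w z ^ p ≤ M) :
    ENNReal.ofReal ((δ ^ d)⁻¹) * ∫⁻ h in annulus d δ, shiftNorm p w h ^ p ≤
      2 ^ d * volume (ball (0 : Rn d) 1) * M := by
  have h1 : ∫⁻ h in annulus d δ, shiftNorm p w h ^ p ≤ M * volume (annulus d δ) := by
    rw [← setLIntegral_const]
    exact setLIntegral_mono_ae' (measurableSet_annulus δ)
      (Eventually.of_forall fun h hh => hM h hh.2)
  have h2 : ENNReal.ofReal ((δ ^ d)⁻¹) * ENNReal.ofReal (δ ^ d) = 1 := by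
    rw [← ENNReal.ofReal_mul (by positivity), inv_mul_cancel₀ (by positivity), ENNReal.ofReal_one]
  calc _ ≤ ENNReal.ofReal ((δ ^ d)⁻¹) *
        (M * (2 ^ d * ENNReal.ofReal (δ ^ d) * volume (ball (0 : Rn d) 1))) := by
        exact mul_le_mul_right (h1.trans (mul_le_mul_right (volume_annulus_le hδ) _)) _
    _ = (ENNReal.ofReal ((δ ^ d)⁻¹) * ENNReal.ofReal (δ ^ d)) *
        (2 ^ d * volume (ball (0 : Rn d) 1) * M) := by ring
    _ = _ := by rw [h2, one_mul]

theorem tendsto_mollify (hp : 1 < p) {w : Rn d → ℝ} (hw : MemLp w (ENNReal.ofReal p) volume) :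
    Tendsto (fun δ => eLpNorm (mollify δ w - w) (ENNReal.ofReal p) volume) (𝓝[>] 0) (𝓝 0) := by
  have hp0 : 0 < p := by linarith
  obtain ⟨C, hC⟩ := exists_mollify_bound d hp
  set K : ℝ≥0∞ := C * (2 ^ d * volume (ball (0 : Rn d) 1)) with hK
  have hKt : K ≠ ⊤ := ENNReal.mul_ne_top ENNReal.coe_ne_top
    (ENNReal.mul_ne_top (by finiteness) measure_ball_lt_top.ne)
  have hpow : Tendsto (fun δ => eLpNorm (mollify δ w - w) (ENNReal.ofReal p) volume ^ p)
      (𝓝[>] 0) (𝓝 0) := by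
    rw [ENNReal.tendsto_nhds_zero]
    intro η hη
    obtain ⟨η', hη', hKη⟩ : ∃ η' : ℝ≥0∞, 0 < η' ∧ K * η' ≤ η := by
      rcases eq_or_ne η ⊤ with rfl | hηt
      · exact ⟨1, one_pos, le_top⟩
      · refine ⟨η / (K + 1), ENNReal.div_pos hη.ne' (by finiteness), ?_⟩
        rw [← mul_div_assoc]
        refine ENNReal.div_le_of_le_mul ?_
        rw [mul_comm]
        gcongr
        exact le_self_add
    have h0 : Tendsto (fun z => shiftNorm p w z ^ p) (𝓝 0) (𝓝 0) := by
      have := (ENNReal.continuous_rpow_const (y := p)).tendsto 0 |>.comp (tendsto_shiftNorm hp hw)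
      simpa [hp0, Function.comp_def] using this
    rw [ENNReal.tendsto_nhds_zero] at h0
    obtain ⟨r, hr, hball⟩ := Metric.eventually_nhds_iff.1 (h0 η' hη')
    filter_upwards [Ioo_mem_nhdsGT (half_pos hr)] with δ hδ
    refine ((hC δ hδ.1 w hw).1).trans (le_trans ?_ hKη)
    rw [mul_assoc, hK, mul_assoc]
    refine mul_le_mul_right (setLIntegral_annulus_le hδ.1 fun z hz => hball ?_) _
    rw [dist_zero_right]
    linarith [hδ.2]
  have := (ENNReal.continuous_rpow_const (y := p⁻¹)).tendsto 0 |>.comp hpow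
  simp only [Function.comp_def, ← ENNReal.rpow_mul, mul_inv_cancel₀ hp0.ne', ENNReal.rpow_one,
    ENNReal.zero_rpow_of_pos (inv_pos.2 hp0)] at this
  exact this

theorem mollify_eq_zero {δ : ℝ} (hδ : 0 < δ) {w : Rn d → ℝ} {K : Set (Rn d)}
    (hw : ∀ᵐ x, x ∉ K → w x = 0) {x : Rn d} (hx : ∀ y ∈ K, 2 * δ ≤ dist x y) :
    mollify δ w x = 0 := by
  rw [mollify_apply]
  refine integral_eq_zero_of_ae ?_
  have h1 := (quasiMeasurePreserving_sub_left (volume : Measure (Rn d)) x).ae hw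
  filter_upwards [h1] with z hz
  by_cases hza : z ∈ annulus d δ
  · have : x - z ∉ K := fun hmem => by
      have h2 := hx _ hmem
      rw [dist_eq_norm, sub_sub_cancel] at h2
      exact absurd hza.2 (not_lt.2 h2)
    simp [hz this]
  · simp [mollifier_eq_zero hδ hza]

end Mollifier

/-! ### Compactness in `L^p` -/

section Compactness

variable {d : ℕ} {p : ℝ}

theorem eLpNorm_restrict_eq {F : Type*} [NormedAddCommGroup F] {w : Rn d → F} {S : Set (Rn d)}
    (hS : MeasurableSet S) (h0 : ∀ᵐ x, x ∉ S → w x = 0) (q : ℝ≥0∞) :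
    eLpNorm w q (volume.restrict S) = eLpNorm w q volume := by
  rw [← eLpNorm_indicator_eq_eLpNorm_restrict hS]
  refine eLpNorm_congr_ae ?_
  filter_upwards [h0] with x hx
  by_cases hxS : x ∈ S
  · rw [indicator_of_mem hxS]
  · rw [indicator_of_notMem hxS, hx hxS]

/-- Hölder's inequality on a bounded set. -/
theorem exists_eLpNorm_one_le (hp : 1 < p) {Ω : Set (Rn d)} (hΩ : Bornology.IsBounded Ω) :
    ∃ C : ℝ≥0, ∀ w : Rn d → ℝ, AEStronglyMeasurable w volume → (∀ᵐ x, x ∉ Ω → w x = 0) →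
      eLpNorm w 1 volume ≤ C * eLpNorm w (ENNReal.ofReal p) volume := by
  obtain ⟨R, hR⟩ := hΩ.subset_ball 0
  have hvol : volume (ball (0 : Rn d) R) ≠ ⊤ := measure_ball_lt_top.ne
  set e : ℝ := 1 / (1 : ℝ≥0∞).toReal - 1 / (ENNReal.ofReal p).toReal with he
  have he0 : 0 ≤ e := by
    rw [he, ENNReal.toReal_ofReal (by linarith), ENNReal.toReal_one, one_div_one, sub_nonneg,
      div_le_one (by linarith)]
    exact hp.le
  refine ⟨(volume (ball (0 : Rn d) R) ^ e).toNNReal, fun w hw h0 => ?_⟩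
  have h0' : ∀ᵐ x, x ∉ ball (0 : Rn d) R → w x = 0 := by
    filter_upwards [h0] with x hx hxR using hx fun h => hxR (hR h)
  rw [ENNReal.coe_toNNReal (ENNReal.rpow_ne_top_of_nonneg he0 hvol), mul_comm,
    ← eLpNorm_restrict_eq measurableSet_ball h0', ← eLpNorm_restrict_eq measurableSet_ball h0']
  have := eLpNorm_le_eLpNorm_mul_rpow_measure_univ (μ := volume.restrict (ball (0 : Rn d) R))
    (one_le_ofReal hp) hw.restrict
  rwa [Measure.restrict_apply_univ] at this

theorem mollify_apply_swap [NeZero d] (δ : ℝ) (w : Rn d → ℝ) (x : Rn d) :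
    mollify δ w x = ∫ z, mollifier d δ (x - z) * w z := by
  simp [mollify, convolution_eq_swap]

theorem integrable_mollifier_swap [NeZero d] {δ : ℝ} (hδ : 0 < δ) {w : Rn d → ℝ}
    (hw : Integrable w volume) (x : Rn d) :
    Integrable (fun z => mollifier d δ (x - z) * w z) volume := by
  obtain ⟨C, -, hC⟩ := exists_mollifier_bound d
  exact hw.bdd_mul (c := C * (δ ^ d)⁻¹)
    ((contDiff_mollifier δ).continuous.comp (by fun_prop)).aestronglyMeasurable
    (Eventually.of_forall fun z => (hC δ hδ).1 _)

/-- Mollification maps `L^1` into the bounded Lipschitz functions. -/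
theorem exists_mollify_lipschitz [NeZero d] {δ : ℝ} (hδ : 0 < δ) : ∃ C : ℝ, 0 ≤ C ∧
    ∀ w : Rn d → ℝ, Integrable w volume → (∀ x, |mollify δ w x| ≤ C * ∫ z, ‖w z‖) ∧
      ∀ x y, |mollify δ w x - mollify δ w y| ≤ C * ‖x - y‖ * ∫ z, ‖w z‖ := by
  obtain ⟨C, hC0, hC⟩ := exists_mollifier_bound d
  set A := C * (δ ^ d)⁻¹ with hA
  set L := C * ((δ ^ d)⁻¹ * δ⁻¹) with hL
  have hA0 : 0 ≤ A := by positivity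
  have hL0 : 0 ≤ L := by positivity
  have hlip : ∀ x y : Rn d, ‖mollifier d δ x - mollifier d δ y‖ ≤ L * ‖x - y‖ := fun x y =>
    Convex.norm_image_sub_le_of_norm_fderiv_le (s := univ)
      (fun z _ => ((contDiff_mollifier δ).differentiable (by simp)) z)
      (fun z _ => (hC δ hδ).2 z) convex_univ (mem_univ _) (mem_univ _)
  refine ⟨max A L, le_max_of_le_left hA0, fun w hw => ⟨fun x => ?_, fun x y => ?_⟩⟩
  · have hI : 0 ≤ ∫ z, ‖w z‖ := integral_nonneg fun _ => norm_nonneg _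
    calc |mollify δ w x| ≤ A * ∫ z, ‖w z‖ := by
          rw [mollify_apply_swap, ← Real.norm_eq_abs, ← integral_const_mul]
          refine norm_integral_le_of_norm_le (hw.norm.const_mul A)
            (Eventually.of_forall fun z => ?_)
          rw [norm_mul]
          exact mul_le_mul_of_nonneg_right ((hC δ hδ).1 _) (norm_nonneg _)
      _ ≤ _ := mul_le_mul_of_nonneg_right (le_max_left _ _) hI
  · have hI : 0 ≤ ∫ z, ‖w z‖ := integral_nonneg fun _ => norm_nonneg _
    calc |mollify δ w x - mollify δ w y| ≤ L * ‖x - y‖ * ∫ z, ‖w z‖ := by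
          rw [mollify_apply_swap, mollify_apply_swap,
            ← integral_sub (integrable_mollifier_swap hδ hw x) (integrable_mollifier_swap hδ hw y),
            ← Real.norm_eq_abs, ← integral_const_mul]
          refine norm_integral_le_of_norm_le (hw.norm.const_mul _)
            (Eventually.of_forall fun z => ?_)
          rw [← sub_mul, norm_mul]
          refine mul_le_mul_of_nonneg_right ?_ (norm_nonneg _)
          simpa using hlip (x - z) (y - z)
      _ ≤ _ := by
        refine mul_le_mul_of_nonneg_right ?_ hI
        exact mul_le_mul_of_nonneg_right (le_max_right _ _) (norm_nonneg _)

/-- Mollification at a fixed scale is compact on the functions that are supported in a fixed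
bounded set. -/
theorem exists_finite_mollify_cover [NeZero d] {Ω : Set (Rn d)} (hΩ : Bornology.IsBounded Ω)
    {w : ℕ → Rn d → ℝ} (hw : ∀ n, Integrable (w n) volume)
    (h0 : ∀ n, ∀ᵐ x, x ∉ Ω → w n x = 0) {B : ℝ} (hB : ∀ n, ∫ z, ‖w n z‖ ≤ B) {δ : ℝ} (hδ : 0 < δ)
    {r : ℝ} (hr : 0 < r) :
    ∃ s : Set ℕ, s.Finite ∧ ∀ n, ∃ m ∈ s,
      eLpNorm (mollify δ (w n) - mollify δ (w m)) (ENNReal.ofReal p) volume ≤ ENNReal.ofReal r := by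
  obtain ⟨R, hR⟩ := hΩ.subset_ball 0
  obtain ⟨C, hC0, hC⟩ := exists_mollify_lipschitz (d := d) hδ
  -- the Arzelà–Ascoli theorem on a ball that contains the supports of all the mollified functions
  set K : Set (Rn d) := closedBall 0 (R + 2 * δ) with hK
  have hKc : CompactSpace K := isCompact_iff_compactSpace.1 (isCompact_closedBall _ _)
  have hzero : ∀ n x, x ∉ K → mollify δ (w n) x = 0 := fun n x hx => by
    refine mollify_eq_zero hδ (h0 n) fun y hy => ?_
    have h1 := mem_ball_zero_iff.1 (hR hy)
    rw [hK, mem_closedBall_zero_iff, not_le] at hx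
    have h2 := norm_sub_norm_le x y
    rw [dist_eq_norm]
    linarith
  have hcont : ∀ n, Continuous (mollify δ (w n)) := fun n =>
    (contDiff_mollify hδ (hw n).locallyIntegrable).continuous
  have hVt : volume K ^ (ENNReal.ofReal p).toReal⁻¹ ≠ ⊤ :=
    ENNReal.rpow_ne_top_of_nonneg (by positivity) (isCompact_closedBall _ _).measure_lt_top.ne
  set V : ℝ := (volume K ^ (ENNReal.ofReal p).toReal⁻¹).toReal with hV
  have hV0 : 0 ≤ V := ENNReal.toReal_nonneg
  obtain ⟨r', hr'eq⟩ : ∃ r', r' = r / (V + 1) := ⟨_, rfl⟩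
  have hr' : 0 < r' := by rw [hr'eq]; positivity
  let F : ℕ → BoundedContinuousFunction K ℝ := fun n =>
    BoundedContinuousFunction.mkOfCompact ⟨fun x => mollify δ (w n) x,
      (hcont n).comp continuous_subtype_val⟩
  have hF : ∀ n (x : K), F n x = mollify δ (w n) x := fun n x => rfl
  have hcpt : IsCompact (closure (range F)) := by
    refine BoundedContinuousFunction.arzela_ascoli (closedBall 0 (C * B)) (isCompact_closedBall _ _)
      _ ?_ ?_
    · rintro f x ⟨n, rfl⟩
      rw [mem_closedBall_zero_iff, hF, Real.norm_eq_abs]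
      exact ((hC (w n) (hw n)).1 _).trans (mul_le_mul_of_nonneg_left (hB n) hC0)
    · have hB0 : 0 ≤ B := (integral_nonneg fun _ => norm_nonneg _).trans (hB 0)
      have : ∀ f : range F, LipschitzWith (Real.toNNReal (C * B)) (fun x : K => f.1 x) := by
        rintro ⟨_, n, rfl⟩
        refine LipschitzWith.of_dist_le_mul fun x y => ?_
        rw [Real.dist_eq, hF, hF, Real.coe_toNNReal _ (by positivity)]
        refine ((hC (w n) (hw n)).2 _ _).trans ?_
        rw [Subtype.dist_eq, dist_eq_norm, mul_right_comm]
        exact mul_le_mul_of_nonneg_right (mul_le_mul_of_nonneg_left (hB n) hC0) (norm_nonneg _)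
      exact (LipschitzWith.uniformEquicontinuous _ _ this).equicontinuous
  have htb : TotallyBounded (range F) := hcpt.totallyBounded.subset subset_closure
  obtain ⟨t, hts, htf, htc⟩ := Metric.finite_approx_of_totallyBounded htb r' hr'
  choose! idx hidx using (fun f hf => hts hf : ∀ f ∈ t, ∃ n, F n = f)
  refine ⟨idx '' t, htf.image _, fun n => ?_⟩
  obtain ⟨f, hft, hfn⟩ := mem_iUnion₂.1 (htc (mem_range_self n))
  refine ⟨idx f, mem_image_of_mem _ hft, ?_⟩
  have hsup : ∀ x, ‖(mollify δ (w n) - mollify δ (w (idx f))) x‖ ≤ r' := fun x => by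
    by_cases hx : x ∈ K
    · rw [← hidx f hft, mem_ball] at hfn
      have := (BoundedContinuousFunction.dist_coe_le_dist (f := F n) (g := F (idx f))
        ⟨x, hx⟩).trans hfn.le
      simpa [Real.dist_eq, hF] using this
    · simpa [hzero n x hx, hzero _ x hx] using hr'.le
  rw [← eLpNorm_restrict_eq (S := K) isClosed_closedBall.measurableSet
    (Eventually.of_forall fun x hx => by simp [hzero n x hx, hzero _ x hx])]
  refine (eLpNorm_le_of_ae_bound (Eventually.of_forall hsup)).trans ?_
  rw [Measure.restrict_apply_univ, ← ENNReal.ofReal_toReal hVt,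
    ← ENNReal.ofReal_mul ENNReal.toReal_nonneg]
  refine ENNReal.ofReal_le_ofReal ?_
  rw [← hV, hr'eq, mul_div_assoc']
  rw [div_le_iff₀ (by positivity)]
  nlinarith

/-- A relative of the Kolmogorov–Riesz theorem: the finite differences are only controlled in
average over annuli, and at a given scale only from some index on. -/
theorem exists_subseq_tendsto_eLpNorm [NeZero d] (hp : 1 < p) {Ω : Set (Rn d)}
    (hΩm : MeasurableSet Ω) (hΩ : Bornology.IsBounded Ω)
    {w : ℕ → Rn d → ℝ} (hw : ∀ n, MemLp (w n) (ENNReal.ofReal p) volume)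
    (h0 : ∀ n, ∀ᵐ x, x ∉ Ω → w n x = 0) {B : ℝ≥0}
    (hB : ∀ n, eLpNorm (w n) (ENNReal.ofReal p) volume ≤ B) {C : ℝ≥0}
    (hA : ∀ δ : ℝ, 0 < δ → ∀ᶠ n in atTop, ∫⁻ h in annulus d δ, shiftNorm p (w n) h ^ p ≤
      C * ENNReal.ofReal (δ ^ p) * ENNReal.ofReal (δ ^ d)) :
    ∃ v : Rn d → ℝ, MemLp v (ENNReal.ofReal p) volume ∧ (∀ᵐ x, x ∉ Ω → v x = 0) ∧
      ∃ φ : ℕ → ℕ, StrictMono φ ∧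
        Tendsto (fun n => eLpNorm (w (φ n) - v) (ENNReal.ofReal p) volume) atTop (𝓝 0) := by
  have hp0 : 0 < p := by linarith
  have hfact : Fact ((1 : ℝ≥0∞) ≤ ENNReal.ofReal p) := ⟨one_le_ofReal hp⟩
  obtain ⟨C1, hC1⟩ := exists_mollify_bound d hp
  obtain ⟨A, hA1⟩ := exists_eLpNorm_one_le hp hΩ
  have hL1 : ∀ n, eLpNorm (w n) 1 volume ≤ A * B := fun n =>
    (hA1 (w n) (hw n).1 (h0 n)).trans (mul_le_mul_right (hB n) _)
  have hwi : ∀ n, Integrable (w n) volume := fun n =>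
    memLp_one_iff_integrable.1 ⟨(hw n).1, (hL1 n).trans_lt (by finiteness)⟩
  have hI : ∀ n, ∫ z, ‖w n z‖ ≤ A * B := fun n => by
    rw [integral_norm_eq_lintegral_enorm (hw n).1, ← eLpNorm_one_eq_lintegral_enorm]
    exact ENNReal.toReal_le_of_le_ofReal (by positivity) ((hL1 n).trans (by
      rw [ENNReal.ofReal_mul (by positivity)]; simp))
  -- at a small enough scale, the mollification error is uniformly small from some index on
  have hsmall : ∀ η : ℝ, 0 < η → ∃ δ : ℝ, 0 < δ ∧ ∀ᶠ n in atTop,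
      eLpNorm (mollify δ (w n) - w n) (ENNReal.ofReal p) volume ≤ ENNReal.ofReal η := by
    intro η hη
    have h1 : Tendsto (fun δ : ℝ => (C1 : ℝ≥0∞) * C * ENNReal.ofReal (δ ^ p)) (𝓝[>] 0) (𝓝 0) := by
      have h2 : Tendsto (fun δ : ℝ => δ ^ p) (𝓝[>] 0) (𝓝 0) := by
        have := (Real.continuousAt_rpow_const 0 p (Or.inr hp0.le)).tendsto
        rw [Real.zero_rpow hp0.ne'] at this
        exact this.mono_left nhdsWithin_le_nhds
      have h3 := ENNReal.Tendsto.const_mul (a := (C1 : ℝ≥0∞) * C) (ENNReal.tendsto_ofReal h2)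
        (Or.inr (by finiteness))
      simpa using h3
    have hηp : (0 : ℝ≥0∞) < ENNReal.ofReal η ^ p :=
      ENNReal.rpow_pos (by simpa using hη) ENNReal.ofReal_ne_top
    obtain ⟨δ, hδη, hδ⟩ := ((h1.eventually_le_const hηp).and self_mem_nhdsWithin).exists
    refine ⟨δ, hδ, (hA δ hδ).mono fun n hn => ?_⟩
    have hδ' : 0 < δ := hδ
    rw [← ENNReal.rpow_le_rpow_iff hp0]
    refine ((hC1 δ hδ (w n) (hw n)).1.trans (mul_le_mul_right hn _)).trans (le_trans (le_of_eq ?_)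
      hδη)
    have h2 : ENNReal.ofReal ((δ ^ d)⁻¹) * ENNReal.ofReal (δ ^ d) = 1 := by
      rw [← ENNReal.ofReal_mul (by positivity), inv_mul_cancel₀ (by positivity), ENNReal.ofReal_one]
    calc _ = (C1 : ℝ≥0∞) * C * ENNReal.ofReal (δ ^ p) *
          (ENNReal.ofReal ((δ ^ d)⁻¹) * ENNReal.ofReal (δ ^ d)) := by ring
      _ = _ := by rw [h2, mul_one]
  set f : ℕ → Lp ℝ (ENNReal.ofReal p) (volume : Measure (Rn d)) :=
    fun n => (hw n).toLp (w n) with hf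
  have hdist : ∀ n m, edist (f n) (f m) = eLpNorm (w n - w m) (ENNReal.ofReal p) volume :=
    fun n m => Lp.edist_toLp_toLp _ _ _ _
  -- an `η`-net: the finitely many initial functions, and finitely many functions whose
  -- mollifications form a net of the mollified tail
  have htb : TotallyBounded (range f) := by
    rw [EMetric.totallyBounded_iff]
    intro η hη
    obtain ⟨a, ha, haη⟩ : ∃ a : ℝ, 0 < a ∧ ENNReal.ofReal (3 * a) < η := by
      obtain ⟨b, hb0, hb⟩ := ENNReal.lt_iff_exists_real_btwn.1 hη
      refine ⟨b / 3, ?_, by rw [mul_div_cancel₀ _ (by norm_num)]; exact hb.2⟩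
      have := ENNReal.ofReal_pos.1 hb.1
      positivity
    obtain ⟨δ, hδ, hδn⟩ := hsmall a ha
    obtain ⟨N, hN⟩ := eventually_atTop.1 hδn
    obtain ⟨s, hs, hcov⟩ := exists_finite_mollify_cover hΩ (w := fun n => w (n + N))
      (fun n => hwi _) (fun n => h0 _) (fun n => hI _) hδ ha
    refine ⟨f '' ((fun n => n + N) '' s ∪ Iio N), ((hs.image _).union (finite_Iio N)).image _, ?_⟩
    rintro _ ⟨n, rfl⟩
    rw [mem_iUnion₂]
    rcases lt_or_ge n N with hn | hn
    · exact ⟨f n, mem_image_of_mem _ (Or.inr hn), Metric.mem_eball_self hη⟩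
    · obtain ⟨m, hm, hnm⟩ := hcov (n - N)
      refine ⟨f (m + N), mem_image_of_mem _ (Or.inl (mem_image_of_mem _ hm)), ?_⟩
      rw [Metric.mem_eball, hdist]
      simp only [Nat.sub_add_cancel hn] at hnm
      have hmm : ∀ k, AEStronglyMeasurable (mollify δ (w k)) volume := fun k =>
        (contDiff_mollify hδ (hwi k).locallyIntegrable).continuous.aestronglyMeasurable
      have hdec : w n - w (m + N) = (-(mollify δ (w n) - w n) +
          (mollify δ (w n) - mollify δ (w (m + N)))) + (mollify δ (w (m + N)) - w (m + N)) := by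
        funext x; simp
      rw [hdec]
      refine lt_of_le_of_lt ?_ haη
      refine (eLpNorm_add_le ((((hmm n).sub (hw n).1).neg).add ((hmm n).sub (hmm _)))
        ((hmm _).sub (hw _).1) hfact.out).trans ?_
      refine (add_le_add_left (eLpNorm_add_le ((hmm n).sub (hw n).1).neg ((hmm n).sub (hmm _))
        hfact.out) _).trans ?_
      rw [eLpNorm_neg]
      refine (add_le_add (add_le_add (hN n hn) hnm) (hN (m + N) (by omega))).trans (le_of_eq ?_)
      rw [← ENNReal.ofReal_add ha.le ha.le, ← ENNReal.ofReal_add (by positivity) ha.le]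
      congr 1
      ring
  have hcpt : IsCompact (closure (range f)) :=
    isCompact_iff_totallyBounded_isComplete.2 ⟨htb.closure, isClosed_closure.isComplete⟩
  obtain ⟨g, -, φ, hφ, hlim⟩ := hcpt.tendsto_subseq (x := f)
    fun n => subset_closure (mem_range_self n)
  have hconv : Tendsto (fun n => eLpNorm (w (φ n) - (g : Rn d → ℝ)) (ENNReal.ofReal p) volume)
      atTop (𝓝 0) := by
    have h1 := tendsto_iff_edist_tendsto_0.1 hlim
    refine h1.congr fun n => ?_
    rw [Function.comp, Lp.edist_def]
    exact eLpNorm_congr_ae ((hw (φ n)).coeFn_toLp.sub EventuallyEq.rfl)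
  refine ⟨g, Lp.memLp g, ?_, φ, hφ, hconv⟩
  have h1 : eLpNorm g (ENNReal.ofReal p) (volume.restrict Ωᶜ) ≤ 0 := by
    refine ge_of_tendsto' hconv fun n => ?_
    refine le_trans (le_of_eq ?_) (eLpNorm_mono_measure _ (Measure.restrict_le_self (s := Ωᶜ)))
    rw [← eLpNorm_neg]
    refine eLpNorm_congr_ae ?_
    rw [EventuallyEq, ae_restrict_iff' hΩm.compl]
    filter_upwards [h0 (φ n)] with x hx hxΩ
    simp [hx hxΩ]
  have h2 := (eLpNorm_eq_zero_iff (Lp.aestronglyMeasurable g).restrict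
    (by simpa using hp0)).1 (le_zero_iff.1 h1)
  rw [EventuallyEq, ae_restrict_iff' hΩm.compl] at h2
  filter_upwards [h2] with x hx hxΩ using hx hxΩ

/-- The annulus bounds pass to limits in `L^p`. -/
theorem annulus_bound_of_tendsto (hp : 1 < p) {w : ℕ → Rn d → ℝ} {v : Rn d → ℝ}
    (hw : ∀ n, AEStronglyMeasurable (w n) volume) (hv : AEStronglyMeasurable v volume)
    (hlim : Tendsto (fun n => eLpNorm (w n - v) (ENNReal.ofReal p) volume) atTop (𝓝 0))
    {δ : ℝ} {M : ℝ≥0∞} (hM : ∃ᶠ n in atTop, ∫⁻ h in annulus d δ, shiftNorm p (w n) h ^ p ≤ M) :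
    ∫⁻ h in annulus d δ, shiftNorm p v h ^ p ≤ 2 ^ p * M := by
  have hp0 : 0 < p := by linarith
  have hvol : volume (annulus d δ) ≠ ⊤ := by
    refine ne_top_of_le_ne_top (measure_ball_lt_top (x := (0 : Rn d)) (r := 2 * δ)).ne
      (measure_mono fun h hh => ?_)
    rw [mem_ball_zero_iff]; exact hh.2
  have h1 : ∀ n, ∫⁻ h in annulus d δ, shiftNorm p v h ^ p ≤
      2 ^ p * (∫⁻ h in annulus d δ, shiftNorm p (w n) h ^ p) +
        2 ^ p * ((2 * eLpNorm (w n - v) (ENNReal.ofReal p) volume) ^ p * volume (annulus d δ)) := by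
    intro n
    rw [← setLIntegral_const, ← lintegral_const_mul _ (measurable_shiftNorm_rpow hp (hw n)),
      ← lintegral_const_mul _ measurable_const,
      ← lintegral_add_left ((measurable_shiftNorm_rpow hp (hw n)).const_mul _)]
    refine lintegral_mono fun h => ?_
    rw [← mul_add]
    refine le_trans ?_ (add_rpow_le_two hp _ _)
    refine ENNReal.rpow_le_rpow ?_ hp0.le
    have hdec : v = w n + -(w n - v) := by funext x; simp
    have h2 := shiftNorm_add_left hp (hw n) ((hw n).sub hv).neg h
    rw [← hdec] at h2
    refine h2.trans (add_le_add_right ?_ _)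
    refine (shiftNorm_le_two_mul hp ((hw n).sub hv).neg h).trans ?_
    rw [eLpNorm_neg]
  have h2 : Tendsto (fun n => 2 ^ p * M + 2 ^ p *
      ((2 * eLpNorm (w n - v) (ENNReal.ofReal p) volume) ^ p * volume (annulus d δ)))
      atTop (𝓝 (2 ^ p * M)) := by
    have h3 := ENNReal.Tendsto.const_mul (a := 2) hlim (Or.inr (by simp))
    have h4 := (ENNReal.continuous_rpow_const (y := p)).tendsto _ |>.comp h3
    have h5 := ENNReal.Tendsto.const_mul (a := 2 ^ p)
      (ENNReal.Tendsto.mul_const (b := volume (annulus d δ)) h4 (Or.inr hvol))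
      (Or.inr (by finiteness))
    have h6 := (tendsto_const_nhds (x := 2 ^ p * M)).add h5
    simpa [Function.comp_def, hp0] using h6
  refine ge_of_tendsto_of_frequently h2 (hM.mono fun n hn => (h1 n).trans ?_)
  exact add_le_add_left (mul_le_mul_right hn _) _

end Compactness

/-! ### Limits of weakly differentiable functions -/

section WeakLimits

variable {d : ℕ} {p : ℝ}

theorem continuous_gradient {f : Rn d → ℝ} (hf : ContDiff ℝ 1 f) : Continuous (gradient f) :=
  (InnerProductSpace.toDual ℝ (Rn d)).symm.continuous.comp (hf.continuous_fderiv one_ne_zero)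

theorem integral_smul_gradient_eq {f g : Rn d → ℝ} (hf : ContDiff ℝ 1 f) (hg : ContDiff ℝ 1 g)
    (hgc : HasCompactSupport g) :
    ∫ x, f x • gradient g x = - ∫ x, g x • gradient f x := by
  have hgc' : HasCompactSupport (gradient g) :=
    (hgc.fderiv ℝ).comp_left (g := (InnerProductSpace.toDual ℝ (Rn d)).symm) (map_zero _)
  have i1 : Integrable (fun x => f x • gradient g x) volume :=
    (hf.continuous.smul (continuous_gradient hg)).integrable_of_hasCompactSupport hgc'.smul_left
  have i2 : Integrable (fun x => g x • gradient f x) volume :=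
    (hg.continuous.smul (continuous_gradient hf)).integrable_of_hasCompactSupport hgc.smul_right
  refine ext_inner_left ℝ fun v => ?_
  rw [inner_neg_right, ← integral_inner i1, ← integral_inner i2]
  have e1 : ∀ x, inner ℝ v (f x • gradient g x) = f x * fderiv ℝ g x v := fun x => by
    rw [real_inner_smul_right, real_inner_comm]
    simp [gradient]
  have e2 : ∀ x, inner ℝ v (g x • gradient f x) = fderiv ℝ f x v * g x := fun x => by
    rw [real_inner_smul_right, real_inner_comm, mul_comm]
    simp [gradient]
  simp only [e1, e2]
  refine integral_mul_fderiv_eq_neg_fderiv_mul_of_integrable ?_ ?_ ?_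
    (fun x _ => hf.differentiable one_ne_zero x) (fun x _ => hg.differentiable one_ne_zero x)
  · exact (i2.const_inner v).congr (Eventually.of_forall e2)
  · exact (i1.const_inner v).congr (Eventually.of_forall e1)
  · exact (hf.continuous.mul hg.continuous).integrable_of_hasCompactSupport hgc.mul_left

theorem hasSobolevGrad_of_contDiff {f : Rn d → ℝ} (hf : ContDiff ℝ 1 f)
    (h1 : MemLp f (ENNReal.ofReal p) volume)
    (h2 : MemLp (gradient f) (ENNReal.ofReal p) volume) :
    HasSobolevGrad p univ f (gradient f) := by
  refine ⟨by simpa using h1, by simpa using h2, fun φ hφ => ?_⟩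
  rw [Measure.restrict_univ]
  exact integral_smul_gradient_eq hf (hφ.1.of_le (by simp)) hφ.2.1

theorem tendsto_integral_smul_of_tendsto_left (hp : 1 < p) {F : Type*} [NormedAddCommGroup F]
    [NormedSpace ℝ F] {μ : Measure (Rn d)} [IsFiniteMeasureOnCompacts μ] {f : ℕ → Rn d → ℝ}
    {f₀ : Rn d → ℝ} {g : Rn d → F} (hf : ∀ n, MemLp (f n) (ENNReal.ofReal p) μ)
    (hf₀ : MemLp f₀ (ENNReal.ofReal p) μ) (hg : Continuous g) (hgc : HasCompactSupport g)
    (h : Tendsto (fun n => eLpNorm (f n - f₀) (ENNReal.ofReal p) μ) atTop (𝓝 0)) :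
    Tendsto (fun n => ∫ x, f n x • g x ∂μ) atTop (𝓝 (∫ x, f₀ x • g x ∂μ)) := by
  have hpq : p.HolderConjugate (p / (p - 1)) := Real.HolderConjugate.conjExponent hp
  have : ENNReal.HolderConjugate (ENNReal.ofReal p) (ENNReal.ofReal (p / (p - 1))) :=
    hpq.ennrealOfReal
  have hgL : MemLp g (ENNReal.ofReal (p / (p - 1))) μ := hg.memLp_of_hasCompactSupport hgc
  have hint : ∀ {u : Rn d → ℝ}, MemLp u (ENNReal.ofReal p) μ → Integrable (fun x => u x • g x) μ :=
    fun hu => memLp_one_iff_integrable.1 (hgL.smul hu)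
  refine tendsto_integral_of_L1' _ (hint hf₀).1 (Eventually.of_forall fun n => hint (hf n)) ?_
  have h2 := ENNReal.Tendsto.mul_const (b := eLpNorm g (ENNReal.ofReal (p / (p - 1))) μ) h
    (Or.inr hgL.2.ne)
  rw [zero_mul] at h2
  refine tendsto_of_tendsto_of_tendsto_of_le_of_le tendsto_const_nhds h2 (fun _ => bot_le)
    fun n => ?_
  refine le_trans (le_of_eq ?_) (eLpNorm_smul_le_mul_eLpNorm (r := 1) hgL.1 ((hf n).1.sub hf₀.1))
  congr 1
  funext x
  simp [sub_smul]

theorem tendsto_integral_smul_of_tendsto_right (hp : 1 < p) {F : Type*} [NormedAddCommGroup F]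
    [NormedSpace ℝ F] {μ : Measure (Rn d)} [IsFiniteMeasureOnCompacts μ] {f : ℕ → Rn d → F}
    {f₀ : Rn d → F} {g : Rn d → ℝ} (hf : ∀ n, MemLp (f n) (ENNReal.ofReal p) μ)
    (hf₀ : MemLp f₀ (ENNReal.ofReal p) μ) (hg : Continuous g) (hgc : HasCompactSupport g)
    (h : Tendsto (fun n => eLpNorm (f n - f₀) (ENNReal.ofReal p) μ) atTop (𝓝 0)) :
    Tendsto (fun n => ∫ x, g x • f n x ∂μ) atTop (𝓝 (∫ x, g x • f₀ x ∂μ)) := by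
  have hpq : p.HolderConjugate (p / (p - 1)) := Real.HolderConjugate.conjExponent hp
  have : ENNReal.HolderConjugate (ENNReal.ofReal (p / (p - 1))) (ENNReal.ofReal p) :=
    hpq.symm.ennrealOfReal
  have hgL : MemLp g (ENNReal.ofReal (p / (p - 1))) μ := hg.memLp_of_hasCompactSupport hgc
  have hint : ∀ {u : Rn d → F}, MemLp u (ENNReal.ofReal p) μ → Integrable (fun x => g x • u x) μ :=
    fun hu => memLp_one_iff_integrable.1 (hu.smul hgL)
  refine tendsto_integral_of_L1' _ (hint hf₀).1 (Eventually.of_forall fun n => hint (hf n)) ?_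
  have h2 := ENNReal.Tendsto.const_mul (a := eLpNorm g (ENNReal.ofReal (p / (p - 1))) μ) h
    (Or.inr hgL.2.ne)
  rw [mul_zero] at h2
  refine tendsto_of_tendsto_of_tendsto_of_le_of_le tendsto_const_nhds h2 (fun _ => bot_le)
    fun n => ?_
  refine le_trans (le_of_eq ?_) (eLpNorm_smul_le_mul_eLpNorm (r := 1) ((hf n).1.sub hf₀.1) hgL.1)
  congr 1
  funext x
  simp [smul_sub]

theorem IsTestFun.memLp {U : Set (Rn d)} {φ : Rn d → ℝ} (hφ : IsTestFun U φ) (q : ℝ≥0∞)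
    (μ : Measure (Rn d)) [IsFiniteMeasureOnCompacts μ] : MemLp φ q μ :=
  hφ.1.continuous.memLp_of_hasCompactSupport hφ.2.1

theorem IsTestFun.memLp_gradient {U : Set (Rn d)} {φ : Rn d → ℝ} (hφ : IsTestFun U φ) (q : ℝ≥0∞)
    (μ : Measure (Rn d)) [IsFiniteMeasureOnCompacts μ] : MemLp (gradient φ) q μ :=
  hφ.continuous_gradient.memLp_of_hasCompactSupport hφ.hasCompactSupport_gradient

theorem gradient_eq_zero_of_notMem {φ : Rn d → ℝ} {x : Rn d} (hx : x ∉ tsupport φ) :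
    gradient φ x = 0 := by
  have : fderiv ℝ φ x = 0 := by
    by_contra h
    exact hx (support_fderiv_subset ℝ h)
  simp [gradient, this]

/-- If test functions in `Ω` and their gradients converge in `L^p(Ω)`, then the limit satisfies
the integration by parts formula even against test functions that do not vanish on `∂Ω`. -/
theorem integral_smul_gradient_of_tendsto (hp : 1 < p) {Ω : Set (Rn d)} {w : Rn d → ℝ}
    {G : Rn d → Rn d} (hw : MemLp w (ENNReal.ofReal p) (volume.restrict Ω))
    (hG : MemLp G (ENNReal.ofReal p) (volume.restrict Ω))
    {φ : ℕ → Rn d → ℝ} (hφ : ∀ n, IsTestFun Ω (φ n))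
    (h1 : Tendsto (fun n => eLpNorm (φ n - w) (ENNReal.ofReal p) (volume.restrict Ω)) atTop (𝓝 0))
    (h2 : Tendsto (fun n => eLpNorm (gradient (φ n) - G) (ENNReal.ofReal p) (volume.restrict Ω))
      atTop (𝓝 0)) {ψ : Rn d → ℝ} {U : Set (Rn d)} (hψ : IsTestFun U ψ) :
    ∫ x in Ω, w x • gradient ψ x = - ∫ x in Ω, ψ x • G x := by
  refine tendsto_nhds_unique
    (tendsto_integral_smul_of_tendsto_left hp (fun n => (hφ n).memLp _ _) hw hψ.continuous_gradient
      hψ.hasCompactSupport_gradient h1) ?_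
  refine (tendsto_integral_smul_of_tendsto_right hp (fun n => (hφ n).memLp_gradient _ _) hG
    hψ.1.continuous hψ.2.1 h2).neg.congr fun n => ?_
  rw [setIntegral_eq_integral_of_forall_compl_eq_zero,
    setIntegral_eq_integral_of_forall_compl_eq_zero,
    integral_smul_gradient_eq ((hφ n).1.of_le (by simp)) (hψ.1.of_le (by simp)) hψ.2.1]
  · intro x hx
    rw [image_eq_zero_of_notMem_tsupport fun h => hx ((hφ n).2.2 h), zero_smul]
  · intro x hx
    rw [gradient_eq_zero_of_notMem fun h => hx ((hφ n).2.2 h), smul_zero]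

theorem memLp_toReal_rpow (hp : 1 < p) {F : Type*} [NormedAddCommGroup F] {μ : Measure (Rn d)}
    {f : Rn d → F} (hf : MemLp f (ENNReal.ofReal p) μ) :
    Integrable (fun x => ‖f x‖ ^ p) μ ∧
      eLpNorm f (ENNReal.ofReal p) μ ^ p = ENNReal.ofReal (∫ x, ‖f x‖ ^ p ∂μ) := by
  have hp0 : 0 < p := by linarith
  have h1 : Integrable (fun x => ‖f x‖ ^ p) μ := by
    have := hf.integrable_norm_rpow (by simpa using hp0) ENNReal.ofReal_ne_top
    rwa [ENNReal.toReal_ofReal hp0.le] at this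
  refine ⟨h1, ?_⟩
  rw [eLpNorm_rpow_eq hp, ofReal_integral_eq_lintegral_ofReal h1
    (Eventually.of_forall fun x => by positivity)]
  refine lintegral_congr fun x => ?_
  rw [ofReal_norm_rpow (by linarith)]

theorem integral_combination {S : Type*} [MeasurableSpace S] {μ : Measure S} {f g h : S → ℝ}
    (hf : Integrable f μ) (hg : Integrable g μ) (hh : Integrable h μ) (s t : ℝ) :
    ∫ x, (s * (f x + g x) + t * (f x / 2 + g x / 2 - h x)) ∂μ =
      s * (∫ x, f x ∂μ + ∫ x, g x ∂μ) +
        t * ((∫ x, f x ∂μ) / 2 + (∫ x, g x ∂μ) / 2 - ∫ x, h x ∂μ) := by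
  have i1 : Integrable (fun x => f x + g x) μ := hf.add hg
  have i2 : Integrable (fun x => f x / 2 + g x / 2) μ := (hf.div_const 2).add (hg.div_const 2)
  have i3 : Integrable (fun x => f x / 2 + g x / 2 - h x) μ := i2.sub hh
  rw [integral_add (i1.const_mul s) (i3.const_mul t), integral_const_mul, integral_const_mul,
    integral_add hf hg, integral_sub i2 hh, integral_add (hf.div_const 2) (hg.div_const 2),
    integral_div, integral_div]

/-- The energy-minimizing elements of the tails of the convex hulls of a sequence of test functions
with bounded gradients have converging gradients: this uses the uniform convexity of `L^p`. -/
theorem exists_convexHull_cauchy (hp : 1 < p) {Ω : Set (Rn d)} {φ : ℕ → Rn d → ℝ}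
    (hφ : ∀ n, IsTestFun Ω (φ n)) {B : ℝ}
    (hB : ∀ n, ∫ x in Ω, ‖gradient (φ n) x‖ ^ p ≤ B) :
    ∃ a : ℕ → Rn d → ℝ, (∀ n, a n ∈ convexHull ℝ (φ '' Ici n)) ∧ (∀ n, IsTestFun Ω (a n)) ∧
      ∀ η : ℝ, 0 < η → ∃ N, ∀ m ≥ N, ∀ n ≥ N,
        ∫ x in Ω, ‖gradient (a n) x - gradient (a m) x‖ ^ p ≤ η := by
  have hp0 : 0 < p := by linarith
  set J : (Rn d → ℝ) → ℝ := fun a => ∫ x in Ω, ‖gradient a x‖ ^ p with hJ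
  have hJ0 : ∀ a, 0 ≤ J a := fun a => integral_nonneg fun x => by positivity
  have hint : ∀ {a}, IsTestFun Ω a → Integrable (fun x => ‖gradient a x‖ ^ p) (volume.restrict Ω) :=
    fun ha => (memLp_toReal_rpow hp (ha.memLp_gradient _ _)).1
  have htest : ∀ n, ∀ a ∈ convexHull ℝ (φ '' Ici n), IsTestFun Ω a := fun n =>
    convexHull_min (by rintro _ ⟨k, -, rfl⟩; exact hφ k)
      fun a ha b hb s t _ _ _ => (IsTestFun.smul s ha).add (IsTestFun.smul t hb)
  have hne : ∀ n, (convexHull ℝ (φ '' Ici n)).Nonempty := fun n =>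
    ⟨φ n, subset_convexHull _ _ (mem_image_of_mem _ self_mem_Ici)⟩
  -- `m n` is the infimum of the energy over the convex hull of the tail; it increases to some `M`
  set m : ℕ → ℝ := fun n => sInf (J '' convexHull ℝ (φ '' Ici n)) with hm
  have hbdd : ∀ n, BddBelow (J '' convexHull ℝ (φ '' Ici n)) := fun n =>
    ⟨0, by rintro _ ⟨a, -, rfl⟩; exact hJ0 a⟩
  have hmJ : ∀ n, ∀ a ∈ convexHull ℝ (φ '' Ici n), m n ≤ J a := fun n a ha =>
    csInf_le (hbdd n) (mem_image_of_mem _ ha)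
  have hmono : ∀ {k n}, k ≤ n → convexHull ℝ (φ '' Ici n) ⊆ convexHull ℝ (φ '' Ici k) :=
    fun h => convexHull_mono (image_mono (Ici_subset_Ici.2 h))
  have hmB : ∀ n, m n ≤ B := fun n =>
    (hmJ n _ (subset_convexHull _ _ (mem_image_of_mem _ self_mem_Ici))).trans (hB n)
  have hmm : Monotone m := fun k n h =>
    csInf_le_csInf (hbdd k) ((hne n).image _) (image_mono (hmono h))
  obtain ⟨M, hM⟩ : ∃ M, Tendsto m atTop (𝓝 M) :=
    ⟨_, tendsto_atTop_ciSup hmm ⟨B, by rintro _ ⟨n, rfl⟩; exact hmB n⟩⟩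
  have hex : ∀ n : ℕ, ∃ a ∈ convexHull ℝ (φ '' Ici n), J a < m n + 1 / ((n : ℝ) + 1) := fun n => by
    obtain ⟨_, ⟨a, ha, rfl⟩, h⟩ := exists_lt_of_csInf_lt ((hne n).image J)
      (show m n < m n + 1 / ((n : ℝ) + 1) by
        have : 0 < 1 / ((n : ℝ) + 1) := by positivity
        linarith)
    exact ⟨a, ha, h⟩
  choose a ha haJ using hex
  refine ⟨a, ha, fun n => htest n _ (ha n), fun η hη => ?_⟩
  have hB0 : 0 ≤ B := (hJ0 _).trans (hB 0)
  obtain ⟨C, hC0, hC⟩ := exists_norm_sub_rpow_le (d := d) hp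
    (show 0 < η / (4 * (B + 1)) by positivity)
  have hlimJ : Tendsto (fun n : ℕ => m n + 1 / ((n : ℝ) + 1)) atTop (𝓝 (M + 0)) :=
    hM.add tendsto_one_div_add_atTop_nhds_zero_nat
  rw [add_zero] at hlimJ
  have hκ : 0 < η / (4 * (C + 1)) := by positivity
  obtain ⟨N, hN⟩ := eventually_atTop.1
    ((hlimJ.eventually_lt_const (show M < M + η / (4 * (C + 1)) by linarith)).and
      (hM.eventually_const_lt (show M - η / (4 * (C + 1)) < M by linarith)))
  refine ⟨N, fun k hk n hn => ?_⟩
  -- the midpoint of two almost minimizers has energy at least close to `M`, so that the uniform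
  -- convexity forces their gradients to be close to each other
  have hmid : (1 / 2 : ℝ) • (a n + a k) ∈ convexHull ℝ (φ '' Ici N) := by
    rw [smul_add]
    exact convex_convexHull ℝ _ (hmono hn (ha n)) (hmono hk (ha k)) (by norm_num) (by norm_num)
      (by norm_num)
  have hta := htest n _ (ha n)
  have htk := htest k _ (ha k)
  have hgrad : ∀ x, gradient ((1 / 2 : ℝ) • (a n + a k)) x =
      (1 / 2 : ℝ) • (gradient (a n) x + gradient (a k) x) := fun x => by
    rw [(hta.add htk).gradient_smul, hta.gradient_add htk]
    rfl
  have hJmid : M - η / (4 * (C + 1)) < J ((1 / 2 : ℝ) • (a n + a k)) :=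
    (hN N le_rfl).2.trans_le (hmJ N _ hmid)
  have hJn : J (a n) < M + η / (4 * (C + 1)) := (haJ n).trans (hN n hn).1
  have hJk : J (a k) < M + η / (4 * (C + 1)) := (haJ k).trans (hN k hk).1
  have hJB : ∀ n, J (a n) ≤ B + 1 := fun n => by
    have : 1 / ((n : ℝ) + 1) ≤ 1 := by
      rw [div_le_one (by positivity)]
      linarith [Nat.cast_nonneg (α := ℝ) n]
    linarith [haJ n, hmB n]
  have hi := hint (htest N _ hmid)
  have key : ∫ x in Ω, ‖gradient (a n) x - gradient (a k) x‖ ^ p ≤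
      η / (4 * (B + 1)) * (J (a n) + J (a k)) +
        C * (J (a n) / 2 + J (a k) / 2 - J ((1 / 2 : ℝ) • (a n + a k))) := by
    have hr : η / (4 * (B + 1)) * (J (a n) + J (a k)) +
        C * (J (a n) / 2 + J (a k) / 2 - J ((1 / 2 : ℝ) • (a n + a k))) =
        ∫ x in Ω, (η / (4 * (B + 1)) * (‖gradient (a n) x‖ ^ p + ‖gradient (a k) x‖ ^ p) +
          C * (‖gradient (a n) x‖ ^ p / 2 + ‖gradient (a k) x‖ ^ p / 2 -
            ‖gradient ((1 / 2 : ℝ) • (a n + a k)) x‖ ^ p)) := by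
      exact (integral_combination (hint hta) (hint htk) hi _ _).symm
    rw [hr]
    refine integral_mono_of_nonneg (Eventually.of_forall fun x => by positivity) ?_
      (Eventually.of_forall fun x => ?_)
    · have i1 := hint hta
      have i2 := hint htk
      exact ((i1.add i2).const_mul _).add
        ((((i1.div_const 2).add (i2.div_const 2)).sub hi).const_mul _)
    · simp only [hgrad]
      exact hC _ _
  refine key.trans ?_
  have e1 : η / (4 * (B + 1)) * (J (a n) + J (a k)) ≤ η / 2 := by
    calc _ ≤ η / (4 * (B + 1)) * ((B + 1) + (B + 1)) := by
          gcongr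
          · exact hJB n
          · exact hJB k
      _ = η / 2 := by field_simp; ring
  have e2 : C * (J (a n) / 2 + J (a k) / 2 - J ((1 / 2 : ℝ) • (a n + a k))) ≤ η / 2 := by
    calc _ ≤ C * (2 * (η / (4 * (C + 1)))) := by
          gcongr
          linarith
      _ = C / (C + 1) * (η / 2) := by field_simp; ring
      _ ≤ 1 * (η / 2) := by
          gcongr
          rw [div_le_one (by positivity)]
          linarith
      _ = η / 2 := one_mul _
  linarith

/-- A function that is approximated in `L^p(Ω)` by test functions with gradients that are bounded in
`L^p(Ω)` belongs to `W^{1,p}_0(Ω)`. -/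
theorem mem_W1pZero_of_bounded (hp : 1 < p) {Ω : Set (Rn d)} {φ : ℕ → Rn d → ℝ} {w : Rn d → ℝ}
    (hφ : ∀ n, IsTestFun Ω (φ n)) (hw : MemLp w (ENNReal.ofReal p) (volume.restrict Ω))
    (hlim : Tendsto (fun n => eLpNorm (φ n - w) (ENNReal.ofReal p) (volume.restrict Ω))
      atTop (𝓝 0)) {B : ℝ≥0}
    (hB : ∀ n, eLpNorm (gradient (φ n)) (ENNReal.ofReal p) (volume.restrict Ω) ^ p ≤ B) :
    w ∈ W1pZero hp Ω := by
  have hp0 : 0 < p := by linarith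
  have hfact : Fact ((1 : ℝ≥0∞) ≤ ENNReal.ofReal p) := ⟨one_le_ofReal hp⟩
  obtain ⟨a, ha, hat, hac⟩ := exists_convexHull_cauchy hp hφ (B := B) fun n => by
    have h1 := hB n
    rw [(memLp_toReal_rpow hp ((hφ n).memLp_gradient _ _)).2] at h1
    exact (ENNReal.ofReal_le_coe.1 h1)
  -- convex combinations of the tail of a convergent sequence have the same limit
  have halim : Tendsto (fun n => eLpNorm (a n - w) (ENNReal.ofReal p) (volume.restrict Ω))
      atTop (𝓝 0) := by
    rw [ENNReal.tendsto_nhds_zero] at hlim ⊢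
    intro η hη
    obtain ⟨N, hN⟩ := eventually_atTop.1 (hlim η hη)
    filter_upwards [eventually_ge_atTop N] with n hn
    have hsub : convexHull ℝ (φ '' Ici n) ⊆ {b | AEStronglyMeasurable b (volume.restrict Ω) ∧
        eLpNorm (b - w) (ENNReal.ofReal p) (volume.restrict Ω) ≤ η} := by
      refine convexHull_min ?_ fun b hb c hc s t hs ht hst => ?_
      · rintro _ ⟨k, hk, rfl⟩
        exact ⟨(hφ k).1.continuous.aestronglyMeasurable, hN k (hn.trans hk)⟩
      · refine ⟨(hb.1.const_smul s).add (hc.1.const_smul t), ?_⟩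
        have hdec : s • b + t • c - w = s • (b - w) + t • (c - w) := by
          have : w = s • w + t • w := by rw [← add_smul, hst, one_smul]
          conv_lhs => rw [this]
          simp only [smul_sub]
          abel
        rw [hdec]
        refine (eLpNorm_add_le ((hb.1.sub hw.1).const_smul s) ((hc.1.sub hw.1).const_smul t)
          hfact.out).trans ?_
        rw [eLpNorm_const_smul, eLpNorm_const_smul]
        refine (add_le_add (mul_le_mul_right hb.2 _) (mul_le_mul_right hc.2 _)).trans (le_of_eq ?_)
        rw [← add_mul, Real.enorm_of_nonneg hs, Real.enorm_of_nonneg ht,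
          ← ENNReal.ofReal_add hs ht, hst, ENNReal.ofReal_one, one_mul]
    exact (hsub (ha n)).2
  set f : ℕ → Lp (Rn d) (ENNReal.ofReal p) (volume.restrict Ω) := fun n =>
    ((hat n).memLp_gradient _ _).toLp (gradient (a n)) with hf
  have hcau : CauchySeq f := by
    rw [EMetric.cauchySeq_iff]
    intro η hη
    obtain ⟨b, hb0, hb⟩ := ENNReal.lt_iff_exists_real_btwn.1 hη
    have hb' := ENNReal.ofReal_pos.1 hb.1
    obtain ⟨N, hN⟩ := hac (b ^ p) (by positivity)
    refine ⟨N, fun m hm n hn => lt_of_le_of_lt ?_ hb.2⟩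
    rw [Lp.edist_toLp_toLp, ← ENNReal.rpow_le_rpow_iff hp0,
      (memLp_toReal_rpow hp (((hat m).memLp_gradient _ _).sub ((hat n).memLp_gradient _ _))).2,
      ENNReal.ofReal_rpow_of_nonneg hb'.le hp0.le]
    exact ENNReal.ofReal_le_ofReal (hN n hn m hm)
  obtain ⟨G, hG⟩ := cauchySeq_tendsto_of_complete hcau
  have hG' : Tendsto (fun n => eLpNorm (gradient (a n) - (G : Rn d → Rn d)) (ENNReal.ofReal p)
      (volume.restrict Ω)) atTop (𝓝 0) := by
    refine (tendsto_iff_edist_tendsto_0.1 hG).congr fun n => ?_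
    rw [Lp.edist_def]
    exact eLpNorm_congr_ae (((hat n).memLp_gradient _ _).coeFn_toLp.sub EventuallyEq.rfl)
  exact ⟨G, ⟨hw, Lp.memLp G, fun ψ hψ => integral_smul_gradient_of_tendsto hp hw (Lp.memLp G) hat
    halim hG' hψ⟩, a, hat, halim, hG'⟩

end WeakLimits

/-! ### Functions with controlled differences on Lipschitz domains -/

section LipschitzDomain

variable {d : ℕ} {p : ℝ}

/-- Near each point of its closure, a Lipschitz domain contains the translates of its points in a
fixed direction, together with balls of a radius proportional to the translation. -/
theorem HasLipschitzBoundary.exists_cone {Ω : Set (Rn d)} (hΩ : HasLipschitzBoundary Ω)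
    (hΩo : IsOpen Ω) {x : Rn d} (hx : x ∈ closure Ω) :
    ∃ r : ℝ, 0 < r ∧ ∃ e : Rn d, ∃ c : ℝ, 0 < c ∧ c ≤ 1 ∧ ∃ t₀ : ℝ, 0 < t₀ ∧
      ∀ y ∈ ball x r ∩ Ω, ∀ t : ℝ, 0 < t → t < t₀ → ball (y + t • e) (c * t) ⊆ Ω := by
  by_cases hxΩ : x ∈ Ω
  · obtain ⟨r, hr, hrΩ⟩ := Metric.isOpen_iff.1 hΩo x hxΩ
    refine ⟨r / 2, by positivity, 0, 1, one_pos, le_rfl, r / 2, by positivity,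
      fun y hy t ht htr z hz => hrΩ ?_⟩
    rw [smul_zero, add_zero, one_mul, mem_ball] at hz
    have := mem_ball.1 hy.1
    rw [mem_ball]
    linarith [dist_triangle z y x]
  · obtain ⟨r, hr, e, he, L, γ, hγ, hΩγ⟩ := hΩ x (by rw [hΩo.frontier_eq]; exact ⟨hx, hxΩ⟩)
    have hc : 0 < (1 + (L : ℝ))⁻¹ := by positivity
    have hc1 : (1 + (L : ℝ))⁻¹ ≤ 1 := inv_le_one_of_one_le₀ (by simp)
    refine ⟨r / 2, by positivity, e, (1 + (L : ℝ))⁻¹, hc, hc1, r / 4, by positivity,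
      fun y hy t ht htr z hz => ?_⟩
    obtain ⟨q, rfl⟩ : ∃ q, z = y + t • e + q := ⟨z - (y + t • e), by abel⟩
    rw [mem_ball, dist_eq_norm, add_sub_cancel_left] at hz
    have hct : (1 + (L : ℝ))⁻¹ * t ≤ t := mul_le_of_le_one_left ht.le hc1
    have hyx := mem_ball.1 hy.1
    have hz_ball : y + t • e + q ∈ ball x r := by
      rw [mem_ball, dist_eq_norm]
      have h1 : y + t • e + q - x = (y - x) + t • e + q := by abel
      rw [h1]
      have h2 : ‖t • e‖ = t := by rw [norm_smul, he, mul_one, Real.norm_of_nonneg ht.le]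
      rw [dist_eq_norm] at hyx
      linarith [norm_add₃_le (a := y - x) (b := t • e) (c := q)]
    rw [hΩγ _ hz_ball]
    have hyγ := (hΩγ y (ball_subset_ball (by linarith) hy.1)).1 hy.2
    have hee : inner ℝ e e = 1 := by rw [real_inner_self_eq_norm_sq, he, one_pow]
    have hin : inner ℝ e (y + t • e + q) = inner ℝ e y + t + inner ℝ e q := by
      rw [inner_add_right, inner_add_right, real_inner_smul_right, hee, mul_one]
    have hq : |inner ℝ e q| ≤ ‖q‖ := by
      have := abs_real_inner_le_norm e q
      rwa [he, one_mul] at this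
    have hproj : ‖q - inner ℝ e q • e‖ ≤ ‖q‖ := by
      have h1 : ‖q - inner ℝ e q • e‖ ^ 2 = ‖q‖ ^ 2 - (inner ℝ e q) ^ 2 := by
        rw [norm_sub_sq_real, norm_smul, he, real_inner_smul_right, real_inner_comm q e, mul_one,
          Real.norm_eq_abs, sq_abs]
        ring
      refine (sq_le_sq₀ (norm_nonneg _) (norm_nonneg _)).1 ?_
      rw [h1]
      linarith [sq_nonneg (inner ℝ e q)]
    have hγq : γ (y + t • e + q - inner ℝ e (y + t • e + q) • e) ≤
        γ (y - inner ℝ e y • e) + L * ‖q‖ := by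
      have h1 := hγ.dist_le_mul (y + t • e + q - inner ℝ e (y + t • e + q) • e)
        (y - inner ℝ e y • e)
      have h2 : y + t • e + q - inner ℝ e (y + t • e + q) • e - (y - inner ℝ e y • e) =
          q - inner ℝ e q • e := by
        rw [hin, add_smul, add_smul]
        abel
      rw [Real.dist_eq, dist_eq_norm, h2] at h1
      have h3 := (le_abs_self _).trans (h1.trans (mul_le_mul_of_nonneg_left hproj L.2))
      linarith
    have hlt : (1 + (L : ℝ)) * ‖q‖ < t := by
      rwa [inv_mul_eq_div, lt_div_iff₀' (by positivity)] at hz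
    have := neg_le_of_abs_le hq
    linarith

/-- Multiplication by a smooth cut-off function preserves the bounds on the finite differences, by
the product rule for differences. -/
theorem exists_annulus_mul_bound (hp : 1 < p) [NeZero d] {v χ : Rn d → ℝ}
    (hv : MemLp v (ENNReal.ofReal p) volume) {C : ℝ≥0}
    (hA : ∀ δ : ℝ, 0 < δ → δ < 1 → ∫⁻ h in annulus d δ, shiftNorm p v h ^ p ≤
      C * ENNReal.ofReal (δ ^ p) * ENNReal.ofReal (δ ^ d))
    (hχ : ContDiff ℝ ∞ χ) (hχc : HasCompactSupport χ) :
    ∃ C' : ℝ≥0, ∀ δ : ℝ, 0 < δ → δ < 1 →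
      ∫⁻ h in annulus d δ, shiftNorm p (fun x => χ x * v x) h ^ p ≤
        C' * ENNReal.ofReal (δ ^ p) * ENNReal.ofReal (δ ^ d) := by
  have hp0 : 0 < p := by linarith
  obtain ⟨A, hA'⟩ := hχ.continuous.bounded_above_of_compact_support hχc
  obtain ⟨L, hL⟩ := hχ.lipschitzWith_of_hasCompactSupport hχc (by simp)
  have hA0 : 0 ≤ A := (norm_nonneg _).trans (hA' 0)
  set V := eLpNorm v (ENNReal.ofReal p) volume with hV
  have hVt : V ≠ ⊤ := hv.2.ne
  have hb1 : volume (ball (0 : Rn d) 1) ≠ ⊤ := measure_ball_lt_top.ne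
  have hshift : ∀ h : Rn d, shiftNorm p (fun x => χ x * v x) h ≤
      ENNReal.ofReal A * shiftNorm p v h + ENNReal.ofReal (L * ‖h‖) * V := fun h => by
    have hm1 : AEStronglyMeasurable (fun x => χ (x + h) * (v (x + h) - v x)) volume :=
      (hχ.continuous.comp (continuous_add_const h)).aestronglyMeasurable.mul
        ((aestronglyMeasurable_shift hv.1 h).sub hv.1)
    have hm2 : AEStronglyMeasurable (fun x => (χ (x + h) - χ x) * v x) volume :=
      ((hχ.continuous.comp (continuous_add_const h)).sub hχ.continuous).aestronglyMeasurable.mul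
        hv.1
    have hdec : (fun x => χ (x + h) * v (x + h) - χ x * v x) =
        (fun x => χ (x + h) * (v (x + h) - v x)) + fun x => (χ (x + h) - χ x) * v x := by
      funext x
      simp only [Pi.add_apply]
      ring
    unfold shiftNorm
    rw [hdec]
    refine (eLpNorm_add_le hm1 hm2 (one_le_ofReal hp)).trans (add_le_add ?_ ?_)
    · refine eLpNorm_le_mul_eLpNorm_of_ae_le_mul (Eventually.of_forall fun x => ?_) _
      rw [norm_mul]
      exact mul_le_mul_of_nonneg_right (hA' _) (norm_nonneg _)
    · refine eLpNorm_le_mul_eLpNorm_of_ae_le_mul (Eventually.of_forall fun x => ?_) _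
      rw [norm_mul]
      refine mul_le_mul_of_nonneg_right ?_ (norm_nonneg _)
      have := hL.dist_le_mul (x + h) x
      rwa [dist_eq_norm, dist_eq_norm, add_sub_cancel_left] at this
  set C' : ℝ≥0∞ := 2 ^ p * (ENNReal.ofReal A ^ p * C +
    (ENNReal.ofReal (2 * L) * V) ^ p * (2 ^ d * volume (ball (0 : Rn d) 1))) with hC'
  have hC't : C' ≠ ⊤ := by
    refine ENNReal.mul_ne_top (by finiteness) (ENNReal.add_ne_top.2 ⟨ENNReal.mul_ne_top
      (ENNReal.rpow_ne_top_of_nonneg hp0.le (by finiteness)) (by finiteness), ENNReal.mul_ne_top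
      (ENNReal.rpow_ne_top_of_nonneg hp0.le (ENNReal.mul_ne_top (by finiteness) hVt))
      (ENNReal.mul_ne_top (by finiteness) hb1)⟩)
  refine ⟨C'.toNNReal, fun δ hδ hδ1 => ?_⟩
  rw [ENNReal.coe_toNNReal hC't]
  have hpt : ∀ h ∈ annulus d δ, shiftNorm p (fun x => χ x * v x) h ^ p ≤
      2 ^ p * (ENNReal.ofReal A ^ p * shiftNorm p v h ^ p) +
        2 ^ p * ((ENNReal.ofReal (2 * L) * V) ^ p * ENNReal.ofReal (δ ^ p)) := fun h hh => by
    rw [← mul_add]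
    refine (ENNReal.rpow_le_rpow (hshift h) hp0.le).trans ((add_rpow_le_two hp _ _).trans ?_)
    refine mul_le_mul_right (add_le_add (le_of_eq (ENNReal.mul_rpow_of_nonneg _ _ hp0.le)) ?_) _
    rw [← ENNReal.ofReal_rpow_of_nonneg hδ.le hp0.le, ← ENNReal.mul_rpow_of_nonneg _ _ hp0.le]
    refine ENNReal.rpow_le_rpow ?_ hp0.le
    rw [mul_right_comm]
    refine mul_le_mul_left ?_ _
    rw [← ENNReal.ofReal_mul (by positivity)]
    refine ENNReal.ofReal_le_ofReal ?_
    nlinarith [hh.2, L.2]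
  refine (setLIntegral_mono_ae' (measurableSet_annulus δ)
    (Eventually.of_forall hpt)).trans ?_
  rw [lintegral_add_right _ measurable_const, setLIntegral_const,
    lintegral_const_mul' _ _ (by finiteness), lintegral_const_mul' _ _
    (ENNReal.rpow_ne_top_of_nonneg hp0.le (by finiteness))]
  refine (add_le_add (mul_le_mul_right (mul_le_mul_right (hA δ hδ hδ1) _) _)
    (mul_le_mul_right (volume_annulus_le hδ) _)).trans (le_of_eq ?_)
  rw [hC']
  ring

/-- A localized function with controlled differences is pushed into `Ω` by a translation before it
is mollified. -/
theorem mul_mem_W1pZero (hp : 1 < p) [NeZero d] {Ω : Set (Rn d)} (hΩb : Bornology.IsBounded Ω)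
    {v χ : Rn d → ℝ}
    (hv : MemLp v (ENNReal.ofReal p) volume) (h0 : ∀ᵐ x, x ∉ Ω → v x = 0) {C : ℝ≥0}
    (hA : ∀ δ : ℝ, 0 < δ → δ < 1 → ∫⁻ h in annulus d δ, shiftNorm p v h ^ p ≤
      C * ENNReal.ofReal (δ ^ p) * ENNReal.ofReal (δ ^ d))
    (hχ : ContDiff ℝ ∞ χ) (hχc : HasCompactSupport χ) {e : Rn d} {c t₀ : ℝ} (hc : 0 < c)
    (hc1 : c ≤ 1) (ht₀ : 0 < t₀)
    (hcone : ∀ y ∈ tsupport χ ∩ Ω, ∀ t : ℝ, 0 < t → t < t₀ → ball (y + t • e) (c * t) ⊆ Ω) :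
    (fun x => χ x * v x) ∈ W1pZero hp Ω := by
  have hp0 : 0 < p := by linarith
  obtain ⟨C', hC'⟩ := exists_annulus_mul_bound hp hv hA hχ hχc
  obtain ⟨C1, hC1⟩ := exists_mollify_bound d hp
  obtain ⟨A, hA'⟩ := hχ.continuous.bounded_above_of_compact_support hχc
  set w : Rn d → ℝ := fun x => χ x * v x with hw
  have hwL : MemLp w (ENNReal.ofReal p) volume :=
    MemLp.of_le_mul hv (hχ.continuous.aestronglyMeasurable.mul hv.1) (c := A)
      (Eventually.of_forall fun x => by
        rw [hw, norm_mul]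
        exact mul_le_mul_of_nonneg_right (hA' _) (norm_nonneg _))
  have hwl : LocallyIntegrable w volume := hwL.locallyIntegrable (one_le_ofReal hp)
  have hw0 : ∀ᵐ x, x ∉ tsupport χ ∩ Ω → w x = 0 := by
    filter_upwards [h0] with x hx hxK
    by_cases hxχ : x ∈ tsupport χ
    · simp [hw, hx fun h => hxK ⟨hxχ, h⟩]
    · simp [hw, image_eq_zero_of_notMem_tsupport hxχ]
  obtain ⟨s, hs0, hst⟩ : ∃ s : ℝ, 0 < s ∧ s ≤ min t₀ 1 := ⟨min t₀ 1, lt_min ht₀ one_pos, le_rfl⟩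
  -- the support is translated by `t n • e`, and a ball of radius `c t n` around its points stays in
  -- `Ω`; mollification at the scale `δ n = c t n / 4` moves it by at most `2 δ n < c t n`
  set t : ℕ → ℝ := fun n => s / (n + 2) with ht
  have htpos : ∀ n, 0 < t n := fun n => by positivity
  have hts : ∀ n, t n < s := fun n => div_lt_self hs0 (by
    have : (0 : ℝ) ≤ n := Nat.cast_nonneg n
    linarith)
  have htt : ∀ n, t n < t₀ := fun n => (hts n).trans_le (hst.trans (min_le_left _ _))
  have ht1 : ∀ n, t n < 1 := fun n => (hts n).trans_le (hst.trans (min_le_right _ _))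
  have htlim : Tendsto t atTop (𝓝 0) := by
    have h1 : Tendsto (fun n : ℕ => (n : ℝ) + 2) atTop atTop :=
      tendsto_atTop_add_const_right _ _ tendsto_natCast_atTop_atTop
    exact h1.const_div_atTop s
  set δ : ℕ → ℝ := fun n => c * t n / 4 with hδ
  have hδpos : ∀ n, 0 < δ n := fun n => by have := htpos n; positivity
  have hδ1 : ∀ n, δ n < 1 := fun n => by
    have := htpos n; have := ht1 n
    simp only [hδ]
    nlinarith
  have hδlim : Tendsto δ atTop (𝓝[>] 0) := by
    refine tendsto_nhdsWithin_iff.2 ⟨?_, Eventually.of_forall hδpos⟩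
    have := (htlim.const_mul c).div_const 4
    simpa using this
  set φ : ℕ → Rn d → ℝ := fun n x => mollify (δ n) w (x + -(t n • e)) with hφ
  have hmsm : ∀ n, ContDiff ℝ ∞ (mollify (δ n) w) := fun n => contDiff_mollify (hδpos n) hwl
  have hφsm : ∀ n, ContDiff ℝ ∞ (φ n) := fun n => (hmsm n).comp (contDiff_id.add contDiff_const)
  have hsupp : ∀ n, tsupport (φ n) ⊆ Ω := fun n => by
    set S : Set (Rn d) := (fun y => y + t n • e) '' (tsupport χ ∩ Ω) with hS
    have h1 : Function.support (φ n) ⊆ thickening (2 * δ n) S := fun x hx => by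
      by_contra hxS
      refine hx (mollify_eq_zero (hδpos n) hw0 fun y hy => ?_)
      by_contra hlt
      refine hxS (mem_thickening_iff.2 ⟨_, mem_image_of_mem _ hy, ?_⟩)
      rw [not_le, dist_eq_norm] at hlt
      have h3 : x - (y + t n • e) = x + -(t n • e) - y := by abel
      rwa [dist_eq_norm, h3]
    have h2 : thickening (c * t n) S ⊆ Ω := fun x hx => by
      obtain ⟨_, ⟨y, hy, rfl⟩, hxy⟩ := mem_thickening_iff.1 hx
      exact hcone y hy _ (htpos n) (htt n) hxy
    refine ((closure_mono h1).trans (closure_thickening_subset_cthickening _ _)).trans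
      (subset_trans ?_ h2)
    have h3 : ((⟨2 * δ n, by have := hδpos n; positivity⟩ : ℝ≥0) : ℝ) < c * t n := by
      have : 0 < c * t n := mul_pos hc (htpos n)
      change 2 * (c * t n / 4) < c * t n
      linarith
    exact cthickening_subset_thickening h3 S
  have hφt : ∀ n, IsTestFun Ω (φ n) := fun n => ⟨hφsm n,
    Metric.isCompact_of_isClosed_isBounded (isClosed_tsupport _) (hΩb.subset (hsupp n)), hsupp n⟩
  refine mem_W1pZero_of_bounded hp hφt (hwL.restrict Ω) ?_ (B := C1 * C') fun n => ?_
  · have h1 := (tendsto_mollify hp hwL).comp hδlim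
    have h2 : Tendsto (fun n => shiftNorm p w (-(t n • e))) atTop (𝓝 0) := by
      refine (tendsto_shiftNorm hp hwL).comp ?_
      simpa using (htlim.smul_const e).neg
    have h3 := h1.add h2
    rw [add_zero] at h3
    refine tendsto_of_tendsto_of_tendsto_of_le_of_le tendsto_const_nhds h3 (fun _ => bot_le)
      fun n => (eLpNorm_restrict_le _ _ _ _).trans ?_
    have hm : AEStronglyMeasurable (mollify (δ n) w - w) volume :=
      (hmsm n).continuous.aestronglyMeasurable.sub hwL.1
    have hdec : φ n - w = (fun x => (mollify (δ n) w - w) (x + -(t n • e))) +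
        fun x => w (x + -(t n • e)) - w x := by
      funext x
      simp [hφ]
    rw [hdec]
    refine (eLpNorm_add_le (aestronglyMeasurable_shift hm _)
      ((aestronglyMeasurable_shift hwL.1 _).sub hwL.1) (one_le_ofReal hp)).trans ?_
    rw [eLpNorm_shift hm]
    exact le_rfl
  · have h1 : gradient (φ n) = fun x => gradient (mollify (δ n) w) (x + -(t n • e)) := by
      funext x
      simp only [gradient, hφ, fderiv_comp_add_right]
    have h2 : AEStronglyMeasurable (gradient (mollify (δ n) w)) volume :=
      (continuous_gradient ((hmsm n).of_le (by simp))).aestronglyMeasurable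
    refine (ENNReal.rpow_le_rpow (eLpNorm_restrict_le _ _ _ _) hp0.le).trans ?_
    rw [h1, eLpNorm_shift h2]
    refine ((hC1 _ (hδpos n) w hwL).2.trans
      (mul_le_mul_right (hC' _ (hδpos n) (hδ1 n)) _)).trans (le_of_eq ?_)
    have hδn := hδpos n
    have e1 : ENNReal.ofReal ((δ n ^ p)⁻¹) * ENNReal.ofReal (δ n ^ p) = 1 := by
      rw [← ENNReal.ofReal_mul (by positivity), inv_mul_cancel₀ (by positivity), ENNReal.ofReal_one]
    have e2 : ENNReal.ofReal ((δ n ^ d)⁻¹) * ENNReal.ofReal (δ n ^ d) = 1 := by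
      rw [← ENNReal.ofReal_mul (by positivity), inv_mul_cancel₀ (by positivity), ENNReal.ofReal_one]
    calc _ = (C1 : ℝ≥0∞) * C' * (ENNReal.ofReal ((δ n ^ p)⁻¹) * ENNReal.ofReal (δ n ^ p)) *
          (ENNReal.ofReal ((δ n ^ d)⁻¹) * ENNReal.ofReal (δ n ^ d)) := by ring
      _ = _ := by
        rw [e1, e2]
        simp

theorem HasSobolevGrad.congr {U : Set (Rn d)} {u w : Rn d → ℝ} {G H : Rn d → Rn d}
    (h : HasSobolevGrad p U u G) (huw : u =ᵐ[volume.restrict U] w)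
    (hGH : G =ᵐ[volume.restrict U] H) : HasSobolevGrad p U w H := by
  refine ⟨h.memLp.ae_eq huw, h.memLp_grad.ae_eq hGH, fun φ hφ => ?_⟩
  have e1 : (fun x => u x • gradient φ x) =ᵐ[volume.restrict U] fun x => w x • gradient φ x :=
    huw.mono fun x hx => by simp only [hx]
  have e2 : (fun x => φ x • G x) =ᵐ[volume.restrict U] fun x => φ x • H x :=
    hGH.mono fun x hx => by simp only [hx]
  rw [← integral_congr_ae e1, ← integral_congr_ae e2, h.integral_eq φ hφ]

theorem mem_W1pZero_congr (hp : 1 < p) {Ω : Set (Rn d)} {u w : Rn d → ℝ} (hu : u ∈ W1pZero hp Ω)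
    (h : u =ᵐ[volume.restrict Ω] w) : w ∈ W1pZero hp Ω := by
  obtain ⟨G, hG, φ, hφ, h1, h2⟩ := hu
  refine ⟨G, hG.congr h EventuallyEq.rfl, φ, hφ, h1.congr fun n => ?_, h2⟩
  exact eLpNorm_congr_ae (EventuallyEq.rfl.sub h)

/-- A function that vanishes outside of a Lipschitz domain `Ω` and satisfies the bounds on finite
differences that are typical of Sobolev functions belongs to `W^{1,p}_0(Ω)`. The function is
localized by a partition of unity to balls in which `Ω` admits a direction that points inwards. -/
theorem mem_W1pZero_of_annulus_bound (hp : 1 < p) [NeZero d] {Ω : Set (Rn d)} (hΩo : IsOpen Ω)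
    (hΩb : Bornology.IsBounded Ω) (hΩL : HasLipschitzBoundary Ω) {v : Rn d → ℝ}
    (hv : MemLp v (ENNReal.ofReal p) volume) (h0 : ∀ᵐ x, x ∉ Ω → v x = 0) {C : ℝ≥0}
    (hA : ∀ δ : ℝ, 0 < δ → δ < 1 → ∫⁻ h in annulus d δ, shiftNorm p v h ^ p ≤
      C * ENNReal.ofReal (δ ^ p) * ENNReal.ofReal (δ ^ d)) : v ∈ W1pZero hp Ω := by
  choose! r hr e c hc hc1 t₀ ht₀ hcone using fun x (hx : x ∈ closure Ω) => hΩL.exists_cone hΩo hx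
  have hcpt : IsCompact (closure Ω) := hΩb.isCompact_closure
  obtain ⟨I, hIΩ, hI⟩ := hcpt.elim_nhds_subcover (fun x => ball x (r x))
    fun x hx => ball_mem_nhds x (hr x hx)
  obtain ⟨f, hf⟩ := SmoothPartitionOfUnity.exists_isSubordinate 𝓘(ℝ, Rn d) (s := closure Ω)
    isClosed_closure (fun i : I => ball (i : Rn d) (r i)) (fun i => isOpen_ball)
    (hI.trans (iUnion₂_subset fun x hx => subset_iUnion_of_subset ⟨x, hx⟩ subset_rfl))
  have hmem : ∀ i : I, (fun x => f i x * v x) ∈ W1pZero hp Ω := fun i => by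
    have hi := hIΩ i i.2
    refine mul_mem_W1pZero hp hΩb hv h0 hA (f i).contMDiff.contDiff ?_ (hc _ hi) (hc1 _ hi)
      (ht₀ _ hi) (e := e i) fun y hy => hcone _ hi y ⟨hf i hy.1, hy.2⟩
    exact Metric.isCompact_of_isClosed_isBounded (isClosed_tsupport _)
      (isBounded_ball.subset (hf i))
  refine mem_W1pZero_congr hp (Submodule.sum_mem _ fun i (_ : i ∈ Finset.univ) => hmem i) ?_
  rw [EventuallyEq, ae_restrict_iff' hΩo.measurableSet]
  refine Eventually.of_forall fun x hx => ?_
  have h1 := f.sum_eq_one (subset_closure hx)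
  rw [finsum_eq_sum_of_fintype] at h1
  rw [Finset.sum_apply, ← Finset.sum_mul, h1, one_mul]

end LipschitzDomain

/-! ### The nonlocal form in the variables `(h, x)` -/

section PairMeasure

variable {d : ℕ} {p : ℝ}

/-- The measure `ν(h) dh`. -/
noncomputable abbrev kernelMeasure (ν : RadialLevyKernel d p) : Measure (Rn d) :=
  volume.withDensity fun h => (ν.toFun h : ℝ≥0∞)

/-- The measure `ν(h) dh dx` on the pairs `(h, x)`. -/
noncomputable abbrev pairMeasure (ν : RadialLevyKernel d p) : Measure (Rn d × Rn d) :=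
  (kernelMeasure ν).prod volume

/-- The finite difference `w(x + h) - w(x)` as a function of `(h, x)`. -/
def difference (w : Rn d → ℝ) (z : Rn d × Rn d) : ℝ := w (z.2 + z.1) - w z.2

/-- The change of variables `(h, x) ↦ (x + h, x)`. -/
def pairMap (d : ℕ) (z : Rn d × Rn d) : Rn d × Rn d := (z.2 + z.1, z.2)

theorem difference_sub (u v : Rn d → ℝ) : difference (u - v) = difference u - difference v := by
  funext z
  simp only [difference, Pi.sub_apply]
  ring

theorem kernel_aemeasurable (ν : RadialLevyKernel d p) :
    AEMeasurable (fun h => (ν.toFun h : ℝ≥0∞)) volume := ν.aemeasurable.coe_nnreal_ennreal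

theorem kernelMeasure_absolutelyContinuous (ν : RadialLevyKernel d p) :
    kernelMeasure ν ≪ volume := withDensity_absolutelyContinuous _ _

theorem pairMeasure_absolutelyContinuous (ν : RadialLevyKernel d p) :
    pairMeasure ν ≪ (volume : Measure (Rn d)).prod volume :=
  (kernelMeasure_absolutelyContinuous ν).prod Measure.AbsolutelyContinuous.rfl

theorem measurePreserving_pairMap_volume :
    MeasurePreserving (pairMap d) (volume.prod volume) (volume.prod volume) := by
  have h : pairMap d = fun z => (z.1 + z.2, z.2) := by
    funext z
    rw [pairMap, add_comm]
  rw [h]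
  exact measurePreserving_add_prod volume volume

theorem measurePreserving_pairMap (ν : RadialLevyKernel d p) :
    MeasurePreserving (pairMap d) (pairMeasure ν)
      ((volume : Measure (Rn d × Rn d)).withDensity fun z => (ν.toFun (z.1 - z.2) : ℝ≥0∞)) := by
  have hT := measurePreserving_pairMap_volume (d := d)
  have hρ : AEMeasurable (fun z : Rn d × Rn d => (ν.toFun (z.1 - z.2) : ℝ≥0∞))
      (volume.prod volume) := (kernel_aemeasurable ν).comp_quasiMeasurePreserving
        (quasiMeasurePreserving_sub volume volume)
  refine ⟨hT.measurable, ?_⟩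
  ext s hs
  rw [Measure.map_apply hT.measurable hs, pairMeasure, kernelMeasure,
    prod_withDensity_left₀ (kernel_aemeasurable ν),
    withDensity_apply _ (hT.measurable hs), withDensity_apply _ hs, Measure.volume_eq_prod]
  have hr := hT.restrict_preimage hs
  have h1 := lintegral_map' (μ := (volume.prod volume).restrict (pairMap d ⁻¹' s)) (g := pairMap d)
    (f := fun z : Rn d × Rn d => (ν.toFun (z.1 - z.2) : ℝ≥0∞))
    (by rw [hr.map_eq]; exact hρ.restrict) hT.measurable.aemeasurable
  rw [hr.map_eq] at h1
  rw [h1]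
  simp [pairMap]

theorem aestronglyMeasurable_difference (ν : RadialLevyKernel d p) {w : Rn d → ℝ}
    (hw : AEStronglyMeasurable w volume) :
    AEStronglyMeasurable (difference w) (pairMeasure ν) := by
  refine AEStronglyMeasurable.mono_ac (pairMeasure_absolutelyContinuous ν) ?_
  have h1 : Measure.QuasiMeasurePreserving (fun z : Rn d × Rn d => z.2 + z.1)
      (volume.prod volume) volume :=
    Measure.quasiMeasurePreserving_fst.comp
      (measurePreserving_pairMap_volume (d := d)).quasiMeasurePreserving
  exact (hw.comp_quasiMeasurePreserving h1).sub
    (hw.comp_quasiMeasurePreserving Measure.quasiMeasurePreserving_snd)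

theorem aestronglyMeasurable_pair {F : Rn d × Rn d → ℝ} (ν : RadialLevyKernel d p)
    (hF : AEStronglyMeasurable F volume) {S : Set (Rn d × Rn d)} :
    AEStronglyMeasurable F (((volume : Measure (Rn d × Rn d)).withDensity
      fun z => (ν.toFun (z.1 - z.2) : ℝ≥0∞)).restrict S) :=
  (hF.mono_ac (withDensity_absolutelyContinuous _ _)).restrict

theorem aestronglyMeasurable_sub_pair {w : Rn d → ℝ} (hw : AEStronglyMeasurable w volume) :
    AEStronglyMeasurable (fun z : Rn d × Rn d => w z.1 - w z.2) volume :=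
  (hw.comp_quasiMeasurePreserving Measure.quasiMeasurePreserving_fst).sub
    (hw.comp_quasiMeasurePreserving Measure.quasiMeasurePreserving_snd)

theorem kernel_sub_aemeasurable (ν : RadialLevyKernel d p) :
    AEMeasurable (fun z : Rn d × Rn d => ν.toFun (z.1 - z.2)) volume :=
  ν.aemeasurable.comp_quasiMeasurePreserving (quasiMeasurePreserving_sub volume volume)

theorem pairEnergy_eq_difference (hp : 1 < p) (ν : RadialLevyKernel d p) {S : Set (Rn d × Rn d)}
    (hS : MeasurableSet S) {w : Rn d → ℝ} (hw : AEStronglyMeasurable w volume) :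
    pairEnergy ν S w = ∫⁻ z in pairMap d ⁻¹' S, ‖difference w z‖ₑ ^ p ∂(pairMeasure ν) := by
  have hT := (measurePreserving_pairMap ν).restrict_preimage hS
  have hm := aestronglyMeasurable_sub_pair hw
  have h1 := lintegral_map' (μ := (pairMeasure ν).restrict (pairMap d ⁻¹' S)) (g := pairMap d)
    (f := fun z : Rn d × Rn d => ‖w z.1 - w z.2‖ₑ ^ p) (by
      rw [hT.map_eq]
      exact ((aestronglyMeasurable_pair ν hm).enorm).pow_const p) hT.measurable.aemeasurable
  rw [hT.map_eq] at h1
  rw [show (∫⁻ z in pairMap d ⁻¹' S, ‖difference w z‖ₑ ^ p ∂(pairMeasure ν)) = _ from h1.symm,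
    setLIntegral_withDensity_eq_setLIntegral_mul_non_measurable₀ _
      (kernel_sub_aemeasurable ν).coe_nnreal_ennreal.restrict _ hS (by simp)]
  unfold pairEnergy
  refine lintegral_congr fun z => ?_
  rw [ofReal_abs_rpow hp, mul_comm]
  rfl

theorem nonlocalForm_eq_difference (hp : 1 < p) (ν : RadialLevyKernel d p) {Ω : Set (Rn d)}
    (hΩ : MeasurableSet Ω) {u v : Rn d → ℝ} (hu : AEStronglyMeasurable u volume)
    (hv : AEStronglyMeasurable v volume) :
    nonlocalForm ν Ω u v = ∫ z in pairMap d ⁻¹' (Ωᶜ ×ˢ Ωᶜ)ᶜ,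
      signedPow p (difference u z) * difference v z ∂(pairMeasure ν) := by
  have hS : MeasurableSet ((Ωᶜ ×ˢ Ωᶜ)ᶜ : Set (Rn d × Rn d)) := (hΩ.compl.prod hΩ.compl).compl
  have hT := (measurePreserving_pairMap ν).restrict_preimage hS
  have hm : AEStronglyMeasurable (fun z : Rn d × Rn d =>
      signedPow p (u z.1 - u z.2) * (v z.1 - v z.2)) volume :=
    ((continuous_signedPow hp).comp_aestronglyMeasurable (aestronglyMeasurable_sub_pair hu)).mul
      (aestronglyMeasurable_sub_pair hv)
  have h1 := integral_map (μ := (pairMeasure ν).restrict (pairMap d ⁻¹' (Ωᶜ ×ˢ Ωᶜ)ᶜ))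
    hT.measurable.aemeasurable (f := fun z : Rn d × Rn d =>
      signedPow p (u z.1 - u z.2) * (v z.1 - v z.2)) (by
      rw [hT.map_eq]
      exact aestronglyMeasurable_pair ν hm)
  rw [hT.map_eq] at h1
  rw [show (∫ z in pairMap d ⁻¹' (Ωᶜ ×ˢ Ωᶜ)ᶜ, signedPow p (difference u z) * difference v z
    ∂(pairMeasure ν)) = _ from h1.symm,
    setIntegral_withDensity_eq_setIntegral_smul₀ (kernel_sub_aemeasurable ν).restrict _ hS]
  unfold nonlocalForm
  refine integral_congr_ae (Eventually.of_forall fun z => ?_)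
  simp only [signedPow, NNReal.smul_def, smul_eq_mul]
  ring

theorem lintegral_pairMeasure_prod (ν : RadialLevyKernel d p) {B : Set (Rn d)}
    (hB : MeasurableSet B) {f : Rn d × Rn d → ℝ≥0∞} (hf : AEMeasurable f (pairMeasure ν)) :
    ∫⁻ z in B ×ˢ univ, f z ∂(pairMeasure ν) =
      ∫⁻ h in B, (∫⁻ x, f (h, x)) * (ν.toFun h : ℝ≥0∞) := by
  have h1 : (pairMeasure ν).restrict (B ×ˢ univ) = ((kernelMeasure ν).restrict B).prod volume := by
    rw [← Measure.prod_restrict, Measure.restrict_univ]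
  rw [h1, lintegral_prod _ (by rw [← h1]; exact hf.restrict),
    setLIntegral_withDensity_eq_setLIntegral_mul_non_measurable₀ _
      (kernel_aemeasurable ν).restrict _ hB (by simp)]
  refine lintegral_congr fun h => ?_
  rw [mul_comm]
  rfl

theorem lintegral_difference_prod (hp : 1 < p) (ν : RadialLevyKernel d p) {B : Set (Rn d)}
    (hB : MeasurableSet B) {w : Rn d → ℝ} (hw : AEStronglyMeasurable w volume) :
    ∫⁻ z in B ×ˢ univ, ‖difference w z‖ₑ ^ p ∂(pairMeasure ν) =
      ∫⁻ h in B, shiftNorm p w h ^ p * (ν.toFun h : ℝ≥0∞) := by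
  rw [lintegral_pairMeasure_prod ν hB
    ((aestronglyMeasurable_difference ν hw).enorm.pow_const p)]
  refine lintegral_congr fun h => ?_
  rw [shiftNorm_rpow hp]
  rfl

theorem integrable_signedPow_mul (hp : 1 < p) {S : Type*} [MeasurableSpace S] {m : Measure S}
    {f g : S → ℝ} (hf : MemLp f (ENNReal.ofReal p) m) (hg : MemLp g (ENNReal.ofReal p) m) :
    Integrable (fun x => signedPow p (f x) * g x) m := by
  have hp0 : 0 < p := by linarith
  obtain ⟨C, hC0, hC⟩ := exists_abs_signedPow_mul_le hp one_pos
  have hint : ∀ {f : S → ℝ}, MemLp f (ENNReal.ofReal p) m → Integrable (fun x => |f x| ^ p) m :=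
    fun hf => by
    have := hf.integrable_norm_rpow (by simpa using hp0) ENNReal.ofReal_ne_top
    simpa [ENNReal.toReal_ofReal hp0.le] using this
  refine (((hint hf).const_mul 1).add ((hint hg).const_mul C)).mono'
    (((continuous_signedPow hp).comp_aestronglyMeasurable hf.1).mul hg.1)
    (Eventually.of_forall fun x => hC _ _)

theorem enorm_integral_signedPow_le {S : Type*} [MeasurableSpace S] {m : Measure S} (hp : 1 < p)
    {η C : ℝ} (hη : 0 ≤ η) (hC0 : 0 ≤ C)
    (hC : ∀ a c : ℝ, |signedPow p a * c| ≤ η * |a| ^ p + C * |c| ^ p) {f g : S → ℝ}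
    (hf : AEStronglyMeasurable f m) :
    ∫⁻ x, ‖signedPow p (f x) * g x‖ₑ ∂m ≤
      ENNReal.ofReal η * ∫⁻ x, ‖f x‖ₑ ^ p ∂m + ENNReal.ofReal C * ∫⁻ x, ‖g x‖ₑ ^ p ∂m := by
  rw [← lintegral_const_mul' _ _ ENNReal.ofReal_ne_top,
    ← lintegral_const_mul' _ _ ENNReal.ofReal_ne_top,
    ← lintegral_add_left' ((hf.enorm.pow_const p).const_mul _)]
  refine lintegral_mono fun x => ?_
  rw [Real.enorm_eq_ofReal_abs]
  refine (ENNReal.ofReal_le_ofReal (hC _ _)).trans (le_of_eq ?_)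
  rw [ENNReal.ofReal_add (by positivity) (by positivity), ENNReal.ofReal_mul hη,
    ENNReal.ofReal_mul hC0, ofReal_abs_rpow hp, ofReal_abs_rpow hp]

theorem enorm_integral_signedPow_sub_le {S : Type*} [MeasurableSpace S] {m : Measure S}
    (hp : 1 < p) {η C : ℝ} (hη : 0 ≤ η) (hC0 : 0 ≤ C)
    (hC : ∀ a b c d : ℝ, |signedPow p a * c - signedPow p b * d| ≤
      η * (|a| ^ p + |b| ^ p + |c| ^ p + |d| ^ p) + C * (|a - b| ^ p + |c - d| ^ p))
    {f₁ f₂ g₁ g₂ : S → ℝ} (hf₁ : AEStronglyMeasurable f₁ m) (hf₂ : AEStronglyMeasurable f₂ m)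
    (hg₁ : AEStronglyMeasurable g₁ m) (hg₂ : AEStronglyMeasurable g₂ m) :
    ∫⁻ x, ‖signedPow p (f₁ x) * g₁ x - signedPow p (f₂ x) * g₂ x‖ₑ ∂m ≤
      ENNReal.ofReal η * (∫⁻ x, ‖f₁ x‖ₑ ^ p ∂m + ∫⁻ x, ‖f₂ x‖ₑ ^ p ∂m + ∫⁻ x, ‖g₁ x‖ₑ ^ p ∂m +
        ∫⁻ x, ‖g₂ x‖ₑ ^ p ∂m) +
      ENNReal.ofReal C * (∫⁻ x, ‖f₁ x - f₂ x‖ₑ ^ p ∂m + ∫⁻ x, ‖g₁ x - g₂ x‖ₑ ^ p ∂m) := by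
  have m1 : AEMeasurable (fun x => ‖f₁ x‖ₑ ^ p) m := hf₁.enorm.pow_const p
  have m2 := hf₂.enorm.pow_const p
  have m3 := hg₁.enorm.pow_const p
  have m4 := hg₂.enorm.pow_const p
  have m5 : AEMeasurable (fun x => ‖f₁ x - f₂ x‖ₑ ^ p) m := (hf₁.sub hf₂).enorm.pow_const p
  have m12 : AEMeasurable (fun x => ‖f₁ x‖ₑ ^ p + ‖f₂ x‖ₑ ^ p) m := m1.add m2
  have m123 : AEMeasurable (fun x => ‖f₁ x‖ₑ ^ p + ‖f₂ x‖ₑ ^ p + ‖g₁ x‖ₑ ^ p) m := m12.add m3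
  have m1234 : AEMeasurable (fun x => ‖f₁ x‖ₑ ^ p + ‖f₂ x‖ₑ ^ p + ‖g₁ x‖ₑ ^ p + ‖g₂ x‖ₑ ^ p) m :=
    m123.add m4
  rw [← lintegral_add_left' m1, ← lintegral_add_left' m12, ← lintegral_add_left' m123,
    ← lintegral_add_left' m5, ← lintegral_const_mul' _ _ ENNReal.ofReal_ne_top,
    ← lintegral_const_mul' _ _ ENNReal.ofReal_ne_top,
    ← lintegral_add_left' (m1234.const_mul _)]
  refine lintegral_mono fun x => ?_
  rw [Real.enorm_eq_ofReal_abs]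
  refine (ENNReal.ofReal_le_ofReal (hC _ _ _ _)).trans (le_of_eq ?_)
  rw [ENNReal.ofReal_add (by positivity) (by positivity), ENNReal.ofReal_mul hη,
    ENNReal.ofReal_mul hC0, ENNReal.ofReal_add (by positivity) (by positivity),
    ENNReal.ofReal_add (by positivity) (by positivity),
    ENNReal.ofReal_add (by positivity) (by positivity),
    ENNReal.ofReal_add (by positivity) (by positivity)]
  simp only [ofReal_abs_rpow hp]

end PairMeasure

/-! ### Convergence of the nonlocal forms of Sobolev functions -/

section SobolevForms

variable {d : ℕ} {p : ℝ}

theorem exists_ofReal_mul_le {A κ : ℝ≥0∞} (hA : A ≠ ⊤) (hκ : 0 < κ) :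
    ∃ η : ℝ, 0 < η ∧ ENNReal.ofReal η * A ≤ κ := by
  have h : Tendsto (fun η : ℝ => ENNReal.ofReal η * A) (𝓝[>] 0) (𝓝 0) := by
    have h1 : Tendsto (fun η : ℝ => ENNReal.ofReal η) (𝓝[>] 0) (𝓝 (ENNReal.ofReal 0)) :=
      (ENNReal.continuous_ofReal.tendsto 0).mono_left nhdsWithin_le_nhds
    simpa using ENNReal.Tendsto.mul_const h1 (Or.inr hA)
  obtain ⟨η, h1, h2⟩ := ((h.eventually_le_const hκ).and self_mem_nhdsWithin).exists
  exact ⟨η, h2, h1⟩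

theorem HasSobolevGrad.pairEnergy_le (hp : 1 < p) {U : Rn d → ℝ} {G : Rn d → Rn d}
    (hU : HasSobolevGrad p univ U G) {ν : RadialLevyKernel d p}
    (hν : ∫⁻ h, ENNReal.ofReal (min 1 (‖h‖ ^ p)) * (ν.toFun h : ℝ≥0∞) = 1) :
    pairEnergy ν univ U ≤ eLpNorm G (ENNReal.ofReal p) volume ^ p +
      (2 * eLpNorm U (ENNReal.ofReal p) volume) ^ p := by
  have hp0 : 0 < p := by linarith
  set K := eLpNorm G (ENNReal.ofReal p) volume ^ p +
    (2 * eLpNorm U (ENNReal.ofReal p) volume) ^ p with hK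
  have hKt : K ≠ ⊤ := ENNReal.add_ne_top.2
    ⟨ENNReal.rpow_ne_top_of_nonneg hp0.le hU.memLp_grad_univ.2.ne,
      ENNReal.rpow_ne_top_of_nonneg hp0.le (ENNReal.mul_ne_top (by simp) hU.memLp_univ.2.ne)⟩
  rw [pairEnergy_univ_eq hp ν hU.memLp_univ.1]
  calc _ ≤ ∫⁻ h, K * (ENNReal.ofReal (min 1 (‖h‖ ^ p)) * (ν.toFun h : ℝ≥0∞)) := by
        refine lintegral_mono fun h => ?_
        rw [← mul_assoc]
        refine mul_le_mul_left ?_ _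
        rcases le_total (‖h‖) 1 with h1 | h1
        · rw [min_eq_right (Real.rpow_le_one (norm_nonneg _) h1 hp0.le), mul_comm]
          exact (hU.shiftNorm_le hp h).trans (mul_le_mul_right le_self_add _)
        · rw [min_eq_left (Real.one_le_rpow h1 hp0.le), ENNReal.ofReal_one, mul_one]
          exact (ENNReal.rpow_le_rpow (shiftNorm_le_two_mul hp hU.memLp_univ.1 h) hp0.le).trans
            le_add_self
    _ = K := by rw [lintegral_const_mul' _ _ hKt, hν, mul_one]

theorem lintegral_norm_le_one (hp : 1 < p) {ν : RadialLevyKernel d p}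
    (hν : ∫⁻ h, ENNReal.ofReal (min 1 (‖h‖ ^ p)) * (ν.toFun h : ℝ≥0∞) = 1) {r : ℝ} (hr : r ≤ 1) :
    ∫⁻ h in {h : Rn d | ‖h‖ ≤ r}, ENNReal.ofReal (‖h‖ ^ p) * (ν.toFun h : ℝ≥0∞) ≤ 1 := by
  have hms : MeasurableSet {h : Rn d | ‖h‖ ≤ r} := measurableSet_le measurable_norm measurable_const
  rw [← hν]
  refine le_trans (setLIntegral_mono_ae' hms (Eventually.of_forall fun h hh => ?_))
    (setLIntegral_le_lintegral {h : Rn d | ‖h‖ ≤ r} _)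
  rw [min_eq_right (Real.rpow_le_one (norm_nonneg _) (le_trans hh hr) (by linarith))]

/-- The contribution of the large `h` to the energy is controlled by the mass of the kernel
there. -/
theorem lintegral_difference_far_le (hp : 1 < p) (ν : RadialLevyKernel d p) {w : Rn d → ℝ}
    (hw : MemLp w (ENNReal.ofReal p) volume) (r : ℝ) :
    ∫⁻ z in {h : Rn d | r < ‖h‖} ×ˢ univ, ‖difference w z‖ₑ ^ p ∂(pairMeasure ν) ≤
      (2 * eLpNorm w (ENNReal.ofReal p) volume) ^ p *
        ∫⁻ h in {h : Rn d | r < ‖h‖}, (ν.toFun h : ℝ≥0∞) := by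
  have hp0 : 0 < p := by linarith
  rw [lintegral_difference_prod hp ν (measurableSet_lt measurable_const measurable_norm) hw.1,
    ← lintegral_const_mul' _ _ (ENNReal.rpow_ne_top_of_nonneg hp0.le
      (ENNReal.mul_ne_top (by simp) hw.2.ne))]
  exact lintegral_mono fun h => mul_le_mul_left
    (ENNReal.rpow_le_rpow (shiftNorm_le_two_mul hp hw.1 h) hp0.le) _

/-- The contribution of the small `h`, for functions that are of order `|h|^p`. -/
theorem lintegral_near_le {ν : RadialLevyKernel d p} {r : ℝ} {K : ℝ≥0∞} (hK : K ≠ ⊤)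
    (hν : ∫⁻ h in {h : Rn d | ‖h‖ ≤ r}, ENNReal.ofReal (‖h‖ ^ p) * (ν.toFun h : ℝ≥0∞) ≤ 1)
    {f : Rn d × Rn d → ℝ≥0∞} (hf : AEMeasurable f (pairMeasure ν))
    (hfK : ∀ h : Rn d, ‖h‖ ≤ r → ∫⁻ x, f (h, x) ≤ ENNReal.ofReal (‖h‖ ^ p) * K) :
    ∫⁻ z in {h : Rn d | ‖h‖ ≤ r} ×ˢ univ, f z ∂(pairMeasure ν) ≤ K := by
  have hms : MeasurableSet {h : Rn d | ‖h‖ ≤ r} := measurableSet_le measurable_norm measurable_const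
  rw [lintegral_pairMeasure_prod ν hms hf]
  calc _ ≤ ∫⁻ h in {h : Rn d | ‖h‖ ≤ r},
          K * (ENNReal.ofReal (‖h‖ ^ p) * (ν.toFun h : ℝ≥0∞)) := by
        refine setLIntegral_mono_ae' hms (Eventually.of_forall fun h hh => ?_)
        rw [← mul_assoc, mul_comm K]
        exact mul_le_mul_left (hfK h hh) _
    _ ≤ K := by
        rw [lintegral_const_mul' _ _ hK]
        exact mul_le_of_le_one_right' hν

theorem aestronglyMeasurable_inner_pair (ν : RadialLevyKernel d p) {G : Rn d → Rn d}
    (hG : AEStronglyMeasurable G volume) :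
    AEStronglyMeasurable (fun z : Rn d × Rn d => inner ℝ (G z.2) z.1) (pairMeasure ν) := by
  refine AEStronglyMeasurable.mono_ac (pairMeasure_absolutelyContinuous ν) ?_
  exact (hG.comp_quasiMeasurePreserving Measure.quasiMeasurePreserving_snd).inner
    measurable_fst.aestronglyMeasurable

theorem lintegral_inner_le (hp : 1 < p) (G : Rn d → Rn d) (h : Rn d) :
    ∫⁻ x, ‖inner ℝ (G x) h‖ₑ ^ p ≤
      ENNReal.ofReal (‖h‖ ^ p) * eLpNorm G (ENNReal.ofReal p) volume ^ p := by
  have hp0 : 0 < p := by linarith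
  rw [eLpNorm_rpow_eq hp, ← lintegral_const_mul' _ _ ENNReal.ofReal_ne_top]
  refine lintegral_mono fun x => ?_
  rw [ofReal_norm_rpow hp, ← ENNReal.mul_rpow_of_nonneg _ _ hp0.le, mul_comm]
  exact ENNReal.rpow_le_rpow (enorm_real_inner_le _ _) hp0.le

/-- A measure with a radial density is invariant under linear isometries. -/
theorem measurePreserving_radial {ρ : Rn d → ℝ≥0∞} (hρ : AEMeasurable ρ volume)
    (hr : ∀ h k : Rn d, ‖h‖ = ‖k‖ → ρ h = ρ k) (A : Rn d ≃ₗᵢ[ℝ] Rn d) :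
    MeasurePreserving A (volume.withDensity ρ) (volume.withDensity ρ) := by
  have hA := A.measurePreserving
  refine ⟨hA.measurable, ?_⟩
  ext s hs
  have hAs := hA.restrict_preimage hs
  rw [Measure.map_apply hA.measurable hs, withDensity_apply _ (hA.measurable hs),
    withDensity_apply _ hs]
  have h1 := lintegral_map' (μ := volume.restrict (A ⁻¹' s)) (g := A) (f := ρ)
    (by rw [hAs.map_eq]; exact hρ.restrict) hA.measurable.aemeasurable
  rw [hAs.map_eq] at h1
  rw [h1]
  exact lintegral_congr fun x => hr _ _ (by simp)

/-- The form of the linearized differences, over small `h`. -/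
theorem integral_signedPow_inner_pair [NeZero d] (hp : 1 < p) {ν : RadialLevyKernel d p} {r : ℝ}
    (hν : ∫⁻ h in {h : Rn d | ‖h‖ ≤ r}, ENNReal.ofReal (‖h‖ ^ p) * (ν.toFun h : ℝ≥0∞) ≤ 1)
    {G H : Rn d → Rn d} (hG : MemLp G (ENNReal.ofReal p) volume)
    (hH : MemLp H (ENNReal.ofReal p) volume) :
    ∫ z in {h : Rn d | ‖h‖ ≤ r} ×ˢ univ,
      signedPow p (inner ℝ (G z.2) z.1) * inner ℝ (H z.2) z.1 ∂(pairMeasure ν) =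
    Kdp d p * (∫⁻ h in {h : Rn d | ‖h‖ ≤ r},
      ENNReal.ofReal (‖h‖ ^ p) * (ν.toFun h : ℝ≥0∞)).toReal *
      ∫ x, ‖G x‖ ^ (p - 2) * inner ℝ (G x) (H x) := by
  have hp0 : 0 < p := by linarith
  set B : Set (Rn d) := {h : Rn d | ‖h‖ ≤ r} with hB
  have hms : MeasurableSet B := measurableSet_le measurable_norm measurable_const
  set I := ∫⁻ h in B, ENNReal.ofReal (‖h‖ ^ p) * (ν.toFun h : ℝ≥0∞) with hI
  have hIt : I ≠ ⊤ := ne_top_of_le_ne_top ENNReal.one_ne_top hν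
  set ρ : Rn d → ℝ≥0 := B.indicator ν.toFun with hρ
  have hρm : AEMeasurable ρ volume := ν.aemeasurable.indicator hms
  have hρr : ∀ h k : Rn d, ‖h‖ = ‖k‖ → ρ h = ρ k := fun h k hk => by
    have : h ∈ B ↔ k ∈ B := by simp only [hB, Set.mem_ofPred_eq, hk]
    by_cases hh : h ∈ B
    · rw [hρ, indicator_of_mem hh, indicator_of_mem (this.1 hh), ν.radial h k hk]
    · rw [hρ, indicator_of_notMem hh, indicator_of_notMem fun h' => hh (this.2 h')]
  have hρc : (fun h => (ρ h : ℝ≥0∞)) = B.indicator fun h => (ν.toFun h : ℝ≥0∞) := by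
    funext h
    by_cases hh : h ∈ B
    · rw [hρ, indicator_of_mem hh, indicator_of_mem hh]
    · rw [hρ, indicator_of_notMem hh, indicator_of_notMem hh, ENNReal.coe_zero]
  set m : Measure (Rn d) := volume.withDensity fun h => (ρ h : ℝ≥0∞) with hm
  have hmr : (kernelMeasure ν).restrict B = m := by
    rw [hm, hρc, withDensity_indicator hms, kernelMeasure, restrict_withDensity hms]
  have hlm : ∀ f : Rn d → ℝ≥0∞, ∫⁻ h, f h ∂m = ∫⁻ h, f h * (ρ h : ℝ≥0∞) := fun f => by
    rw [hm, lintegral_withDensity_eq_lintegral_mul_non_measurable₀ _ hρm.coe_nnreal_ennreal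
      (by simp)]
    exact lintegral_congr fun h => mul_comm _ _
  have hIρ : ∫⁻ h, ENNReal.ofReal (‖h‖ ^ p) * (ρ h : ℝ≥0∞) = I := by
    rw [hI, ← lintegral_indicator hms]
    refine lintegral_congr fun h => ?_
    by_cases hh : h ∈ B
    · rw [hρ, indicator_of_mem hh, indicator_of_mem hh]
    · rw [hρ, indicator_of_notMem hh, indicator_of_notMem hh, ENNReal.coe_zero, mul_zero]
  have hcn : Continuous fun h : Rn d => ‖h‖ ^ p :=
    continuous_norm.rpow_const fun _ => Or.inr hp0.le
  have hnorm : Integrable (fun h : Rn d => ‖h‖ ^ p) m := by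
    refine ⟨hcn.aestronglyMeasurable, ?_⟩
    rw [hasFiniteIntegral_iff_ofReal (Eventually.of_forall fun h => by positivity), hlm, hIρ]
    exact hIt.lt_top
  have hinner : ∀ a : Rn d, ∫ h, |inner ℝ a h| ^ p ∂m = Kdp d p * I.toReal * ‖a‖ ^ p := fun a => by
    have hc : Continuous fun h : Rn d => |inner ℝ a h| ^ p :=
      (continuous_abs_rpow hp).comp (by fun_prop)
    rw [integral_eq_lintegral_of_nonneg_ae (Eventually.of_forall fun h => by positivity)
      hc.aestronglyMeasurable, hlm, lintegral_inner_radial hp hρm hρr, hIρ, ENNReal.toReal_mul,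
      ENNReal.toReal_ofReal (mul_nonneg Kdp_nonneg (by positivity))]
    ring
  have hprod : (pairMeasure ν).restrict (B ×ˢ univ) = m.prod volume := by
    rw [← hmr, ← Measure.prod_restrict, Measure.restrict_univ]
  have hmem : ∀ {G : Rn d → Rn d}, MemLp G (ENNReal.ofReal p) volume →
      MemLp (fun z : Rn d × Rn d => inner ℝ (G z.2) z.1) (ENNReal.ofReal p)
        (m.prod volume) := fun {G} hG => by
    have hme := aestronglyMeasurable_inner_pair ν hG.1
    rw [← hprod]
    refine ⟨hme.restrict, ?_⟩
    have hGt : eLpNorm G (ENNReal.ofReal p) volume ^ p ≠ ⊤ :=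
      ENNReal.rpow_ne_top_of_nonneg hp0.le hG.2.ne
    have h1 := lintegral_near_le hGt hν (hme.enorm.pow_const p)
      fun h _ => lintegral_inner_le hp G h
    rw [← eLpNorm_rpow_eq hp] at h1
    exact (ENNReal.rpow_lt_top_iff_of_pos hp0).1 (h1.trans_lt hGt.lt_top)
  rw [hprod, integral_prod_symm _ (integrable_signedPow_mul hp (hmem hG) (hmem hH)),
    ← integral_const_mul]
  refine integral_congr_ae (Eventually.of_forall fun x => ?_)
  exact integral_signedPow_inner hp (measurePreserving_radial hρm.coe_nnreal_ennreal
    fun h k hk => by rw [hρr h k hk]) hnorm hinner (G x) (H x)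

theorem memLp_difference (hp : 1 < p) {ν : RadialLevyKernel d p} {w : Rn d → ℝ}
    (hw : AEStronglyMeasurable w volume) (h : pairEnergy ν univ w < ⊤) :
    MemLp (difference w) (ENNReal.ofReal p) (pairMeasure ν) := by
  have hp0 : 0 < p := by linarith
  refine ⟨aestronglyMeasurable_difference ν hw, ?_⟩
  rw [pairEnergy_eq_difference hp ν MeasurableSet.univ hw, preimage_univ, setLIntegral_univ,
    ← eLpNorm_rpow_eq hp] at h
  exact (ENNReal.rpow_lt_top_iff_of_pos hp0).1 h

theorem HasSobolevGrad.pairEnergy_lt_top (hp : 1 < p) {U : Rn d → ℝ} {G : Rn d → Rn d}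
    (hU : HasSobolevGrad p univ U G) {ν : RadialLevyKernel d p}
    (hν : ∫⁻ h, ENNReal.ofReal (min 1 (‖h‖ ^ p)) * (ν.toFun h : ℝ≥0∞) = 1) :
    pairEnergy ν univ U < ⊤ := by
  have hp0 : 0 < p := by linarith
  refine (hU.pairEnergy_le hp hν).trans_lt (ENNReal.add_lt_top.2
    ⟨ENNReal.rpow_lt_top_of_nonneg hp0.le hU.memLp_grad_univ.2.ne,
      ENNReal.rpow_lt_top_of_nonneg hp0.le (ENNReal.mul_ne_top (by simp) hU.memLp_univ.2.ne)⟩)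

/-- The nonlocal forms converge to the local form. Small `h` contribute through the first order
Taylor expansion in `L^p`, and the contribution of the other `h` vanishes in the limit. -/
theorem tendsto_integral_signedPow_difference [NeZero d] (hp : 1 < p)
    {ν : ℝ → RadialLevyKernel d p} (hν : IsLevyApproxUnity ν) {U W : Rn d → ℝ} {G H : Rn d → Rn d}
    (hU : HasSobolevGrad p univ U G) (hW : HasSobolevGrad p univ W H) :
    Tendsto (fun ε => ∫ z, signedPow p (difference U z) * difference W z ∂(pairMeasure (ν ε)))
      (𝓝[>] 0) (𝓝 (Kdp d p * ∫ x, ‖G x‖ ^ (p - 2) * inner ℝ (G x) (H x))) := by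
  have hp0 : 0 < p := by linarith
  set L := ∫ x, ‖G x‖ ^ (p - 2) * inner ℝ (G x) (H x) with hL
  rw [Metric.tendsto_nhds]
  intro κ hκ
  have hκ' : (0 : ℝ≥0∞) < ENNReal.ofReal (κ / 8) := by simpa using hκ
  set NG := eLpNorm G (ENNReal.ofReal p) volume ^ p with hNG
  set NH := eLpNorm H (ENNReal.ofReal p) volume ^ p with hNH
  have hNGt : NG ≠ ⊤ := ENNReal.rpow_ne_top_of_nonneg hp0.le hU.memLp_grad_univ.2.ne
  have hNHt : NH ≠ ⊤ := ENNReal.rpow_ne_top_of_nonneg hp0.le hW.memLp_grad_univ.2.ne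
  obtain ⟨η, hη, hηκ⟩ := exists_ofReal_mul_le (A := NG + NG + NH + NH)
    (by finiteness) hκ'
  obtain ⟨C, hC0, hC⟩ := exists_abs_signedPow_mul_sub_le hp hη
  obtain ⟨C', hC'0, hC'⟩ := exists_abs_signedPow_mul_le hp one_pos
  obtain ⟨τ, hτ, hτκ⟩ := exists_ofReal_mul_le (A := ENNReal.ofReal C * 2) (by finiteness) hκ'
  have hsmall : ∀ {F : Rn d → Rn d}, MemLp F (ENNReal.ofReal p) volume →
      ∀ᶠ z in 𝓝 (0 : Rn d), shiftNorm p F z ^ p ≤ ENNReal.ofReal τ := fun {F} hF => by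
    have h1 := (ENNReal.continuous_rpow_const (y := p)).tendsto 0 |>.comp (tendsto_shiftNorm hp hF)
    have h2 : Tendsto (fun z => shiftNorm p F z ^ p) (𝓝 0) (𝓝 0) := by
      simpa [hp0, Function.comp_def] using h1
    exact h2.eventually_le_const (by simpa using hτ)
  -- for `|h| ≤ r` the Taylor remainder is at most `τ |h|^p`, by continuity of translations
  obtain ⟨r₀, hr₀, hr₀τ⟩ := Metric.eventually_nhds_iff.1
    ((hsmall hU.memLp_grad_univ).and (hsmall hW.memLp_grad_univ))
  obtain ⟨r, hr, hr1, hrr⟩ : ∃ r : ℝ, 0 < r ∧ r ≤ 1 ∧ r < r₀ :=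
    ⟨min 1 (r₀ / 2), by positivity, min_le_left _ _, (min_le_right _ _).trans_lt (by linarith)⟩
  have hrτ : ∀ h z : Rn d, ‖h‖ ≤ r → ‖z‖ ≤ ‖h‖ → shiftNorm p G z ^ p ≤ ENNReal.ofReal τ ∧
      shiftNorm p H z ^ p ≤ ENNReal.ofReal τ := fun h z hh hz =>
    hr₀τ (by rw [dist_zero_right]; linarith)
  set A := (2 * eLpNorm U (ENNReal.ofReal p) volume) ^ p with hA
  set A' := (2 * eLpNorm W (ENNReal.ofReal p) volume) ^ p with hA'
  have hAt : A ≠ ⊤ := ENNReal.rpow_ne_top_of_nonneg hp0.le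
    (ENNReal.mul_ne_top (by simp) hU.memLp_univ.2.ne)
  have hA't : A' ≠ ⊤ := ENNReal.rpow_ne_top_of_nonneg hp0.le
    (ENNReal.mul_ne_top (by simp) hW.memLp_univ.2.ne)
  -- the kernel has little mass in `{|h| > r}`, and almost unit `p`-th moment in `{|h| ≤ r}`
  have hfar : ∀ᶠ ε in 𝓝[>] (0 : ℝ), (ENNReal.ofReal 1 * A + ENNReal.ofReal C' * A') *
      ∫⁻ h in {h : Rn d | r < ‖h‖}, ((ν ε).toFun h : ℝ≥0∞) ≤ ENNReal.ofReal (κ / 8) := by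
    have h1 := ENNReal.Tendsto.const_mul (a := ENNReal.ofReal 1 * A + ENNReal.ofReal C' * A')
      (hν.concentrates r hr) (Or.inr (by finiteness))
    rw [mul_zero] at h1
    exact h1.eventually_le_const hκ'
  have hmass : ∀ᶠ ε in 𝓝[>] (0 : ℝ), dist (Kdp d p * (∫⁻ h in {h : Rn d | ‖h‖ ≤ r},
      ENNReal.ofReal (‖h‖ ^ p) * ((ν ε).toFun h : ℝ≥0∞)).toReal * L) (Kdp d p * L) < κ / 2 := by
    have h1 := (ENNReal.tendsto_toReal ENNReal.one_ne_top).comp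
      (tendsto_mass_near_zero hp hν hr hr1)
    have h2 := (h1.const_mul (Kdp d p)).mul_const L
    rw [ENNReal.toReal_one, mul_one] at h2
    exact (Metric.tendsto_nhds.1 h2) (κ / 2) (by positivity)
  filter_upwards [hfar, hmass, self_mem_nhdsWithin] with ε hfε hmε hε
  have hnε := hν.normalized ε hε
  set B : Set (Rn d) := {h : Rn d | ‖h‖ ≤ r} with hB
  have hms : MeasurableSet B := measurableSet_le measurable_norm measurable_const
  have hcompl : (B ×ˢ (univ : Set (Rn d)))ᶜ = {h : Rn d | r < ‖h‖} ×ˢ univ := by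
    ext z
    simp [hB]
  have h1 := lintegral_norm_le_one hp hnε hr1
  have hDU := memLp_difference hp hU.memLp_univ.1 (hU.pairEnergy_lt_top hp hnε)
  have hDW := memLp_difference hp hW.memLp_univ.1 (hW.pairEnergy_lt_top hp hnε)
  have hF := integrable_signedPow_mul hp hDU hDW
  have hiG := aestronglyMeasurable_inner_pair (ν ε) hU.memLp_grad_univ.1
  have hiH := aestronglyMeasurable_inner_pair (ν ε) hW.memLp_grad_univ.1
  have hnearG := lintegral_near_le hNGt h1 (hiG.enorm.pow_const p)
    fun h _ => lintegral_inner_le hp G h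
  have hnearH := lintegral_near_le hNHt h1 (hiH.enorm.pow_const p)
    fun h _ => lintegral_inner_le hp H h
  have hnearU := lintegral_near_le hNGt h1 (hDU.1.enorm.pow_const p) fun h _ => by
    rw [hNG]
    refine le_trans (le_of_eq ?_) (hU.shiftNorm_le hp h)
    rw [shiftNorm_rpow hp]
    rfl
  have hnearW := lintegral_near_le hNHt h1 (hDW.1.enorm.pow_const p) fun h _ => by
    rw [hNH]
    refine le_trans (le_of_eq ?_) (hW.shiftNorm_le hp h)
    rw [shiftNorm_rpow hp]
    rfl
  have htayU := lintegral_near_le (K := ENNReal.ofReal τ) (by finiteness) h1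
    ((hDU.1.sub hiG).enorm.pow_const p) fun h hh =>
      hU.lintegral_taylor_le hp fun z hz => (hrτ h z hh hz).1
  have htayW := lintegral_near_le (K := ENNReal.ofReal τ) (by finiteness) h1
    ((hDW.1.sub hiH).enorm.pow_const p) fun h hh =>
      hW.lintegral_taylor_le hp fun z hz => (hrτ h z hh hz).2
  have hlin : Integrable (fun z : Rn d × Rn d => signedPow p (inner ℝ (G z.2) z.1) *
      inner ℝ (H z.2) z.1) ((pairMeasure (ν ε)).restrict (B ×ˢ univ)) := by
    refine integrable_signedPow_mul hp ⟨hiG.restrict, ?_⟩ ⟨hiH.restrict, ?_⟩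
    · rw [← eLpNorm_rpow_eq hp] at hnearG
      exact (ENNReal.rpow_lt_top_iff_of_pos hp0).1 (hnearG.trans_lt hNGt.lt_top)
    · rw [← eLpNorm_rpow_eq hp] at hnearH
      exact (ENNReal.rpow_lt_top_iff_of_pos hp0).1 (hnearH.trans_lt hNHt.lt_top)
  -- for `|h| ≤ r` the differences may be replaced by their linearizations
  have hnear : ‖(∫ z in B ×ˢ univ, signedPow p (difference U z) * difference W z
      ∂(pairMeasure (ν ε))) - ∫ z in B ×ˢ univ, signedPow p (inner ℝ (G z.2) z.1) *
      inner ℝ (H z.2) z.1 ∂(pairMeasure (ν ε))‖ₑ ≤ ENNReal.ofReal (κ / 4) := by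
    rw [← integral_sub hF.restrict hlin]
    refine (enorm_integral_le_lintegral_enorm _).trans ((enorm_integral_signedPow_sub_le hp hη.le
      hC0 hC hDU.1.restrict hiG.restrict hDW.1.restrict hiH.restrict).trans ?_)
    calc _ ≤ ENNReal.ofReal η * (NG + NG + NH + NH) +
          ENNReal.ofReal C * (ENNReal.ofReal τ + ENNReal.ofReal τ) :=
          add_le_add (mul_le_mul_right (add_le_add (add_le_add (add_le_add hnearU hnearG) hnearW)
            hnearH) _) (mul_le_mul_right (add_le_add htayU htayW) _)
      _ ≤ ENNReal.ofReal (κ / 8) + ENNReal.ofReal (κ / 8) := by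
          refine add_le_add hηκ (le_trans (le_of_eq ?_) hτκ)
          ring
      _ = ENNReal.ofReal (κ / 4) := by
          rw [← ENNReal.ofReal_add (by positivity) (by positivity)]
          congr 1
          ring
  have hfar' : ‖∫ z in (B ×ˢ univ)ᶜ, signedPow p (difference U z) * difference W z
      ∂(pairMeasure (ν ε))‖ₑ ≤ ENNReal.ofReal (κ / 8) := by
    refine (enorm_integral_le_lintegral_enorm _).trans ((enorm_integral_signedPow_le hp
      zero_le_one hC'0 hC' hDU.1.restrict).trans (le_trans ?_ hfε))
    rw [hcompl, add_mul, mul_assoc, mul_assoc]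
    exact add_le_add (mul_le_mul_right (lintegral_difference_far_le hp _ hU.memLp_univ r) _)
      (mul_le_mul_right (lintegral_difference_far_le hp _ hW.memLp_univ r) _)
  -- the form of the linearizations is a multiple of the local form
  rw [integral_signedPow_inner_pair hp h1 hU.memLp_grad_univ hW.memLp_grad_univ] at hnear
  rw [← integral_add_compl (hms.prod MeasurableSet.univ) hF]
  rw [← ofReal_norm, ENNReal.ofReal_le_ofReal_iff (by positivity)] at hnear hfar'
  rw [dist_eq_norm] at hmε ⊢
  set X := ∫ z in B ×ˢ univ, signedPow p (difference U z) * difference W z ∂(pairMeasure (ν ε))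
  set Y := ∫ z in (B ×ˢ univ)ᶜ, signedPow p (difference U z) * difference W z ∂(pairMeasure (ν ε))
  set Z := Kdp d p * (∫⁻ h in B, ENNReal.ofReal (‖h‖ ^ p) * ((ν ε).toFun h : ℝ≥0∞)).toReal * L
  have hdec : X + Y - Kdp d p * L = (X - Z) + Y + (Z - Kdp d p * L) := by ring
  rw [hdec]
  have := norm_add₃_le (a := X - Z) (b := Y) (c := Z - Kdp d p * L)
  linarith

end SobolevForms

/-! ### The nonlocal form along sequences that vanish in `L^p` -/

section VanishingSequences

variable {d : ℕ} {p : ℝ}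

theorem measurePreserving_shift_pair (ν : RadialLevyKernel d p) (y : Rn d) :
    MeasurePreserving (fun z : Rn d × Rn d => (z.1, z.2 + y)) (pairMeasure ν) (pairMeasure ν) :=
  (MeasurePreserving.id _).prod (measurePreserving_add_right volume y)

theorem difference_shift (w : Rn d → ℝ) (y : Rn d) (z : Rn d × Rn d) :
    difference (fun x => w (x + y)) z = difference w (z.1, z.2 + y) := by
  simp only [difference]
  rw [add_right_comm]

theorem lintegral_shift_pair {ν : RadialLevyKernel d p} {f : Rn d × Rn d → ℝ≥0∞}
    (hf : AEMeasurable f (pairMeasure ν)) (y : Rn d) :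
    ∫⁻ z, f (z.1, z.2 + y) ∂(pairMeasure ν) = ∫⁻ z, f z ∂(pairMeasure ν) := by
  have hT := measurePreserving_shift_pair ν y
  have h1 := lintegral_map' (μ := pairMeasure ν) (g := fun z : Rn d × Rn d => (z.1, z.2 + y))
    (f := f) (by rw [hT.map_eq]; exact hf) hT.measurable.aemeasurable
  rw [hT.map_eq] at h1
  exact h1.symm

theorem integral_shift_pair {ν : RadialLevyKernel d p} {f : Rn d × Rn d → ℝ}
    (hf : AEStronglyMeasurable f (pairMeasure ν)) (y : Rn d) :
    ∫ z, f (z.1, z.2 + y) ∂(pairMeasure ν) = ∫ z, f z ∂(pairMeasure ν) := by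
  have hT := measurePreserving_shift_pair ν y
  have h1 := integral_map (μ := pairMeasure ν) (φ := fun z : Rn d × Rn d => (z.1, z.2 + y))
    hT.measurable.aemeasurable (f := f) (by rw [hT.map_eq]; exact hf)
  rw [hT.map_eq] at h1
  exact h1.symm

theorem memLp_shift_pair {ν : RadialLevyKernel d p} {f : Rn d × Rn d → ℝ}
    (hf : MemLp f (ENNReal.ofReal p) (pairMeasure ν)) (y : Rn d) :
    MemLp (fun z => f (z.1, z.2 + y)) (ENNReal.ofReal p) (pairMeasure ν) :=
  hf.comp_measurePreserving (measurePreserving_shift_pair ν y)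

theorem eLpNorm_shift_pair {ν : RadialLevyKernel d p} {f : Rn d × Rn d → ℝ}
    (hf : AEStronglyMeasurable f (pairMeasure ν)) (y : Rn d) {q : ℝ≥0∞} :
    eLpNorm (fun z => f (z.1, z.2 + y)) q (pairMeasure ν) = eLpNorm f q (pairMeasure ν) :=
  eLpNorm_comp_measurePreserving hf (measurePreserving_shift_pair ν y)

theorem aestronglyMeasurable_shift_difference (ν : RadialLevyKernel d p) {w : Rn d → ℝ}
    (hw : AEStronglyMeasurable w volume) :
    AEStronglyMeasurable (fun q : (Rn d × Rn d) × Rn d => difference w (q.1.1, q.1.2 + -q.2))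
      ((pairMeasure ν).prod volume) := by
  refine AEStronglyMeasurable.mono_ac ((pairMeasure_absolutelyContinuous ν).prod
    Measure.AbsolutelyContinuous.rfl) ?_
  have hs : Measure.QuasiMeasurePreserving
      (fun q : (Rn d × Rn d) × Rn d => q.1.2 - q.2)
      (((volume : Measure (Rn d)).prod volume).prod volume) volume :=
    (quasiMeasurePreserving_sub volume volume).comp
      (QuasiMeasurePreserving.prodMap Measure.quasiMeasurePreserving_snd
        (Measure.QuasiMeasurePreserving.id volume))
  have hs' : Measure.QuasiMeasurePreserving
      (fun q : (Rn d × Rn d) × Rn d => q.1.2 + q.1.1 - q.2)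
      (((volume : Measure (Rn d)).prod volume).prod volume) volume :=
    (quasiMeasurePreserving_sub volume volume).comp
      (QuasiMeasurePreserving.prodMap (Measure.quasiMeasurePreserving_fst.comp
        (measurePreserving_pairMap_volume (d := d)).quasiMeasurePreserving)
        (Measure.QuasiMeasurePreserving.id volume))
  have h1 := (hw.comp_quasiMeasurePreserving hs').sub (hw.comp_quasiMeasurePreserving hs)
  refine h1.congr (Eventually.of_forall fun q => ?_)
  simp only [difference, Pi.sub_apply, Function.comp]
  congr 2
  abel

theorem difference_mollify_sub [NeZero d] {δ : ℝ} (hδ : 0 < δ) {w : Rn d → ℝ}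
    (hw : LocallyIntegrable w volume) (z : Rn d × Rn d) :
    difference (mollify δ w - w) z =
      ∫ y, mollifier d δ y * (difference w (z.1, z.2 + -y) - difference w z) := by
  have hi : ∀ x, Integrable (fun y => mollifier d δ y * (w (x - y) - w x)) volume := fun x => by
    simp only [mul_sub]
    exact (integrable_mollifier_mul hδ hw x).sub ((integrable_mollifier hδ).mul_const _)
  simp only [difference, Pi.sub_apply]
  rw [mollify_sub_eq hδ hw, mollify_sub_eq hδ hw, ← integral_sub (hi _) (hi _)]
  refine integral_congr_ae (Eventually.of_forall fun y => ?_)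
  have : z.2 + -y + z.1 = z.2 + z.1 - y := by abel
  beta_reduce
  rw [this, ← sub_eq_add_neg]
  ring

/-- The error of a mollification is tested against the nonlocal gradient of `U`: by translation
invariance, the finite differences in the mollification act on `U`. -/
theorem enorm_integral_mollify_sub_le [NeZero d] (hp : 1 < p) {ν : RadialLevyKernel d p}
    {U w : Rn d → ℝ} (hU : MemLp (difference U) (ENNReal.ofReal p) (pairMeasure ν))
    (hw : MemLp w (ENNReal.ofReal p) volume)
    (hDw : MemLp (difference w) (ENNReal.ofReal p) (pairMeasure ν)) {δ : ℝ} (hδ : 0 < δ) {R : ℝ≥0∞}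
    (hR : ∀ y : Rn d, ‖y‖ < 2 * δ → ∫⁻ z, ‖signedPow p (difference U (z.1, z.2 + y)) *
      difference w z - signedPow p (difference U z) * difference w z‖ₑ ∂(pairMeasure ν) ≤ R) :
    ‖∫ z, signedPow p (difference U z) * difference (mollify δ w - w) z ∂(pairMeasure ν)‖ₑ ≤ R := by
  have hp0 : 0 < p := by linarith
  have hwl : LocallyIntegrable w volume := hw.locallyIntegrable (one_le_ofReal hp)
  set M := pairMeasure ν with hM
  set A : Rn d × Rn d → ℝ := fun z => signedPow p (difference U z) with hA
  have hAm : AEStronglyMeasurable A M :=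
    (continuous_signedPow hp).comp_aestronglyMeasurable hU.1
  set f : (Rn d × Rn d) → Rn d → ℝ := fun z y =>
    A z * (mollifier d δ y * (difference w (z.1, z.2 + -y) - difference w z)) with hf
  have hdiff : ∀ y, MemLp (fun z => difference w (z.1, z.2 + -y) - difference w z)
      (ENNReal.ofReal p) M := fun y => (memLp_shift_pair hDw (-y)).sub hDw
  obtain ⟨C, hC0, hC⟩ := exists_abs_signedPow_mul_le hp one_pos
  set EU := ∫⁻ z, ‖difference U z‖ₑ ^ p ∂M with hEU
  set Ew := eLpNorm (difference w) (ENNReal.ofReal p) M with hEw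
  have hEUt : EU ≠ ⊤ := by
    rw [hEU, ← eLpNorm_rpow_eq hp]
    exact ENNReal.rpow_ne_top_of_nonneg hp0.le hU.2.ne
  set K := ENNReal.ofReal 1 * EU + ENNReal.ofReal C * (Ew + Ew) ^ p with hK
  have hKt : K ≠ ⊤ := ENNReal.add_ne_top.2 ⟨by finiteness, ENNReal.mul_ne_top (by finiteness)
    (ENNReal.rpow_ne_top_of_nonneg hp0.le (ENNReal.add_ne_top.2 ⟨hDw.2.ne, hDw.2.ne⟩))⟩
  have hbound : ∀ y, ∫⁻ z, ‖A z * (difference w (z.1, z.2 + -y) - difference w z)‖ₑ ∂M ≤ K :=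
    fun y => by
    refine (enorm_integral_signedPow_le hp zero_le_one hC0 hC hU.1).trans
      (add_le_add_right (mul_le_mul_right ?_ _) _)
    rw [← eLpNorm_rpow_eq hp]
    refine ENNReal.rpow_le_rpow ?_ hp0.le
    refine (eLpNorm_sub_le (memLp_shift_pair hDw (-y)).1 hDw.1 (one_le_ofReal hp)).trans
      (add_le_add_left (le_of_eq ?_) _)
    exact eLpNorm_shift_pair hDw.1 (-y)
  have hfm : AEStronglyMeasurable (Function.uncurry f) (M.prod volume) := by
    refine (hAm.comp_quasiMeasurePreserving Measure.quasiMeasurePreserving_fst).mul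
      (((contDiff_mollifier δ).continuous.comp continuous_snd).aestronglyMeasurable.mul
        ((aestronglyMeasurable_shift_difference ν hw.1).sub
          (hDw.1.comp_quasiMeasurePreserving Measure.quasiMeasurePreserving_fst)))
  have hfi : Integrable (Function.uncurry f) (M.prod volume) := by
    refine ⟨hfm, ?_⟩
    rw [HasFiniteIntegral, lintegral_prod_symm _ hfm.enorm]
    calc _ ≤ ∫⁻ y, ‖mollifier d δ y‖ₑ * K := by
          refine lintegral_mono fun y => ?_
          refine le_trans (le_of_eq ?_) (mul_le_mul_right (hbound y) _)
          rw [← lintegral_const_mul' _ _ (by finiteness)]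
          refine lintegral_congr fun z => ?_
          rw [← enorm_mul]
          congr 1
          simp only [Function.uncurry, hf]
          ring
      _ < ⊤ := by
          rw [lintegral_mul_const' _ _ hKt]
          exact ENNReal.mul_lt_top (integrable_mollifier hδ).2 hKt.lt_top
  have hswap : ∫ z, A z * difference (mollify δ w - w) z ∂M =
      ∫ y, mollifier d δ y *
        ∫ z, (A (z.1, z.2 + y) * difference w z - A z * difference w z) ∂M := by
    calc _ = ∫ z, ∫ y, f z y ∂volume ∂M := by
          refine integral_congr_ae (Eventually.of_forall fun z => ?_)
          simp only [hf]
          rw [integral_const_mul, ← difference_mollify_sub hδ hwl]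
      _ = ∫ y, ∫ z, f z y ∂M := integral_integral_swap hfi
      _ = _ := by
          refine integral_congr_ae (Eventually.of_forall fun y => ?_)
          have e1 : ∀ z, f z y = mollifier d δ y *
              (A z * difference w (z.1, z.2 + -y) - A z * difference w z) := fun z => by
            simp only [hf]
            ring
          simp only [e1]
          rw [integral_const_mul]
          congr 1
          rw [integral_sub (integrable_signedPow_mul hp hU (memLp_shift_pair hDw (-y)))
              (integrable_signedPow_mul hp hU hDw),
            integral_sub (integrable_signedPow_mul hp (memLp_shift_pair hU y) hDw)
              (integrable_signedPow_mul hp hU hDw)]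
          congr 1
          have h3 := integral_shift_pair (hAm.mul (memLp_shift_pair hDw (-y)).1) y
          simp only [Pi.mul_apply, add_neg_cancel_right] at h3
          exact h3.symm
  rw [hswap]
  refine (enorm_integral_le_lintegral_enorm _).trans ?_
  calc _ ≤ ∫⁻ y, ENNReal.ofReal (mollifier d δ y) * R := by
        refine lintegral_mono fun y => ?_
        rw [enorm_mul, Real.enorm_of_nonneg (mollifier_nonneg hδ y)]
        by_cases hy : y ∈ annulus d δ
        · exact mul_le_mul_right ((enorm_integral_le_lintegral_enorm _).trans (hR y hy.2)) _
        · rw [mollifier_eq_zero hδ hy, ENNReal.ofReal_zero, zero_mul, zero_mul]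
    _ = R := by
        rw [lintegral_mul_const _ ((contDiff_mollifier δ).continuous.measurable.ennreal_ofReal),
          ← ofReal_integral_eq_lintegral_ofReal (integrable_mollifier hδ)
            (Eventually.of_forall (mollifier_nonneg hδ)), integral_mollifier hδ,
          ENNReal.ofReal_one, one_mul]

/-- Mollification at a fixed scale maps `L^p` into `W^{1,p}`. -/
theorem exists_mollify_sobolev [NeZero d] (hp : 1 < p) {δ : ℝ} (hδ : 0 < δ) :
    ∃ C : ℝ≥0, ∀ w : Rn d → ℝ, MemLp w (ENNReal.ofReal p) volume →
      HasSobolevGrad p univ (mollify δ w) (gradient (mollify δ w)) ∧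
      eLpNorm (gradient (mollify δ w)) (ENNReal.ofReal p) volume ^ p +
        (2 * eLpNorm (mollify δ w) (ENNReal.ofReal p) volume) ^ p ≤
        C * eLpNorm w (ENNReal.ofReal p) volume ^ p := by
  have hp0 : 0 < p := by linarith
  obtain ⟨C1, hC1⟩ := exists_mollify_bound d hp
  set V : ℝ≥0∞ := 2 ^ d * volume (ball (0 : Rn d) 1) with hV
  have hVt : V ≠ ⊤ := ENNReal.mul_ne_top (by finiteness) measure_ball_lt_top.ne
  set K1 : ℝ≥0∞ := C1 * ENNReal.ofReal ((δ ^ p)⁻¹) * (V * 2 ^ p) with hK1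
  set K2 : ℝ≥0∞ := C1 * (V * 2 ^ p) with hK2
  set K : ℝ≥0∞ := K1 + 2 ^ p * (2 ^ p * (K2 + 1)) with hK
  have h2p : (2 : ℝ≥0∞) ^ p ≠ ⊤ := by finiteness
  have hKt : K ≠ ⊤ := by finiteness
  refine ⟨K.toNNReal, fun w hw => ?_⟩
  rw [ENNReal.coe_toNNReal hKt]
  set N := eLpNorm w (ENNReal.ofReal p) volume ^ p with hN
  have hNt : N ≠ ⊤ := ENNReal.rpow_ne_top_of_nonneg hp0.le hw.2.ne
  have hwl : LocallyIntegrable w volume := hw.locallyIntegrable (one_le_ofReal hp)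
  have hsm : ContDiff ℝ ∞ (mollify δ w) := contDiff_mollify hδ hwl
  have hΦ : ENNReal.ofReal ((δ ^ d)⁻¹) * ∫⁻ h in annulus d δ, shiftNorm p w h ^ p ≤
      V * 2 ^ p * N := by
    refine (setLIntegral_annulus_le hδ fun z _ =>
      ENNReal.rpow_le_rpow (shiftNorm_le_two_mul hp hw.1 z) hp0.le).trans (le_of_eq ?_)
    rw [ENNReal.mul_rpow_of_nonneg _ _ hp0.le, mul_assoc, mul_assoc, hV, mul_assoc]
  have hgrad : eLpNorm (gradient (mollify δ w)) (ENNReal.ofReal p) volume ^ p ≤ K1 * N := by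
    refine (hC1 δ hδ w hw).2.trans ?_
    rw [mul_assoc, hK1, mul_assoc (_ * _)]
    exact mul_le_mul_right hΦ _
  have hdist : eLpNorm (mollify δ w - w) (ENNReal.ofReal p) volume ^ p ≤ K2 * N := by
    refine (hC1 δ hδ w hw).1.trans ?_
    rw [mul_assoc, hK2, mul_assoc (C1 : ℝ≥0∞)]
    exact mul_le_mul_right hΦ _
  have hm : AEStronglyMeasurable (mollify δ w) volume := hsm.continuous.aestronglyMeasurable
  have hnorm : eLpNorm (mollify δ w) (ENNReal.ofReal p) volume ^ p ≤ 2 ^ p * (K2 + 1) * N := by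
    have h1 : mollify δ w = (mollify δ w - w) + w := by simp
    have h2 := eLpNorm_add_le (hm.sub hw.1) hw.1 (one_le_ofReal hp)
    rw [← h1] at h2
    refine (ENNReal.rpow_le_rpow h2 hp0.le).trans ((add_rpow_le_two hp _ _).trans ?_)
    rw [mul_assoc, add_mul, one_mul]
    exact mul_le_mul_right (add_le_add_left hdist _) _
  refine ⟨hasSobolevGrad_of_contDiff (hsm.of_le (by simp)) ⟨hm, ?_⟩
    ⟨(continuous_gradient (hsm.of_le (by simp))).aestronglyMeasurable, ?_⟩, ?_⟩
  · exact (ENNReal.rpow_lt_top_iff_of_pos hp0).1 (hnorm.trans_lt (by finiteness))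
  · exact (ENNReal.rpow_lt_top_iff_of_pos hp0).1 (hgrad.trans_lt (by finiteness))
  · rw [ENNReal.mul_rpow_of_nonneg _ _ hp0.le, hK, add_mul, mul_assoc (2 ^ p)]
    exact add_le_add hgrad (mul_le_mul_right hnorm _)

/-- The nonlocal form of a fixed Sobolev function `U` tends to zero along functions with bounded
energies that vanish in `L^p` in the limit. This replaces the weak convergence of gradients, which
has no direct meaning while the forms vary. The functions are split into a mollification at a fixed
scale, which vanishes even in `W^{1,p}`, and the error of mollification, whose contribution is small
uniformly in `ε` because the translations can be moved to `U`. -/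
theorem tendsto_integral_signedPow_of_tendsto_zero [NeZero d] (hp : 1 < p)
    {ν : ℝ → RadialLevyKernel d p} (hν : IsLevyApproxUnity ν) {U : Rn d → ℝ} {G : Rn d → Rn d}
    (hU : HasSobolevGrad p univ U G) {ι : Type*} {l : Filter ι} {ε : ι → ℝ}
    (hε : ∀ᶠ i in l, 0 < ε i) {w : ι → Rn d → ℝ}
    (hw : ∀ᶠ i in l, MemLp (w i) (ENNReal.ofReal p) volume) {B : ℝ≥0}
    (hB : ∀ᶠ i in l, pairEnergy (ν (ε i)) univ (w i) ≤ B)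
    (hlim : Tendsto (fun i => eLpNorm (w i) (ENNReal.ofReal p) volume) l (𝓝 0)) :
    Tendsto (fun i => ∫ z, signedPow p (difference U z) * difference (w i) z
      ∂(pairMeasure (ν (ε i)))) l (𝓝 0) := by
  have hp0 : 0 < p := by linarith
  rw [Metric.tendsto_nhds]
  intro κ hκ
  have hκ' : (0 : ℝ≥0∞) < ENNReal.ofReal (κ / 8) := by simpa using hκ
  set NU := eLpNorm G (ENNReal.ofReal p) volume ^ p +
    (2 * eLpNorm U (ENNReal.ofReal p) volume) ^ p with hNU
  have hNUt : NU ≠ ⊤ := ENNReal.add_ne_top.2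
    ⟨ENNReal.rpow_ne_top_of_nonneg hp0.le hU.memLp_grad_univ.2.ne,
      ENNReal.rpow_ne_top_of_nonneg hp0.le (ENNReal.mul_ne_top (by simp) hU.memLp_univ.2.ne)⟩
  -- the first pair of constants serves for the error of mollification, the second pair for the
  -- mollified functions
  obtain ⟨η, hη, hηκ⟩ := exists_ofReal_mul_le (A := NU + NU + B + B) (by finiteness) hκ'
  obtain ⟨C, hC0, hC⟩ := exists_abs_signedPow_mul_sub_le hp hη
  obtain ⟨η', hη', hη'κ⟩ := exists_ofReal_mul_le (A := NU) hNUt hκ'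
  obtain ⟨C', hC'0, hC'⟩ := exists_abs_signedPow_mul_le hp hη'
  have hsmall : Tendsto (fun z => ENNReal.ofReal C * (shiftNorm p G z ^ p +
      (2 * shiftNorm p U z) ^ p)) (𝓝 0) (𝓝 0) := by
    have hc := (ENNReal.continuous_rpow_const (y := p)).tendsto 0
    rw [ENNReal.zero_rpow_of_pos hp0] at hc
    have h1 := hc.comp (tendsto_shiftNorm hp hU.memLp_grad_univ)
    have h2 := ENNReal.Tendsto.const_mul (a := 2) (tendsto_shiftNorm hp hU.memLp_univ)
      (Or.inr (by simp))
    rw [mul_zero] at h2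
    have h3 := ENNReal.Tendsto.const_mul (a := ENNReal.ofReal C) (h1.add (hc.comp h2))
      (Or.inr (by finiteness))
    simpa [Function.comp_def] using h3
  -- translations of size less than `r` move `U` by little in `W^{1,p}`; the scale of mollification
  -- is `r / 2` because the mollifier at the scale `δ` is supported in the ball of radius `2 δ`
  obtain ⟨r, hr, hrκ⟩ := Metric.eventually_nhds_iff.1 (hsmall.eventually_le_const hκ')
  obtain ⟨C1, hC1⟩ := exists_mollify_sobolev (d := d) hp (half_pos hr)
  have hmol : ∀ᶠ i in l, ENNReal.ofReal C' * (C1 *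
      eLpNorm (w i) (ENNReal.ofReal p) volume ^ p) ≤ ENNReal.ofReal (κ / 8) := by
    have hc := (ENNReal.continuous_rpow_const (y := p)).tendsto 0
    rw [ENNReal.zero_rpow_of_pos hp0] at hc
    have h1 := ENNReal.Tendsto.const_mul (a := (C1 : ℝ≥0∞)) (hc.comp hlim) (Or.inr (by simp))
    rw [mul_zero] at h1
    have h2 := ENNReal.Tendsto.const_mul (a := ENNReal.ofReal C') h1 (Or.inr (by finiteness))
    rw [mul_zero] at h2
    exact h2.eventually_le_const hκ'
  filter_upwards [hε, hw, hB, hmol] with i hεi hwi hBi hmi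
  have hnε := hν.normalized (ε i) hεi
  have hDU := memLp_difference hp hU.memLp_univ.1 (hU.pairEnergy_lt_top hp hnε)
  have hDw := memLp_difference hp hwi.1 (hBi.trans_lt ENNReal.coe_lt_top)
  have hen : ∀ {v : Rn d → ℝ}, AEStronglyMeasurable v volume →
      ∫⁻ z, ‖difference v z‖ₑ ^ p ∂(pairMeasure (ν (ε i))) = pairEnergy (ν (ε i)) univ v :=
    fun hv => by
    rw [pairEnergy_eq_difference hp _ MeasurableSet.univ hv, preimage_univ, setLIntegral_univ]
  obtain ⟨hS, hSb⟩ := hC1 (w i) hwi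
  have hDm := memLp_difference hp hS.memLp_univ.1 (hS.pairEnergy_lt_top hp hnε)
  have hUe := hU.pairEnergy_le hp hnε
  have h1 := enorm_integral_mollify_sub_le hp hDU hwi hDw (half_pos hr)
    (R := ENNReal.ofReal (κ / 4)) fun y hy => by
    have hshift := hU.comp_add_sub hp y
    have hsm : AEStronglyMeasurable (fun x => U (x + y)) volume :=
      aestronglyMeasurable_shift hU.memLp_univ.1 y
    refine (enorm_integral_signedPow_sub_le hp hη.le hC0 hC (memLp_shift_pair hDU y).1 hDU.1 hDw.1
      hDw.1).trans ?_
    have e1 : ∫⁻ z, ‖difference U (z.1, z.2 + y) - difference U z‖ₑ ^ p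
        ∂(pairMeasure (ν (ε i))) = pairEnergy (ν (ε i)) univ (fun x => U (x + y) - U x) := by
      rw [← hen hshift.memLp_univ.1]
      refine lintegral_congr fun z => ?_
      rw [← difference_shift]
      congr 2
      simp only [difference]
      ring
    rw [lintegral_shift_pair (hDU.1.enorm.pow_const p) y, hen hU.memLp_univ.1, hen hwi.1, e1]
    simp only [sub_self, enorm_zero, ENNReal.zero_rpow_of_pos hp0, lintegral_zero, add_zero]
    refine (add_le_add (mul_le_mul_right (add_le_add (add_le_add (add_le_add hUe hUe) hBi) hBi) _)
      (mul_le_mul_right (hshift.pairEnergy_le hp hnε) _)).trans ?_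
    have e2 : ENNReal.ofReal (κ / 4) = ENNReal.ofReal (κ / 8) + ENNReal.ofReal (κ / 8) := by
      rw [← ENNReal.ofReal_add (by positivity) (by positivity)]
      congr 1
      ring
    rw [e2]
    exact add_le_add hηκ (hrκ (by rw [dist_zero_right]; linarith))
  have h2 : ‖∫ z, signedPow p (difference U z) * difference (mollify (r / 2) (w i)) z
      ∂(pairMeasure (ν (ε i)))‖ₑ ≤ ENNReal.ofReal (κ / 4) := by
    refine (enorm_integral_le_lintegral_enorm _).trans ((enorm_integral_signedPow_le hp hη'.le
      hC'0 hC' hDU.1).trans ?_)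
    rw [hen hU.memLp_univ.1, hen hS.memLp_univ.1]
    refine (add_le_add (mul_le_mul_right hUe _) (mul_le_mul_right
      ((hS.pairEnergy_le hp hnε).trans hSb) _)).trans ((add_le_add hη'κ hmi).trans (le_of_eq ?_))
    rw [← ENNReal.ofReal_add (by positivity) (by positivity)]
    congr 1
    ring
  rw [← ofReal_norm, ENNReal.ofReal_le_ofReal_iff (by positivity)] at h1 h2
  have hdec : ∫ z, signedPow p (difference U z) * difference (w i) z ∂(pairMeasure (ν (ε i))) =
      (∫ z, signedPow p (difference U z) * difference (mollify (r / 2) (w i)) z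
        ∂(pairMeasure (ν (ε i)))) -
      ∫ z, signedPow p (difference U z) * difference (mollify (r / 2) (w i) - w i) z
        ∂(pairMeasure (ν (ε i))) := by
    rw [difference_sub, ← integral_sub (integrable_signedPow_mul hp hDU hDm)
      (integrable_signedPow_mul hp hDU (hDm.sub hDw))]
    refine integral_congr_ae (Eventually.of_forall fun z => ?_)
    simp only [Pi.sub_apply]
    ring
  rw [dist_zero_right, hdec]
  exact (norm_sub_le _ _).trans_lt (by linarith)

end VanishingSequences

/-! ### Extension, gluing, and the energy across the boundary -/

section Boundary

variable {d : ℕ} {p : ℝ}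

/-- The boundary of a Lipschitz domain is locally a graph, and a graph has pairwise disjoint
translates. -/
theorem HasLipschitzBoundary.volume_frontier {Ω : Set (Rn d)} (hΩ : HasLipschitzBoundary Ω)
    (hΩo : IsOpen Ω) : volume (frontier Ω) = 0 := by
  refine measure_null_of_locally_null _ fun x₀ hx₀ => ?_
  obtain ⟨r, hr, e, he, L, γ, hγ, hΩγ⟩ := hΩ x₀ hx₀
  have hc1 : Continuous fun x : Rn d => γ (x - inner ℝ e x • e) := hγ.continuous.comp (by fun_prop)
  have hc2 : Continuous fun x : Rn d => (inner ℝ e x : ℝ) := by fun_prop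
  set Γ : Set (Rn d) := {x | γ (x - inner ℝ e x • e) = inner ℝ e x} with hΓ
  have hΓm : MeasurableSet Γ := (isClosed_eq hc1 hc2).measurableSet
  have hsub : frontier Ω ∩ ball x₀ r ⊆ Γ := by
    rintro x ⟨hxf, hxb⟩
    rw [hΩo.frontier_eq] at hxf
    refine le_antisymm ?_ (not_lt.1 fun h => hxf.2 ((hΩγ x hxb).2 h))
    have hcl : x ∈ closure (Ω ∩ ball x₀ r) := by
      have hxc := mem_closure_iff_nhds.1 hxf.1
      rw [mem_closure_iff_nhds]
      intro t ht
      obtain ⟨y, ⟨hyt, hyb⟩, hyΩ⟩ := hxc (t ∩ ball x₀ r)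
        (inter_mem ht (isOpen_ball.mem_nhds hxb))
      exact ⟨y, hyt, hyΩ, hyb⟩
    have : closure (Ω ∩ ball x₀ r) ⊆ {x | γ (x - inner ℝ e x • e) ≤ inner ℝ e x} :=
      closure_minimal (fun y hy => ((hΩγ y hy.2).1 hy.1).le) (isClosed_le hc1 hc2)
    exact this hcl
  have hee : inner ℝ e e = 1 := by rw [real_inner_self_eq_norm_sq, he, one_pow]
  have hΓ0 : volume Γ = 0 := by
    refine Measure.addHaar_eq_zero_of_disjoint_translates volume
      (u := fun n : ℕ => (1 / ((n : ℝ) + 1)) • e) ?_ ?_ hΓm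
    · refine isBounded_iff_forall_norm_le.2 ⟨1, ?_⟩
      rintro _ ⟨n, rfl⟩
      rw [norm_smul, he, mul_one, Real.norm_of_nonneg (by positivity), div_le_one (by positivity)]
      linarith [Nat.cast_nonneg (α := ℝ) n]
    · intro m n hmn
      refine disjoint_left.2 fun x hxm hxn => hmn ?_
      obtain ⟨_, rfl, y, hy, rfl⟩ := hxm
      obtain ⟨_, rfl, z, hz, hzy⟩ := hxn
      -- two points of the graph on the same line in direction `e` coincide
      have hz' : z = y + (1 / ((m : ℝ) + 1) - 1 / ((n : ℝ) + 1)) • e := by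
        rw [sub_smul]
        simp only at hzy
        rw [← add_sub_assoc, eq_sub_iff_add_eq, add_comm z, hzy, add_comm]
      set s := 1 / ((m : ℝ) + 1) - 1 / ((n : ℝ) + 1) with hs
      have hin : inner ℝ e z = inner ℝ e y + s := by
        rw [hz', inner_add_right, real_inner_smul_right, hee, mul_one]
      have hpr : z - inner ℝ e z • e = y - inner ℝ e y • e := by
        rw [hin, hz', add_smul]
        abel
      have h1 : γ (z - inner ℝ e z • e) = inner ℝ e z := hz
      have h2 : γ (y - inner ℝ e y • e) = inner ℝ e y := hy
      rw [hpr, h2, hin] at h1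
      have h3 : 1 / ((m : ℝ) + 1) = 1 / ((n : ℝ) + 1) := by linarith
      rw [one_div, one_div, inv_inj] at h3
      exact_mod_cast add_right_cancel h3
  refine ⟨frontier Ω ∩ ball x₀ r, inter_mem self_mem_nhdsWithin
    (mem_nhdsWithin_of_mem_nhds (ball_mem_nhds _ hr)), measure_mono_null hsub hΓ0⟩

theorem setIntegral_test_eq {F : Type*} [NormedAddCommGroup F] [NormedSpace ℝ F] {U : Set (Rn d)}
    {φ : Rn d → ℝ} (hφ : tsupport φ ⊆ U) (f : Rn d → F) :
    ∫ x in U, φ x • f x = ∫ x, φ x • f x := by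
  refine setIntegral_eq_integral_of_forall_compl_eq_zero fun x hx => ?_
  rw [image_eq_zero_of_notMem_tsupport fun h => hx (hφ h), zero_smul]

theorem setIntegral_gradient_eq {U : Set (Rn d)} {φ : Rn d → ℝ} (hφ : tsupport φ ⊆ U)
    (f : Rn d → ℝ) : ∫ x in U, f x • gradient φ x = ∫ x, f x • gradient φ x := by
  refine setIntegral_eq_integral_of_forall_compl_eq_zero fun x hx => ?_
  rw [gradient_eq_zero_of_notMem fun h => hx (hφ h), smul_zero]

theorem HasSobolevGrad.restrict {u : Rn d → ℝ} {G : Rn d → Rn d} (h : HasSobolevGrad p univ u G)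
    (U : Set (Rn d)) : HasSobolevGrad p U u G := by
  refine ⟨h.memLp_univ.restrict U, h.memLp_grad_univ.restrict U, fun φ hφ => ?_⟩
  have h1 := h.integral_eq φ ⟨hφ.1, hφ.2.1, subset_univ _⟩
  rw [Measure.restrict_univ] at h1
  rw [setIntegral_test_eq hφ.2.2, setIntegral_gradient_eq hφ.2.2, h1]

theorem HasSobolevGrad.grad_unique (hp : 1 < p) {U : Set (Rn d)} (hU : IsOpen U) {u : Rn d → ℝ}
    {G H : Rn d → Rn d} (hG : HasSobolevGrad p U u G) (hH : HasSobolevGrad p U u H) :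
    G =ᵐ[volume.restrict U] H := by
  have hl : LocallyIntegrableOn (G - H) U volume :=
    locallyIntegrableOn_of_locallyIntegrable_restrict
      ((hG.memLp_grad.sub hH.memLp_grad).locallyIntegrable (one_le_ofReal hp))
  have h := hU.ae_eq_zero_of_integral_contDiff_smul_eq_zero hl fun φ h1 h2 h3 => by
    have hφ : IsTestFun U φ := ⟨h1, h2, h3⟩
    rw [← setIntegral_test_eq h3]
    simp only [Pi.sub_apply, smul_sub]
    rw [integral_sub (hG.integrable_right hp hφ) (hH.integrable_right hp hφ), sub_eq_zero,
      ← neg_inj, ← hG.integral_eq φ hφ, ← hH.integral_eq φ hφ]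
  rw [EventuallyEq, ae_restrict_iff' hU.measurableSet]
  filter_upwards [h] with x hx hxU
  exact sub_eq_zero.1 (hx hxU)

theorem HasSobolevGrad.weakGrad_ae_eq (hp : 1 < p) {U : Set (Rn d)} (hU : IsOpen U) {u : Rn d → ℝ}
    {G : Rn d → Rn d} (hG : HasSobolevGrad p U u G) :
    weakGrad p U u =ᵐ[volume.restrict U] G := by
  have h : MemW1p p U u := ⟨G, hG⟩
  have : weakGrad p U u = h.choose := by rw [weakGrad, dif_pos h]
  rw [this]
  exact h.choose_spec.grad_unique hp hU hG

theorem localForm_eq (hp : 1 < p) {Ω : Set (Rn d)} (hΩ : IsOpen Ω) {u v : Rn d → ℝ}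
    {G H : Rn d → Rn d} (hu : HasSobolevGrad p Ω u G) (hv : HasSobolevGrad p Ω v H) :
    localForm p Ω u v = ∫ x in Ω, ‖G x‖ ^ (p - 2) * inner ℝ (G x) (H x) := by
  refine integral_congr_ae ?_
  filter_upwards [hu.weakGrad_ae_eq hp hΩ, hv.weakGrad_ae_eq hp hΩ] with x h1 h2
  rw [h1, h2]

/-- The extension by zero of a function in `W^{1,p}_0(Ω)`. -/
theorem exists_hasSobolevGrad_indicator (hp : 1 < p) {Ω : Set (Rn d)} (hΩ : MeasurableSet Ω)
    {v : Rn d → ℝ} (hv : v ∈ W1pZero hp Ω) :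
    ∃ G : Rn d → Rn d, HasSobolevGrad p univ (Ω.indicator v) (Ω.indicator G) := by
  obtain ⟨G, hG, φ, hφ, h1, h2⟩ := hv
  refine ⟨G, ?_, ?_, fun ψ hψ => ?_⟩
  · rw [Measure.restrict_univ]
    exact (memLp_indicator_iff_restrict hΩ).2 hG.memLp
  · rw [Measure.restrict_univ]
    exact (memLp_indicator_iff_restrict hΩ).2 hG.memLp_grad
  · have h3 := integral_smul_gradient_of_tendsto hp hG.memLp hG.memLp_grad hφ h1 h2 hψ
    rw [Measure.restrict_univ, ← integral_indicator hΩ, ← integral_indicator hΩ] at *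
    have e1 : (fun x => Ω.indicator v x • gradient ψ x) =
        Ω.indicator fun x => v x • gradient ψ x := by
      funext x
      by_cases hx : x ∈ Ω <;> simp [hx]
    have e2 : (fun x => ψ x • Ω.indicator G x) = Ω.indicator fun x => ψ x • G x := by
      funext x
      by_cases hx : x ∈ Ω <;> simp [hx]
    rw [e1, e2, h3]

/-- The extension `gbar` is prescribed outside of the closure of `Ω` only, and `g` is used on the
complement of `Ω`; the boundary between the two is a null set. -/
theorem glue_ae_eq {Ω : Set (Rn d)} (hΩo : IsOpen Ω) (hΩL : HasLipschitzBoundary Ω)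
    {u g gbar : Rn d → ℝ} (hg : gbar =ᵐ[volume.restrict (closure Ω)ᶜ] g) :
    gbar + Ω.indicator (u - gbar) =ᵐ[volume] glue Ω u g := by
  have h1 : ∀ᵐ x, x ∉ frontier Ω := measure_eq_zero_iff_ae_notMem.1 (hΩL.volume_frontier hΩo)
  have h2 : ∀ᵐ x, x ∈ (closure Ω)ᶜ → gbar x = g x :=
    (ae_restrict_iff' isClosed_closure.measurableSet.compl).1 hg
  filter_upwards [h1, h2] with x hx1 hx2
  by_cases hx : x ∈ Ω
  · simp [glue, hx]
  · have : x ∈ (closure Ω)ᶜ := fun h => hx1 (by rw [hΩo.frontier_eq]; exact ⟨h, hx⟩)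
    simp [glue, hx, hx2 this]

/-- The pairs of points that are separated by the boundary of `Ω`. -/
def crossSet (Ω : Set (Rn d)) : Set (Rn d × Rn d) := Ω ×ˢ Ωᶜ ∪ Ωᶜ ×ˢ Ω

theorem measurableSet_crossSet {Ω : Set (Rn d)} (hΩ : MeasurableSet Ω) :
    MeasurableSet (crossSet Ω) := (hΩ.prod hΩ.compl).union (hΩ.compl.prod hΩ)

theorem IsPreconnected.inter_frontier_nonempty_of_isOpen {X : Type*} [TopologicalSpace X]
    {s U : Set X} (hs : IsPreconnected s) (hU : IsOpen U) (h1 : (s ∩ U).Nonempty)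
    (h2 : (s ∩ Uᶜ).Nonempty) : (s ∩ frontier U).Nonempty := by
  by_contra hne
  rw [hU.frontier_eq, not_nonempty_iff_eq_empty] at hne
  have hcov : ∀ x ∈ s, x ∉ U → x ∈ (closure U)ᶜ := fun x hx hxU hxc =>
    (hne.subset (⟨hx, hxc, hxU⟩ : x ∈ s ∩ (closure U \ U))).elim
  obtain ⟨x, hx, hxU⟩ := h2
  obtain ⟨y, -, hyU, hyc⟩ := hs U (closure U)ᶜ hU isClosed_closure.isOpen_compl
    (fun x hx => (em (x ∈ U)).imp id (hcov x hx)) h1 ⟨x, hx, hcov x hx hxU⟩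
  exact hyc (subset_closure hyU)

/-- Two points on different sides of the boundary are joined by a segment that meets it. -/
theorem mem_cthickening_frontier {Ω : Set (Rn d)} (hΩo : IsOpen Ω) {x h : Rn d} {r : ℝ}
    (hh : ‖h‖ ≤ r) (hx : (x + h, x) ∈ crossSet Ω) : x ∈ cthickening r (frontier Ω) := by
  have hpre : IsPreconnected (segment ℝ x (x + h)) := (convex_segment _ _).isPreconnected
  have hl := left_mem_segment ℝ x (x + h)
  have hr := right_mem_segment ℝ x (x + h)
  obtain ⟨y, hy, hyf⟩ : (segment ℝ x (x + h) ∩ frontier Ω).Nonempty := by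
    rcases hx with hx | hx
    · exact hpre.inter_frontier_nonempty_of_isOpen hΩo ⟨_, hr, hx.1⟩ ⟨_, hl, hx.2⟩
    · exact hpre.inter_frontier_nonempty_of_isOpen hΩo ⟨_, hl, hx.2⟩ ⟨_, hr, hx.1⟩
  refine mem_cthickening_of_dist_le x y r _ hyf ?_
  obtain ⟨t, ht, rfl⟩ := (segment_eq_image' ℝ x (x + h)).subset hy
  rw [dist_eq_norm, add_sub_cancel_left, sub_add_cancel_left, norm_neg, norm_smul,
    Real.norm_of_nonneg ht.1]
  exact (mul_le_of_le_one_left (norm_nonneg _) ht.2).trans hh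

/-- Since the boundary is a null set, the energy of a Sobolev function across it vanishes in the
limit. -/
theorem tendsto_pairEnergy_crossSet (hp : 1 < p) {ν : ℝ → RadialLevyKernel d p}
    (hν : IsLevyApproxUnity ν) {Ω : Set (Rn d)} (hΩo : IsOpen Ω) (hΩb : Bornology.IsBounded Ω)
    (hΩL : HasLipschitzBoundary Ω) {U : Rn d → ℝ} {G : Rn d → Rn d}
    (hU : HasSobolevGrad p univ U G) :
    Tendsto (fun ε => pairEnergy (ν ε) (crossSet Ω) U) (𝓝[>] 0) (𝓝 0) := by
  have hp0 : 0 < p := by linarith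
  rw [ENNReal.tendsto_nhds_zero]
  intro κ hκ
  obtain ⟨κ', hκ'0, hκ'⟩ : ∃ κ' : ℝ≥0∞, 0 < κ' ∧ κ' + κ' ≤ κ :=
    ⟨κ / 2, ENNReal.half_pos hκ.ne', (ENNReal.add_halves κ).le⟩
  have hcol : Tendsto (fun r => ∫⁻ x in cthickening r (frontier Ω), ‖G x‖ₑ ^ p) (𝓝 0) (𝓝 0) := by
    refine tendsto_setLIntegral_zero ?_ ?_
    · rw [← eLpNorm_rpow_eq hp]
      exact ENNReal.rpow_ne_top_of_nonneg hp0.le hU.memLp_grad_univ.2.ne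
    · have hcpt : IsCompact (frontier Ω) :=
        hΩb.isCompact_closure.of_isClosed_subset isClosed_frontier frontier_subset_closure
      have := tendsto_measure_cthickening_of_isCompact (μ := volume) hcpt
      rwa [hΩL.volume_frontier hΩo] at this
  obtain ⟨τ, hτ0, hττ⟩ : ∃ τ : ℝ≥0∞, 0 < τ ∧ 2 ^ p * (τ + τ) ≤ κ' ∧ τ ≠ ⊤ := by
    obtain ⟨η, hη, hηκ⟩ := exists_ofReal_mul_le (A := 2 ^ p * 2) (by finiteness) hκ'0
    refine ⟨ENNReal.ofReal η, by simpa using hη, le_trans (le_of_eq ?_) hηκ, by finiteness⟩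
    ring
  obtain ⟨hτκ, hτt⟩ := hττ
  have hshift : ∀ᶠ z in 𝓝 (0 : Rn d), shiftNorm p G z ^ p ≤ τ := by
    have h1 := (ENNReal.continuous_rpow_const (y := p)).tendsto 0 |>.comp
      (tendsto_shiftNorm hp hU.memLp_grad_univ)
    have h2 : Tendsto (fun z => shiftNorm p G z ^ p) (𝓝 0) (𝓝 0) := by
      simpa [hp0, Function.comp_def] using h1
    exact h2.eventually_le_const hτ0
  obtain ⟨r₁, hr₁, hr₁τ⟩ := Metric.eventually_nhds_iff.1 hshift
  obtain ⟨r₂, hr₂, hr₂τ⟩ := Metric.eventually_nhds_iff.1 (hcol.eventually_le_const hτ0)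
  obtain ⟨r, hr, hr1, hrr₁, hrr₂⟩ : ∃ r : ℝ, 0 < r ∧ r ≤ 1 ∧ r < r₁ ∧ r < r₂ :=
    ⟨min 1 (min r₁ r₂ / 2), by positivity, min_le_left _ _,
      (min_le_right _ _).trans_lt (by linarith [min_le_left r₁ r₂, lt_min hr₁ hr₂]),
      (min_le_right _ _).trans_lt (by linarith [min_le_right r₁ r₂, lt_min hr₁ hr₂])⟩
  have hAt : (2 * eLpNorm U (ENNReal.ofReal p) volume) ^ p ≠ ⊤ :=
    ENNReal.rpow_ne_top_of_nonneg hp0.le (ENNReal.mul_ne_top (by simp) hU.memLp_univ.2.ne)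
  have hfar : ∀ᶠ ε in 𝓝[>] (0 : ℝ), (2 * eLpNorm U (ENNReal.ofReal p) volume) ^ p *
      ∫⁻ h in {h : Rn d | r < ‖h‖}, ((ν ε).toFun h : ℝ≥0∞) ≤ κ' := by
    have h1 := ENNReal.Tendsto.const_mul (a := (2 * eLpNorm U (ENNReal.ofReal p) volume) ^ p)
      (hν.concentrates r hr) (Or.inr hAt)
    rw [mul_zero] at h1
    exact h1.eventually_le_const hκ'0
  filter_upwards [hfar, self_mem_nhdsWithin] with ε hfε hε
  have hmass := lintegral_norm_le_one hp (hν.normalized ε hε) hr1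
  have hms : MeasurableSet (crossSet Ω) := measurableSet_crossSet hΩo.measurableSet
  have hTm : MeasurableSet (pairMap d ⁻¹' crossSet Ω) :=
    measurePreserving_pairMap_volume.measurable hms
  have hBm : MeasurableSet {h : Rn d | ‖h‖ ≤ r} := measurableSet_le measurable_norm measurable_const
  set D : Rn d × Rn d → ℝ≥0∞ := (pairMap d ⁻¹' crossSet Ω).indicator
    fun z => ‖difference U z‖ₑ ^ p with hD
  have hDm : AEMeasurable D (pairMeasure (ν ε)) :=
    ((aestronglyMeasurable_difference (ν ε) hU.memLp_univ.1).enorm.pow_const p).indicator hTm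
  have hcompl : ({h : Rn d | ‖h‖ ≤ r} ×ˢ (univ : Set (Rn d)))ᶜ = {h : Rn d | r < ‖h‖} ×ˢ univ := by
    ext z
    simp
  rw [pairEnergy_eq_difference hp (ν ε) hms hU.memLp_univ.1, ← lintegral_indicator hTm,
    ← lintegral_add_compl _ (hBm.prod MeasurableSet.univ), hcompl]
  -- small `h`: only points near the boundary contribute, up to the Taylor remainder;
  -- large `h`: the kernel has little mass there
  refine (add_le_add ?_ ?_).trans hκ'
  · refine (lintegral_near_le (K := 2 ^ p * (τ + τ)) (by finiteness) hmass hDm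
      fun h hh => ?_).trans hτκ
    have hmG : AEMeasurable (fun x => ‖U (x + h) - U x - inner ℝ (G x) h‖ₑ ^ p) volume :=
      (((aestronglyMeasurable_shift hU.memLp_univ.1 h).sub hU.memLp_univ.1).sub
        (hU.memLp_grad_univ.1.inner aestronglyMeasurable_const)).enorm.pow_const p
    calc ∫⁻ x, D (h, x) ≤ ∫⁻ x, 2 ^ p * (‖U (x + h) - U x - inner ℝ (G x) h‖ₑ ^ p +
          ENNReal.ofReal (‖h‖ ^ p) *
            (cthickening r (frontier Ω)).indicator (fun x => ‖G x‖ₑ ^ p) x) := by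
          refine lintegral_mono fun x => ?_
          by_cases hx : (h, x) ∈ pairMap d ⁻¹' crossSet Ω
          · rw [hD, indicator_of_mem hx, indicator_of_mem (mem_cthickening_frontier hΩo hh hx)]
            have h1 : difference U (h, x) =
                (U (x + h) - U x - inner ℝ (G x) h) + inner ℝ (G x) h := by
              simp [difference]
            rw [h1]
            refine (ENNReal.rpow_le_rpow (enorm_add_le _ _) hp0.le).trans
              ((add_rpow_le_two hp _ _).trans (mul_le_mul_right (add_le_add_right ?_ _) _))
            rw [ofReal_norm_rpow hp, ← ENNReal.mul_rpow_of_nonneg _ _ hp0.le, mul_comm]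
            exact ENNReal.rpow_le_rpow (enorm_real_inner_le _ _) hp0.le
          · rw [hD, indicator_of_notMem hx]
            exact bot_le
      _ = 2 ^ p * ((∫⁻ x, ‖U (x + h) - U x - inner ℝ (G x) h‖ₑ ^ p) + ENNReal.ofReal (‖h‖ ^ p) *
            ∫⁻ x in cthickening r (frontier Ω), ‖G x‖ₑ ^ p) := by
          rw [lintegral_const_mul' _ _ (by finiteness), lintegral_add_left' hmG,
            lintegral_const_mul' _ _ (by finiteness),
            lintegral_indicator isClosed_cthickening.measurableSet]
      _ ≤ 2 ^ p * (ENNReal.ofReal (‖h‖ ^ p) * τ + ENNReal.ofReal (‖h‖ ^ p) * τ) := by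
          refine mul_le_mul_right (add_le_add (hU.lintegral_taylor_le hp fun z hz => hr₁τ ?_)
            (mul_le_mul_right (hr₂τ ?_) _)) _
          · rw [dist_zero_right]
            linarith
          · rw [dist_zero_right, Real.norm_of_nonneg hr.le]
            exact hrr₂
      _ = _ := by ring
  · refine le_trans (lintegral_mono fun z => ?_)
      ((lintegral_difference_far_le hp (ν ε) hU.memLp_univ r).trans hfε)
    exact indicator_le_self _ _ _

end Boundary

/-! ### Energies as integrals, and monotonicity -/

section Monotone

variable {p : ℝ}

/-- A linear term is absorbed into a small multiple of the `p`-th power. -/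
theorem exists_le_add_mul_rpow (hp : 1 < p) {η : ℝ} (hη : 0 < η) :
    ∃ C : ℝ≥0, ∀ x : ℝ≥0∞, x ≤ C + ENNReal.ofReal η * x ^ p := by
  have hp0 : 0 < p := by linarith
  have hp1 : 0 < p - 1 := by linarith
  set L : ℝ := (1 / η) ^ (1 / (p - 1)) with hL
  have hL0 : 0 < L := by positivity
  refine ⟨L.toNNReal, fun x => ?_⟩
  induction x with
  | top => rw [ENNReal.top_rpow_of_pos hp0, ENNReal.mul_top (by simpa using hη), add_top]
  | coe t =>
    rcases le_total (t : ℝ) L with h | h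
    · exact le_add_right (ENNReal.coe_le_coe.2 (NNReal.le_toNNReal_of_coe_le h))
    · have ht : 0 < (t : ℝ) := hL0.trans_le h
      refine le_add_left ?_
      rw [← ENNReal.ofReal_coe_nnreal, ENNReal.ofReal_rpow_of_pos ht, ← ENNReal.ofReal_mul hη.le]
      refine ENNReal.ofReal_le_ofReal ?_
      have h1 : 1 / η ≤ (t : ℝ) ^ (p - 1) := by
        calc 1 / η = L ^ (p - 1) := by
              rw [hL, ← Real.rpow_mul (by positivity), one_div_mul_cancel hp1.ne', Real.rpow_one]
          _ ≤ _ := Real.rpow_le_rpow hL0.le h hp1.le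
      rw [div_le_iff₀ hη] at h1
      calc (t : ℝ) = 1 * t := (one_mul _).symm
        _ ≤ (t : ℝ) ^ (p - 1) * η * t := mul_le_mul_of_nonneg_right h1 ht.le
        _ = η * ((t : ℝ) ^ (p - 1) * t) := by ring
        _ = η * (t : ℝ) ^ p := by
          rw [← Real.rpow_add_one ht.ne', sub_add_cancel]

variable {S : Type*} [MeasurableSpace S]

theorem lintegral_rpow_eq_ofReal (hp : 1 < p) {m : Measure S} {f : S → ℝ}
    (hf : MemLp f (ENNReal.ofReal p) m) :
    ∫⁻ x, ‖f x‖ₑ ^ p ∂m = ENNReal.ofReal (∫ x, signedPow p (f x) * f x ∂m) := by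
  rw [ofReal_integral_eq_lintegral_ofReal (integrable_signedPow_mul hp hf hf)
    (Eventually.of_forall fun x => ?_)]
  · refine lintegral_congr fun x => ?_
    rw [signedPow_mul_self hp, ofReal_abs_rpow hp]
  · simp only [signedPow_mul_self hp, Pi.zero_apply]
    positivity

/-- Functions that are bounded in `L^p`, tested with functions that vanish in `L^p` in the limit;
the measures may vary. -/
theorem tendsto_integral_signedPow_mul_zero (hp : 1 < p) {ι : Type*} {l : Filter ι}
    {m : ι → Measure S} {a c : ι → S → ℝ} (ha : ∀ᶠ i in l, AEStronglyMeasurable (a i) (m i))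
    {B : ℝ≥0} (hB : ∀ᶠ i in l, ∫⁻ x, ‖a i x‖ₑ ^ p ∂(m i) ≤ B)
    (hc : Tendsto (fun i => ∫⁻ x, ‖c i x‖ₑ ^ p ∂(m i)) l (𝓝 0)) :
    Tendsto (fun i => ∫ x, signedPow p (a i x) * c i x ∂(m i)) l (𝓝 0) := by
  rw [tendsto_zero_iff_enorm_tendsto_zero, ENNReal.tendsto_nhds_zero]
  intro κ hκ
  obtain ⟨η, hη, hηκ⟩ := exists_ofReal_mul_le (A := B) (by simp) (ENNReal.half_pos hκ.ne')
  obtain ⟨C, hC0, hC⟩ := exists_abs_signedPow_mul_le hp hη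
  have h1 := ENNReal.Tendsto.const_mul (a := ENNReal.ofReal C) hc (Or.inr (by simp))
  rw [mul_zero] at h1
  filter_upwards [ha, hB, h1.eventually_le_const (ENNReal.half_pos hκ.ne')] with i hai hBi hi
  refine (enorm_integral_le_lintegral_enorm _).trans
    ((enorm_integral_signedPow_le hp hη.le hC0 hC hai).trans ?_)
  exact (add_le_add ((mul_le_mul_right hBi _).trans hηκ) hi).trans (ENNReal.add_halves κ).le

/-- Minty's argument: the map `a ↦ |a|^(p-2) a` is uniformly monotone on bounded subsets of
`L^p`. -/
theorem tendsto_lintegral_sub_rpow_of_monotone (hp : 1 < p) {ι : Type*} {l : Filter ι}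
    {m : ι → Measure S} {a b : ι → S → ℝ} (ha : ∀ᶠ i in l, MemLp (a i) (ENNReal.ofReal p) (m i))
    (hb : ∀ᶠ i in l, MemLp (b i) (ENNReal.ofReal p) (m i)) {B : ℝ≥0}
    (hBa : ∀ᶠ i in l, ∫⁻ x, ‖a i x‖ₑ ^ p ∂(m i) ≤ B)
    (hBb : ∀ᶠ i in l, ∫⁻ x, ‖b i x‖ₑ ^ p ∂(m i) ≤ B)
    (hJ : Tendsto (fun i => ∫ x, signedPow p (a i x) * (a i x - b i x) ∂(m i) -
      ∫ x, signedPow p (b i x) * (a i x - b i x) ∂(m i)) l (𝓝 0)) :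
    Tendsto (fun i => ∫⁻ x, ‖a i x - b i x‖ₑ ^ p ∂(m i)) l (𝓝 0) := by
  rw [ENNReal.tendsto_nhds_zero]
  intro κ hκ
  obtain ⟨η, hη, hηκ⟩ := exists_ofReal_mul_le (A := B + B) (by simp) (ENNReal.half_pos hκ.ne')
  obtain ⟨C, hC0, hC⟩ := exists_abs_sub_rpow_le hp hη
  have h1 := ENNReal.Tendsto.const_mul (a := ENNReal.ofReal C)
    (ENNReal.tendsto_ofReal hJ) (Or.inr (by simp))
  rw [ENNReal.ofReal_zero, mul_zero] at h1
  filter_upwards [ha, hb, hBa, hBb, h1.eventually_le_const (ENNReal.half_pos hκ.ne')]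
    with i hai hbi hBai hBbi hi
  have hsub := hai.sub hbi
  have i1 := integrable_signedPow_mul hp hai hsub
  have i2 := integrable_signedPow_mul hp hbi hsub
  simp only [Pi.sub_apply] at i1 i2
  have i3 : Integrable (fun x => signedPow p (a i x) * (a i x - b i x) -
      signedPow p (b i x) * (a i x - b i x)) (m i) := i1.sub i2
  have hnn : ∀ x, 0 ≤ signedPow p (a i x) * (a i x - b i x) -
      signedPow p (b i x) * (a i x - b i x) := fun x => by
    rw [← sub_mul]
    rcases le_total (a i x) (b i x) with h | h
    · exact mul_nonneg_of_nonpos_of_nonpos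
        (sub_nonpos.2 ((strictMono_signedPow hp).monotone h)) (sub_nonpos.2 h)
    · exact mul_nonneg (sub_nonneg.2 ((strictMono_signedPow hp).monotone h)) (sub_nonneg.2 h)
  have hma : AEMeasurable (fun x => ‖a i x‖ₑ ^ p) (m i) := hai.1.enorm.pow_const p
  have hmb : AEMeasurable (fun x => ‖a i x‖ₑ ^ p + ‖b i x‖ₑ ^ p) (m i) :=
    hma.add (hbi.1.enorm.pow_const p)
  calc ∫⁻ x, ‖a i x - b i x‖ₑ ^ p ∂(m i)
      ≤ ∫⁻ x, (ENNReal.ofReal η * (‖a i x‖ₑ ^ p + ‖b i x‖ₑ ^ p) + ENNReal.ofReal C *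
          ENNReal.ofReal (signedPow p (a i x) * (a i x - b i x) -
            signedPow p (b i x) * (a i x - b i x))) ∂(m i) := by
        refine lintegral_mono fun x => ?_
        rw [← ofReal_abs_rpow hp, ← ofReal_abs_rpow hp, ← ofReal_abs_rpow hp,
          ← ENNReal.ofReal_add (by positivity) (by positivity), ← ENNReal.ofReal_mul hη.le,
          ← ENNReal.ofReal_mul hC0, ← ENNReal.ofReal_add (by positivity)
            (mul_nonneg hC0 (hnn x)), ← sub_mul]
        exact ENNReal.ofReal_le_ofReal (hC _ _)
    _ = ENNReal.ofReal η * (∫⁻ x, ‖a i x‖ₑ ^ p ∂(m i) + ∫⁻ x, ‖b i x‖ₑ ^ p ∂(m i)) +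
          ENNReal.ofReal C * ENNReal.ofReal (∫ x, signedPow p (a i x) * (a i x - b i x) ∂(m i) -
            ∫ x, signedPow p (b i x) * (a i x - b i x) ∂(m i)) := by
        rw [lintegral_add_left' (hmb.const_mul _), lintegral_const_mul' _ _ (by simp),
          lintegral_const_mul' _ _ (by simp), lintegral_add_left' hma, ← integral_sub i1 i2,
          ofReal_integral_eq_lintegral_ofReal i3 (Eventually.of_forall hnn)]
    _ ≤ κ := (add_le_add ((mul_le_mul_right (add_le_add hBai hBbi) _).trans hηκ) hi).trans
        (ENNReal.add_halves κ).le

end Monotone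

section Spaces

variable {d : ℕ} {p : ℝ}

/-- The measure `ν(h) dh dx` on the pairs `(h, x)` such that `x + h` and `x` are not both in the
complement of `Ω`. -/
noncomputable abbrev pairMeasureOn (ν : RadialLevyKernel d p) (Ω : Set (Rn d)) :
    Measure (Rn d × Rn d) :=
  (pairMeasure ν).restrict (pairMap d ⁻¹' (Ωᶜ ×ˢ Ωᶜ)ᶜ)

theorem energy_eq_difference (hp : 1 < p) (ν : RadialLevyKernel d p) {Ω : Set (Rn d)}
    (hΩ : MeasurableSet Ω) {w : Rn d → ℝ} (hw : AEStronglyMeasurable w volume) :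
    energy ν Ω w = ∫⁻ z, ‖difference w z‖ₑ ^ p ∂(pairMeasureOn ν Ω) :=
  pairEnergy_eq_difference hp ν (hΩ.compl.prod hΩ.compl).compl hw

theorem memLp_difference_on (hp : 1 < p) {ν : RadialLevyKernel d p} {Ω : Set (Rn d)}
    (hΩ : MeasurableSet Ω) {w : Rn d → ℝ} (hw : w ∈ WAcross hp ν Ω) :
    MemLp (difference w) (ENNReal.ofReal p) (pairMeasureOn ν Ω) := by
  have hp0 : 0 < p := by linarith
  refine ⟨(aestronglyMeasurable_difference ν hw.1).restrict, ?_⟩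
  have h := hw.2.2
  rw [energy_eq_difference hp ν hΩ hw.1, ← eLpNorm_rpow_eq hp] at h
  exact (ENNReal.rpow_lt_top_iff_of_pos hp0).1 h

theorem difference_eq_zero_ae (ν : RadialLevyKernel d p) {Ω : Set (Rn d)}
    {w : Rn d → ℝ} (h0 : ∀ᵐ x, x ∉ Ω → w x = 0) :
    ∀ᵐ z ∂(pairMeasure ν), z ∉ pairMap d ⁻¹' (Ωᶜ ×ˢ Ωᶜ)ᶜ → difference w z = 0 := by
  have h1 : Measure.QuasiMeasurePreserving (fun z : Rn d × Rn d => z.2 + z.1)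
      (volume.prod volume) volume :=
    Measure.quasiMeasurePreserving_fst.comp
      (measurePreserving_pairMap_volume (d := d)).quasiMeasurePreserving
  have h2 := h1.ae h0
  have h3 := (Measure.quasiMeasurePreserving_snd (μ := (volume : Measure (Rn d)))
    (ν := (volume : Measure (Rn d)))).ae h0
  refine (pairMeasure_absolutelyContinuous ν).ae_le ?_
  filter_upwards [h2, h3] with z hz1 hz2 hz
  have hz' : z.2 + z.1 ∈ Ωᶜ ∧ z.2 ∈ Ωᶜ := not_not.1 hz
  rw [difference, hz1 hz'.1, hz2 hz'.2, sub_zero]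

theorem setIntegral_difference_eq (ν : RadialLevyKernel d p) {Ω : Set (Rn d)}
    {w : Rn d → ℝ} (h0 : ∀ᵐ x, x ∉ Ω → w x = 0) (a : Rn d × Rn d → ℝ) :
    ∫ z, a z * difference w z ∂(pairMeasureOn ν Ω) =
      ∫ z, a z * difference w z ∂(pairMeasure ν) := by
  refine setIntegral_eq_integral_of_ae_compl_eq_zero ?_
  filter_upwards [difference_eq_zero_ae ν h0] with z hz hzT
  rw [hz hzT, mul_zero]

theorem ae_eq_zero_of_mem_WAcrossZero {hp : 1 < p} {ν : RadialLevyKernel d p} {Ω : Set (Rn d)}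
    (hΩ : MeasurableSet Ω) {w : Rn d → ℝ} (hw : w ∈ WAcrossZero hp ν Ω) :
    ∀ᵐ x, x ∉ Ω → w x = 0 := (ae_restrict_iff' hΩ.compl).1 hw.2

theorem memLp_of_mem_WAcrossZero {hp : 1 < p} {ν : RadialLevyKernel d p} {Ω : Set (Rn d)}
    (hΩ : MeasurableSet Ω) {w : Rn d → ℝ} (hw : w ∈ WAcrossZero hp ν Ω) :
    MemLp w (ENNReal.ofReal p) volume :=
  ⟨hw.1.1, by
    rw [← eLpNorm_restrict_eq hΩ (ae_eq_zero_of_mem_WAcrossZero hΩ hw)]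
    exact hw.1.2.1.2⟩

theorem HasSobolevGrad.mem_WAcross (hp : 1 < p) {ν : RadialLevyKernel d p}
    (hν : ∫⁻ h, ENNReal.ofReal (min 1 (‖h‖ ^ p)) * (ν.toFun h : ℝ≥0∞) = 1) {U : Rn d → ℝ}
    {G : Rn d → Rn d} (hU : HasSobolevGrad p univ U G) (Ω : Set (Rn d)) : U ∈ WAcross hp ν Ω :=
  ⟨hU.memLp_univ.1, hU.memLp_univ.restrict Ω,
    (pairEnergy_mono ν (subset_univ _) U).trans_lt (hU.pairEnergy_lt_top hp hν)⟩

theorem normAcross_rpow (hp : 1 < p) (ν : RadialLevyKernel d p) (Ω : Set (Rn d)) (w : Rn d → ℝ) :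
    normAcross ν Ω w ^ p =
      eLpNorm w (ENNReal.ofReal p) (volume.restrict Ω) ^ p + energy ν Ω w := by
  rw [normAcross, ← ENNReal.rpow_mul, one_div_mul_cancel (by linarith), ENNReal.rpow_one]

/-- The members of a sequence that approach `0` from the right have indices that tend to
infinity. -/
theorem nhdsGT_inf_range_le (e : ℕ → ℝ) : 𝓝[>] (0 : ℝ) ⊓ 𝓟 (range e) ≤ map e atTop := by
  intro s hs
  obtain ⟨N, hN⟩ := mem_atTop_sets.1 (mem_map.1 hs)
  have h1 : ∀ i ∈ Finset.range N, ∀ᶠ ε in 𝓝[>] (0 : ℝ), ε ≠ e i := fun i _ => by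
    rcases eq_or_ne (e i) 0 with h | h
    · rw [h]
      exact eventually_mem_nhdsWithin.mono fun ε hε => ne_of_gt hε
    · exact (eventually_ne_nhds h.symm).filter_mono nhdsWithin_le_nhds
  rw [mem_inf_principal]
  filter_upwards [(Finset.eventually_all _).2 h1] with ε hε hr
  obtain ⟨n, rfl⟩ := hr
  exact hN n (not_lt.1 fun hn => hε n (Finset.mem_range.2 hn) rfl)

/-- Asymptotic weak convergence along a sequence `e n → 0`: off the sequence, the family is
completed with the limit itself. -/
theorem AsympWeakConv.tendsto_comp {hp : 1 < p} {ν : ℝ → RadialLevyKernel d p} {Ω : Set (Rn d)}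
    {fε : ∀ ε : ℝ, WAcrossZero hp (ν ε) Ω →ₗ[ℝ] ℝ} {f : W1pZero hp Ω →ₗ[ℝ] ℝ}
    (hf : AsympWeakConv hp ν Ω fε f) {e : ℕ → ℝ} (he : Tendsto e atTop (𝓝[>] 0))
    (V : ∀ ε, WAcrossZero hp (ν ε) Ω) (v : W1pZero hp Ω) {w : Rn d → ℝ}
    (hw : ∀ᶠ ε in 𝓝[>] (0 : ℝ), w ∈ WAcrossZero hp (ν ε) Ω)
    (hwv : w =ᵐ[volume.restrict Ω] (v : Rn d → ℝ))
    (hV : Tendsto (fun n => eLpNorm ((V (e n) : Rn d → ℝ) - (v : Rn d → ℝ)) (ENNReal.ofReal p)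
      (volume.restrict Ω)) atTop (𝓝 0)) :
    Tendsto (fun n => fε (e n) (V (e n))) atTop (𝓝 (f v)) := by
  classical
  set V' : ∀ ε, WAcrossZero hp (ν ε) Ω := fun ε =>
    if ε ∈ range e then V ε else if h : w ∈ WAcrossZero hp (ν ε) Ω then ⟨w, h⟩ else 0 with hV'
  have h0 : eLpNorm (w - (v : Rn d → ℝ)) (ENNReal.ofReal p) (volume.restrict Ω) = 0 := by
    have : w - (v : Rn d → ℝ) =ᵐ[volume.restrict Ω] 0 := by
      filter_upwards [hwv] with x hx
      simp [hx]
    rw [eLpNorm_congr_ae this, eLpNorm_zero]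
  have hlim : Tendsto (fun ε => eLpNorm ((V' ε : Rn d → ℝ) - (v : Rn d → ℝ)) (ENNReal.ofReal p)
      (volume.restrict Ω)) (𝓝[>] 0) (𝓝 0) := by
    rw [ENNReal.tendsto_nhds_zero]
    intro κ hκ
    have h1 : ∀ᶠ ε in map e atTop, eLpNorm ((V ε : Rn d → ℝ) - (v : Rn d → ℝ))
        (ENNReal.ofReal p) (volume.restrict Ω) ≤ κ :=
      eventually_map.2 (hV.eventually_le_const hκ)
    filter_upwards [hw, eventually_inf_principal.1 (h1.filter_mono (nhdsGT_inf_range_le e))]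
      with ε hε1 hε2
    by_cases hr : ε ∈ range e
    · rw [show V' ε = V ε from if_pos hr]
      exact hε2 hr
    · rw [show V' ε = ⟨w, hε1⟩ from (if_neg hr).trans (dif_pos hε1)]
      exact h0.le.trans bot_le
  refine ((hf.weak_strong V' v hlim).comp he).congr fun n => ?_
  have : V' (e n) = V (e n) := if_pos (mem_range_self n)
  rw [Function.comp_apply, this]

end Spaces

/-! ### Convergence of the energies -/

section Convergence

variable {d : ℕ} {p : ℝ}

theorem pairEnergy_sub_le (hp : 1 < p) (ν : RadialLevyKernel d p) (S : Set (Rn d × Rn d))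
    {u : Rn d → ℝ} (hu : AEStronglyMeasurable u volume) (v : Rn d → ℝ) :
    pairEnergy ν S (u - v) ≤ 2 ^ p * (pairEnergy ν S u + pairEnergy ν S v) := by
  have h : pairEnergy ν S (-v) = pairEnergy ν S v := by
    rw [← neg_one_smul ℝ v, pairEnergy_smul, abs_neg, abs_one, Real.one_rpow,
      ENNReal.ofReal_one, one_mul]
  rw [sub_eq_add_neg, ← h]
  exact pairEnergy_add_le hp ν S hu

/-- The infimum in the definition of the trace norm is almost attained. -/
theorem exists_lift (hp : 1 < p) {ν : RadialLevyKernel d p} {Ω : Set (Rn d)} {g : Rn d → ℝ}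
    {τ : ℝ≥0∞} (h : traceNorm hp ν Ω g < τ) :
    ∃ w ∈ WAcross hp ν Ω, w =ᵐ[volume.restrict Ωᶜ] g ∧ normAcross ν Ω w < τ := by
  rw [traceNorm] at h
  simp only [iInf_lt_iff] at h
  obtain ⟨w, hw, hwτ⟩ := h
  exact ⟨w, hw.1, hw.2, hwτ⟩

/-- The a priori bound: testing the equation with `u - b`, where `b` carries the exterior datum,
controls the energy of the solution by that of `b`. -/
theorem exists_energy_bound (hp : 1 < p) (M P R : ℝ≥0) :
    ∃ B : ℝ≥0, ∀ (ν : RadialLevyKernel d p) (Ω : Set (Rn d)), MeasurableSet Ω →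
      ∀ u ∈ WAcross hp ν Ω, ∀ b ∈ WAcross hp ν Ω, energy ν Ω b ≤ R →
      eLpNorm (u - b) (ENNReal.ofReal p) (volume.restrict Ω) ^ p ≤ P * energy ν Ω (u - b) →
      ENNReal.ofReal |nonlocalForm ν Ω u (u - b)| ≤ M * normAcross ν Ω (u - b) →
      energy ν Ω u ≤ B := by
  obtain ⟨C, hC0, hC⟩ := exists_abs_signedPow_mul_le hp (η := 1 / 4) (by norm_num)
  obtain ⟨η, hη, hηκ⟩ := exists_ofReal_mul_le (A := M * ((P + 1) * 2 ^ p)) (κ := 4⁻¹)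
    (by finiteness) (by simp)
  obtain ⟨C', hC'⟩ := exists_le_add_mul_rpow hp hη
  set T : ℝ≥0∞ := M * C' + 4⁻¹ * R + ENNReal.ofReal C * R with hT
  have hTt : T ≠ ⊤ := by finiteness
  refine ⟨(2 * T).toNNReal, fun ν Ω hΩ u hu b hb hR hP hM => ?_⟩
  rw [ENNReal.coe_toNNReal (by finiteness)]
  have hV := Submodule.sub_mem _ hu hb
  have hDu := memLp_difference_on hp hΩ hu
  have hDb := memLp_difference_on hp hΩ hb
  have hDV := memLp_difference_on hp hΩ hV
  have hN : normAcross ν Ω (u - b) ^ p ≤ (P + 1) * 2 ^ p * (energy ν Ω u + R) := by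
    rw [normAcross_rpow hp, mul_assoc, add_mul, one_mul]
    have h1 : energy ν Ω (u - b) ≤ 2 ^ p * (energy ν Ω u + R) :=
      (pairEnergy_sub_le hp ν _ hu.1 b).trans (mul_le_mul_right (add_le_add_right hR _) _)
    exact add_le_add (hP.trans (mul_le_mul_right h1 _)) h1
  have hsplit : energy ν Ω u = ENNReal.ofReal (nonlocalForm ν Ω u (u - b) +
      ∫ z, signedPow p (difference u z) * difference b z ∂(pairMeasureOn ν Ω)) := by
    rw [energy_eq_difference hp ν hΩ hu.1, lintegral_rpow_eq_ofReal hp hDu,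
      nonlocalForm_eq_difference hp ν hΩ hu.1 hV.1, ← integral_add
        (integrable_signedPow_mul hp hDu hDV) (integrable_signedPow_mul hp hDu hDb)]
    congr 2
    funext z
    rw [difference_sub, Pi.sub_apply]
    ring
  -- the contributions of `b` and of the right-hand side are each bounded by a quarter of the energy
  -- of `u` and a constant, so that the energy of `u` can be absorbed
  have hb' : ENNReal.ofReal
      (∫ z, signedPow p (difference u z) * difference b z ∂(pairMeasureOn ν Ω)) ≤
      4⁻¹ * energy ν Ω u + ENNReal.ofReal C * R := by
    refine (Real.ofReal_le_enorm _).trans ((enorm_integral_le_lintegral_enorm _).trans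
      ((enorm_integral_signedPow_le hp (by norm_num) hC0 hC hDu.1).trans ?_))
    rw [← energy_eq_difference hp ν hΩ hu.1, ← energy_eq_difference hp ν hΩ hb.1]
    refine add_le_add (le_of_eq ?_) (mul_le_mul_right hR _)
    rw [one_div, ENNReal.ofReal_inv_of_pos (by norm_num), ENNReal.ofReal_ofNat]
  have hF : ENNReal.ofReal (nonlocalForm ν Ω u (u - b)) ≤
      M * C' + 4⁻¹ * (energy ν Ω u + R) :=
    calc ENNReal.ofReal (nonlocalForm ν Ω u (u - b)) ≤ M * normAcross ν Ω (u - b) :=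
          (ENNReal.ofReal_le_ofReal (le_abs_self _)).trans hM
      _ ≤ M * (C' + ENNReal.ofReal η * ((P + 1) * 2 ^ p * (energy ν Ω u + R))) :=
          mul_le_mul_right ((hC' _).trans (add_le_add_right (mul_le_mul_right hN _) _)) _
      _ = M * C' + ENNReal.ofReal η * (M * ((P + 1) * 2 ^ p)) * (energy ν Ω u + R) := by ring
      _ ≤ _ := add_le_add_right (mul_le_mul_left hηκ _) _
  have hA : energy ν Ω u ≠ ⊤ := hu.2.2.ne
  have h1 : energy ν Ω u ≤ 2⁻¹ * energy ν Ω u + T :=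
    calc energy ν Ω u ≤ M * C' + 4⁻¹ * (energy ν Ω u + R) +
          (4⁻¹ * energy ν Ω u + ENNReal.ofReal C * R) :=
          hsplit.le.trans (ENNReal.ofReal_add_le.trans (add_le_add hF hb'))
      _ = (4⁻¹ + 4⁻¹) * energy ν Ω u + T := by rw [hT]; ring
      _ = _ := by
        rw [← two_mul, show (4 : ℝ≥0∞)⁻¹ = 2⁻¹ * 2⁻¹ by
          rw [← ENNReal.mul_inv (by simp) (by simp)]; norm_num, ← mul_assoc,
          ENNReal.mul_inv_cancel (by simp) (by simp), one_mul]
  have h2 : 2⁻¹ * energy ν Ω u ≤ T := by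
    have h3 : energy ν Ω u = 2⁻¹ * energy ν Ω u + 2⁻¹ * energy ν Ω u := by
      rw [← add_mul, ENNReal.inv_two_add_inv_two, one_mul]
    exact (ENNReal.add_le_add_iff_left (ENNReal.mul_ne_top (by simp) hA)).1 (h3.symm.le.trans h1)
  calc energy ν Ω u = 2 * (2⁻¹ * energy ν Ω u) := by
        rw [← mul_assoc, ENNReal.mul_inv_cancel (by simp) (by simp), one_mul]
    _ ≤ _ := mul_le_mul_right h2 _

/-- Weak compactness and Minty's argument: the solutions converge in energy to `U`, if `U` solves
the limit equation in `Ω` and has asymptotically the same exterior datum. -/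
theorem tendsto_energy_sub [NeZero d] (hp : 1 < p)
    {ν : ℝ → RadialLevyKernel d p} (hν : IsLevyApproxUnity ν) (hν1 : d = 1 → OneDimLowerBound ν)
    {Ω : Set (Rn d)} (hΩo : IsOpen Ω) (hΩb : Bornology.IsBounded Ω)
    (hΩL : HasLipschitzBoundary Ω) {fε : ∀ ε : ℝ, WAcrossZero hp (ν ε) Ω →ₗ[ℝ] ℝ}
    {f : W1pZero hp Ω →ₗ[ℝ] ℝ} (hfε : AsympWeakConv hp ν Ω fε f) {uε h : ℝ → Rn d → ℝ}
    {U : Rn d → ℝ} {G : Rn d → Rn d} (hU : HasSobolevGrad p univ U G)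
    (V : ∀ ε : ℝ, WAcrossZero hp (ν ε) Ω)
    (huε : ∀ ε : ℝ, 0 < ε → uε ε ∈ WAcross hp (ν ε) Ω)
    (hweak : ∀ ε : ℝ, 0 < ε → ∀ v : WAcrossZero hp (ν ε) Ω,
      (Kdp d p)⁻¹ * nonlocalForm (ν ε) Ω (uε ε) v = fε ε v)
    (hh : ∀ᶠ ε in 𝓝[>] (0 : ℝ), h ε ∈ WAcross hp (ν ε) Ω)
    (hV : ∀ᶠ ε in 𝓝[>] (0 : ℝ), (V ε : Rn d → ℝ) = uε ε - (U + h ε))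
    (hh0 : Tendsto (fun ε => energy (ν ε) Ω (h ε)) (𝓝[>] 0) (𝓝 0))
    (hUf : ∀ v : W1pZero hp Ω, localForm p Ω U v = f v) :
    Tendsto (fun ε => energy (ν ε) Ω (uε ε - U)) (𝓝[>] 0) (𝓝 0) := by
  have hp0 : 0 < p := by linarith
  have hΩm := hΩo.measurableSet
  have hK := Kdp_pos (d := d) hp
  obtain ⟨M, hM⟩ := hfε.bounded
  obtain ⟨P, hP⟩ := exists_poincare hp hΩb hν
  obtain ⟨CA, hCA⟩ := exists_annulus_bound hp hν hν1
  -- uniform bounds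
  obtain ⟨R, hR⟩ : ∃ R : ℝ≥0, ∀ ε, 0 < ε → pairEnergy (ν ε) univ U ≤ R := by
    refine ⟨(eLpNorm G (ENNReal.ofReal p) volume ^ p +
      (2 * eLpNorm U (ENNReal.ofReal p) volume) ^ p).toNNReal, fun ε hε => ?_⟩
    rw [ENNReal.coe_toNNReal]
    · exact hU.pairEnergy_le hp (hν.normalized ε hε)
    · exact ENNReal.add_ne_top.2 ⟨ENNReal.rpow_ne_top_of_nonneg hp0.le hU.memLp_grad_univ.2.ne,
        ENNReal.rpow_ne_top_of_nonneg hp0.le (ENNReal.mul_ne_top (by simp) hU.memLp_univ.2.ne)⟩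
  have hRΩ : ∀ ε, 0 < ε → energy (ν ε) Ω U ≤ R := fun ε hε =>
    (pairEnergy_mono _ (subset_univ _) U).trans (hR ε hε)
  obtain ⟨R', hR'c⟩ : ∃ R' : ℝ≥0, (R' : ℝ≥0∞) = 2 ^ p * (R + 1) :=
    ⟨_, ENNReal.coe_toNNReal (by finiteness)⟩
  obtain ⟨B, hB⟩ := exists_energy_bound (d := d) hp ((Kdp d p).toNNReal * M) P R'
  have hzero : ∀ ε, ∀ᵐ x, x ∉ Ω → (V ε : Rn d → ℝ) x = 0 := fun ε =>
    ae_eq_zero_of_mem_WAcrossZero hΩm (V ε).2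
  have hVm : ∀ ε, MemLp (V ε : Rn d → ℝ) (ENNReal.ofReal p) volume := fun ε =>
    memLp_of_mem_WAcrossZero hΩm (V ε).2
  have hVe : ∀ ε, energy (ν ε) Ω (V ε : Rn d → ℝ) = pairEnergy (ν ε) univ (V ε : Rn d → ℝ) :=
    fun ε => energy_eq_univ hp (ν ε) hΩm (hzero ε)
  have hform : ∀ ε, 0 < ε → nonlocalForm (ν ε) Ω (uε ε) (V ε) = Kdp d p * fε ε (V ε) :=
    fun ε hε => by rw [← hweak ε hε (V ε), mul_inv_cancel_left₀ hK.ne']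
  have hbU : ∀ᶠ ε in 𝓝[>] (0 : ℝ), energy (ν ε) Ω (U + h ε) ≤ R' := by
    filter_upwards [self_mem_nhdsWithin, hh0.eventually_le_const one_pos] with ε hε hhε
    rw [hR'c]
    exact (pairEnergy_add_le hp _ _ hU.memLp_univ.1).trans
      (mul_le_mul_right (add_le_add (hRΩ ε hε) hhε) _)
  have hbu : ∀ᶠ ε in 𝓝[>] (0 : ℝ), energy (ν ε) Ω (uε ε) ≤ B := by
    filter_upwards [self_mem_nhdsWithin, hbU, hh, hV, hP] with ε hε hbε hhε hVε hPε
    refine hB (ν ε) Ω hΩm _ (huε ε hε) _ (Submodule.add_mem _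
      (hU.mem_WAcross hp (hν.normalized ε hε) Ω) hhε) hbε ?_ ?_
    · rw [← hVε, hVe, eLpNorm_restrict_eq hΩm (hzero ε)]
      exact hPε _ (hVm ε).1 (hzero ε)
    · rw [← hVε, hform ε hε, abs_mul, abs_of_pos hK, ENNReal.ofReal_mul hK.le, ENNReal.coe_mul,
        mul_assoc]
      exact mul_le_mul_right (hM ε hε (V ε)) _
  obtain ⟨B', hB'c⟩ : ∃ B' : ℝ≥0, (B' : ℝ≥0∞) = 2 ^ p * (B + R') :=
    ⟨_, ENNReal.coe_toNNReal (by finiteness)⟩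
  have hbV : ∀ᶠ ε in 𝓝[>] (0 : ℝ), pairEnergy (ν ε) univ (V ε : Rn d → ℝ) ≤ B' := by
    filter_upwards [self_mem_nhdsWithin, hbU, hbu, hV] with ε hε h1 h2 hVε
    rw [← hVe, hVε, hB'c]
    exact (pairEnergy_sub_le hp _ _ (huε ε hε).1 _).trans (mul_le_mul_right (add_le_add h2 h1) _)
  have hbL : ∀ᶠ ε in 𝓝[>] (0 : ℝ), eLpNorm (V ε : Rn d → ℝ) (ENNReal.ofReal p) volume ≤
      ((P * B') ^ (1 / p) : ℝ≥0) := by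
    filter_upwards [hbV, hP] with ε h1 h2
    rw [ENNReal.coe_rpow_of_nonneg _ (by positivity), one_div, ENNReal.le_rpow_inv_iff hp0,
      ENNReal.coe_mul]
    exact (h2 _ (hVm ε).1 (hzero ε)).trans (mul_le_mul_right h1 _)
  refine tendsto_of_subseq_tendsto fun e₀ he₀ => ?_
  obtain ⟨N, hN⟩ := eventually_atTop.1 (he₀.eventually (hbL.and
    (hbV.and (hbu.and (hh.and (hV.and self_mem_nhdsWithin))))))
  -- a subsequence along which the differences converge in `L^p`
  have he₁ : Tendsto (fun n => e₀ (n + N)) atTop (𝓝[>] 0) :=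
    he₀.comp (tendsto_add_atTop_nat N)
  have hann : ∀ δ : ℝ, 0 < δ → ∀ᶠ n in atTop,
      ∫⁻ z in annulus d δ, shiftNorm p (V (e₀ (n + N)) : Rn d → ℝ) z ^ p ≤
        (CA * B' : ℝ≥0) * ENNReal.ofReal (δ ^ p) * ENNReal.ofReal (δ ^ d) := fun δ hδ => by
    filter_upwards [he₁.eventually (hCA δ hδ)] with n hn
    refine (hn _ (hVm _).1).trans ((mul_le_mul_right (hN (n + N) (by simp)).2.1 _).trans
      (le_of_eq ?_))
    rw [ENNReal.coe_mul]
    ring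
  obtain ⟨v, hv, hv0, φ, hφ, hlim⟩ := exists_subseq_tendsto_eLpNorm hp hΩm hΩb
    (fun n => hVm (e₀ (n + N))) (fun n => hzero _) (fun n => (hN (n + N) (by simp)).1) hann
  set e : ℕ → ℝ := fun n => e₀ (φ n + N) with he_def
  have he : Tendsto e atTop (𝓝[>] 0) := he₁.comp hφ.tendsto_atTop
  have hN' : ∀ n, _ := fun n => hN (φ n + N) (by simp)
  have hvW : v ∈ W1pZero hp Ω := by
    obtain ⟨C, hC⟩ : ∃ C : ℝ≥0, (C : ℝ≥0∞) = 2 ^ p * (CA * B' : ℝ≥0) :=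
      ⟨_, ENNReal.coe_toNNReal (by finiteness)⟩
    refine mem_W1pZero_of_annulus_bound hp hΩo hΩb hΩL hv hv0 (C := C) fun δ hδ _ => ?_
    refine (annulus_bound_of_tendsto hp (fun n => (hVm (e n)).1) hv.1 hlim
      (hφ.tendsto_atTop.eventually (hann δ hδ)).frequently).trans (le_of_eq ?_)
    rw [hC]
    ring
  obtain ⟨H, hH⟩ := exists_hasSobolevGrad_indicator hp hΩm hvW
  set W := Ω.indicator v with hW
  have hWv : W =ᵐ[volume] v := by
    filter_upwards [hv0] with x hx
    by_cases hxΩ : x ∈ Ω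
    · simp [hW, hxΩ]
    · simp [hW, hxΩ, hx hxΩ]
  have hW0 : ∀ᵐ x, x ∉ Ω → W x = 0 :=
    Eventually.of_forall fun x hx => indicator_of_notMem hx _
  have hWmem : ∀ ε, 0 < ε → W ∈ WAcrossZero hp (ν ε) Ω := fun ε hε =>
    ⟨hH.mem_WAcross hp (hν.normalized ε hε) Ω, (ae_restrict_iff' hΩm.compl).2 hW0⟩
  -- the right-hand sides converge
  have hf : Tendsto (fun n => fε (e n) (V (e n))) atTop (𝓝 (f ⟨v, hvW⟩)) := by
    refine hfε.tendsto_comp he V ⟨v, hvW⟩ (w := W) (eventually_mem_nhdsWithin.mono hWmem)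
      (ae_restrict_of_ae hWv) ?_
    exact tendsto_of_tendsto_of_tendsto_of_le_of_le tendsto_const_nhds hlim (fun _ => bot_le)
      fun n => eLpNorm_mono_measure _ Measure.restrict_le_self
  -- the equation for `uε`, tested with `V`
  have hT1 : Tendsto (fun n => ∫ z, signedPow p (difference (uε (e n)) z) *
      difference (V (e n) : Rn d → ℝ) z ∂(pairMeasureOn (ν (e n)) Ω)) atTop
      (𝓝 (Kdp d p * f ⟨v, hvW⟩)) := by
    refine (hf.const_mul (Kdp d p)).congr fun n => ?_
    have hε : 0 < e n := (hN' n).2.2.2.2.2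
    rw [← hform _ hε, nonlocalForm_eq_difference hp _ hΩm (huε _ hε).1 (hVm _).1]
  have hGloc : Kdp d p * ∫ x, ‖G x‖ ^ (p - 2) * inner ℝ (G x) (Ω.indicator H x) =
      Kdp d p * f ⟨v, hvW⟩ := by
    have hWΩ : W =ᵐ[volume.restrict Ω] v := ae_restrict_of_ae hWv
    rw [← hUf ⟨v, hvW⟩, localForm_eq hp hΩo (hU.restrict Ω)
      ((hH.restrict Ω).congr hWΩ EventuallyEq.rfl), setIntegral_eq_integral_of_forall_compl_eq_zero]
    intro x hx
    rw [indicator_of_notMem hx, inner_zero_right, mul_zero]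
  have hDU : ∀ ε, 0 < ε → MemLp (difference U) (ENNReal.ofReal p) (pairMeasure (ν ε)) :=
    fun ε hε => memLp_difference hp hU.memLp_univ.1 (hU.pairEnergy_lt_top hp (hν.normalized ε hε))
  have hDW : ∀ ε, 0 < ε → MemLp (difference W) (ENNReal.ofReal p) (pairMeasure (ν ε)) :=
    fun ε hε => memLp_difference hp hH.memLp_univ.1 (hH.pairEnergy_lt_top hp (hν.normalized ε hε))
  have hDV : ∀ ε, MemLp (difference (V ε : Rn d → ℝ)) (ENNReal.ofReal p) (pairMeasure (ν ε)) :=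
    fun ε => memLp_difference hp (hVm ε).1 ((hVe ε).symm.trans_lt (V ε).2.1.2.2)
  -- the form of `U`, tested with the same functions, has the same limit: `V (e n)` is split into
  -- its limit `W`, for which the forms converge to the local form, and a part that vanishes in
  -- `L^p` in the limit
  have hT2 : Tendsto (fun n => ∫ z, signedPow p (difference U z) *
      difference (V (e n) : Rn d → ℝ) z ∂(pairMeasureOn (ν (e n)) Ω)) atTop
      (𝓝 (Kdp d p * f ⟨v, hvW⟩)) := by
    have h1 := (tendsto_integral_signedPow_difference hp hν hU hH).comp he
    rw [hGloc] at h1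
    obtain ⟨RW, hRW⟩ : ∃ RW : ℝ≥0, ∀ ε, 0 < ε → pairEnergy (ν ε) univ W ≤ RW := by
      refine ⟨(eLpNorm (Ω.indicator H) (ENNReal.ofReal p) volume ^ p +
        (2 * eLpNorm W (ENNReal.ofReal p) volume) ^ p).toNNReal, fun ε hε => ?_⟩
      rw [ENNReal.coe_toNNReal]
      · exact hH.pairEnergy_le hp (hν.normalized ε hε)
      · exact ENNReal.add_ne_top.2 ⟨ENNReal.rpow_ne_top_of_nonneg hp0.le hH.memLp_grad_univ.2.ne,
          ENNReal.rpow_ne_top_of_nonneg hp0.le (ENNReal.mul_ne_top (by simp) hH.memLp_univ.2.ne)⟩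
    obtain ⟨C, hC⟩ : ∃ C : ℝ≥0, (C : ℝ≥0∞) = 2 ^ p * (B' + RW) :=
      ⟨_, ENNReal.coe_toNNReal (by finiteness)⟩
    have h2 := tendsto_integral_signedPow_of_tendsto_zero hp hν hU (l := atTop) (ε := e)
      (w := fun n => (V (e n) : Rn d → ℝ) - W) (Eventually.of_forall fun n => (hN' n).2.2.2.2.2)
      (Eventually.of_forall fun n => (hVm _).sub hH.memLp_univ) (B := C)
      (Eventually.of_forall fun n => by
        rw [hC]
        exact (pairEnergy_sub_le hp _ _ (hVm _).1 _).trans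
          (mul_le_mul_right (add_le_add (hN' n).2.1 (hRW _ (hN' n).2.2.2.2.2)) _)) (by
        refine hlim.congr fun n => eLpNorm_congr_ae ?_
        filter_upwards [hWv] with x hx
        exact congrArg (fun t => (V (e n) : Rn d → ℝ) x - t) hx.symm)
    have h3 := h1.add h2
    rw [add_zero] at h3
    refine h3.congr fun n => ?_
    have hε : 0 < e n := (hN' n).2.2.2.2.2
    have h4 := (hDV (e n)).sub (hDW (e n) hε)
    rw [← difference_sub] at h4
    rw [setIntegral_difference_eq _ (hzero (e n)), Function.comp_apply, ← integral_add
      (integrable_signedPow_mul hp (hDU _ hε) (hDW _ hε))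
      (integrable_signedPow_mul hp (hDU _ hε) h4)]
    refine integral_congr_ae (Eventually.of_forall fun z => ?_)
    simp only [difference_sub, Pi.sub_apply]
    ring
  -- the contribution of the lift of the exterior datum is negligible
  have hhε : ∀ n, h (e n) ∈ WAcross hp (ν (e n)) Ω := fun n => (hN' n).2.2.2.1
  have huU : ∀ n, uε (e n) ∈ WAcross hp (ν (e n)) Ω := fun n => huε _ (hN' n).2.2.2.2.2
  have hUU : ∀ n, U ∈ WAcross hp (ν (e n)) Ω := fun n =>
    hU.mem_WAcross hp (hν.normalized _ (hN' n).2.2.2.2.2) Ω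
  have hh1 : Tendsto (fun n => ∫⁻ z, ‖difference (h (e n)) z‖ₑ ^ p
      ∂(pairMeasureOn (ν (e n)) Ω)) atTop (𝓝 0) :=
    (hh0.comp he).congr fun n => energy_eq_difference hp _ hΩm (hhε n).1
  have hBu : ∀ n, ∫⁻ z, ‖difference (uε (e n)) z‖ₑ ^ p ∂(pairMeasureOn (ν (e n)) Ω) ≤ B := fun n =>
    (energy_eq_difference hp _ hΩm (huU n).1).symm.le.trans (hN' n).2.2.1
  have hBU : ∀ n, ∫⁻ z, ‖difference U z‖ₑ ^ p ∂(pairMeasureOn (ν (e n)) Ω) ≤ R := fun n =>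
    (energy_eq_difference hp _ hΩm hU.memLp_univ.1).symm.le.trans (hRΩ _ (hN' n).2.2.2.2.2)
  have hMu := fun n => memLp_difference_on hp hΩm (huU n)
  have hMU := fun n => memLp_difference_on hp hΩm (hUU n)
  have hMh := fun n => memLp_difference_on hp hΩm (hhε n)
  have hMV := fun n => memLp_difference_on hp hΩm (V (e n)).2.1
  have hT3 := tendsto_integral_signedPow_mul_zero hp (l := atTop)
    (Eventually.of_forall fun n => (hMu n).1) (Eventually.of_forall hBu) hh1
  have hT4 := tendsto_integral_signedPow_mul_zero hp (l := atTop)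
    (Eventually.of_forall fun n => (hMU n).1) (Eventually.of_forall hBU) hh1
  have hsum := (hT1.add hT3).sub (hT2.add hT4)
  rw [sub_self] at hsum
  have hdiff : ∀ n z, difference (uε (e n)) z - difference U z =
      difference (V (e n) : Rn d → ℝ) z + difference (h (e n)) z := fun n z => by
    rw [(hN' n).2.2.2.2.1]
    simp only [difference, Pi.sub_apply, Pi.add_apply, he_def]
    ring
  refine ⟨fun n => φ n + N, ?_⟩
  refine (tendsto_lintegral_sub_rpow_of_monotone hp (l := atTop) (B := B + R)
    (Eventually.of_forall hMu) (Eventually.of_forall hMU)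
    (Eventually.of_forall fun n => (hBu n).trans (by simp))
    (Eventually.of_forall fun n => (hBU n).trans (by simp)) (hsum.congr fun n => ?_)).congr
      fun n => ?_
  · simp only [hdiff, mul_add]
    rw [integral_add (integrable_signedPow_mul hp (hMu n) (hMV n))
      (integrable_signedPow_mul hp (hMu n) (hMh n)),
      integral_add (integrable_signedPow_mul hp (hMU n) (hMV n))
      (integrable_signedPow_mul hp (hMU n) (hMh n))]
  · rw [energy_eq_difference hp _ hΩm ((huU n).1.sub hU.memLp_univ.1), difference_sub]
    rfl

end Convergence

/-! ### Comparison of the norms, and the convergence theorem -/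

section Conclusion

variable {d : ℕ} {p : ℝ}

theorem MemW1p.glue [NeZero d] (hp : 1 < p) {Ω : Set (Rn d)} (hΩo : IsOpen Ω)
    (hΩL : HasLipschitzBoundary Ω) {u g gbar : Rn d → ℝ} (hgbar : MemW1p p univ gbar)
    (hg : gbar =ᵐ[volume.restrict (closure Ω)ᶜ] g) (hu : u - gbar ∈ W1pZero hp Ω) :
    MemW1p p univ (glue Ω u g) := by
  obtain ⟨G, hG⟩ := hgbar
  obtain ⟨H, hH⟩ := exists_hasSobolevGrad_indicator hp hΩo.measurableSet hu
  exact ⟨_, (hG.add hp hH).congr (ae_restrict_of_ae (glue_ae_eq hΩo hΩL hg)) EventuallyEq.rfl⟩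

theorem tendsto_normAcross_zero (hp : 1 < p) {ι : Type*} {l : Filter ι}
    {ν : ι → RadialLevyKernel d p} {Ω : Set (Rn d)} {w : ι → Rn d → ℝ}
    (h1 : Tendsto (fun i => eLpNorm (w i) (ENNReal.ofReal p) (volume.restrict Ω)) l (𝓝 0))
    (h2 : Tendsto (fun i => energy (ν i) Ω (w i)) l (𝓝 0)) :
    Tendsto (fun i => normAcross (ν i) Ω (w i)) l (𝓝 0) := by
  have hp0 : 0 < p := by linarith
  have h3 := ((ENNReal.continuous_rpow_const (y := p)).tendsto 0).comp h1
  rw [ENNReal.zero_rpow_of_pos hp0] at h3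
  have h4 := ((ENNReal.continuous_rpow_const (y := 1 / p)).tendsto _).comp (h3.add h2)
  rw [add_zero, ENNReal.zero_rpow_of_pos (by positivity)] at h4
  exact h4

theorem eLpNorm_le_normAcross (hp : 1 < p) (ν : RadialLevyKernel d p) (Ω : Set (Rn d))
    (w : Rn d → ℝ) :
    eLpNorm w (ENNReal.ofReal p) (volume.restrict Ω) ≤ normAcross ν Ω w := by
  have hp0 : 0 < p := by linarith
  rw [← ENNReal.rpow_le_rpow_iff hp0, normAcross_rpow hp]
  exact le_self_add

theorem energyCr_le_energy (ν : RadialLevyKernel d p) (Ω : Set (Rn d)) (w : Rn d → ℝ) :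
    energyCr ν Ω w ≤ energy ν Ω w :=
  pairEnergy_mono ν (subset_compl_iff_disjoint_right.2
    (disjoint_left.2 fun _ hz hz' => hz'.1 hz.1)) w

theorem normIn_le_normAcross (hp : 1 < p) (ν : RadialLevyKernel d p) (Ω : Set (Rn d))
    (w : Rn d → ℝ) : normIn ν Ω w ≤ normAcross ν Ω w := by
  refine ENNReal.rpow_le_rpow (add_le_add_right ?_ _) (by positivity)
  exact pairEnergy_mono ν (subset_compl_iff_disjoint_right.2
    (disjoint_left.2 fun _ hz hz' => hz'.1 hz.1)) w

theorem normIn_congr (ν : RadialLevyKernel d p) {Ω : Set (Rn d)} (hΩ : MeasurableSet Ω)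
    {w w' : Rn d → ℝ} (h : EqOn w w' Ω) : normIn ν Ω w = normIn ν Ω w' := by
  have h1 : energyIn ν Ω w = energyIn ν Ω w' :=
    setLIntegral_congr_fun (hΩ.prod hΩ) fun z hz => by simp only [h hz.1, h hz.2]
  have h2 : eLpNorm w (ENNReal.ofReal p) (volume.restrict Ω) =
      eLpNorm w' (ENNReal.ofReal p) (volume.restrict Ω) :=
    eLpNorm_congr_ae ((ae_restrict_iff' hΩ).2 (Eventually.of_forall h))
  rw [normIn, normIn, h1, h2]

/-- A function that vanishes in `Ω` has energy across the boundary only. -/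
theorem energy_le_crossSet (hp : 1 < p) (ν : RadialLevyKernel d p) {Ω : Set (Rn d)}
    (hΩ : MeasurableSet Ω) {w : Rn d → ℝ} (hw : w =ᵐ[volume.restrict Ω] 0) :
    energy ν Ω w ≤ pairEnergy ν (crossSet Ω) w := by
  have hp0 : p ≠ 0 := by linarith
  have hw' : w =ᵐ[volume] Ωᶜ.indicator w := by
    filter_upwards [(ae_restrict_iff' hΩ).1 hw] with x hx
    by_cases hxΩ : x ∈ Ω
    · simpa [hxΩ] using hx hxΩ
    · simp [hxΩ]
  have h0 : pairEnergy ν (Ω ×ˢ Ω) w = 0 := by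
    rw [pairEnergy_congr ν _ hw']
    refine (setLIntegral_congr_fun (hΩ.prod hΩ) fun z hz => ?_).trans lintegral_zero
    simp [hz.1, hz.2, Real.zero_rpow hp0]
  calc energy ν Ω w ≤ pairEnergy ν (Ω ×ˢ Ω ∪ crossSet Ω) w := by
        refine pairEnergy_mono ν (fun z hz => ?_) w
        by_cases h1 : z.1 ∈ Ω <;> by_cases h2 : z.2 ∈ Ω
        · exact Or.inl ⟨h1, h2⟩
        · exact Or.inr (Or.inl ⟨h1, h2⟩)
        · exact Or.inr (Or.inr ⟨h1, h2⟩)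
        · exact (hz ⟨h1, h2⟩).elim
    _ ≤ pairEnergy ν (Ω ×ˢ Ω) w + pairEnergy ν (crossSet Ω) w := lintegral_union_le _ _ _
    _ = _ := by rw [h0, zero_add]

theorem energyCr_le_crossSet (ν : RadialLevyKernel d p) (Ω : Set (Rn d)) (w : Rn d → ℝ) :
    energyCr ν Ω w ≤ pairEnergy ν (crossSet Ω) w :=
  pairEnergy_mono ν subset_union_left w

theorem tendsto_two_rpow_mul_add {ι : Type*} {l : Filter ι} {x y : ι → ℝ≥0∞} (hp : 1 < p)
    (hx : Tendsto x l (𝓝 0)) (hy : Tendsto y l (𝓝 0)) :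
    Tendsto (fun i => 2 ^ p * (x i + y i)) l (𝓝 0) := by
  have hp0 : 0 ≤ p := by linarith
  have h := ENNReal.Tendsto.const_mul (a := 2 ^ p) (hx.add hy) (Or.inr (by finiteness))
  rwa [add_zero, mul_zero] at h

end Conclusion

theorem theorem5p6 {d : ℕ} [NeZero d] {p : ℝ} (hp : 1 < p)
    (ν : ℝ → RadialLevyKernel d p) (hν : IsLevyApproxUnity ν)
    (hν1 : d = 1 → OneDimLowerBound ν)
    (Ω : Set (Rn d)) (hΩo : IsOpen Ω) (hΩb : Bornology.IsBounded Ω)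
    (hΩL : HasLipschitzBoundary Ω)
    (fε : ∀ ε : ℝ, WAcrossZero hp (ν ε) Ω →ₗ[ℝ] ℝ) (f : W1pZero hp Ω →ₗ[ℝ] ℝ)
    (hf : IsBoundedFunctional hp Ω f) (hfε : AsympWeakConv hp ν Ω fε f)
    (gε : ℝ → Rn d → ℝ) (g : Rn d → ℝ)
    (hg : MemW1p p (closure Ω)ᶜ g)
    (hgε : ∀ ε : ℝ, 0 < ε → MemTrace hp (ν ε) Ω (gε ε))
    (hconv : Tendsto (fun ε : ℝ => traceNorm hp (ν ε) Ω (gε ε - g)) (𝓝[>] 0) (𝓝 0))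
    (uε : ℝ → Rn d → ℝ) (u : Rn d → ℝ)
    (huε : ∀ ε : ℝ, 0 < ε →
      IsNonlocalDirichletSol hp (Kdp d p)⁻¹ (ν ε) Ω (fε ε) (gε ε) (uε ε))
    (hu : IsLocalDirichletSol hp Ω f g u) :
    Tendsto (fun ε : ℝ => normIn (ν ε) Ω (uε ε - u)) (𝓝[>] 0) (𝓝 0) ∧
    MemW1p p univ (glue Ω u g) ∧
    Tendsto (fun ε : ℝ => normAcross (ν ε) Ω (uε ε - glue Ω u g)) (𝓝[>] 0) (𝓝 0) ∧
    (∀ ubar : Rn d → ℝ, MemW1p p univ ubar → ubar =ᵐ[volume.restrict Ω] u →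
      Tendsto (fun ε : ℝ => normAcross (ν ε) Ω (uε ε - ubar)) (𝓝[>] 0) (𝓝 0) ∧
      Tendsto (fun ε : ℝ => energyCr (ν ε) Ω (uε ε - ubar)) (𝓝[>] 0) (𝓝 0)) ∧
    Tendsto (fun ε : ℝ => energyCr (ν ε) Ω (uε ε)) (𝓝[>] 0) (𝓝 0) := by
  have hp0 : 0 < p := by linarith
  have hΩm := hΩo.measurableSet
  obtain ⟨gbar, hgbar, hgg, hug⟩ := hu.boundary
  have hUmem : MemW1p p univ (glue Ω u g) := hgbar.glue hp hΩo hΩL hgg hug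
  set U := glue Ω u g with hUdef
  have hUu : EqOn U u Ω := fun x hx => by simp [hUdef, glue, hx]
  have hUg : EqOn U g Ωᶜ := fun x hx => by
    simp [hUdef, glue, (mem_compl_iff _ _).1 hx]
  obtain ⟨G, hU⟩ := hUmem
  have hUf : ∀ v : W1pZero hp Ω, localForm p Ω U v = f v := fun v => by
    obtain ⟨H, hH, -⟩ := v.2
    have h1 := hU.restrict Ω
    have h2 : HasSobolevGrad p Ω u G :=
      h1.congr ((ae_restrict_iff' hΩm).2 (Eventually.of_forall hUu)) EventuallyEq.rfl
    rw [← hu.weak v, localForm_eq hp hΩo h1 hH, localForm_eq hp hΩo h2 hH]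
  -- almost optimal lifts of the differences of the exterior data
  have hlift : ∀ ε : ℝ, ∃ (h : Rn d → ℝ) (V : WAcrossZero hp (ν ε) Ω), 0 < ε →
      traceNorm hp (ν ε) Ω (gε ε - g) < ⊤ → h ∈ WAcross hp (ν ε) Ω ∧
      normAcross (ν ε) Ω h ≤ traceNorm hp (ν ε) Ω (gε ε - g) + ENNReal.ofReal ε ∧
      (V : Rn d → ℝ) = uε ε - (U + h) := fun ε => by
    -- only the `ε` with finite trace norm matter; `V` has to be total, and is zero for the others
    by_cases hε : 0 < ε ∧ traceNorm hp (ν ε) Ω (gε ε - g) < ⊤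
    · obtain ⟨h, hh, hhg, hhn⟩ := exists_lift hp (ENNReal.lt_add_right hε.2.ne
        (b := ENNReal.ofReal ε) (by simpa using hε.1))
      refine ⟨h, ⟨uε ε - (U + h), Submodule.sub_mem _ (huε ε hε.1).mem (Submodule.add_mem _
        (hU.mem_WAcross hp (hν.normalized ε hε.1) Ω) hh), ?_⟩, fun _ _ => ⟨hh, hhn.le, rfl⟩⟩
      filter_upwards [hhg, (huε ε hε.1).complement, ae_restrict_mem hΩm.compl] with x h1 h2 h3
      simp only [Pi.sub_apply, Pi.add_apply, Pi.zero_apply, h1, h2, hUg h3]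
      ring
    · exact ⟨0, 0, fun h1 h2 => (hε ⟨h1, h2⟩).elim⟩
  choose h V hhV using hlift
  have hgood : ∀ᶠ ε in 𝓝[>] (0 : ℝ), h ε ∈ WAcross hp (ν ε) Ω ∧
      normAcross (ν ε) Ω (h ε) ≤ traceNorm hp (ν ε) Ω (gε ε - g) + ENNReal.ofReal ε ∧
      (V ε : Rn d → ℝ) = uε ε - (U + h ε) := by
    filter_upwards [self_mem_nhdsWithin, hconv.eventually_lt_const ENNReal.zero_lt_top]
      with ε h1 h2 using hhV ε h1 h2
  have hhn : Tendsto (fun ε => normAcross (ν ε) Ω (h ε)) (𝓝[>] 0) (𝓝 0) := by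
    have h1 : Tendsto (fun ε : ℝ => ENNReal.ofReal ε) (𝓝[>] 0) (𝓝 0) := by
      have := (ENNReal.continuous_ofReal.tendsto 0).mono_left
        (nhdsWithin_le_nhds (s := Ioi (0 : ℝ)))
      rwa [ENNReal.ofReal_zero] at this
    have h2 := hconv.add h1
    rw [add_zero] at h2
    exact tendsto_of_tendsto_of_tendsto_of_le_of_le' tendsto_const_nhds h2
      (Eventually.of_forall fun _ => bot_le) (hgood.mono fun ε hε => hε.2.1)
  have hh0 : Tendsto (fun ε => energy (ν ε) Ω (h ε)) (𝓝[>] 0) (𝓝 0) := by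
    have h1 := ((ENNReal.continuous_rpow_const (y := p)).tendsto 0).comp hhn
    rw [ENNReal.zero_rpow_of_pos hp0] at h1
    refine tendsto_of_tendsto_of_tendsto_of_le_of_le tendsto_const_nhds h1 (fun _ => bot_le)
      fun ε => ?_
    rw [Function.comp_apply, normAcross_rpow hp]
    exact le_add_self
  have henergy : Tendsto (fun ε => energy (ν ε) Ω (uε ε - U)) (𝓝[>] 0) (𝓝 0) :=
    tendsto_energy_sub hp hν hν1 hΩo hΩb hΩL hfε hU V (fun ε hε => (huε ε hε).mem)
      (fun ε hε => (huε ε hε).weak) (hgood.mono fun _ h => h.1) (hgood.mono fun _ h => h.2.2)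
      hh0 hUf
  -- the `L^p` norms are controlled through the Poincaré inequality
  have hLp : Tendsto (fun ε => eLpNorm (uε ε - U) (ENNReal.ofReal p) (volume.restrict Ω))
      (𝓝[>] 0) (𝓝 0) := by
    obtain ⟨P, hP⟩ := exists_poincare hp hΩb hν
    have h1 := ENNReal.Tendsto.const_mul (a := (P : ℝ≥0∞))
      (tendsto_two_rpow_mul_add hp henergy hh0) (Or.inr (by simp))
    rw [mul_zero] at h1
    have h2 := ((ENNReal.continuous_rpow_const (y := 1 / p)).tendsto _).comp h1
    rw [ENNReal.zero_rpow_of_pos (by positivity)] at h2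
    have h3 := h2.add hhn
    rw [add_zero] at h3
    refine tendsto_of_tendsto_of_tendsto_of_le_of_le' tendsto_const_nhds h3
      (Eventually.of_forall fun _ => bot_le) ?_
    filter_upwards [self_mem_nhdsWithin, hgood, hP] with ε hε hgε' hPε
    obtain ⟨hhε, -, hVε⟩ := hgε'
    have h0 := ae_eq_zero_of_mem_WAcrossZero hΩm (V ε).2
    have hVL := memLp_of_mem_WAcrossZero hΩm (V ε).2
    have hum := (huε ε hε).mem.1
    have hsum : uε ε - U = (V ε : Rn d → ℝ) + h ε := by
      rw [hVε]
      abel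
    have hV' : (V ε : Rn d → ℝ) = (uε ε - U) - h ε := by
      rw [hVε]
      abel
    have hVen : energy (ν ε) Ω (V ε : Rn d → ℝ) ≤
        2 ^ p * (energy (ν ε) Ω (uε ε - U) + energy (ν ε) Ω (h ε)) := by
      rw [hV']
      exact pairEnergy_sub_le hp _ _ (hum.sub hU.memLp_univ.1) _
    nth_rewrite 1 [hsum]
    refine (eLpNorm_add_le hVL.1.restrict hhε.2.1.1 (one_le_ofReal hp)).trans
      (add_le_add ?_ (eLpNorm_le_normAcross hp _ _ _))
    rw [eLpNorm_restrict_eq hΩm h0, Function.comp_apply, one_div, ENNReal.le_rpow_inv_iff hp0]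
    refine (hPε _ hVL.1 h0).trans (mul_le_mul_right ?_ _)
    rw [← energy_eq_univ hp _ hΩm h0]
    exact hVen
  have hmain : Tendsto (fun ε => normAcross (ν ε) Ω (uε ε - U)) (𝓝[>] 0) (𝓝 0) :=
    tendsto_normAcross_zero hp hLp henergy
  refine ⟨?_, ⟨G, hU⟩, hmain, fun ubar hubar hubu => ?_, ?_⟩
  · refine tendsto_of_tendsto_of_tendsto_of_le_of_le tendsto_const_nhds hmain (fun _ => bot_le)
      fun ε => ?_
    have h1 : EqOn (uε ε - u) (uε ε - U) Ω := fun x hx => by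
      simp only [Pi.sub_apply, hUu hx]
    simp only
    rw [normIn_congr (ν ε) hΩm h1]
    exact normIn_le_normAcross hp _ _ _
  · obtain ⟨Gbar, hubar⟩ := hubar
    -- `U - ubar` is a Sobolev function that vanishes in `Ω`, so its energy is carried by the pairs
    -- that are separated by the boundary
    have hD := hU.add hp (hubar.smul (-1))
    have hD0 : U + (-1 : ℝ) • ubar =ᵐ[volume.restrict Ω] 0 := by
      filter_upwards [hubu, ae_restrict_mem hΩm] with x h1 h2
      simp [h1, hUu h2]
    have hsum : ∀ ε, uε ε - ubar = (uε ε - U) + (U + (-1 : ℝ) • ubar) := fun ε => by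
      rw [neg_one_smul]
      abel
    have hDe : Tendsto (fun ε => energy (ν ε) Ω (U + (-1 : ℝ) • ubar)) (𝓝[>] 0) (𝓝 0) :=
      tendsto_of_tendsto_of_tendsto_of_le_of_le tendsto_const_nhds
        (tendsto_pairEnergy_crossSet hp hν hΩo hΩb hΩL hD) (fun _ => bot_le)
        fun ε => energy_le_crossSet hp _ hΩm hD0
    have he : Tendsto (fun ε => energy (ν ε) Ω (uε ε - ubar)) (𝓝[>] 0) (𝓝 0) := by
      refine tendsto_of_tendsto_of_tendsto_of_le_of_le' tendsto_const_nhds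
        (tendsto_two_rpow_mul_add hp henergy hDe) (Eventually.of_forall fun _ => bot_le) ?_
      filter_upwards [self_mem_nhdsWithin] with ε hε
      rw [hsum]
      exact pairEnergy_add_le hp _ _ ((huε ε hε).mem.1.sub hU.memLp_univ.1)
    refine ⟨tendsto_normAcross_zero hp (hLp.congr fun ε => eLpNorm_congr_ae ?_) he,
      tendsto_of_tendsto_of_tendsto_of_le_of_le tendsto_const_nhds he (fun _ => bot_le)
        fun ε => energyCr_le_energy _ _ _⟩
    rw [hsum]
    filter_upwards [hD0] with x hx
    rw [Pi.add_apply, hx, Pi.zero_apply, add_zero]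
  · have hcr : Tendsto (fun ε => energyCr (ν ε) Ω (uε ε - U)) (𝓝[>] 0) (𝓝 0) :=
      tendsto_of_tendsto_of_tendsto_of_le_of_le tendsto_const_nhds henergy (fun _ => bot_le)
        fun ε => energyCr_le_energy _ _ _
    have hcrU : Tendsto (fun ε => energyCr (ν ε) Ω U) (𝓝[>] 0) (𝓝 0) :=
      tendsto_of_tendsto_of_tendsto_of_le_of_le tendsto_const_nhds
        (tendsto_pairEnergy_crossSet hp hν hΩo hΩb hΩL hU) (fun _ => bot_le)
        fun ε => energyCr_le_crossSet _ _ _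
    refine tendsto_of_tendsto_of_tendsto_of_le_of_le' tendsto_const_nhds
      (tendsto_two_rpow_mul_add hp hcr hcrU) (Eventually.of_forall fun _ => bot_le) ?_
    filter_upwards [self_mem_nhdsWithin] with ε hε
    nth_rewrite 1 [← sub_add_cancel (uε ε) U]
    exact pairEnergy_add_le hp _ _ ((huε ε hε).mem.1.sub hU.memLp_univ.1)
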